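/- Let $\gamma,\beta,\mu>0$ be constants. Let $U=[n,u,E,B]$ ($n$ scalar, $u,E,B$ with values in three-dimensional space) satisfy the linearized homogeneous Navier-Stokes-Maxwell system $$\partial_t n+\gamma\nabla\cdot u=0,\qquad \partial_t u+\gamma\nabla n+\beta E-\mu\Delta u=0,\qquad \partial_t E-\nabla\times B-\beta u=0,\qquad \partial_t B+\nabla\times E=0,$$ $$\nabla\cdot E=-\tfrac{\beta}{\gamma}n,\qquad \nabla\cdot B=0,$$ for $t>0$, $x\in\mathbb R^3$, with initial data $U|_{t=0}=U_0=[n_0,u_0,E_0,B_0]$ satisfying $\nabla\cdot E_0=-\frac\beta\gamma n_0$, $\nabla\cdot B_0=0$. (Solutions are understood in the sense of tempered distributions in $x$: for every Schwartz function $\varphi$ the pairings of the components of $U(t)$ with $\varphi$ are differentiable in $t>0$ and continuous from the right at $t=0$. An $L^r$ norm is $+\infty$ for a distribution that is not an $L^r$ function; thus an estimate below has content when its right-hand side is finite, and then it includes that the left-hand side is finite.) For an integer $j\ge0$ and $1\le p\le q\le\infty$ put $$\delta(j,p,q)=\frac j2+\frac32\Big(\frac1p-\frac1q\Big),$$ and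 for $\ell\in\mathbb R$ and $1\le s\le2\le q\le\infty$ let $$m(\ell,s,q)=\begin{cases}0&\text{if }\ell+3(\frac1s-\frac1q)<0,\\ \ell&\text{if }\ell+3(\frac1s-\frac1q)\ge0,\ s=q=2\text{ and }\ell\text{ is an integer},\\ [\ell+3(\frac1s-\frac1q)]+1&\text{otherwise,}\end{cases}$$ where $[\cdot]$ is the integer part. Norms of tuples of functions, such as $\|[n_0,B_0]\|_{L^p}$ or $\|\nabla^m u_0\|_{L^s}$, are sums of the norms of the components. There is a constant $c>0$ depending only on $\gamma,\beta,\mu$ such that for all $1\le p,s\le2\le q\le\infty$, all real $\ell\ge0$ and all integers $j\ge0$ there is a constant $C>0$, depending only on $\gamma,\beta,\mu,p,s,q,\ell,j$, such that every such solution satisfies, for all $t\ge0$, $$\begin{aligned}\|\nabla^jn(t)\|_{L^q}\le C\Big\{&(1+t)^{-\delta(j+1,p,q)}\|E_0\|_{L^p}+(1+t)^{-\delta(j+1,p,q)}\|u_0\|_{L^p}\\&+e^{-ct}\|\nabla^{m(j,s,q)}n_0\|_{L^s}+e^{-ct}\|\nabla^{m(j-1,s,q)}u_0\|_{L^s}\Big\},\end{aligned}$$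 $$\begin{aligned}\|\nabla^ju(t)\|_{L^q}\le C\Big\{&(1+t)^{-\delta(j+1,p,q)}\|[n_0,B_0]\|_{L^p}+(1+t)^{-\delta(j,p,q)}\|[u_0,E_0]\|_{L^p}\\&+(1+t)^{-\frac12\delta(j+2,p,q)}\|u_0\|_{L^p}+(1+t)^{-\frac12\delta(j+4,p,q)}\|E_0\|_{L^p}+(1+t)^{-\frac12\delta(j+1,p,q)}\|B_0\|_{L^p}\\&+e^{-ct}\big(\|\nabla^{m(j-1,s,q)}n_0\|_{L^s}+\|\nabla^{m(j,s,q)}u_0\|_{L^s}+\|\nabla^{m(j-2,s,q)}E_0\|_{L^s}+\|\nabla^{m(j-3,s,q)}B_0\|_{L^s}\big)\\&+(1+t)^{-\frac\ell2}\big(\|\nabla^{m(j-4+\ell,s,q)}u_0\|_{L^s}+\|\nabla^{m(j-2+\ell,s,q)}[E_0,B_0]\|_{L^s}\big)\Big\},\end{aligned}$$ $$\begin{aligned}\|\nabla^jE(t)\|_{L^q}\le C\Big\{&(1+t)^{-\delta(j,p,q)}\|[u_0,E_0]\|_{L^p}+(1+t)^{-\delta(j+1,p,q)}\|B_0\|_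{L^p}\\&+(1+t)^{-\frac12\delta(j+4,p,q)}\|u_0\|_{L^p}+(1+t)^{-\frac12\delta(j+6,p,q)}\|E_0\|_{L^p}+(1+t)^{-\frac12\delta(j+3,p,q)}\|B_0\|_{L^p}\\&+e^{-ct}\big(\|\nabla^{m(j-2,s,q)}u_0\|_{L^s}+\|\nabla^{m(j,s,q)}E_0\|_{L^s}+\|\nabla^{m(j-5,s,q)}B_0\|_{L^s}\big)\\&+(1+t)^{-\frac\ell2}\big(\|\nabla^{m(j-2+\ell,s,q)}u_0\|_{L^s}+\|\nabla^{m(j+\ell,s,q)}[E_0,B_0]\|_{L^s}\big)\Big\},\end{aligned}$$ $$\begin{aligned}\|\nabla^jB(t)\|_{L^q}\le C\Big\{&(1+t)^{-\delta(j+1,p,q)}\|[u_0,E_0]\|_{L^p}+(1+t)^{-\delta(j+2,p,q)}\|B_0\|_{L^p}\\&+(1+t)^{-\frac12\delta(j+1,p,q)}\|u_0\|_{L^p}+(1+t)^{-\frac12\delta(j+3,p,q)}\|E_0\|_{L^p}+(1+t)^{-\frac12\delta(j,p,q)}\|B_0\|_{L^p}\\&+e^{-ct}\big(\|\nabla^{m(j-3,s,q)}u_0\|_{L^s}+\|\nabla^{m(j-5,s,q)}E_0\|_{L^s}+\|\nabla^{m(j-6,s,q)}B_0\|_{L^s}\big)\\&+(1+t)^{-\frac\ell2}\big(\|\nabla^{m(j-2+\ell,s,q)}u_0\|_{L^s}+\|\nabla^{m(j+\ell,s,q)}[E_0,B_0]\|_{L^s}\big)\Big\}.\end{aligned}$$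 -/

import Mathlib

open scoped ENNReal SchwartzMap LineDeriv Laplacian

noncomputable section

/-- The physical space `ℝ³`. -/
abbrev R3 : Type := EuclideanSpace ℝ (Fin 3)

/-- (Complex valued) tempered distributions on `ℝ³`, with the weak-star topology. -/
abbrev TDist : Type := 𝓢'(R3, ℂ)

/-- The standard basis vector `e_i` of `ℝ³`. -/
def basisVec (i : Fin 3) : R3 := EuclideanSpace.single i 1

/-- The partial derivative `∂_{x_i}` of a tempered distribution. -/
def pd (i : Fin 3) (T : TDist) : TDist := ∂_{basisVec i} T

/-- Divergence of a vector of tempered distributions. -/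
def divergence (V : Fin 3 → TDist) : TDist := ∑ i, pd i (V i)

/-- Curl of a vector of tempered distributions. -/
def curl (V : Fin 3 → TDist) : Fin 3 → TDist :=
  ![pd 1 (V 2) - pd 2 (V 1), pd 2 (V 0) - pd 0 (V 2), pd 0 (V 1) - pd 1 (V 0)]

/-- `∂_t T (t) = T'`, tested against Schwartz functions of the space variable. -/
def HasTimeDeriv (T : ℝ → TDist) (T' : TDist) (t : ℝ) : Prop :=
  ∀ φ : 𝓢(R3, ℂ), HasDerivAt (fun τ => T τ φ) (T' φ) t

/-- `T` attains the initial value `T₀` at `t = 0`, continuously from the right when tested against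
Schwartz functions. -/
def HasInitialValue (T : ℝ → TDist) (T₀ : TDist) : Prop :=
  T 0 = T₀ ∧
    ∀ φ : 𝓢(R3, ℂ), ContinuousWithinAt (fun τ => T τ φ) (Set.Ici 0) 0

/-- `U = [n, u, E, B]` solves, for `t > 0` and in the sense of tempered distributions on `ℝ³`, the
linearized homogeneous Navier-Stokes-Maxwell system with initial data
`U₀ = [n₀, u₀, E₀, B₀]`:
`∂_t n + γ ∇·u = 0`, `∂_t u + γ ∇n + β E - μ Δu = 0`, `∂_t E - ∇×B - β u = 0`,
`∂_t B + ∇×E = 0`, `∇·E = -(β/γ) n`, `∇·B = 0`. -/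
structure IsLinearSolution (γ β μ : ℝ) (n : ℝ → TDist) (u E B : ℝ → Fin 3 → TDist)
    (n₀ : TDist) (u₀ E₀ B₀ : Fin 3 → TDist) : Prop where
  eq_n : ∀ t, 0 < t → HasTimeDeriv n (-(γ • divergence (u t))) t
  eq_u : ∀ t, 0 < t → ∀ i, HasTimeDeriv (fun τ => u τ i)
    (-(γ • pd i (n t)) - β • E t i + μ • Δ (u t i)) t
  eq_E : ∀ t, 0 < t → ∀ i, HasTimeDeriv (fun τ => E τ i) (curl (B t) i + β • u t i) t
  eq_B : ∀ t, 0 < t → ∀ i, HasTimeDeriv (fun τ => B τ i) (-(curl (E t) i)) t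
  div_E : ∀ t, 0 ≤ t → divergence (E t) = -((β / γ) • n t)
  div_B : ∀ t, 0 ≤ t → divergence (B t) = 0
  init_n : HasInitialValue n n₀
  init_u : ∀ i, HasInitialValue (fun t => u t i) (u₀ i)
  init_E : ∀ i, HasInitialValue (fun t => E t i) (E₀ i)
  init_B : ∀ i, HasInitialValue (fun t => B t i) (B₀ i)

/-- The `L^p` norm of a tempered distribution (`1 ≤ p ≤ ∞`): the `L^p` norm of the function that
represents it, and `∞` if it is not represented by a function in `L^p`. -/
def distLpNorm (p : ℝ≥0∞) (T : TDist) : ℝ≥0∞ :=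
  ⨅ (f : R3 → ℂ) (_ : MeasureTheory.MemLp f p MeasureTheory.volume)
    (_ : ∀ φ : 𝓢(R3, ℂ), T φ = ∫ x, φ x * f x),
    MeasureTheory.eLpNorm f p MeasureTheory.volume

/-- `‖∇^m T‖_{L^p}` for a scalar `T`: the sum of the norms of all partial derivatives of order
`m`, taken in the sense of distributions. -/
def gradNorm (m : ℕ) (p : ℝ≥0∞) (T : TDist) : ℝ≥0∞ :=
  ∑ α : Fin m → Fin 3, distLpNorm p (∂^{fun i => basisVec (α i)} T)

/-- `‖∇^m V‖_{L^p}` for a vector `V`. -/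
def vgradNorm (m : ℕ) (p : ℝ≥0∞) (V : Fin 3 → TDist) : ℝ≥0∞ :=
  ∑ i, gradNorm m p (V i)

/-- `‖V‖_{L^p}` for a vector `V`. -/
def vecLpNorm (p : ℝ≥0∞) (V : Fin 3 → TDist) : ℝ≥0∞ := ∑ i, distLpNorm p (V i)

/-- `3 (1/s - 1/q)`, where `1/∞ = 0`. -/
def gap (s q : ℝ≥0∞) : ℝ := 3 * ((s⁻¹).toReal - (q⁻¹).toReal)

/-- The low-frequency rate index `δ(j,p,q) = j/2 + (3/2)(1/p - 1/q)`. -/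
def rateIndex (j : ℕ) (p q : ℝ≥0∞) : ℝ := (j : ℝ) / 2 + gap p q / 2

open Classical in
/-- The regularity index `m(ℓ,s,q)`: it is `0` if `ℓ + 3(1/s-1/q) < 0`, it is `ℓ` if
`ℓ + 3(1/s-1/q) ≥ 0`, `s = q = 2` and `ℓ` is an integer, and it is `[ℓ + 3(1/s-1/q)] + 1`
otherwise. -/
def regIndex (l : ℝ) (s q : ℝ≥0∞) : ℕ :=
  if l + gap s q < 0 then 0
  else if s = 2 ∧ q = 2 ∧ ∃ z : ℤ, l = z then ⌊l⌋₊
  else ⌊l + gap s q⌋₊ + 1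

/-- The factor `(1 + t)^{-a}`. -/
def polyDecay (a t : ℝ) : ℝ≥0∞ := ENNReal.ofReal ((1 + t) ^ (-a))

/-- The factor `e^{-ct}`. -/
def expDecay (c t : ℝ) : ℝ≥0∞ := ENNReal.ofReal (Real.exp (-(c * t)))

end

/-! ### Real interpolation between `L¹ → L^∞` and `L² → L²` -/

open MeasureTheory
open scoped FourierTransform

/-! At a frequency of length `k = |2πξ|` the system becomes a linear ordinary differential equation
with constant coefficients. The Gauss law expresses the density through `E`, so `[u, E, B]` solves a
closed equation. The Helmholtz decomposition splits it. The longitudinal part `[n, div u]` is a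
damped oscillator with polynomial `λ² + μk²λ + γ²k² + β²`. The transverse part `[curl u, curl E,
kB]` is, component by component, a 3×3 system with characteristic polynomial `(λ + μk²)(λ² + k²) +
β²λ = (λ + ν)(λ² + Tλ + D)`.

For small `k` one has `ν ~ k⁴` while the quadratic factor decays at rate `k²`. This produces two
families of algebraic rates: `δ` from `e^{-ck²t}` and `δ/2` from `e^{-ck⁴t}`, each coefficient
carrying its own power of `k`. For large `k` one has `ν ~ k²` but `T ~ k⁻²`, so only `e^{-ct/k²}` is
left, and it is traded for `(1+t)^{-ℓ/2} k^ℓ`: decay is bought with derivatives. No root is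
computed. The number `ν` comes from the intermediate value theorem, the quadratic factors are
handled by one Lyapunov functional (`abs_le_of_damped_oscillator`), and intermediate frequencies by
an energy with two small cross terms (`exists_middle_frequency_bound_real`). The outcome is
`IsFrequencyFlow.exists_low_frequency_bound` and `IsFrequencyFlow.exists_high_frequency_bound`.

Pointwise bounds become norm bounds by applying Hausdorff-Young to the data (`p → p'`), Hölder with
a kernel in `L^r` where `1/r = 1/p - 1/q`, and Hausdorff-Young again to return (`q' → q`). Scaling
gives the `L^r` norm of the low-frequency kernels, hence the rates. At high frequency `regIndex` is
the least order for which the leftover negative power of `k` is guaranteed to lie in `L^r`.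
Hausdorff-Young is needed only up to a constant and is obtained by real interpolation.

It remains to see that an arbitrary distributional solution is given on the Fourier side by the
matrix exponential. Against a compactly supported test function, iterating the multiplication
operators costs only a geometric factor in every Schwartz seminorm. The Baire property of the
Schwartz space bounds the solution on `[0, t]` by one seminorm, so the Taylor remainder in time
tends to `0` (`IsSymbolFlow.apply_eq_integral_exp`). Data with an infinite norm on the right need no
argument, so the transforms of the data may be taken to be functions. -/

theorem lintegral_Ioc_ofReal_rpow {s b : ℝ} (hs : -1 < s) (hb : 0 ≤ b) :
    ∫⁻ x in Set.Ioc 0 b, ENNReal.ofReal (x ^ s) = ENNReal.ofReal (b ^ (s + 1) / (s + 1)) := by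
  rw [← ofReal_integral_eq_lintegral_ofReal]
  · rw [← intervalIntegral.integral_of_le hb, integral_rpow (Or.inl hs),
      Real.zero_rpow (by linarith), sub_zero]
  · exact (intervalIntegrable_iff_integrableOn_Ioc_of_le hb).1
      (intervalIntegral.intervalIntegrable_rpow' hs)
  · filter_upwards [ae_restrict_mem measurableSet_Ioc] with x hx
    exact Real.rpow_nonneg hx.1.le _

theorem lintegral_enorm_indicator_lt_le {α : Type*} [MeasurableSpace α] {ν : Measure α} {P : ℝ}
    (hP : 1 < P) {f : α → ℂ} (hN : ∫⁻ x, ‖f x‖ₑ ^ P ∂ν ≤ 1)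
    {a : ℝ} (ha : 0 < a) :
    ∫⁻ x, ‖{x | a < ‖f x‖}.indicator f x‖ₑ ∂ν ≤ ENNReal.ofReal (a ^ (1 - P)) := by
  calc ∫⁻ x, ‖{x | a < ‖f x‖}.indicator f x‖ₑ ∂ν
      ≤ ∫⁻ x, ENNReal.ofReal (a ^ (1 - P)) * ‖f x‖ₑ ^ P ∂ν := by
        refine lintegral_mono fun x => ?_
        by_cases hx : a < ‖f x‖
        · rw [Set.indicator_of_mem (by exact hx), ← ofReal_norm,
            ENNReal.ofReal_rpow_of_nonneg (norm_nonneg _) (by linarith),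
            ← ENNReal.ofReal_mul (by positivity)]
          apply ENNReal.ofReal_le_ofReal
          have ht : 0 < ‖f x‖ := ha.trans hx
          calc ‖f x‖ = ‖f x‖ ^ (1 - P) * ‖f x‖ ^ P := by
                rw [← Real.rpow_add ht]; simp
            _ ≤ a ^ (1 - P) * ‖f x‖ ^ P := by
                gcongr ?_ * _
                exact Real.rpow_le_rpow_of_nonpos ha hx.le (by linarith)
        · rw [Set.indicator_of_notMem (by exact hx)]
          simp
    _ = ENNReal.ofReal (a ^ (1 - P)) * ∫⁻ x, ‖f x‖ₑ ^ P ∂ν :=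
        lintegral_const_mul' _ _ ENNReal.ofReal_ne_top
    _ ≤ ENNReal.ofReal (a ^ (1 - P)) * 1 := by gcongr
    _ = _ := mul_one _

/-- The core of the Marcinkiewicz interpolation between `L¹ → L^∞` and `L² → L²`. -/
theorem lintegral_rpow_le_of_level_split {α : Type*} [MeasurableSpace α] {ν : Measure α} [SFinite ν]
    {P r : ℝ} (hP1 : 1 < P) (hP2 : P < 2) (hr : r = P / (P - 1)) {f g : α → ℂ}
    (hf : Measurable f) (hg : AEMeasurable g ν) (hN : ∫⁻ x, ‖f x‖ₑ ^ P ∂ν ≤ 1)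
    (hdec : ∀ a : ℝ, 0 < a → ∃ g₁ g₂ : α → ℂ, AEMeasurable g₂ ν ∧ (∀ᵐ x ∂ν, g x = g₁ x + g₂ x) ∧
      (∀ᵐ x ∂ν, ‖g₁ x‖ₑ ≤ ∫⁻ x, ‖{x | a < ‖f x‖}.indicator f x‖ₑ ∂ν) ∧
      ∫⁻ x, ‖g₂ x‖ₑ ^ 2 ∂ν ≤ ∫⁻ x, ‖{x | ‖f x‖ ≤ a}.indicator f x‖ₑ ^ 2 ∂ν) :
    ∫⁻ x, ‖g x‖ₑ ^ r ∂ν ≤ ENNReal.ofReal r * ENNReal.ofReal (4 * 2 ^ (r - 2) / (r - 2)) := by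
  have hP0 : 0 < P - 1 := by linarith
  have hr1 : (r - 1) * (P - 1) = 1 := by rw [hr]; field_simp; ring
  have hr2 : 2 < r := by rw [hr, lt_div_iff₀ hP0]; linarith
  have hrP : 2 - (P - 1) * (r - 2) = P := by linear_combination -hr1
  have hlevel : ∀ l : ℝ, 0 < l → ν {x | l < ‖g x‖} * ENNReal.ofReal (l ^ (r - 1)) ≤
      ∫⁻ x, ENNReal.ofReal (4 * l ^ (r - 3)) *
        ‖{x | ‖f x‖ ≤ (l / 2) ^ (-(r - 1))}.indicator f x‖ₑ ^ 2 ∂ν := by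
    intro l hl
    -- The cutting height depends on the level: since `(r-1)(P-1) = 1`, it makes `a^{1-P} = l/2`.
    -- The tall part of `f` then contributes at most `l/2` to `g`, so `{‖g‖ > l}` is controlled by
    -- `g₂` alone, through Chebyshev in `L²`.
    set a := (l / 2) ^ (-(r - 1)) with ha_def
    have ha : 0 < a := Real.rpow_pos_of_pos (by positivity) _
    obtain ⟨g₁, g₂, hg₂, hsum, h₁, h₂⟩ := hdec a ha
    have hal : a ^ (1 - P) = l / 2 := by
      rw [ha_def, ← Real.rpow_mul (by positivity)]
      have : -(r - 1) * (1 - P) = 1 := by linear_combination hr1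
      rw [this, Real.rpow_one]
    have hb := lintegral_enorm_indicator_lt_le hP1 hN ha
    rw [hal] at hb
    have hsub : ν {x | l < ‖g x‖} ≤ ν {x | ENNReal.ofReal ((l / 2) ^ 2) ≤ ‖g₂ x‖ₑ ^ 2} := by
      apply measure_mono_ae
      filter_upwards [hsum, h₁] with x hx hx1 hlx
      have hx1' : ‖g₁ x‖ ≤ l / 2 := by
        have := hx1.trans hb
        rw [← ofReal_norm] at this
        exact (ENNReal.ofReal_le_ofReal_iff (by positivity)).1 this
      have hlx' : l < ‖g x‖ := hlx
      have : l / 2 ≤ ‖g₂ x‖ := by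
        have := norm_add_le (g₁ x) (g₂ x)
        rw [← hx] at this
        linarith
      change ENNReal.ofReal ((l / 2) ^ 2) ≤ ‖g₂ x‖ₑ ^ 2
      rw [← ofReal_norm, ENNReal.ofReal_pow (by positivity)]
      gcongr
    have hcheb := mul_meas_ge_le_lintegral₀ (μ := ν) (f := fun x => ‖g₂ x‖ₑ ^ 2)
      (hg₂.enorm.pow_const 2) (ENNReal.ofReal ((l / 2) ^ 2))
    rw [lintegral_const_mul' _ _ ENNReal.ofReal_ne_top]
    calc ν {x | l < ‖g x‖} * ENNReal.ofReal (l ^ (r - 1))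
        ≤ ν {x | ENNReal.ofReal ((l / 2) ^ 2) ≤ ‖g₂ x‖ₑ ^ 2} * ENNReal.ofReal (l ^ (r - 1)) := by
          gcongr
      _ = ENNReal.ofReal (4 * l ^ (r - 3)) *
          (ENNReal.ofReal ((l / 2) ^ 2) * ν {x | ENNReal.ofReal ((l / 2) ^ 2) ≤ ‖g₂ x‖ₑ ^ 2}) := by
          rw [← mul_assoc, ← ENNReal.ofReal_mul (by positivity), mul_comm]
          congr 2
          have : l ^ (r - 1) = l ^ (r - 3) * l ^ 2 := by
            rw [← Real.rpow_natCast l 2, ← Real.rpow_add hl]; norm_num; ring_nf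
          rw [this]; ring
      _ ≤ _ := by gcongr; exact hcheb.trans h₂
  have hmeas : MeasurableSet {z : ℝ × α | ‖f z.2‖ ≤ (z.1 / 2) ^ (-(r - 1))} := by
    apply measurableSet_le
    · fun_prop
    · fun_prop
  have h1 : ∫⁻ x, ‖g x‖ₑ ^ r ∂ν = ENNReal.ofReal r * ∫⁻ l in Set.Ioi (0 : ℝ),
      ν {x | l < ‖g x‖} * ENNReal.ofReal (l ^ (r - 1)) := by
    rw [← lintegral_rpow_eq_lintegral_meas_lt_mul ν (f := fun x => ‖g x‖)
      (Filter.Eventually.of_forall fun x => norm_nonneg _) hg.norm (by linarith : 0 < r)]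
    refine lintegral_congr fun x => ?_
    rw [← ofReal_norm, ENNReal.ofReal_rpow_of_nonneg (norm_nonneg _) (by linarith)]
  rw [h1]
  gcongr
  calc ∫⁻ l in Set.Ioi (0 : ℝ), ν {x | l < ‖g x‖} * ENNReal.ofReal (l ^ (r - 1))
      ≤ ∫⁻ l in Set.Ioi (0 : ℝ), (∫⁻ x, ENNReal.ofReal (4 * l ^ (r - 3)) *
        ‖{x | ‖f x‖ ≤ (l / 2) ^ (-(r - 1))}.indicator f x‖ₑ ^ 2 ∂ν) :=
        setLIntegral_mono' measurableSet_Ioi hlevel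
    _ = ∫⁻ x, (∫⁻ l in Set.Ioi (0 : ℝ), ENNReal.ofReal (4 * l ^ (r - 3)) *
        ‖{x | ‖f x‖ ≤ (l / 2) ^ (-(r - 1))}.indicator f x‖ₑ ^ 2) ∂ν := by
        apply lintegral_lintegral_swap
        apply Measurable.aemeasurable
        have h2 : Measurable fun z : ℝ × α =>
            {z : ℝ × α | ‖f z.2‖ ≤ (z.1 / 2) ^ (-(r - 1))}.indicator (fun z => f z.2) z :=
          (hf.comp measurable_snd).indicator hmeas
        exact Measurable.mul (f := fun z : ℝ × α => ENNReal.ofReal (4 * z.1 ^ (r - 3)))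
          (by fun_prop) (h2.enorm.pow_const 2)
    _ ≤ ∫⁻ x, ENNReal.ofReal (4 * 2 ^ (r - 2) / (r - 2)) * ‖f x‖ₑ ^ P ∂ν := by
        refine lintegral_mono fun x => ?_
        by_cases hx0 : f x = 0
        · have : ∀ s : Set α, s.indicator f x = 0 := fun s => by
            simp [hx0]
          simp [this]
        have hx : 0 < ‖f x‖ := norm_pos_iff.2 hx0
        -- For fixed `x` the cut-off condition on `l` reads `l ≤ b`. The remaining integral of
        -- `l^{r-3}` over `(0, b]` converges because `r > 2`, and `2 - (P-1)(r-2) = P` turns it into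
        -- a multiple of `‖f x‖^P`.
        set b := 2 * ‖f x‖ ^ (-(P - 1)) with hb_def
        have hb : 0 ≤ b := by positivity
        calc ∫⁻ l in Set.Ioi (0 : ℝ), ENNReal.ofReal (4 * l ^ (r - 3)) *
              ‖{x | ‖f x‖ ≤ (l / 2) ^ (-(r - 1))}.indicator f x‖ₑ ^ 2
            ≤ ∫⁻ l in Set.Ioi (0 : ℝ), (Set.Ioc 0 b).indicator
                (fun l => ENNReal.ofReal (4 * ‖f x‖ ^ 2) * ENNReal.ofReal (l ^ (r - 3))) l := by
              refine setLIntegral_mono' measurableSet_Ioi fun l hl => ?_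
              have hl' : 0 < l := hl
              by_cases hxl : ‖f x‖ ≤ (l / 2) ^ (-(r - 1))
              · have hlb : l ≤ b := by
                  have h3 := Real.rpow_le_rpow_of_nonpos hx hxl (by linarith : -(P - 1) ≤ 0)
                  rw [← Real.rpow_mul (by positivity)] at h3
                  have h4 : -(r - 1) * -(P - 1) = 1 := by linear_combination hr1
                  rw [h4, Real.rpow_one] at h3
                  rw [hb_def]; linarith
                rw [Set.indicator_of_mem (Set.mem_Ioc.2 ⟨hl', hlb⟩),
                  Set.indicator_of_mem (by exact hxl), ← ofReal_norm,
                  ← ENNReal.ofReal_pow (norm_nonneg _), ← ENNReal.ofReal_mul (by positivity),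
                  ← ENNReal.ofReal_mul (by positivity)]
                apply ENNReal.ofReal_le_ofReal
                apply le_of_eq; ring
              · rw [Set.indicator_of_notMem (by exact hxl)]
                simp
          _ ≤ ∫⁻ l in Set.Ioc 0 b,
                ENNReal.ofReal (4 * ‖f x‖ ^ 2) * ENNReal.ofReal (l ^ (r - 3)) := by
              rw [← lintegral_indicator measurableSet_Ioc]
              exact setLIntegral_le_lintegral _ _
          _ = ENNReal.ofReal (4 * ‖f x‖ ^ 2) * ENNReal.ofReal (b ^ (r - 3 + 1) / (r - 3 + 1)) := by
              rw [lintegral_const_mul' _ _ ENNReal.ofReal_ne_top,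
                lintegral_Ioc_ofReal_rpow (by linarith) hb]
          _ ≤ ENNReal.ofReal (4 * 2 ^ (r - 2) / (r - 2)) * ‖f x‖ₑ ^ P := by
              rw [← ofReal_norm, ENNReal.ofReal_rpow_of_nonneg (norm_nonneg _)
                (by linarith), ← ENNReal.ofReal_mul (by positivity),
                ← ENNReal.ofReal_mul (div_nonneg (by positivity) (by linarith))]
              apply ENNReal.ofReal_le_ofReal
              apply le_of_eq
              have h5 : ‖f x‖ ^ P = ‖f x‖ ^ 2 * (‖f x‖ ^ (-(P - 1))) ^ (r - 2) := by
                rw [← Real.rpow_mul (by positivity), ← Real.rpow_natCast _ 2, ← Real.rpow_add hx]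
                congr 1
                push_cast
                linarith
              have h6 : r - 3 + 1 = r - 2 := by ring
              rw [h5, hb_def, h6, Real.mul_rpow (by positivity) (by positivity)]
              ring
    _ = ENNReal.ofReal (4 * 2 ^ (r - 2) / (r - 2)) * ∫⁻ x, ‖f x‖ₑ ^ P ∂ν :=
        lintegral_const_mul' _ _ ENNReal.ofReal_ne_top
    _ ≤ ENNReal.ofReal (4 * 2 ^ (r - 2) / (r - 2)) * 1 := by gcongr
    _ = _ := mul_one _

theorem lintegral_enorm_indicator_le_sq_le {α : Type*} [MeasurableSpace α] {ν : Measure α} {P : ℝ}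
    (hP0 : 0 < P) (hP : P < 2) {f : α → ℂ} (hN : ∫⁻ x, ‖f x‖ₑ ^ P ∂ν ≤ 1)
    {a : ℝ} (ha : 0 < a) :
    ∫⁻ x, ‖{x | ‖f x‖ ≤ a}.indicator f x‖ₑ ^ 2 ∂ν ≤ ENNReal.ofReal (a ^ (2 - P)) := by
  calc ∫⁻ x, ‖{x | ‖f x‖ ≤ a}.indicator f x‖ₑ ^ 2 ∂ν
      ≤ ∫⁻ x, ENNReal.ofReal (a ^ (2 - P)) * ‖f x‖ₑ ^ P ∂ν := by
        refine lintegral_mono fun x => ?_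
        by_cases hx : ‖f x‖ ≤ a
        · rw [Set.indicator_of_mem (by exact hx), ← ofReal_norm,
            ENNReal.ofReal_rpow_of_nonneg (norm_nonneg _) hP0.le,
            ← ENNReal.ofReal_mul (by positivity), ← ENNReal.ofReal_pow (norm_nonneg _)]
          apply ENNReal.ofReal_le_ofReal
          rcases (norm_nonneg (f x)).eq_or_lt with h0 | ht
          · rw [← h0]; simp; positivity
          calc ‖f x‖ ^ 2 = ‖f x‖ ^ (2 - P) * ‖f x‖ ^ P := by
                rw [← Real.rpow_add ht]; simp
            _ ≤ a ^ (2 - P) * ‖f x‖ ^ P := by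
                gcongr ?_ * _
                exact Real.rpow_le_rpow ht.le hx (by linarith)
        · rw [Set.indicator_of_notMem (by exact hx)]
          simp
    _ = ENNReal.ofReal (a ^ (2 - P)) * ∫⁻ x, ‖f x‖ₑ ^ P ∂ν :=
        lintegral_const_mul' _ _ ENNReal.ofReal_ne_top
    _ ≤ ENNReal.ofReal (a ^ (2 - P)) * 1 := by gcongr
    _ = _ := mul_one _

/-! ### Fourier pairs and the Hausdorff-Young inequality -/

/-- The function `g` represents the distributional Fourier transform of the function `f`. -/
def IsFourierPair (f g : R3 → ℂ) : Prop :=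
  ∀ φ : 𝓢(R3, ℂ), ∫ x, (𝓕 φ) x * f x = ∫ x, φ x * g x

theorem isFourierPair_fourier {f : R3 → ℂ} (hf : Integrable f) : IsFourierPair f (𝓕 f) := by
  intro φ
  have h := VectorFourier.integral_fourierIntegral_smul_eq_flip (L := innerₗ R3)
    Real.continuous_fourierChar continuous_inner φ.integrable hf (μ := volume) (ν := volume)
  rw [flip_innerₗ] at h
  exact h

theorem continuous_fourier_of_integrable {f : R3 → ℂ} (hf : Integrable f) : Continuous (𝓕 f) :=
  VectorFourier.fourierIntegral_continuous Real.continuous_fourierChar continuous_inner hf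

theorem enorm_fourier_le_lintegral (f : R3 → ℂ) (x : R3) : ‖𝓕 f x‖ₑ ≤ ∫⁻ x, ‖f x‖ₑ := by
  have h : 𝓕 f x = ∫ v, Real.fourierChar (-(inner ℝ v x)) • f v := Real.fourier_eq f x
  rw [h]
  refine (enorm_integral_le_lintegral_enorm _).trans (le_of_eq ?_)
  refine lintegral_congr fun v => ?_
  rw [← ofReal_norm, ← ofReal_norm, Circle.norm_smul]

theorem exists_isFourierPair_memLp_two {f : R3 → ℂ} (hf : MemLp f 2) :
    ∃ g : R3 → ℂ, MemLp g 2 ∧ IsFourierPair f g ∧ eLpNorm g 2 = eLpNorm f 2 := by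
  refine ⟨(𝓕 (hf.toLp f) : Lp ℂ 2 volume), Lp.memLp _, fun φ => ?_, ?_⟩
  · have := congrArg (fun T : 𝓢'(R3, ℂ) => T φ) (Lp.fourier_toTemperedDistribution_eq (hf.toLp f))
    simp only [TemperedDistribution.fourier_apply, Lp.toTemperedDistribution_apply,
      smul_eq_mul] at this
    rw [← this]
    apply integral_congr_ae
    filter_upwards [hf.coeFn_toLp] with x hx
    rw [hx]
  · have h := Lp.norm_fourier_eq (hf.toLp f)
    rw [Lp.norm_def, Lp.norm_def, ENNReal.toReal_eq_toReal_iff' (Lp.eLpNorm_ne_top _)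
      (Lp.eLpNorm_ne_top _)] at h
    rw [h]
    exact eLpNorm_congr_ae hf.coeFn_toLp

/-- Uniqueness of the representing function. Compactly supported tests suffice, so local
integrability is all that is asked of the functions. -/
theorem ae_eq_of_forall_integral_schwartz_eq {g g' : R3 → ℂ} (hg : LocallyIntegrable g)
    (hg' : LocallyIntegrable g')
    (h : ∀ φ : 𝓢(R3, ℂ), HasCompactSupport φ → ∫ x, φ x * g x = ∫ x, φ x * g' x) : g =ᵐ[volume] g' := by
  apply ae_eq_of_integral_contDiff_smul_eq hg hg'
  intro ψ hψ hc
  have hc' : HasCompactSupport (Complex.ofRealCLM ∘ ψ) := hc.comp_left rfl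
  have hs' : ContDiff ℝ (⊤ : ℕ∞) (Complex.ofRealCLM ∘ ψ) := by fun_prop
  have := h (hc'.toSchwartzMap hs') hc'
  simpa using this

theorem SchwartzMap.integrable_mul_memLp {p : ℝ≥0∞} (hp : 1 ≤ p) {g : R3 → ℂ} (hg : MemLp g p)
    (φ : 𝓢(R3, ℂ)) : Integrable fun x => φ x * g x := by
  have := ENNReal.HolderConjugate.inv_one_sub_inv' hp
  have : ENNReal.HolderTriple (1 - p⁻¹)⁻¹ p 1 := by
    have : ENNReal.HolderConjugate p (1 - p⁻¹)⁻¹ := inferInstance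
    exact this.symm
  exact (φ.memLp (1 - p⁻¹)⁻¹).integrable_mul hg

/-- The part of `f` above height `a` is integrable and the part below is square integrable. The
first is transformed by the Fourier integral, the second by Plancherel. -/
theorem exists_level_split {P : ℝ} (hP1 : 1 < P) (hP2 : P < 2) {f : R3 → ℂ} (hf : Measurable f)
    (hN : ∫⁻ x, ‖f x‖ₑ ^ P ≤ 1) {a : ℝ} (ha : 0 < a) :
    ∃ g₁ g₂ : R3 → ℂ, MemLp g₁ ∞ ∧ MemLp g₂ 2 ∧ IsFourierPair f (fun x => g₁ x + g₂ x) ∧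
      (∀ᵐ x, ‖g₁ x‖ₑ ≤ ∫⁻ x, ‖{x | a < ‖f x‖}.indicator f x‖ₑ) ∧
      ∫⁻ x, ‖g₂ x‖ₑ ^ 2 ≤ ∫⁻ x, ‖{x | ‖f x‖ ≤ a}.indicator f x‖ₑ ^ 2 := by
  set f₁ := {x | a < ‖f x‖}.indicator f with hf₁
  set f₂ := {x | ‖f x‖ ≤ a}.indicator f with hf₂
  have hm₁ : Measurable f₁ := hf.indicator (measurableSet_lt measurable_const hf.norm)
  have hm₂ : Measurable f₂ := hf.indicator (measurableSet_le hf.norm measurable_const)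
  have hi₁ : Integrable f₁ :=
    ⟨hm₁.aestronglyMeasurable, (lintegral_enorm_indicator_lt_le hP1 hN ha).trans_lt
      ENNReal.ofReal_lt_top⟩
  have hsq : ∀ g : R3 → ℂ, eLpNorm g 2 = (∫⁻ x, ‖g x‖ₑ ^ 2) ^ (1 / 2 : ℝ) := by
    intro g
    rw [eLpNorm_eq_lintegral_rpow_enorm_toReal (by norm_num) (by norm_num)]
    simp
  have hi₂ : MemLp f₂ 2 := by
    refine ⟨hm₂.aestronglyMeasurable, ?_⟩
    rw [hsq]
    exact ENNReal.rpow_lt_top_of_nonneg (by norm_num)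
      ((lintegral_enorm_indicator_le_sq_le (by linarith) hP2 hN ha).trans_lt
        ENNReal.ofReal_lt_top).ne
  obtain ⟨g₂, hg₂, hp₂, hn₂⟩ := exists_isFourierPair_memLp_two hi₂
  have hb : ∀ x, ‖𝓕 f₁ x‖ₑ ≤ ∫⁻ x, ‖f₁ x‖ₑ := enorm_fourier_le_lintegral f₁
  have hg₁ : MemLp (𝓕 f₁) ∞ := by
    refine ⟨(continuous_fourier_of_integrable hi₁).aestronglyMeasurable, ?_⟩
    rw [eLpNorm_exponent_top]
    refine (eLpNormEssSup_le_of_ae_enorm_bound (Filter.Eventually.of_forall hb)).trans_lt ?_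
    exact hi₁.2
  refine ⟨𝓕 f₁, g₂, hg₁, hg₂, fun φ => ?_, Filter.Eventually.of_forall hb, ?_⟩
  · have hfs : ∀ x, f x = f₁ x + f₂ x := by
      intro x
      by_cases hx : ‖f x‖ ≤ a
      · rw [hf₁, hf₂, Set.indicator_of_notMem (s := {x | a < ‖f x‖}) (by exact not_lt.2 hx),
          Set.indicator_of_mem (by exact hx), zero_add]
      · rw [hf₁, hf₂, Set.indicator_of_mem (s := {x | a < ‖f x‖}) (by exact not_le.1 hx),
          Set.indicator_of_notMem (by exact hx), add_zero]
    simp only [hfs, mul_add]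
    rw [integral_add ((𝓕 φ).integrable_mul_memLp le_rfl (memLp_one_iff_integrable.2 hi₁))
      ((𝓕 φ).integrable_mul_memLp one_le_two hi₂),
      integral_add (φ.integrable_mul_memLp le_top hg₁) (φ.integrable_mul_memLp one_le_two hg₂),
      isFourierPair_fourier hi₁ φ, hp₂ φ]
  · rw [hsq, hsq] at hn₂
    exact ((ENNReal.rpow_left_injective (by norm_num : (1 / 2 : ℝ) ≠ 0)) hn₂).le

/-- The Hausdorff-Young inequality, up to a constant, strictly between the endpoints. -/
theorem exists_isFourierPair_of_normalized {P r : ℝ} (hP1 : 1 < P) (hP2 : P < 2)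
    (hr : r = P / (P - 1)) {f : R3 → ℂ} (hf : Measurable f)
    (hN : ∫⁻ x, ‖f x‖ₑ ^ P ≤ 1) :
    ∃ g : R3 → ℂ, AEStronglyMeasurable g ∧ IsFourierPair f g ∧
      ∫⁻ x, ‖g x‖ₑ ^ r ≤ ENNReal.ofReal r * ENNReal.ofReal (4 * 2 ^ (r - 2) / (r - 2)) := by
  obtain ⟨g₁, g₂, hg₁, hg₂, hp, -, -⟩ := exists_level_split hP1 hP2 hf hN one_pos
  have hloc : ∀ {g₁ g₂ : R3 → ℂ}, MemLp g₁ ∞ → MemLp g₂ 2 →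
      LocallyIntegrable (fun x => g₁ x + g₂ x) := fun h₁ h₂ =>
    (h₁.locallyIntegrable le_top).add (h₂.locallyIntegrable one_le_two)
  refine ⟨fun x => g₁ x + g₂ x, hg₁.1.add hg₂.1, hp,
    lintegral_rpow_le_of_level_split hP1 hP2 hr hf (hg₁.1.add hg₂.1).aemeasurable hN ?_⟩
  intro a ha
  -- The transform was defined from the split at height `1`. Uniqueness of Fourier pairs identifies
  -- it with the sum obtained at any other height.
  obtain ⟨h₁, h₂, hh₁, hh₂, hq, hb₁, hb₂⟩ := exists_level_split hP1 hP2 hf hN ha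
  refine ⟨h₁, h₂, hh₂.1.aemeasurable, ?_, hb₁, hb₂⟩
  refine ae_eq_of_forall_integral_schwartz_eq (hloc hg₁ hg₂) (hloc hh₁ hh₂) fun φ _ => ?_
  rw [← hp φ, ← hq φ]

theorem eLpNorm_const_mul_complex (c : ℂ) (f : R3 → ℂ) (p : ℝ≥0∞) :
    eLpNorm (fun x => c * f x) p volume = ‖c‖ₑ * eLpNorm f p volume :=
  eLpNorm_const_smul c f p volume

/-- The Hausdorff-Young inequality, up to a constant. -/
theorem hausdorff_young {p p' : ℝ≥0∞} (h1 : 1 ≤ p) (h2 : p ≤ 2) (hpp : p⁻¹ + p'⁻¹ = 1) :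
    ∃ C : ℝ, 0 ≤ C ∧ ∀ f : R3 → ℂ, MemLp f p → ∃ g : R3 → ℂ, MemLp g p' ∧ IsFourierPair f g ∧
      eLpNorm g p' ≤ ENNReal.ofReal C * eLpNorm f p := by
  rcases h1.eq_or_lt with rfl | h1
  · have hp' : p' = ∞ := by
      rw [inv_one] at hpp
      have : p'⁻¹ = 0 := by
        have h3 : (1 : ℝ≥0∞) + p'⁻¹ = 1 + 0 := by rw [hpp, add_zero]
        exact (ENNReal.add_right_inj ENNReal.one_ne_top).1 h3
      exact ENNReal.inv_eq_zero.1 this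
    subst hp'
    refine ⟨1, zero_le_one, fun f hf => ?_⟩
    have hi := memLp_one_iff_integrable.1 hf
    have hb : eLpNorm (𝓕 f) ∞ volume ≤ eLpNorm f 1 volume := by
      rw [eLpNorm_exponent_top, eLpNorm_one_eq_lintegral_enorm]
      exact eLpNormEssSup_le_of_ae_enorm_bound
        (Filter.Eventually.of_forall (enorm_fourier_le_lintegral f))
    exact ⟨𝓕 f, ⟨(continuous_fourier_of_integrable hi).aestronglyMeasurable,
      hb.trans_lt hf.2⟩, isFourierPair_fourier hi, by simpa using hb⟩
  rcases h2.eq_or_lt with rfl | h2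
  · have hp' : p' = 2 := by
      rw [← ENNReal.inv_two_add_inv_two] at hpp
      exact inv_injective ((ENNReal.add_right_inj (by simp)).1 hpp)
    subst hp'
    refine ⟨1, zero_le_one, fun f hf => ?_⟩
    obtain ⟨g, hg, hp, hn⟩ := exists_isFourierPair_memLp_two hf
    exact ⟨g, hg, hp, by simp [hn]⟩
  have hptop : p ≠ ∞ := (h2.trans ENNReal.ofNat_lt_top).ne
  set P := p.toReal with hP
  have hpP : p = ENNReal.ofReal P := (ENNReal.ofReal_toReal hptop).symm
  have hP1 : 1 < P := by
    rw [hpP] at h1; simpa using h1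
  have hP2 : P < 2 := by
    rw [hpP, ← ENNReal.ofReal_ofNat, ENNReal.ofReal_lt_ofReal_iff (by norm_num)] at h2; exact h2
  set r := P / (P - 1) with hr
  have hr0 : 0 < r := div_pos (by linarith) (by linarith)
  have hp' : p' = ENNReal.ofReal r := by
    have h3 : p⁻¹ + (ENNReal.ofReal r)⁻¹ = 1 := by
      rw [hpP, ← ENNReal.ofReal_inv_of_pos (by linarith), ← ENNReal.ofReal_inv_of_pos hr0,
        ← ENNReal.ofReal_add (by positivity) (by positivity), ← ENNReal.ofReal_one]
      congr 1
      have : P - 1 ≠ 0 := by linarith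
      have : P ≠ 0 := by linarith
      rw [hr]; field_simp; ring
    rw [← h3] at hpp
    exact inv_injective ((ENNReal.add_right_inj
      (ENNReal.inv_ne_top.2 (zero_lt_one.trans h1).ne')).1 hpp)
  have hp'0 : p' ≠ 0 := by rw [hp']; simpa using hr0
  have hp't : p' ≠ ∞ := by rw [hp']; exact ENNReal.ofReal_ne_top
  have hp'r : p'.toReal = r := by rw [hp', ENNReal.toReal_ofReal hr0.le]
  have hp0 : p ≠ 0 := (zero_lt_one.trans h1).ne'
  set K := r * (4 * 2 ^ (r - 2) / (r - 2)) with hK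
  have hr2 : 2 < r := by rw [hr, lt_div_iff₀ (by linarith)]; linarith
  have hr20 : 0 < r - 2 := by linarith
  have hK0 : 0 ≤ K := by positivity
  refine ⟨K ^ (1 / r), by positivity, fun f hf => ?_⟩
  by_cases hN : eLpNorm f p volume = 0
  · have hf0 : f =ᵐ[volume] 0 := (eLpNorm_eq_zero_iff hf.1 hp0).1 hN
    refine ⟨fun _ => 0, MemLp.zero, fun φ => ?_, by simp⟩
    have : ∫ x, (𝓕 φ) x * f x = ∫ x : R3, (0 : ℂ) := by
      apply integral_congr_ae
      filter_upwards [hf0] with x hx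
      simp [hx]
    simpa using this
  set N := (eLpNorm f p volume).toReal with hNdef
  have hNe : eLpNorm f p volume = ENNReal.ofReal N := (ENNReal.ofReal_toReal hf.2.ne).symm
  have hN0 : 0 < N := ENNReal.toReal_pos hN hf.2.ne
  -- Homogeneity reduces to unit norm. The strongly measurable representative is needed because the
  -- interpolation cuts along level sets.
  set f' : R3 → ℂ := fun x => (N : ℂ)⁻¹ * hf.1.mk f x with hf'
  have hf'm : Measurable f' := hf.1.stronglyMeasurable_mk.measurable.const_mul _
  have hf'n : eLpNorm f' p volume ≤ 1 := by
    rw [hf', eLpNorm_const_mul_complex, ← eLpNorm_congr_ae hf.1.ae_eq_mk, hNe, ← ofReal_norm, norm_inv,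
      Complex.norm_real, Real.norm_of_nonneg hN0.le, ← ENNReal.ofReal_mul (by positivity),
      inv_mul_cancel₀ hN0.ne', ENNReal.ofReal_one]
  have hf'N : ∫⁻ x, ‖f' x‖ₑ ^ P ≤ 1 := by
    rw [eLpNorm_eq_lintegral_rpow_enorm_toReal hp0 hptop] at hf'n
    by_contra hcon
    exact absurd hf'n (not_le.2 (ENNReal.one_lt_rpow (not_le.1 hcon) (by positivity)))
  obtain ⟨g, hgm, hgp, hgn⟩ := exists_isFourierPair_of_normalized hP1 hP2 hr hf'm hf'N
  have hgn' : eLpNorm g p' volume ≤ ENNReal.ofReal (K ^ (1 / r)) := by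
    rw [eLpNorm_eq_lintegral_rpow_enorm_toReal hp'0 hp't, hp'r,
      ← ENNReal.ofReal_rpow_of_nonneg hK0 (by positivity), hK, ENNReal.ofReal_mul hr0.le]
    gcongr
  have hfin : eLpNorm (fun x => (N : ℂ) * g x) p' volume ≤
      ENNReal.ofReal (K ^ (1 / r)) * eLpNorm f p volume := by
    rw [eLpNorm_const_mul_complex, hNe, mul_comm, ← ofReal_norm, Complex.norm_real, Real.norm_of_nonneg hN0.le]
    gcongr
  refine ⟨fun x => N * g x, ⟨hgm.const_mul _, hfin.trans_lt
    (ENNReal.mul_lt_top ENNReal.ofReal_lt_top hf.2)⟩, fun φ => ?_, hfin⟩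
  have h5 : ∫ x, φ x * (N * g x) = N * ∫ x, φ x * g x := by
    rw [← integral_const_mul]
    congr 1 with x
    ring
  rw [h5, ← hgp φ, ← integral_const_mul]
  apply integral_congr_ae
  filter_upwards [hf.1.ae_eq_mk] with x hx
  have : (N : ℂ) ≠ 0 := by exact_mod_cast hN0.ne'
  simp only [hf']
  rw [← hx]
  field_simp

/-! ### Tempered distributions given by functions -/

/-- The tempered distribution `T` is given by integration against the function `f`. -/
def Represents (T : TDist) (f : R3 → ℂ) : Prop := ∀ φ : 𝓢(R3, ℂ), T φ = ∫ x, φ x * f x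

/-- Two representing functions agree almost everywhere, so the infimum defining the norm runs over a
single value. -/
theorem Represents.distLpNorm_eq {p : ℝ≥0∞} (hp : 1 ≤ p) {T : TDist} {f : R3 → ℂ}
    (h : Represents T f) (hf : MemLp f p) : distLpNorm p T = eLpNorm f p volume := by
  apply le_antisymm
  · exact iInf_le_of_le f (iInf_le_of_le hf (iInf_le _ h))
  · refine le_iInf fun g => le_iInf fun hg => le_iInf fun hT => le_of_eq ?_
    refine eLpNorm_congr_ae (ae_eq_of_forall_integral_schwartz_eq (hf.locallyIntegrable hp)
      (hg.locallyIntegrable hp) fun φ _ => ?_)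
    rw [← h φ, ← hT φ]

theorem exists_represents_of_distLpNorm_ne_top {p : ℝ≥0∞} (hp : 1 ≤ p) {T : TDist}
    (h : distLpNorm p T ≠ ∞) :
    ∃ f : R3 → ℂ, MemLp f p ∧ Represents T f ∧ eLpNorm f p volume = distLpNorm p T := by
  have : ∃ f : R3 → ℂ, MemLp f p ∧ Represents T f := by
    by_contra! hcon
    refine h ?_
    refine iInf_eq_top.2 fun f => iInf_eq_top.2 fun hf => iInf_eq_top.2 fun hT => ?_
    exact absurd hT (hcon f hf)
  obtain ⟨f, hf, hT⟩ := this
  exact ⟨f, hf, hT, (hT.distLpNorm_eq hp hf).symm⟩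

theorem exists_fourier_represents {p p' : ℝ≥0∞} (h1 : 1 ≤ p) (h2 : p ≤ 2)
    (hpp : p⁻¹ + p'⁻¹ = 1) :
    ∃ C : ℝ, 0 ≤ C ∧ ∀ T : TDist, distLpNorm p T ≠ ∞ → ∃ g : R3 → ℂ, MemLp g p' ∧
      Represents (𝓕 T) g ∧ eLpNorm g p' volume ≤ ENNReal.ofReal C * distLpNorm p T := by
  obtain ⟨C, hC, h⟩ := hausdorff_young h1 h2 hpp
  refine ⟨C, hC, fun T hT => ?_⟩
  obtain ⟨f, hf, hTf, hn⟩ := exists_represents_of_distLpNorm_ne_top h1 hT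
  obtain ⟨g, hg, hp, hb⟩ := h f hf
  refine ⟨g, hg, fun φ => ?_, hn ▸ hb⟩
  rw [TemperedDistribution.fourier_apply, hTf, hp φ]

/-- The inverse transform is the forward transform of the reflected function, so Hausdorff-Young
applied to `h(-x)` returns from the frequency side to the physical side. -/
theorem distLpNorm_le_of_fourier_represents {q q' : ℝ≥0∞} (h1 : 1 ≤ q') (h2 : q' ≤ 2)
    (hqq : q'⁻¹ + q⁻¹ = 1) :
    ∃ C : ℝ, 0 ≤ C ∧ ∀ (T : TDist) (h : R3 → ℂ), MemLp h q' → Represents (𝓕 T) h →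
      distLpNorm q T ≤ ENNReal.ofReal C * eLpNorm h q' volume := by
  obtain ⟨C, hC, hY⟩ := hausdorff_young h1 h2 hqq
  refine ⟨C, hC, fun T h hh hT => ?_⟩
  have hneg : MeasurePreserving (fun x : R3 => -x) volume volume :=
    Measure.measurePreserving_neg volume
  obtain ⟨f, hf, hp, hb⟩ := hY (fun x => h (-x)) (hh.comp_measurePreserving hneg)
  have hq : 1 ≤ q := by
    have : q⁻¹ ≤ 1 := hqq ▸ le_add_self
    simpa using this
  have hTf : Represents T f := by
    intro φ
    rw [← hp φ]
    have h3 : T φ = (𝓕 T) (𝓕⁻ φ) := by simp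
    rw [h3, hT, ← integral_neg_eq_self]
    congr 1 with x
    rw [SchwartzMap.fourierInv_apply_eq]
    simp
  have h4 : eLpNorm (fun x => h (-x)) q' volume = eLpNorm h q' volume :=
    eLpNorm_comp_measurePreserving hh.1 hneg
  rw [hTf.distLpNorm_eq hq hf, ← h4]
  exact hb

/-! ### Completeness of the Schwartz space and uniform boundedness -/

theorem SchwartzMap.exists_seminorm_sub_lt_of_cauchySeq {u : ℕ → 𝓢(R3, ℂ)} (hu : CauchySeq u)
    (k n : ℕ) {ε : ℝ} (hε : 0 < ε) :
    ∃ N, ∀ i ≥ N, ∀ j ≥ N, SchwartzMap.seminorm ℝ k n (u i - u j) < ε := by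
  have h1 : Filter.Tendsto (fun p : ℕ × ℕ => u p.2 - u p.1) Filter.atTop (nhds 0) := by
    have := cauchySeq_iff_tendsto.1 hu
    rw [uniformity_eq_comap_nhds_zero, Filter.tendsto_comap_iff] at this
    exact this
  have h2 := ((schwartz_withSeminorms ℝ R3 ℂ).tendsto_nhds_atTop _ _).1 h1 (k, n) ε hε
  obtain ⟨⟨N₁, N₂⟩, hN⟩ := h2
  refine ⟨max N₁ N₂, fun i hi j hj => ?_⟩
  have := hN (j, i) ⟨(le_max_left _ _).trans hj, (le_max_right _ _).trans hi⟩
  simpa using this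

/-- All derivatives of a Cauchy sequence converge uniformly, also after multiplication by powers of
`‖x‖`. The limits of the derivatives of successive orders are derivatives of one another and so form
a Taylor series of the limit of order `0`. The weighted estimates pass to the limit, giving both the
decay of the limit and convergence in every seminorm. -/
theorem SchwartzMap.exists_tendsto_of_cauchySeq {u : ℕ → 𝓢(R3, ℂ)} (hu : CauchySeq u) :
    ∃ g, Filter.Tendsto u Filter.atTop (nhds g) := by
  have hC : ∀ (k n : ℕ) (ε : ℝ), 0 < ε → ∃ N, ∀ i ≥ N, ∀ j ≥ N, ∀ x,
      ‖x‖ ^ k * ‖iteratedFDeriv ℝ n (u i) x - iteratedFDeriv ℝ n (u j) x‖ ≤ ε := by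
    intro k n ε hε
    obtain ⟨N, hN⟩ := exists_seminorm_sub_lt_of_cauchySeq hu k n hε
    refine ⟨N, fun i hi j hj x => ?_⟩
    have h1 := (SchwartzMap.le_seminorm ℝ k n (u i - u j) x).trans (hN i hi j hj).le
    have h2 : iteratedFDeriv ℝ n (u i - u j) x =
        iteratedFDeriv ℝ n (u i) x - iteratedFDeriv ℝ n (u j) x := by
      have : ((u i - u j : 𝓢(R3, ℂ)) : R3 → ℂ) = (u i : R3 → ℂ) - (u j : R3 → ℂ) := by
        ext x; simp
      rw [this]
      exact iteratedFDeriv_sub_apply ((u i).contDiffAt n) ((u j).contDiffAt n)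
    rwa [h2] at h1
  have hG : ∀ (n : ℕ) (x : R3), ∃ G, Filter.Tendsto (fun i => iteratedFDeriv ℝ n (u i) x)
      Filter.atTop (nhds G) := by
    intro n x
    apply cauchySeq_tendsto_of_complete
    rw [Metric.cauchySeq_iff]
    intro ε hε
    obtain ⟨N, hN⟩ := hC 0 n (ε / 2) (by positivity)
    refine ⟨N, fun i hi j hj => ?_⟩
    have := hN i hi j hj x
    rw [dist_eq_norm]
    simp only [pow_zero, one_mul] at this
    linarith
  choose G hG using hG
  have hlim : ∀ (k n : ℕ) (ε : ℝ), 0 < ε → ∃ N, ∀ i ≥ N, ∀ x,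
      ‖x‖ ^ k * ‖iteratedFDeriv ℝ n (u i) x - G n x‖ ≤ ε := by
    intro k n ε hε
    obtain ⟨N, hN⟩ := hC k n ε hε
    refine ⟨N, fun i hi x => ?_⟩
    have ht : Filter.Tendsto (fun j => ‖x‖ ^ k * ‖iteratedFDeriv ℝ n (u i) x -
        iteratedFDeriv ℝ n (u j) x‖) Filter.atTop
        (nhds (‖x‖ ^ k * ‖iteratedFDeriv ℝ n (u i) x - G n x‖)) :=
      ((tendsto_const_nhds.sub (hG n x)).norm).const_mul _
    refine le_of_tendsto ht ?_
    filter_upwards [Filter.eventually_ge_atTop N] with j hj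
    exact hN i hi j hj x
  have hunif : ∀ n : ℕ, TendstoUniformly (fun i x => iteratedFDeriv ℝ n (u i) x) (G n)
      Filter.atTop := by
    intro n
    rw [Metric.tendstoUniformly_iff]
    intro ε hε
    obtain ⟨N, hN⟩ := hlim 0 n (ε / 2) (by positivity)
    filter_upwards [Filter.eventually_ge_atTop N] with i hi x
    have := hN i hi x
    rw [dist_comm, dist_eq_norm]
    simp only [pow_zero, one_mul] at this
    linarith
  have hder : ∀ (n : ℕ) (x : R3), HasFDerivAt (G n) (G (n + 1) x).curryLeft x := by
    intro n
    refine hasFDerivAt_of_tendstoUniformly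
      (f' := fun i x => (iteratedFDeriv ℝ (n + 1) (u i) x).curryLeft) (l := Filter.atTop)
      (f := fun i x => iteratedFDeriv ℝ n (u i) x) ?_ ?_ (hG n)
    · exact (continuousMultilinearCurryLeftEquiv ℝ (fun _ : Fin (n + 1) => R3)
        ℂ).isometry.uniformContinuous.comp_tendstoUniformly (hunif (n + 1))
    · intro i x
      have hd : DifferentiableAt ℝ (iteratedFDeriv ℝ n (u i)) x :=
        (((u i).smooth ⊤).differentiable_iteratedFDeriv (by exact_mod_cast ENat.natCast_lt_top n)) x
      have := hd.hasFDerivAt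
      rwa [fderiv_iteratedFDeriv] at this
  have hT : HasFTaylorSeriesUpTo ((⊤ : ℕ∞) : WithTop ℕ∞) (fun x => (G 0 x).curry0)
      (fun x n => G n x) :=
    { zero_eq := fun x => rfl
      fderiv := fun m _ x => hder m x
      cont := fun m _ => continuous_iff_continuousAt.2 fun x => (hder m x).continuousAt }
  have hiter : ∀ n x, iteratedFDeriv ℝ n (fun x => (G 0 x).curry0) x = G n x := fun n x =>
    (hT.eq_iteratedFDeriv (by exact_mod_cast le_top) x).symm
  let g : 𝓢(R3, ℂ) :=
    { toFun := fun x => (G 0 x).curry0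
      smooth' := hT.contDiff
      decay' := by
        intro k n
        obtain ⟨N, hN⟩ := hlim k n 1 one_pos
        refine ⟨SchwartzMap.seminorm ℝ k n (u N) + 1, fun x => ?_⟩
        rw [hiter]
        have h1 := hN N le_rfl x
        have h2 := SchwartzMap.le_seminorm ℝ k n (u N) x
        have h3 : ‖G n x‖ ≤ ‖iteratedFDeriv ℝ n (u N) x‖ +
            ‖iteratedFDeriv ℝ n (u N) x - G n x‖ := by
          rw [norm_sub_rev]
          exact norm_le_norm_add_norm_sub' _ _
        calc ‖x‖ ^ k * ‖G n x‖ ≤ ‖x‖ ^ k * (‖iteratedFDeriv ℝ n (u N) x‖ +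
            ‖iteratedFDeriv ℝ n (u N) x - G n x‖) := by gcongr
          _ ≤ _ := by rw [mul_add]; exact add_le_add h2 h1 }
  refine ⟨g, ((schwartz_withSeminorms ℝ R3 ℂ).tendsto_nhds_atTop _ _).2 ?_⟩
  rintro ⟨k, n⟩ ε hε
  obtain ⟨N, hN⟩ := hlim k n (ε / 2) (by positivity)
  refine ⟨N, fun i hi => ?_⟩
  refine lt_of_le_of_lt (SchwartzMap.seminorm_le_bound ℝ k n (u i - g) (M := ε / 2)
    (by positivity) fun x => ?_) (by linarith)
  have h2 : iteratedFDeriv ℝ n (u i - g : 𝓢(R3, ℂ)) x = iteratedFDeriv ℝ n (u i) x - G n x := by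
    have : ((u i - g : 𝓢(R3, ℂ)) : R3 → ℂ) = (u i : R3 → ℂ) - (g : R3 → ℂ) := by
      ext x; simp
    rw [this, ← hiter n x]
    exact iteratedFDeriv_sub_apply ((u i).contDiffAt n) (g.contDiffAt n)
  rw [h2]
  exact hN i hi x

/-- The uniformity is countably generated, so Cauchy sequences suffice. Completeness matters here
through the Baire property, on which uniform boundedness rests. -/
instance SchwartzMap.completeSpace : CompleteSpace 𝓢(R3, ℂ) := by
  have : (nhds (0 : 𝓢(R3, ℂ))).IsCountablyGenerated := inferInstance
  have := IsUniformAddGroup.uniformity_countably_generated (α := 𝓢(R3, ℂ))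
  exact UniformSpace.complete_of_cauchySeq_tendsto fun u hu => exists_tendsto_of_cauchySeq hu

instance SchwartzMap.baireSpace : BaireSpace 𝓢(R3, ℂ) := by
  have : (nhds (0 : 𝓢(R3, ℂ))).IsCountablyGenerated := inferInstance
  have := IsUniformAddGroup.uniformity_countably_generated (α := 𝓢(R3, ℂ))
  infer_instance

/-- The uniform boundedness principle for tempered distributions. -/
theorem exists_seminorm_bound_of_pointwise_bounded {ι : Type*} (T : ι → TDist)
    (h : ∀ φ : 𝓢(R3, ℂ), ∃ C : ℝ, ∀ i, ‖T i φ‖ ≤ C) :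
    ∃ (s : Finset (ℕ × ℕ)) (C : ℝ), 0 ≤ C ∧ ∀ i (φ : 𝓢(R3, ℂ)),
      ‖T i φ‖ ≤ C * (s.sup (schwartzSeminormFamily ℂ R3 ℂ)) φ := by
  let q : ι → Seminorm ℂ 𝓢(R3, ℂ) := fun i => (normSeminorm ℂ ℂ).comp (T i).toLinearMap
  have hq : ∀ i φ, q i φ = ‖T i φ‖ := fun i φ => rfl
  have hbdd : BddAbove (Set.range q) := by
    rw [Seminorm.bddAbove_range_iff]
    intro φ
    obtain ⟨C, hC⟩ := h φ
    exact ⟨C, by rintro _ ⟨i, rfl⟩; exact hC i⟩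
  -- Baire category enters here: a pointwise bounded supremum of continuous seminorms is again
  -- continuous.
  have hcont := Seminorm.continuous_iSup q
    (fun i => continuous_norm.comp (T i).continuous) hbdd
  have hcont' : Continuous (⨆ i, q i : Seminorm ℂ 𝓢(R3, ℂ)) := by
    rw [Seminorm.coe_iSup_eq hbdd]
    exact hcont
  obtain ⟨s, C, -, hs⟩ := Seminorm.bound_of_continuous (schwartz_withSeminorms ℂ R3 ℂ) _ hcont'
  refine ⟨s, C, C.2, fun i φ => ?_⟩
  have h1 := hs φ
  have h2 : q i φ ≤ (⨆ i, q i : Seminorm ℂ 𝓢(R3, ℂ)) φ := by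
    rw [Seminorm.coe_iSup_eq hbdd, iSup_apply]
    obtain ⟨K, hK⟩ := h φ
    exact le_ciSup (f := fun i => q i φ) ⟨K, by rintro _ ⟨j, rfl⟩; exact hK j⟩ i
  exact h2.trans h1

/-! ### Density of compactly supported test functions -/

theorem exists_smooth_cutoff : ∃ χ : R3 → ℂ, ContDiff ℝ ((⊤ : ℕ∞) : WithTop ℕ∞) χ ∧
    HasCompactSupport χ ∧ (∀ x, ‖x‖ ≤ 1 → χ x = 1) ∧ (∀ x, ‖χ x‖ ≤ 1) := by
  let b : ContDiffBump (0 : R3) := ⟨1, 2, one_pos, one_lt_two⟩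
  refine ⟨fun x => ((b x : ℝ) : ℂ), ?_, ?_, ?_, ?_⟩
  · exact Complex.ofRealCLM.contDiff.comp b.contDiff
  · exact b.hasCompactSupport.comp_left (g := fun r : ℝ => (r : ℂ)) Complex.ofReal_zero
  · intro x hx
    have : b x = 1 := b.one_of_mem_closedBall (by simpa using hx)
    simp [this]
  · intro x
    rw [Complex.norm_real, Real.norm_of_nonneg b.nonneg]
    exact b.le_one

/-- Multiply by `χ(x/(m+1))`. The error vanishes for `‖x‖ < m+1`, and elsewhere one additional power
of `‖x‖` in the seminorm pays for a factor `1/(m+1)`. The bound by `‖φ x‖` is there for dominated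
convergence. -/
theorem SchwartzMap.exists_tendsto_hasCompactSupport (φ : 𝓢(R3, ℂ)) :
    ∃ u : ℕ → 𝓢(R3, ℂ), (∀ m, HasCompactSupport (u m)) ∧
      Filter.Tendsto u Filter.atTop (nhds φ) ∧ (∀ m x, ‖u m x‖ ≤ ‖φ x‖) := by
  obtain ⟨χ, hχ, hc, h1, hb⟩ := exists_smooth_cutoff
  let L : ℕ → R3 →L[ℝ] R3 := fun m => ((m : ℝ) + 1)⁻¹ • ContinuousLinearMap.id ℝ R3
  have hLn : ∀ m, ‖L m‖ ≤ 1 := fun m => by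
    refine (norm_smul_le (((m : ℝ) + 1)⁻¹) (ContinuousLinearMap.id ℝ R3)).trans ?_
    have h2 : ‖((m : ℝ) + 1)⁻¹‖ ≤ 1 := by
      rw [Real.norm_of_nonneg (by positivity)]
      exact inv_le_one_of_one_le₀ (by linarith [Nat.cast_nonneg (α := ℝ) m])
    exact mul_le_one₀ h2 (norm_nonneg _) ContinuousLinearMap.norm_id_le
  have hLx : ∀ m x, L m x = ((m : ℝ) + 1)⁻¹ • x := fun m x => rfl
  have hsm : ∀ m, ContDiff ℝ ((⊤ : ℕ∞) : WithTop ℕ∞) (fun x => χ (L m x) * φ x) := fun m =>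
    (hχ.comp (L m).contDiff).mul (φ.smooth ⊤)
  have hcm : ∀ m, HasCompactSupport (fun x => χ (L m x) * φ x) := fun m => by
    have hne : ((m : ℝ) + 1)⁻¹ ≠ 0 := by positivity
    have h3 : HasCompactSupport (fun x => χ (L m x)) :=
      hc.comp_homeomorph (Homeomorph.smulOfNeZero _ hne)
    exact h3.mul_right
  refine ⟨fun m => (hcm m).toSchwartzMap (hsm m), fun m => hcm m, ?_, ?_⟩
  swap
  · intro m x
    change ‖χ (L m x) * φ x‖ ≤ _
    rw [norm_mul]
    exact mul_le_of_le_one_left (norm_nonneg _) (hb _)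
  set ψ : R3 → ℂ := fun x => χ x - 1 with hψ
  have hψs : ContDiff ℝ ((⊤ : ℕ∞) : WithTop ℕ∞) ψ := hχ.sub contDiff_const
  have hψb : ∀ i : ℕ, ∃ M, 0 ≤ M ∧ ∀ x, ‖iteratedFDeriv ℝ i ψ x‖ ≤ M := by
    intro i
    have hcont : Continuous (iteratedFDeriv ℝ i χ) :=
      hχ.continuous_iteratedFDeriv (by exact_mod_cast le_top)
    obtain ⟨M, hM⟩ := hcont.bounded_above_of_compact_support (hc.iteratedFDeriv i)
    refine ⟨M + 1, by linarith [norm_nonneg (iteratedFDeriv ℝ i χ 0), hM 0], fun x => ?_⟩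
    have h4 : iteratedFDeriv ℝ i ψ x = iteratedFDeriv ℝ i χ x -
        iteratedFDeriv ℝ i (fun _ : R3 => (1 : ℂ)) x :=
      iteratedFDeriv_sub_apply (hχ.of_le (by exact_mod_cast le_top)).contDiffAt
        contDiff_const.contDiffAt
    rw [h4]
    refine (norm_sub_le _ _).trans (add_le_add (hM x) ?_)
    rcases Nat.eq_zero_or_pos i with rfl | hi
    · simp
    · rw [iteratedFDeriv_const_of_ne hi.ne']
      simp
  choose M hM0 hM using hψb
  rw [(schwartz_withSeminorms ℝ R3 ℂ).tendsto_nhds_atTop]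
  rintro ⟨k, n⟩ ε hε
  set S := ∑ i ∈ Finset.range (n + 1), (n.choose i : ℝ) * M i *
    SchwartzMap.seminorm ℝ (k + 1) (n - i) φ with hS
  have hS0 : 0 ≤ S := Finset.sum_nonneg fun i _ =>
    mul_nonneg (mul_nonneg (Nat.cast_nonneg _) (hM0 i)) (apply_nonneg _ _)
  obtain ⟨m₀, hm₀⟩ := exists_nat_gt (S / ε)
  refine ⟨m₀, fun m hm => ?_⟩
  have hmS : S / ((m : ℝ) + 1) < ε := by
    rw [div_lt_iff₀ (by positivity)]
    rw [div_lt_iff₀ hε] at hm₀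
    have : (m₀ : ℝ) ≤ m := by exact_mod_cast hm
    nlinarith
  refine lt_of_le_of_lt (SchwartzMap.seminorm_le_bound ℝ k n _ (M := S / ((m : ℝ) + 1))
    (by positivity) fun x => ?_) hmS
  have hfun : (((hcm m).toSchwartzMap (hsm m) - φ : 𝓢(R3, ℂ)) : R3 → ℂ) =
      fun x => (ψ ∘ L m) x * φ x := by
    ext x
    change χ (L m x) * φ x - φ x = (χ (L m x) - 1) * φ x
    ring
  rw [hfun]
  have hψL : ∀ i x, ‖iteratedFDeriv ℝ i (ψ ∘ L m) x‖ ≤ M i := by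
    intro i x
    rw [(L m).iteratedFDeriv_comp_right hψs x (by exact_mod_cast le_top)]
    refine (ContinuousMultilinearMap.norm_compContinuousLinearMap_le _ _).trans ?_
    refine (mul_le_mul (hM i _) (Finset.prod_le_one (fun _ _ => norm_nonneg _)
      fun _ _ => hLn m) (Finset.prod_nonneg fun _ _ => norm_nonneg _) (hM0 i)).trans ?_
    rw [mul_one]
  have hm1 : (0 : ℝ) < (m : ℝ) + 1 := by positivity
  by_cases hx : ‖x‖ < (m : ℝ) + 1
  · have hev : Filter.EventuallyEq (nhds x) (fun x => (ψ ∘ L m) x * φ x) fun _ => 0 := by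
      filter_upwards [(isOpen_lt continuous_norm continuous_const).mem_nhds hx] with y hy
      have hy' : ‖y‖ < (m : ℝ) + 1 := hy
      have : χ (L m y) = 1 := by
        apply h1
        rw [hLx, norm_smul, norm_inv, Real.norm_of_nonneg hm1.le, inv_mul_le_iff₀ hm1]
        linarith
      simp [hψ, this]
    rw [(hev.iteratedFDeriv ℝ n).eq_of_nhds]
    have : iteratedFDeriv ℝ n (fun _ : R3 => (0 : ℂ)) x = 0 := by
      rw [iteratedFDeriv_fun_zero]; rfl
    rw [this, norm_zero, mul_zero]
    positivity
  · rw [not_lt] at hx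
    have h5 := norm_iteratedFDeriv_mul_le (n := n) (hψs.comp (L m).contDiff) (φ.smooth ⊤) x
      (by exact_mod_cast le_top)
    rw [le_div_iff₀ hm1]
    calc ‖x‖ ^ k * ‖iteratedFDeriv ℝ n (fun x => (ψ ∘ L m) x * φ x) x‖ * ((m : ℝ) + 1)
        ≤ ‖x‖ ^ k * (∑ i ∈ Finset.range (n + 1), (n.choose i : ℝ) *
          ‖iteratedFDeriv ℝ i (ψ ∘ L m) x‖ * ‖iteratedFDeriv ℝ (n - i) φ x‖) * ‖x‖ := by
          gcongr
      _ = ∑ i ∈ Finset.range (n + 1), (n.choose i : ℝ) *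
          ‖iteratedFDeriv ℝ i (ψ ∘ L m) x‖ *
            (‖x‖ ^ (k + 1) * ‖iteratedFDeriv ℝ (n - i) φ x‖) := by
          rw [Finset.mul_sum, Finset.sum_mul]
          refine Finset.sum_congr rfl fun i _ => ?_
          ring
      _ ≤ S := by
          rw [hS]
          gcongr with i hi
          · exact mul_nonneg (Nat.cast_nonneg _) (hM0 i)
          · exact hψL i x
          · exact SchwartzMap.le_seminorm ℝ (k + 1) (n - i) φ x

/-- The solution formula is obtained for compactly supported tests only. Once the function in it is
known to lie in some `L^r`, this lemma extends it to all Schwartz functions. -/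
theorem represents_of_hasCompactSupport {r : ℝ≥0∞} (hr : 1 ≤ r) {T : TDist} {h : R3 → ℂ}
    (hh : MemLp h r)
    (hT : ∀ φ : 𝓢(R3, ℂ), HasCompactSupport φ → T φ = ∫ x, φ x * h x) : Represents T h := by
  intro φ
  obtain ⟨u, hu, hlim, hb⟩ := φ.exists_tendsto_hasCompactSupport
  have h1 : Filter.Tendsto (fun m => T (u m)) Filter.atTop (nhds (T φ)) :=
    (T.continuous.tendsto φ).comp hlim
  have h2 : Filter.Tendsto (fun m => ∫ x, u m x * h x) Filter.atTop
      (nhds (∫ x, φ x * h x)) := by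
    refine tendsto_integral_of_dominated_convergence (fun x => ‖φ x * h x‖) (fun m => ?_)
      (φ.integrable_mul_memLp hr hh).norm (fun m => ?_) ?_
    · exact ((u m).integrable_mul_memLp hr hh).1
    · refine Filter.Eventually.of_forall fun x => ?_
      rw [norm_mul, norm_mul]
      gcongr
      exact hb m x
    · refine Filter.Eventually.of_forall fun x => ?_
      have h3 : Continuous fun f : 𝓢(R3, ℂ) => f x :=
        (TemperedDistribution.delta x : 𝓢'(R3, ℂ)).continuous
      exact ((h3.tendsto φ).comp hlim).mul_const _
  refine tendsto_nhds_unique h1 (h2.congr fun m => ?_)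
  rw [hT (u m) (hu m)]

/-! ### Iterated matrix multiplication operators on test functions -/

section Symbol

variable {ι : Type*} [Fintype ι]

/-- The transpose of the matrix of multiplication operators with symbols `a`. -/
noncomputable def symbolOp (a : ι → ι → R3 → ℂ) (ψ : ι → 𝓢(R3, ℂ)) : ι → 𝓢(R3, ℂ) := fun j =>
  ∑ i, SchwartzMap.smulLeftCLM ℂ (a i j) (ψ i)

/-- The value at `x` of a matrix symbol, as a linear map. -/
noncomputable def symbolMap (a : ι → ι → R3 → ℂ) (x : R3) : (ι → ℂ) →L[ℂ] (ι → ℂ) :=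
  LinearMap.toContinuousLinearMap (Matrix.mulVecLin (Matrix.of fun i j => a i j x))

variable {a : ι → ι → R3 → ℂ}

theorem symbolMap_apply (x : R3) (v : ι → ℂ) (i : ι) :
    symbolMap a x v i = ∑ j, a i j x * v j := by
  simp [symbolMap, Matrix.mulVec, dotProduct]

theorem symbolOp_apply (ha : ∀ i j, (a i j).HasTemperateGrowth) (ψ : ι → 𝓢(R3, ℂ)) (j : ι)
    (x : R3) : symbolOp a ψ j x = ∑ i, a i j x * ψ i x := by
  rw [symbolOp, sum_apply]
  refine Finset.sum_congr rfl fun i _ => ?_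
  rw [SchwartzMap.smulLeftCLM_apply_apply (ha i j), smul_eq_mul]

/-- Applying the transposed operator `n` times to the tests is the same as applying the `n`-th power
of the matrix to the vector. This turns a Taylor series in the tests into the exponential series of
the symbol. -/
theorem sum_symbolOp_iterate_mul (ha : ∀ i j, (a i j).HasTemperateGrowth) (n : ℕ)
    (ψ : ι → 𝓢(R3, ℂ)) (x : R3) (v : ι → ℂ) :
    ∑ j, ((symbolOp a)^[n] ψ) j x * v j = ∑ i, ψ i x * ((symbolMap a x) ^ n) v i := by
  induction n generalizing ψ with
  | zero => simp
  | succ n ih =>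
    rw [Function.iterate_succ_apply, ih, pow_succ']
    simp only [symbolOp_apply ha, mul_apply_eq_comp, symbolMap_apply, Finset.sum_mul,
      Finset.mul_sum]
    rw [Finset.sum_comm]
    refine Finset.sum_congr rfl fun i _ => Finset.sum_congr rfl fun j _ => ?_
    ring

theorem symbolOp_iterate_eq_zero (ha : ∀ i j, (a i j).HasTemperateGrowth) {R : ℝ}
    {ψ : ι → 𝓢(R3, ℂ)} (hψ : ∀ i x, R < ‖x‖ → ψ i x = 0) (n : ℕ) (i : ι) {x : R3} (hx : R < ‖x‖) :
    ((symbolOp a)^[n] ψ) i x = 0 := by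
  induction n generalizing ψ with
  | zero => exact hψ i x hx
  | succ n ih =>
    rw [Function.iterate_succ_apply]
    refine ih fun j y hy => ?_
    rw [symbolOp_apply ha]
    exact Finset.sum_eq_zero fun i _ => by rw [hψ i y hy, mul_zero]

theorem norm_iteratedFDeriv_symbolOp_le (ha : ∀ i j, (a i j).HasTemperateGrowth) {M : ℕ} {x : R3}
    {A Q : ℝ} (hA : 0 ≤ A) (hAa : ∀ i j, ∀ l ≤ M, ‖iteratedFDeriv ℝ l (a i j) x‖ ≤ A)
    {ψ : ι → 𝓢(R3, ℂ)} (hQ : ∀ i, ∀ l ≤ M, ‖iteratedFDeriv ℝ l (ψ i) x‖ ≤ Q) (j : ι) {l : ℕ}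
    (hl : l ≤ M) :
    ‖iteratedFDeriv ℝ l (symbolOp a ψ j) x‖ ≤ Fintype.card ι * 2 ^ M * A * Q := by
  have hQ0 : 0 ≤ Q := (norm_nonneg _).trans (hQ j 0 (Nat.zero_le _))
  have hsm : ∀ i, ContDiff ℝ ((⊤ : ℕ∞) : WithTop ℕ∞) (fun y => a i j y * ψ i y) := fun i =>
    (ha i j).1.mul ((ψ i).smooth ⊤)
  have hfun : (symbolOp a ψ j : R3 → ℂ) = ∑ i, fun y => a i j y * ψ i y := by
    ext y
    rw [symbolOp_apply ha, Finset.sum_apply]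
  rw [hfun, iteratedFDeriv_sum_apply fun i _ =>
    ((hsm i).of_le (by exact_mod_cast le_top)).contDiffAt]
  refine (norm_sum_le _ _).trans ?_
  have hterm : ∀ i ∈ Finset.univ, ‖iteratedFDeriv ℝ l (fun y => a i j y * ψ i y) x‖ ≤
      2 ^ M * A * Q := by
    intro i _
    refine (norm_iteratedFDeriv_mul_le (n := l) (ha i j).1 ((ψ i).smooth ⊤) x
      (by exact_mod_cast le_top)).trans ?_
    calc ∑ m ∈ Finset.range (l + 1), (l.choose m : ℝ) * ‖iteratedFDeriv ℝ m (a i j) x‖ *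
          ‖iteratedFDeriv ℝ (l - m) (ψ i) x‖
        ≤ ∑ m ∈ Finset.range (l + 1), (l.choose m : ℝ) * A * Q := by
          gcongr with m hm
          · exact hAa i j m ((Nat.lt_succ_iff.1 (Finset.mem_range.1 hm)).trans hl)
          · exact hQ i _ ((Nat.sub_le _ _).trans hl)
      _ = 2 ^ l * A * Q := by
          rw [← Finset.sum_mul, ← Finset.sum_mul, ← Nat.cast_sum, Nat.sum_range_choose]
          push_cast; ring
      _ ≤ 2 ^ M * A * Q := by
          gcongr
          exact one_le_two
  refine (Finset.sum_le_sum hterm).trans (le_of_eq ?_)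
  rw [Finset.sum_const, nsmul_eq_mul, Finset.card_univ]
  ring

/-- On a ball the derivatives of the symbols up to order `M` are bounded, and multiplication by a
symbol needs no derivative of the test function beyond those being estimated. By Leibniz each
application costs the same factor `K`, so the growth is geometric and not factorial. -/
theorem exists_iteratedFDeriv_symbolOp_iterate_bound (ha : ∀ i j, (a i j).HasTemperateGrowth)
    (R : ℝ) (M : ℕ) (ψ : ι → 𝓢(R3, ℂ)) :
    ∃ K Q : ℝ, 0 ≤ K ∧ 0 ≤ Q ∧ ∀ (n : ℕ) (i : ι) (l : ℕ), l ≤ M → ∀ x : R3, ‖x‖ ≤ R →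
      ‖iteratedFDeriv ℝ l ((symbolOp a)^[n] ψ i) x‖ ≤ Q * K ^ n := by
  have hex : ∃ A, 0 ≤ A ∧ ∀ x : R3, ‖x‖ ≤ R → ∀ i j, ∀ l ≤ M,
      ‖iteratedFDeriv ℝ l (a i j) x‖ ≤ A := by
    have h1 : ∀ p : ι × ι × ℕ, ∃ A, 0 ≤ A ∧ ∀ x : R3, ‖x‖ ≤ R →
        ‖iteratedFDeriv ℝ p.2.2 (a p.1 p.2.1) x‖ ≤ A := by
      rintro ⟨i, j, l⟩
      have hcont : Continuous (iteratedFDeriv ℝ l (a i j)) :=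
        (ha i j).1.continuous_iteratedFDeriv (by exact_mod_cast le_top)
      obtain ⟨A, hA⟩ := (isCompact_closedBall (0 : R3) R).exists_bound_of_continuousOn
        hcont.continuousOn
      exact ⟨max A 0, le_max_right _ _, fun x hx =>
        (hA x (by simpa using hx)).trans (le_max_left _ _)⟩
    choose A hA0 hA using h1
    refine ⟨∑ i, ∑ j, ∑ l ∈ Finset.range (M + 1), A (i, j, l), ?_, ?_⟩
    · exact Finset.sum_nonneg fun i _ => Finset.sum_nonneg fun j _ =>
        Finset.sum_nonneg fun l _ => hA0 _
    · intro x hx i j l hl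
      refine (hA (i, j, l) x hx).trans ?_
      refine le_trans ?_ (Finset.single_le_sum (f := fun i => ∑ j, ∑ l ∈ Finset.range (M + 1),
        A (i, j, l)) (fun i _ => Finset.sum_nonneg fun j _ =>
        Finset.sum_nonneg fun l _ => hA0 _) (Finset.mem_univ i))
      refine le_trans ?_ (Finset.single_le_sum (f := fun j => ∑ l ∈ Finset.range (M + 1),
        A (i, j, l)) (fun j _ => Finset.sum_nonneg fun l _ => hA0 _) (Finset.mem_univ j))
      exact Finset.single_le_sum (f := fun l => A (i, j, l)) (fun l _ => hA0 _)
        (Finset.mem_range.2 (Nat.lt_succ_of_le hl))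
  obtain ⟨A, hA0, hA⟩ := hex
  set Q := ∑ i, ∑ l ∈ Finset.range (M + 1), SchwartzMap.seminorm ℝ 0 l (ψ i) with hQ
  have hQi : ∀ i, ∀ l ≤ M, ∀ x, ‖iteratedFDeriv ℝ l (ψ i) x‖ ≤ Q := by
    intro i l hl x
    refine (SchwartzMap.norm_iteratedFDeriv_le_seminorm ℝ (ψ i) l x).trans ?_
    refine le_trans ?_ (Finset.single_le_sum (f := fun i => ∑ l ∈ Finset.range (M + 1),
      SchwartzMap.seminorm ℝ 0 l (ψ i)) (fun i _ => Finset.sum_nonneg fun l _ =>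
      apply_nonneg _ _) (Finset.mem_univ i))
    exact Finset.single_le_sum (f := fun l => SchwartzMap.seminorm ℝ 0 l (ψ i))
      (fun l _ => apply_nonneg _ _) (Finset.mem_range.2 (Nat.lt_succ_of_le hl))
  refine ⟨Fintype.card ι * 2 ^ M * A, Q, by positivity, Finset.sum_nonneg fun i _ =>
    Finset.sum_nonneg fun l _ => apply_nonneg _ _, fun n => ?_⟩
  induction n with
  | zero => intro i l hl x _; simpa using hQi i l hl x
  | succ n ih =>
    intro i l hl x hx
    rw [Function.iterate_succ_apply']
    refine (norm_iteratedFDeriv_symbolOp_le ha hA0 (fun i j l hl => hA x hx i j l hl)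
      (fun i l hl => ih i l hl x hx) i hl).trans (le_of_eq ?_)
    ring

/-- The iterates stay supported in the ball of radius `R`, where the weights are bounded, so the
local derivative bounds control full Schwartz seminorms. -/
theorem exists_seminorm_symbolOp_iterate_bound (ha : ∀ i j, (a i j).HasTemperateGrowth)
    {R : ℝ} {ψ : ι → 𝓢(R3, ℂ)} (hψ : ∀ i x, R < ‖x‖ → ψ i x = 0) (s : Finset (ℕ × ℕ)) :
    ∃ K Q : ℝ, 0 ≤ K ∧ 0 ≤ Q ∧ ∀ (n : ℕ) (i : ι),
      (s.sup (schwartzSeminormFamily ℂ R3 ℂ)) ((symbolOp a)^[n] ψ i) ≤ Q * K ^ n := by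
  obtain ⟨K, Q, hK, hQ, hb⟩ := exists_iteratedFDeriv_symbolOp_iterate_bound ha R
    (s.sup Prod.snd) ψ
  refine ⟨K, (max R 1) ^ (s.sup Prod.fst) * Q, hK, by positivity, fun n i => ?_⟩
  refine Seminorm.finset_sup_apply_le (by positivity) ?_
  rintro ⟨k, l⟩ hkl
  refine SchwartzMap.seminorm_le_bound ℂ k l _ (by positivity) fun x => ?_
  have hl : l ≤ s.sup Prod.snd := Finset.le_sup (f := Prod.snd) hkl
  have hk : k ≤ s.sup Prod.fst := Finset.le_sup (f := Prod.fst) hkl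
  by_cases hx : ‖x‖ ≤ R
  · have h1 : ‖x‖ ^ k ≤ (max R 1) ^ (s.sup Prod.fst) :=
      (pow_le_pow_left₀ (norm_nonneg _) (hx.trans (le_max_left _ _)) k).trans
        (pow_le_pow_right₀ (le_max_right _ _) hk)
    rw [mul_assoc]
    exact mul_le_mul h1 (hb n i l hl x hx) (norm_nonneg _) (by positivity)
  · have h2 : x ∉ tsupport ((symbolOp a)^[n] ψ i) := by
      have h3 : tsupport ((symbolOp a)^[n] ψ i) ⊆ Metric.closedBall (0 : R3) R := by
        refine closure_minimal (fun y hy => ?_) Metric.isClosed_closedBall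
        by_contra hcon
        rw [mem_closedBall_zero_iff, not_le] at hcon
        exact hy (symbolOp_iterate_eq_zero ha hψ n i hcon)
      intro h4
      exact hx (by simpa using h3 h4)
    have h5 : iteratedFDeriv ℝ l ((symbolOp a)^[n] ψ i) x = 0 := by
      by_contra hcon
      exact h2 (support_iteratedFDeriv_subset l hcon)
    rw [h5, norm_zero, mul_zero]
    positivity

end Symbol

/-! ### Weak flows are given by the exponential of the symbol -/

section Flow

variable {ι : Type*} [Fintype ι] {a : ι → ι → R3 → ℂ} {V : ℝ → ι → TDist}

/-- `V` is a weak solution, for `t > 0`, of the linear system `∂_t V_i = ∑ j, a_ij V_j` with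
multiplication operators as coefficients, and is weakly continuous at `t = 0`. -/
structure IsSymbolFlow (a : ι → ι → R3 → ℂ) (V : ℝ → ι → TDist) : Prop where
  hasDerivAt : ∀ t, 0 < t → ∀ i (φ : 𝓢(R3, ℂ)), HasDerivAt (fun τ => V τ i φ)
    (∑ j, V t j (SchwartzMap.smulLeftCLM ℂ (a i j) φ)) t
  continuousWithinAt : ∀ i (φ : 𝓢(R3, ℂ)),
    ContinuousWithinAt (fun τ => V τ i φ) (Set.Ici 0) 0

namespace IsSymbolFlow

theorem continuousOn_apply (hV : IsSymbolFlow a V) (i : ι) (φ : 𝓢(R3, ℂ)) :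
    ContinuousOn (fun τ => V τ i φ) (Set.Ici 0) := by
  intro t ht
  rcases (Set.mem_Ici.1 ht).eq_or_lt with rfl | h0
  · exact hV.continuousWithinAt i φ
  · exact (hV.hasDerivAt t h0 i φ).continuousAt.continuousWithinAt

theorem continuousOn_sum (hV : IsSymbolFlow a V) (ψ : ι → 𝓢(R3, ℂ)) :
    ContinuousOn (fun τ => ∑ i, V τ i (ψ i)) (Set.Ici 0) :=
  continuousOn_finsetSum _ fun i _ => hV.continuousOn_apply i (ψ i)

theorem hasDerivAt_sum (hV : IsSymbolFlow a V) (ψ : ι → 𝓢(R3, ℂ)) {t : ℝ} (ht : 0 < t) :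
    HasDerivAt (fun τ => ∑ i, V τ i (ψ i)) (∑ i, V t i (symbolOp a ψ i)) t := by
  have h1 : HasDerivAt (fun τ => ∑ i, V τ i (ψ i))
      (∑ i, ∑ j, V t j (SchwartzMap.smulLeftCLM ℂ (a i j) (ψ i))) t :=
    HasDerivAt.fun_sum fun i _ => hV.hasDerivAt t ht i (ψ i)
  rw [Finset.sum_comm] at h1
  have h2 : ∑ i, V t i (symbolOp a ψ i) =
      ∑ j, ∑ i, V t j (SchwartzMap.smulLeftCLM ℂ (a i j) (ψ i)) :=
    Finset.sum_congr rfl fun j _ => map_sum (V t j) _ _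
  rwa [h2]

/-- At `t = 0` only continuity is part of the definition. The right derivative exists there because
the derivative for `t > 0` is itself a pairing with the flow, hence has a limit as `t → 0`. -/
theorem hasDerivWithinAt_sum (hV : IsSymbolFlow a V) (ψ : ι → 𝓢(R3, ℂ)) {t : ℝ} (ht : 0 ≤ t) :
    HasDerivWithinAt (fun τ => ∑ i, V τ i (ψ i)) (∑ i, V t i (symbolOp a ψ i)) (Set.Ici t) t := by
  rcases ht.eq_or_lt with rfl | h0
  · refine hasDerivWithinAt_Ici_of_tendsto_deriv (s := Set.Ioi 0) ?_ ?_ self_mem_nhdsWithin ?_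
    · exact fun t ht => (hV.hasDerivAt_sum ψ ht).differentiableAt.differentiableWithinAt
    · exact ((hV.continuousOn_sum ψ) 0 Set.self_mem_Ici).mono Set.Ioi_subset_Ici_self
    · have h1 : Filter.Tendsto (fun τ => ∑ i, V τ i (symbolOp a ψ i)) (nhdsWithin 0 (Set.Ioi 0))
          (nhds (∑ i, V 0 i (symbolOp a ψ i))) :=
        ((hV.continuousOn_sum (symbolOp a ψ)) 0 Set.self_mem_Ici).mono Set.Ioi_subset_Ici_self
      refine h1.congr' ?_
      filter_upwards [self_mem_nhdsWithin] with t ht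
      exact (hV.hasDerivAt_sum ψ ht).deriv.symm
  · exact (hV.hasDerivAt_sum ψ h0).hasDerivWithinAt

/-- Induction on the order: the time derivative of the remainder of order `N + 1` for `ψ` is the
remainder of order `N` for `symbolOp a ψ`. Integrating its bound raises `t^N/N!` to the next term.
-/
theorem norm_sub_taylor_le (hV : IsSymbolFlow a V) {T : ℝ} {B : (ι → 𝓢(R3, ℂ)) → ℝ}
    (hB : ∀ ψ, ∀ t ∈ Set.Icc 0 T, ‖∑ i, V t i (ψ i)‖ ≤ B ψ) (N : ℕ) (ψ : ι → 𝓢(R3, ℂ)) {t : ℝ}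
    (ht : t ∈ Set.Icc 0 T) :
    ‖∑ i, V t i (ψ i) - ∑ n ∈ Finset.range N, ((t ^ n / n.factorial : ℝ) : ℂ) *
      ∑ i, V 0 i ((symbolOp a)^[n] ψ i)‖ ≤ B ((symbolOp a)^[N] ψ) * (t ^ N / N.factorial) := by
  induction N generalizing ψ t with
  | zero => simpa using hB ψ t ht
  | succ N ih =>
    have hpow : ∀ (n : ℕ) (t : ℝ), HasDerivAt (fun τ : ℝ => τ ^ (n + 1) / (n + 1).factorial)
        (t ^ n / n.factorial) t := by
      intro n t
      have h1 := (hasDerivAt_pow (n + 1) t).div_const ((n + 1).factorial : ℝ)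
      have h2 : ((n + 1 : ℕ) : ℝ) * t ^ (n + 1 - 1) / ((n + 1).factorial : ℝ) =
          t ^ n / n.factorial := by
        rw [Nat.factorial_succ]
        push_cast
        have : (n.factorial : ℝ) ≠ 0 := by positivity
        field_simp
      rwa [h2] at h1
    have hfun : ∀ τ : ℝ, ∑ n ∈ Finset.range (N + 1), ((τ ^ n / n.factorial : ℝ) : ℂ) *
        ∑ i, V 0 i ((symbolOp a)^[n] ψ i) = ∑ i, V 0 i (ψ i) +
        ∑ n ∈ Finset.range N, ((τ ^ (n + 1) / (n + 1).factorial : ℝ) : ℂ) *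
        ∑ i, V 0 i ((symbolOp a)^[n] (symbolOp a ψ) i) := by
      intro τ
      rw [Finset.sum_range_succ', add_comm]
      simp
    have hder : ∀ τ ∈ Set.Ico 0 T, HasDerivWithinAt (fun τ => ∑ i, V τ i (ψ i) -
        ∑ n ∈ Finset.range (N + 1), ((τ ^ n / n.factorial : ℝ) : ℂ) *
        ∑ i, V 0 i ((symbolOp a)^[n] ψ i)) (∑ i, V τ i (symbolOp a ψ i) -
        ∑ n ∈ Finset.range N, ((τ ^ n / n.factorial : ℝ) : ℂ) *
        ∑ i, V 0 i ((symbolOp a)^[n] (symbolOp a ψ) i)) (Set.Ici τ) τ := by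
      intro τ hτ
      refine (hV.hasDerivWithinAt_sum ψ hτ.1).sub ?_
      simp_rw [hfun]
      refine HasDerivWithinAt.const_add _ ?_
      refine HasDerivWithinAt.fun_sum fun n _ => ?_
      exact ((hpow n τ).ofReal_comp.mul_const _).hasDerivWithinAt
    refine image_norm_le_of_norm_deriv_right_le_deriv_boundary' (a := 0) (b := T)
      (B := fun τ => B ((symbolOp a)^[N + 1] ψ) * (τ ^ (N + 1) / (N + 1).factorial))
      (B' := fun τ => B ((symbolOp a)^[N + 1] ψ) * (τ ^ N / N.factorial)) ?_ hder ?_ ?_ ?_ ?_ ht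
    · refine ((hV.continuousOn_sum ψ).mono Set.Icc_subset_Ici_self).sub ?_
      fun_prop
    · simp_rw [hfun]
      simp
    · fun_prop
    · exact fun τ _ => ((hpow N τ).const_mul _).hasDerivWithinAt
    · intro τ hτ
      exact ih (symbolOp a ψ) ⟨hτ.1, hτ.2.le⟩

/-- For each test the pairing is continuous, hence bounded, on `[0, T]`. Uniform boundedness
replaces these bounds by a single seminorm. -/
theorem exists_bound (hV : IsSymbolFlow a V) (T : ℝ) :
    ∃ (s : Finset (ℕ × ℕ)) (C : ℝ), 0 ≤ C ∧ ∀ ψ : ι → 𝓢(R3, ℂ), ∀ t ∈ Set.Icc 0 T,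
      ‖∑ i, V t i (ψ i)‖ ≤ C * ∑ i, (s.sup (schwartzSeminormFamily ℂ R3 ℂ)) (ψ i) := by
  obtain ⟨s, C, hC, h⟩ := exists_seminorm_bound_of_pointwise_bounded
    (fun p : ι × Set.Icc 0 T => V p.2 p.1) (fun φ => by
      have h1 : ∀ i, ∃ C, ∀ t ∈ Set.Icc 0 T, ‖V t i φ‖ ≤ C := fun i =>
        isCompact_Icc.exists_bound_of_continuousOn
          ((hV.continuousOn_apply i φ).mono Set.Icc_subset_Ici_self)
      choose C hC using h1
      refine ⟨∑ i, |C i|, ?_⟩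
      rintro ⟨i, t, ht⟩
      exact (hC i t ht).trans ((le_abs_self _).trans (Finset.single_le_sum
        (f := fun i => |C i|) (fun i _ => abs_nonneg _) (Finset.mem_univ i))))
  refine ⟨s, C, hC, fun ψ t ht => (norm_sum_le _ _).trans ?_⟩
  rw [Finset.mul_sum]
  exact Finset.sum_le_sum fun i _ => h (i, ⟨t, ht⟩) (ψ i)

/-- The geometric factor `K^N` from the iterates meets `t^N/N!` from the remainder, and `(Kt)^N/N!`
tends to `0`. -/
theorem tendsto_taylor (hV : IsSymbolFlow a V) (ha : ∀ i j, (a i j).HasTemperateGrowth)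
    {R : ℝ} {ψ : ι → 𝓢(R3, ℂ)} (hψ : ∀ i x, R < ‖x‖ → ψ i x = 0) {t : ℝ} (ht : 0 ≤ t) :
    Filter.Tendsto (fun N => ∑ n ∈ Finset.range N, ((t ^ n / n.factorial : ℝ) : ℂ) *
      ∑ i, V 0 i ((symbolOp a)^[n] ψ i)) Filter.atTop (nhds (∑ i, V t i (ψ i))) := by
  obtain ⟨s, C, hC, hb⟩ := hV.exists_bound t
  obtain ⟨K, Q, hK, hQ, hKQ⟩ := exists_seminorm_symbolOp_iterate_bound ha hψ s
  rw [tendsto_iff_norm_sub_tendsto_zero]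
  have hlim : Filter.Tendsto (fun N : ℕ => C * (Fintype.card ι * Q) *
      ((K * t) ^ N / N.factorial)) Filter.atTop (nhds 0) := by
    simpa using (FloorSemiring.tendsto_pow_div_factorial_atTop (K * t)).const_mul
      (C * (Fintype.card ι * Q))
  refine squeeze_zero (fun _ => norm_nonneg _) (fun N => ?_) hlim
  rw [norm_sub_rev]
  refine (hV.norm_sub_taylor_le hb N ψ ⟨ht, le_rfl⟩).trans ?_
  calc (C * ∑ i, (s.sup (schwartzSeminormFamily ℂ R3 ℂ)) ((symbolOp a)^[N] ψ i)) *
        (t ^ N / N.factorial)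
      ≤ (C * (∑ _i : ι, Q * K ^ N)) * (t ^ N / N.factorial) := by
        gcongr
        exact hKQ N _
    _ = C * (Fintype.card ι * Q) * ((K * t) ^ N / N.factorial) := by
        rw [Finset.sum_const, nsmul_eq_mul, Finset.card_univ, mul_pow]
        ring

theorem tendsto_exp_partial_sum (A : (ι → ℂ) →L[ℂ] (ι → ℂ)) (t : ℝ) (v : ι → ℂ) (i : ι) :
    Filter.Tendsto (fun N => ∑ n ∈ Finset.range N, ((t ^ n / n.factorial : ℝ) : ℂ) *
      (A ^ n) v i) Filter.atTop (nhds (NormedSpace.exp ((t : ℂ) • A) v i)) := by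
  have h1 := (NormedSpace.exp_series_hasSum_exp' (𝕂 := ℂ) ((t : ℂ) • A)).tendsto_sum_nat
  have h2 : Continuous fun L : (ι → ℂ) →L[ℂ] (ι → ℂ) => L v i :=
    (continuous_apply i).comp (ContinuousLinearMap.apply ℂ (ι → ℂ) v).continuous
  refine ((h2.tendsto _).comp h1).congr fun N => ?_
  simp only [Function.comp_apply, sum_apply, Finset.sum_apply]
  refine Finset.sum_congr rfl fun n _ => ?_
  have h3 : ∀ n : ℕ, ((((t : ℂ) • A) ^ n : (ι → ℂ) →L[ℂ] (ι → ℂ))) v =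
      (t : ℂ) ^ n • (A ^ n) v := by
    intro n
    induction n with
    | zero => simp
    | succ n ih =>
      rw [pow_succ', pow_succ' A, mul_apply_eq_comp, mul_apply_eq_comp, ih, map_smul, smul_apply,
        smul_smul, pow_succ]
  rw [smul_apply, h3, Pi.smul_apply, Pi.smul_apply, smul_eq_mul, smul_eq_mul]
  push_cast
  ring

/-- Solutions of a linear system of multiplication operators whose initial values are functions
are given by the pointwise exponential of the symbol. -/
theorem apply_eq_integral_exp [DecidableEq ι] (hV : IsSymbolFlow a V)
    (ha : ∀ i j, (a i j).HasTemperateGrowth) {g : ι → R3 → ℂ} (hg : ∀ i, LocallyIntegrable (g i))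
    (h0 : ∀ i, Represents (V 0 i) (g i)) {t : ℝ} (ht : 0 ≤ t) (i : ι) {φ : 𝓢(R3, ℂ)}
    (hφ : HasCompactSupport φ) :
    V t i φ = ∫ x, φ x * NormedSpace.exp ((t : ℂ) • symbolMap a x) (fun j => g j x) i := by
  obtain ⟨R, hR⟩ := hφ.isCompact.isBounded.subset_closedBall (0 : R3)
  -- The whole system is tested at once. Only slot `i` is occupied initially, while the iterates
  -- fill the other slots.
  set ψ : ι → 𝓢(R3, ℂ) := Pi.single i φ with hψdef
  have hψ : ∀ j x, R < ‖x‖ → ψ j x = 0 := by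
    intro j x hx
    by_cases hj : j = i
    · subst hj
      rw [hψdef, Pi.single_eq_same]
      refine image_eq_zero_of_notMem_tsupport fun hmem => ?_
      have := hR hmem
      rw [mem_closedBall_zero_iff] at this
      linarith
    · rw [hψdef, Pi.single_eq_of_ne hj]; rfl
  have h1 := hV.tendsto_taylor ha hψ ht
  have hsum : ∑ j, V t j (ψ j) = V t i φ := by
    rw [Finset.sum_eq_single i]
    · rw [hψdef, Pi.single_eq_same]
    · intro j _ hj
      rw [hψdef, Pi.single_eq_of_ne hj, map_zero]
    · simp
  rw [hsum] at h1
  obtain ⟨K, Q, hK, hQ, hKQ⟩ := exists_iteratedFDeriv_symbolOp_iterate_bound ha R 0 ψ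
  have hbd : ∀ n j x, ‖(symbolOp a)^[n] ψ j x‖ ≤
      (Metric.closedBall (0 : R3) R).indicator (fun _ => Q * K ^ n) x := by
    intro n j x
    by_cases hx : ‖x‖ ≤ R
    · rw [Set.indicator_of_mem (by simpa using hx)]
      simpa using hKQ n j 0 le_rfl x hx
    · rw [Set.indicator_of_notMem (by simpa using hx),
        symbolOp_iterate_eq_zero ha hψ n j (not_le.1 hx), norm_zero]
  have hint : ∀ n j, Integrable fun x => (symbolOp a)^[n] ψ j x * g j x := by
    intro n j
    have h2 : IntegrableOn (fun x => (symbolOp a)^[n] ψ j x * g j x)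
        (Metric.closedBall (0 : R3) R) := by
      have h3 : IntegrableOn (g j) (Metric.closedBall (0 : R3) R) :=
        (hg j).integrableOn_isCompact (isCompact_closedBall _ _)
      refine Integrable.bdd_mul (c := Q * K ^ n) h3
        ((symbolOp a)^[n] ψ j).continuous.aestronglyMeasurable
        (Filter.Eventually.of_forall fun x => (hbd n j x).trans ?_)
      exact Set.indicator_le_self' (fun _ _ => by positivity) x
    rw [← integrable_indicator_iff Metric.isClosed_closedBall.measurableSet] at h2
    refine h2.congr (Filter.Eventually.of_forall fun x => ?_)
    by_cases hx : ‖x‖ ≤ R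
    · rw [Set.indicator_of_mem (by simpa using hx)]
    · rw [Set.indicator_of_notMem (by simpa using hx)]
      simp only [symbolOp_iterate_eq_zero ha hψ n j (not_le.1 hx), zero_mul]
  have hpart : ∀ N, ∑ n ∈ Finset.range N, ((t ^ n / n.factorial : ℝ) : ℂ) *
      ∑ j, V 0 j ((symbolOp a)^[n] ψ j) = ∫ x, ∑ n ∈ Finset.range N,
      ((t ^ n / n.factorial : ℝ) : ℂ) * ∑ j, (symbolOp a)^[n] ψ j x * g j x := by
    intro N
    rw [integral_finsetSum _ fun n _ => (integrable_finsetSum _ fun j _ => hint n j).const_mul _]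
    refine Finset.sum_congr rfl fun n _ => ?_
    rw [integral_const_mul, integral_finsetSum _ fun j _ => hint n j]
    congr 1
    exact Finset.sum_congr rfl fun j _ => h0 j _
  simp_rw [hpart] at h1
  refine tendsto_nhds_unique h1 ?_
  -- The integrands are supported in a fixed ball and dominated there by `e^{Kt}` times the data, so
  -- local integrability of the data suffices.
  refine tendsto_integral_of_dominated_convergence
    (fun x => (Metric.closedBall (0 : R3) R).indicator
      (fun x => Real.exp (K * t) * Q * ∑ j, ‖g j x‖) x) (fun N => ?_) ?_ (fun N => ?_) ?_
  · exact (integrable_finsetSum _ fun n _ =>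
      (integrable_finsetSum _ fun j _ => hint n j).const_mul _).1
  · rw [integrable_indicator_iff Metric.isClosed_closedBall.measurableSet]
    refine Integrable.const_mul (integrable_finsetSum _ fun j _ => ?_) _
    exact ((hg j).integrableOn_isCompact (isCompact_closedBall _ _)).norm
  · refine Filter.Eventually.of_forall fun x => ?_
    by_cases hx : ‖x‖ ≤ R
    · rw [Set.indicator_of_mem (by simpa using hx)]
      calc ‖∑ n ∈ Finset.range N, ((t ^ n / n.factorial : ℝ) : ℂ) *
            ∑ j, (symbolOp a)^[n] ψ j x * g j x‖
          ≤ ∑ n ∈ Finset.range N, (t ^ n / n.factorial) * ∑ j, (Q * K ^ n) * ‖g j x‖ := by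
            refine (norm_sum_le _ _).trans (Finset.sum_le_sum fun n _ => ?_)
            rw [norm_mul, Complex.norm_real, Real.norm_of_nonneg (by positivity)]
            gcongr
            refine (norm_sum_le _ _).trans (Finset.sum_le_sum fun j _ => ?_)
            rw [norm_mul]
            gcongr
            have := hbd n j x
            rwa [Set.indicator_of_mem (by simpa using hx)] at this
        _ = (∑ n ∈ Finset.range N, (K * t) ^ n / n.factorial) * Q * ∑ j, ‖g j x‖ := by
            rw [Finset.sum_mul, Finset.sum_mul]
            refine Finset.sum_congr rfl fun n _ => ?_
            rw [← Finset.mul_sum, mul_pow]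
            ring
        _ ≤ _ := by
            gcongr
            exact Real.sum_le_exp_of_nonneg (by positivity) N
    · rw [Set.indicator_of_notMem (by simpa using hx)]
      refine le_of_eq (norm_eq_zero.2 (Finset.sum_eq_zero fun n _ => ?_))
      rw [Finset.sum_eq_zero fun j _ => ?_, mul_zero]
      rw [symbolOp_iterate_eq_zero ha hψ n j (not_le.1 hx), zero_mul]
  · refine Filter.Eventually.of_forall fun x => ?_
    have h4 := (tendsto_exp_partial_sum (symbolMap a x) t (fun j => g j x) i).const_mul (φ x)
    refine h4.congr fun N => ?_
    rw [Finset.mul_sum]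
    refine Finset.sum_congr rfl fun n _ => ?_
    rw [sum_symbolOp_iterate_mul ha, Finset.sum_eq_single i]
    · rw [hψdef, Pi.single_eq_same]
      ring
    · intro j _ hj
      rw [hψdef, Pi.single_eq_of_ne hj]
      simp
    · simp

end IsSymbolFlow

end Flow

/-! ### Decay estimates for linear ordinary differential equations -/

theorem le_exp_mul_of_deriv_le {L L' : ℝ → ℝ} {c : ℝ} (hL : ∀ t, HasDerivAt L (L' t) t)
    (h : ∀ t, 0 ≤ t → L' t ≤ -(c * L t)) {t : ℝ} (ht : 0 ≤ t) :
    L t ≤ Real.exp (-(c * t)) * L 0 := by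
  have hd : ∀ t, HasDerivAt (fun t => Real.exp (c * t) * L t)
      (Real.exp (c * t) * (c * 1) * L t + Real.exp (c * t) * L' t) t := fun t =>
    (((hasDerivAt_id t).const_mul c).exp).mul (hL t)
  have hanti : AntitoneOn (fun t => Real.exp (c * t) * L t) (Set.Ici 0) := by
    refine antitoneOn_of_deriv_nonpos (convex_Ici 0)
      (fun t _ => (hd t).continuousAt.continuousWithinAt)
      (fun t _ => (hd t).differentiableAt.differentiableWithinAt) fun t ht => ?_
    rw [interior_Ici, Set.mem_Ioi] at ht
    rw [(hd t).deriv]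
    have h1 := h t ht.le
    have h2 := Real.exp_pos (c * t)
    nlinarith
  have h3 := hanti (Set.self_mem_Ici) (Set.mem_Ici.2 ht) ht
  simp only [mul_zero, Real.exp_zero, one_mul] at h3
  rw [Real.exp_neg, ← div_eq_inv_mul, le_div_iff₀ (Real.exp_pos _)]
  linarith

/-- The function `e^{ct} x` has damping `l - c ≥ l/2` and forcing at most `K`. Both `±e^{ct} x`
therefore stay below the initial size plus the equilibrium value `K/(l-c) ≤ 2K/l`. -/
theorem abs_le_of_deriv_eq_neg_mul_add {x h : ℝ → ℝ} {l c K : ℝ} (hl : 0 < l) (hc : 2 * c ≤ l)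
    (hx : ∀ t, HasDerivAt x (-(l * x t) + h t) t)
    (hh : ∀ t, 0 ≤ t → |h t| ≤ K * Real.exp (-(c * t))) {t : ℝ} (ht : 0 ≤ t) :
    |x t| ≤ Real.exp (-(c * t)) * (|x 0| + 2 * K / l) := by
  have hK : 0 ≤ K := by
    have := (abs_nonneg _).trans (hh 0 le_rfl)
    simpa using this
  have hlc : 0 < l - c := by
    rcases le_or_gt c 0 with h0 | h0 <;> linarith
  have hd : ∀ t, HasDerivAt (fun t => Real.exp (c * t) * x t)
      (Real.exp (c * t) * (c * 1) * x t + Real.exp (c * t) * (-(l * x t) + h t)) t := fun t =>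
    (((hasDerivAt_id t).const_mul c).exp).mul (hx t)
  have hy : ∀ t, 0 ≤ t → |Real.exp (c * t) * h t| ≤ K := by
    intro t ht
    rw [abs_mul, abs_of_pos (Real.exp_pos _)]
    calc Real.exp (c * t) * |h t| ≤ Real.exp (c * t) * (K * Real.exp (-(c * t))) := by
          gcongr; exact hh t ht
      _ = K := by rw [mul_left_comm, ← Real.exp_add]; simp
  have key : ∀ σ : ℝ, (σ = 1 ∨ σ = -1) → σ * (Real.exp (c * t) * x t) ≤ |x 0| + 2 * K / l := by
    intro σ hσ
    have h1 : ∀ t, HasDerivAt (fun t => σ * (Real.exp (c * t) * x t) - K / (l - c))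
        (σ * (Real.exp (c * t) * (c * 1) * x t + Real.exp (c * t) * (-(l * x t) + h t))) t :=
      fun t => ((hd t).const_mul σ).sub_const _
    have h2 := le_exp_mul_of_deriv_le (c := l - c) h1 (fun t ht => by
      have h3 : σ * (Real.exp (c * t) * h t) ≤ K := by
        have h4 := abs_le.1 (hy t ht)
        rcases hσ with rfl | rfl
        · linarith
        · linarith
      have h5 : (l - c) * (K / (l - c)) = K := mul_div_cancel₀ _ hlc.ne'
      nlinarith) ht
    simp only [mul_zero, Real.exp_zero, one_mul] at h2
    have h6 : σ * x 0 ≤ |x 0| := by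
      rcases hσ with rfl | rfl
      · rw [one_mul]; exact le_abs_self _
      · rw [neg_one_mul]; exact neg_le_abs _
    have h7 : Real.exp (-((l - c) * t)) ≤ 1 := Real.exp_le_one_iff.2 (by
      have := mul_nonneg hlc.le ht; linarith)
    have h8 : 0 < Real.exp (-((l - c) * t)) := Real.exp_pos _
    have h9 : K / (l - c) ≤ 2 * K / l := by
      rw [div_le_div_iff₀ hlc hl]; nlinarith
    have h10 : 0 ≤ K / (l - c) := div_nonneg hK hlc.le
    have h11 : Real.exp (-((l - c) * t)) * (σ * x 0) ≤ |x 0| :=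
      (mul_le_mul_of_nonneg_left h6 h8.le).trans (mul_le_of_le_one_left (abs_nonneg _) h7)
    nlinarith
  have hfin : |Real.exp (c * t) * x t| ≤ |x 0| + 2 * K / l :=
    abs_le.2 ⟨by linarith [key (-1) (Or.inr rfl)], by linarith [key 1 (Or.inl rfl)]⟩
  rw [abs_mul, abs_of_pos (Real.exp_pos _)] at hfin
  rw [Real.exp_neg, ← div_eq_inv_mul, le_div_iff₀ (Real.exp_pos _)]
  linarith

theorem abs_le_of_sq_le_mul_exp {x M c t : ℝ} (hM : 0 ≤ M)
    (h : x ^ 2 ≤ Real.exp (-(2 * c * t)) * M ^ 2) : |x| ≤ Real.exp (-(c * t)) * M := by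
  have h1 : Real.exp (-(2 * c * t)) = Real.exp (-(c * t)) ^ 2 := by
    rw [← Real.exp_nat_mul]; congr 1; push_cast; ring
  rw [h1, ← mul_pow] at h
  exact abs_le_of_sq_le_sq h (by positivity)

theorem hasDerivAt_re {f : ℝ → ℂ} {f' : ℂ} {t : ℝ} (h : HasDerivAt f f' t) :
    HasDerivAt (fun t => (f t).re) f'.re t :=
  (Complex.reCLM.hasFDerivAt.comp_hasDerivAt t h)

theorem hasDerivAt_im {f : ℝ → ℂ} {f' : ℂ} {t : ℝ} (h : HasDerivAt f f' t) :
    HasDerivAt (fun t => (f t).im) f'.im t :=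
  (Complex.imCLM.hasFDerivAt.comp_hasDerivAt t h)

/-- Decay of a damped oscillator `f'' + T f' + D f = 0`, uniformly from the underdamped to the
overdamped regime. -/
theorem abs_le_of_damped_oscillator {f g : ℝ → ℝ} {T D ρ K : ℝ} (hT : 0 < T) (hD : 0 < D)
    (hρ : 3 * ρ * (D + T ^ 2) ≤ T * D) (hK : 0 < K) (hKD : K ^ 2 ≤ D + T ^ 2)
    (hf : ∀ t, HasDerivAt f (g t) t) (hg : ∀ t, HasDerivAt g (-(T * g t) - D * f t) t)
    {t : ℝ} (ht : 0 ≤ t) :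
    |f t| ≤ Real.exp (-(ρ * t)) * (4 * (|f 0| + |g 0| / K)) := by
  -- Lyapunov functional whose cross term is chosen so that its derivative is exactly `-(T g² + T D
  -- f²)`. It is at most `3/2 g² + (D + T²) f²` and at least `(D + T²) f²/8`, whatever the sign of
  -- the discriminant `T² - 4D`.
  have hder : ∀ t, HasDerivAt (fun t => g t ^ 2 + T * (f t * g t) + (D + T ^ 2 / 2) * f t ^ 2)
      (2 * g t * (-(T * g t) - D * f t) + T * (g t * g t + f t * (-(T * g t) - D * f t)) +
        (D + T ^ 2 / 2) * (2 * f t * g t)) t := by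
    intro t
    refine ((((hg t).pow 2).add (((hf t).mul (hg t)).const_mul T)).add
      (((hf t).pow 2).const_mul (D + T ^ 2 / 2))).congr_deriv ?_
    simp
  have hρT : 3 * ρ ≤ T := by
    rcases le_or_gt ρ 0 with h | h
    · linarith
    · have : 3 * ρ * D ≤ T * D := by nlinarith [mul_nonneg h.le (sq_nonneg T)]
      exact le_of_mul_le_mul_right this hD
  have hupper : ∀ x y : ℝ, y ^ 2 + T * (x * y) + (D + T ^ 2 / 2) * x ^ 2 ≤
      3 / 2 * y ^ 2 + (D + T ^ 2) * x ^ 2 := fun x y => by nlinarith [sq_nonneg (y - T * x)]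
  have hlower : ∀ x y : ℝ, (D + T ^ 2) / 8 * x ^ 2 ≤
      y ^ 2 + T * (x * y) + (D + T ^ 2 / 2) * x ^ 2 := fun x y => by
    nlinarith [sq_nonneg (2 * y + T * x), mul_nonneg hD.le (sq_nonneg x), sq_nonneg (T * x)]
  have hpos : ∀ x y : ℝ, 0 ≤ y ^ 2 + T * (x * y) + (D + T ^ 2 / 2) * x ^ 2 := fun x y =>
    le_trans (by positivity) (hlower x y)
  have hdec := le_exp_mul_of_deriv_le (c := 2 * ρ) hder (fun t _ => by
    have h1 : 2 * ρ * (g t ^ 2 + T * (f t * g t) + (D + T ^ 2 / 2) * f t ^ 2) ≤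
        T * g t ^ 2 + T * D * f t ^ 2 := by
      rcases le_or_gt ρ 0 with h | h
      · have h2 := mul_nonneg (neg_nonneg.2 h) (hpos (f t) (g t))
        have h3 : 0 ≤ T * g t ^ 2 + T * D * f t ^ 2 := by positivity
        linarith
      · have h2 := mul_le_mul_of_nonneg_left (hupper (f t) (g t)) h.le
        have h3 := mul_le_mul_of_nonneg_right hρT (sq_nonneg (g t))
        have h4 := mul_le_mul_of_nonneg_right hρ (sq_nonneg (f t))
        have h5 : 0 ≤ ρ * ((D + T ^ 2) * f t ^ 2) := by positivity
        linarith
    linarith) ht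
  refine abs_le_of_sq_le_mul_exp (by positivity) ?_
  have h1 := (hlower (f t) (g t)).trans hdec
  have h2 : g 0 ^ 2 + T * (f 0 * g 0) + (D + T ^ 2 / 2) * f 0 ^ 2 ≤
      (D + T ^ 2) / 8 * (4 * (|f 0| + |g 0| / K)) ^ 2 := by
    refine (hupper (f 0) (g 0)).trans ?_
    have h3 : g 0 ^ 2 = K ^ 2 * (|g 0| / K) ^ 2 := by
      rw [← sq_abs (g 0), div_pow]; field_simp
    have h4 : K ^ 2 * (|g 0| / K) ^ 2 ≤ (D + T ^ 2) * (|g 0| / K) ^ 2 := by gcongr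
    have h5 : 0 ≤ (D + T ^ 2) * (|f 0| * (|g 0| / K)) := by positivity
    have h6 : 0 ≤ (D + T ^ 2) * (|g 0| / K) ^ 2 := by positivity
    have h7 : 0 ≤ (D + T ^ 2) * |f 0| ^ 2 := by positivity
    rw [← sq_abs (f 0), h3]
    linarith
  have h3 : (D + T ^ 2) / 8 * f t ^ 2 ≤ (D + T ^ 2) / 8 *
      (Real.exp (-(2 * ρ * t)) * (4 * (|f 0| + |g 0| / K)) ^ 2) := by
    have := mul_le_mul_of_nonneg_left h2 (Real.exp_pos (-(2 * ρ * t))).le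
    linarith
  exact le_of_mul_le_mul_left h3 (by positivity)

theorem norm_le_of_damped_oscillator {f g : ℝ → ℂ} {T D ρ K : ℝ} (hT : 0 < T) (hD : 0 < D)
    (hρ : 3 * ρ * (D + T ^ 2) ≤ T * D) (hK : 0 < K) (hKD : K ^ 2 ≤ D + T ^ 2)
    (hf : ∀ t, HasDerivAt f (g t) t) (hg : ∀ t, HasDerivAt g (-(T * g t) - D * f t) t)
    {t : ℝ} (ht : 0 ≤ t) :
    ‖f t‖ ≤ Real.exp (-(ρ * t)) * (8 * (‖f 0‖ + ‖g 0‖ / K)) := by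
  have h1 := abs_le_of_damped_oscillator hT hD hρ hK hKD (fun t => hasDerivAt_re (hf t))
    (fun t => (hasDerivAt_re (hg t)).congr_deriv (by simp)) ht
  have h2 := abs_le_of_damped_oscillator hT hD hρ hK hKD (fun t => hasDerivAt_im (hf t))
    (fun t => (hasDerivAt_im (hg t)).congr_deriv (by simp)) ht
  have h3 : Real.exp (-(ρ * t)) * (4 * (|(f 0).re| + |(g 0).re| / K)) ≤
      Real.exp (-(ρ * t)) * (4 * (‖f 0‖ + ‖g 0‖ / K)) := by
    gcongr <;> exact Complex.abs_re_le_norm _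
  have h4 : Real.exp (-(ρ * t)) * (4 * (|(f 0).im| + |(g 0).im| / K)) ≤
      Real.exp (-(ρ * t)) * (4 * (‖f 0‖ + ‖g 0‖ / K)) := by
    gcongr <;> exact Complex.abs_im_le_norm _
  have := Complex.norm_le_abs_re_add_abs_im (f t)
  linarith

/-- The homogeneous solution `e^{-lt} x(0)` is subtracted first, so that the initial value keeps the
full rate `l` and only the forced part decays like `e^{-ct}`. -/
theorem norm_le_of_deriv_eq_neg_mul_add {x h : ℝ → ℂ} {l c K : ℝ} (hl : 0 < l) (hc : 2 * c ≤ l)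
    (hx : ∀ t, HasDerivAt x (-(l * x t) + h t) t)
    (hh : ∀ t, 0 ≤ t → ‖h t‖ ≤ K * Real.exp (-(c * t))) {t : ℝ} (ht : 0 ≤ t) :
    ‖x t‖ ≤ Real.exp (-(l * t)) * ‖x 0‖ + Real.exp (-(c * t)) * (4 * K / l) := by
  have he : ∀ t : ℝ, HasDerivAt (fun t : ℝ => (Real.exp (-(l * t)) : ℂ) * x 0)
      (-(l * ((Real.exp (-(l * t)) : ℂ) * x 0))) t := by
    intro t
    have h1 : HasDerivAt (fun t : ℝ => Real.exp (-(l * t))) (Real.exp (-(l * t)) * (-(l * 1))) t :=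
      (((hasDerivAt_id t).const_mul l).neg).exp
    refine (h1.ofReal_comp.mul_const (x 0)).congr_deriv ?_
    push_cast
    ring
  have hy : ∀ t, HasDerivAt (fun t => x t - (Real.exp (-(l * t)) : ℂ) * x 0)
      (-(l * (x t - (Real.exp (-(l * t)) : ℂ) * x 0)) + h t) t := fun t =>
    ((hx t).sub (he t)).congr_deriv (by ring)
  have h1 := abs_le_of_deriv_eq_neg_mul_add (h := fun t => (h t).re) hl hc
    (fun t => (hasDerivAt_re (hy t)).congr_deriv (by
      rw [Complex.add_re, Complex.neg_re, Complex.re_ofReal_mul]))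
    (fun t ht => (Complex.abs_re_le_norm _).trans (hh t ht)) ht
  have h2 := abs_le_of_deriv_eq_neg_mul_add (h := fun t => (h t).im) hl hc
    (fun t => (hasDerivAt_im (hy t)).congr_deriv (by
      rw [Complex.add_im, Complex.neg_im, Complex.im_ofReal_mul]))
    (fun t ht => (Complex.abs_im_le_norm _).trans (hh t ht)) ht
  have h3 := Complex.norm_le_abs_re_add_abs_im (x t - (Real.exp (-(l * t)) : ℂ) * x 0)
  have h4 : ‖x t‖ ≤ ‖x t - (Real.exp (-(l * t)) : ℂ) * x 0‖ + Real.exp (-(l * t)) * ‖x 0‖ := by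
    have h5 := norm_add_le (x t - (Real.exp (-(l * t)) : ℂ) * x 0)
      ((Real.exp (-(l * t)) : ℂ) * x 0)
    rw [sub_add_cancel, norm_mul, Complex.norm_real, Real.norm_eq_abs,
      abs_of_pos (Real.exp_pos _)] at h5
    exact h5
  simp only [mul_zero, neg_zero, Real.exp_zero, Complex.ofReal_one, one_mul, sub_self,
    Complex.zero_re, Complex.zero_im, abs_zero, zero_add] at h1 h2
  have h6 : 4 * K / l = 2 * K / l + 2 * K / l := by ring
  rw [h6, mul_add]
  linarith

/-! ### The longitudinal part: density and divergence of the velocity -/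

/-- The compressible part `n' = -γ d`, `d' = -μ k² d + ((γ² k² + β²) / γ) n` at the frequency
`k`. -/
structure IsCompressibleFlow (γ β μ k : ℝ) (n d : ℝ → ℂ) : Prop where
  deriv_n : ∀ t, HasDerivAt n (-(γ * d t)) t
  deriv_d : ∀ t, HasDerivAt d (-(μ * k ^ 2 * d t) + (γ ^ 2 * k ^ 2 + β ^ 2) / γ * n t) t

/-- Eliminating one unknown shows that `n` and `d` both solve the oscillator with `T = μk²` and `D =
γ²k² + β²`; the initial velocities are read off from the system. -/
theorem IsCompressibleFlow.norm_le {γ β μ k ρ K : ℝ} (hγ : 0 < γ) (hβ : 0 < β) (hμ : 0 < μ)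
    (hk : 0 < k) {n d : ℝ → ℂ} (h : IsCompressibleFlow γ β μ k n d)
    (hρ : 3 * ρ * (γ ^ 2 * k ^ 2 + β ^ 2 + (μ * k ^ 2) ^ 2) ≤
      μ * k ^ 2 * (γ ^ 2 * k ^ 2 + β ^ 2)) (hK : 0 < K)
    (hKD : K ^ 2 ≤ γ ^ 2 * k ^ 2 + β ^ 2 + (μ * k ^ 2) ^ 2) {t : ℝ} (ht : 0 ≤ t) :
    ‖n t‖ ≤ Real.exp (-(ρ * t)) * (8 * (‖n 0‖ + γ * ‖d 0‖ / K)) ∧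
    ‖d t‖ ≤ Real.exp (-(ρ * t)) *
      (8 * (‖d 0‖ + (μ * k ^ 2 * ‖d 0‖ + (γ ^ 2 * k ^ 2 + β ^ 2) / γ * ‖n 0‖) / K)) := by
  have hT : 0 < μ * k ^ 2 := by positivity
  have hD : 0 < γ ^ 2 * k ^ 2 + β ^ 2 := by positivity
  have hγ' : (γ : ℂ) ≠ 0 := by exact_mod_cast hγ.ne'
  constructor
  · have h1 := norm_le_of_damped_oscillator hT hD hρ hK hKD h.deriv_n (fun t =>
      (((h.deriv_d t).const_mul (γ : ℂ)).neg).congr_deriv (by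
        push_cast; field_simp; ring)) ht
    rwa [norm_neg, norm_mul, Complex.norm_real, Real.norm_of_nonneg hγ.le] at h1
  · have h1 := norm_le_of_damped_oscillator hT hD hρ hK hKD h.deriv_d (fun t =>
      ((((h.deriv_d t).const_mul (μ * k ^ 2 : ℂ)).neg).add
        ((h.deriv_n t).const_mul ((γ ^ 2 * k ^ 2 + β ^ 2) / γ : ℂ))).congr_deriv (by
        push_cast; field_simp; ring)) ht
    refine h1.trans ?_
    gcongr
    refine (norm_add_le _ _).trans (le_of_eq ?_)
    have e1 : (μ * k ^ 2 : ℂ) = ((μ * k ^ 2 : ℝ) : ℂ) := by push_cast; rfl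
    have e2 : ((γ ^ 2 * k ^ 2 + β ^ 2) / γ : ℂ) = (((γ ^ 2 * k ^ 2 + β ^ 2) / γ : ℝ) : ℂ) := by
      push_cast; rfl
    rw [norm_neg, e1, e2, norm_mul, norm_mul, Complex.norm_real, Complex.norm_real, Real.norm_of_nonneg hT.le,
      Real.norm_of_nonneg (by positivity)]

/-- For `k ≤ 1` the quantity `D + T²` is bounded above and `D ≥ β²`, so the rate `TD/(D + T²)` is at
least of order `k²`. The initial velocity is measured on the scale `K = β`. -/
theorem IsCompressibleFlow.exists_low_frequency_bound {γ β μ : ℝ} (hγ : 0 < γ) (hβ : 0 < β)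
    (hμ : 0 < μ) :
    ∃ c C : ℝ, 0 < c ∧ 0 < C ∧ ∀ (k : ℝ) (n d : ℝ → ℂ), IsCompressibleFlow γ β μ k n d →
      0 < k → k ≤ 1 → ∀ t, 0 ≤ t →
        ‖n t‖ ≤ C * (Real.exp (-(c * k ^ 2 * t)) * (‖n 0‖ + ‖d 0‖)) ∧
        ‖d t‖ ≤ C * (Real.exp (-(c * k ^ 2 * t)) * (‖n 0‖ + ‖d 0‖)) := by
  refine ⟨μ * β ^ 2 / (3 * (γ ^ 2 + β ^ 2 + μ ^ 2)),
    8 * (1 + γ / β + μ / β + (γ ^ 2 + β ^ 2) / γ / β), by positivity, by positivity,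
    fun k n d h hk hk1 t ht => ?_⟩
  have hk2 : k ^ 2 ≤ 1 := pow_le_one₀ hk.le hk1
  have hD : γ ^ 2 * k ^ 2 + β ^ 2 ≤ γ ^ 2 + β ^ 2 := by
    have := mul_le_mul_of_nonneg_left hk2 (sq_nonneg γ); linarith
  have hμk : μ * k ^ 2 ≤ μ := by
    have := mul_le_mul_of_nonneg_left hk2 hμ.le; linarith
  have hS : γ ^ 2 * k ^ 2 + β ^ 2 + (μ * k ^ 2) ^ 2 ≤ γ ^ 2 + β ^ 2 + μ ^ 2 := by
    have : (μ * k ^ 2) ^ 2 ≤ μ ^ 2 := by gcongr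
    linarith
  obtain ⟨h1, h2⟩ := h.norm_le hγ hβ hμ hk
    (ρ := μ * β ^ 2 / (3 * (γ ^ 2 + β ^ 2 + μ ^ 2)) * k ^ 2) (K := β)
    (by
      have h3 : 3 * (μ * β ^ 2 / (3 * (γ ^ 2 + β ^ 2 + μ ^ 2)) * k ^ 2) *
          (γ ^ 2 * k ^ 2 + β ^ 2 + (μ * k ^ 2) ^ 2) ≤
          3 * (μ * β ^ 2 / (3 * (γ ^ 2 + β ^ 2 + μ ^ 2)) * k ^ 2) *
          (γ ^ 2 + β ^ 2 + μ ^ 2) := by gcongr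
      refine h3.trans ?_
      have h4 : 3 * (μ * β ^ 2 / (3 * (γ ^ 2 + β ^ 2 + μ ^ 2)) * k ^ 2) *
          (γ ^ 2 + β ^ 2 + μ ^ 2) = μ * k ^ 2 * β ^ 2 := by field_simp
      rw [h4]
      gcongr
      have : 0 ≤ γ ^ 2 * k ^ 2 := by positivity
      linarith) hβ (by
        have : 0 ≤ γ ^ 2 * k ^ 2 := by positivity
        have : 0 ≤ (μ * k ^ 2) ^ 2 := by positivity
        linarith) ht
  have hn := norm_nonneg (n 0)
  have hd := norm_nonneg (d 0)
  have p1 : 0 ≤ γ / β := by positivity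
  have p2 : 0 ≤ μ / β := by positivity
  have p3 : 0 ≤ (γ ^ 2 + β ^ 2) / γ / β := by positivity
  have hE := Real.exp_pos (-(μ * β ^ 2 / (3 * (γ ^ 2 + β ^ 2 + μ ^ 2)) * k ^ 2 * t))
  constructor
  · refine h1.trans ?_
    rw [mul_left_comm (8 * _)]
    refine mul_le_mul_of_nonneg_left ?_ hE.le
    have : γ * ‖d 0‖ / β = γ / β * ‖d 0‖ := by ring
    rw [this]
    nlinarith [mul_nonneg p1 hn, mul_nonneg p2 hn, mul_nonneg p2 hd, mul_nonneg p3 hn,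
      mul_nonneg p3 hd]
  · refine h2.trans ?_
    rw [mul_left_comm (8 * _)]
    refine mul_le_mul_of_nonneg_left ?_ hE.le
    have h5 : (μ * k ^ 2 * ‖d 0‖ + (γ ^ 2 * k ^ 2 + β ^ 2) / γ * ‖n 0‖) / β ≤
        (μ * ‖d 0‖ + (γ ^ 2 + β ^ 2) / γ * ‖n 0‖) / β := by gcongr
    have : (μ * ‖d 0‖ + (γ ^ 2 + β ^ 2) / γ * ‖n 0‖) / β = μ / β * ‖d 0‖ +
      (γ ^ 2 + β ^ 2) / γ / β * ‖n 0‖ := by ring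
    rw [this] at h5
    nlinarith [mul_nonneg p1 hn, mul_nonneg p1 hd, mul_nonneg p2 hn, mul_nonneg p3 hd]

/-- The oscillator is strongly overdamped. The two parts of `c` give `6c ≤ T` and `6cT ≤ D`, which
together yield the required rate condition. Measuring the initial velocity on the scale `K = μk²`
produces the gain `k⁻²` in front of `d`. -/
theorem IsCompressibleFlow.exists_high_frequency_bound {γ β μ : ℝ} (hγ : 0 < γ) (hβ : 0 < β)
    (hμ : 0 < μ) :
    ∃ c C : ℝ, 0 < c ∧ 0 < C ∧ ∀ (k : ℝ) (n d : ℝ → ℂ), IsCompressibleFlow γ β μ k n d →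
      1 ≤ k → ∀ t, 0 ≤ t →
        ‖n t‖ ≤ C * (Real.exp (-(c * t)) * (‖n 0‖ + ‖d 0‖ / k ^ 2)) ∧
        ‖d t‖ ≤ C * (Real.exp (-(c * t)) * (‖n 0‖ + ‖d 0‖)) := by
  refine ⟨min (μ / 6) (γ ^ 2 / (6 * μ)),
    8 * (2 + γ / μ + (γ ^ 2 + β ^ 2) / γ / μ), by positivity, by positivity,
    fun k n d h hk1 t ht => ?_⟩
  set c := min (μ / 6) (γ ^ 2 / (6 * μ)) with hc
  have hc0 : 0 < c := by positivity
  have hc1 : c ≤ μ / 6 := min_le_left _ _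
  have hc2 : c * (6 * μ) ≤ γ ^ 2 := by
    have := min_le_right (μ / 6) (γ ^ 2 / (6 * μ))
    rwa [← hc, le_div_iff₀ (by positivity)] at this
  have hk : 0 < k := by linarith
  have hk2 : 1 ≤ k ^ 2 := one_le_pow₀ hk1
  obtain ⟨h1, h2⟩ := h.norm_le hγ hβ hμ hk (ρ := c) (K := μ * k ^ 2)
    (by
      have hD : 0 < γ ^ 2 * k ^ 2 + β ^ 2 := by positivity
      have h3 : 6 * c ≤ μ * k ^ 2 := by nlinarith
      have h4 : 6 * c * (μ * k ^ 2) ≤ γ ^ 2 * k ^ 2 + β ^ 2 := by nlinarith [sq_nonneg β]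
      have h5 := mul_le_mul_of_nonneg_right h3 hD.le
      have h6 := mul_le_mul_of_nonneg_left h4 (by positivity : 0 ≤ μ * k ^ 2)
      linarith) (by positivity) (by
        have : 0 ≤ γ ^ 2 * k ^ 2 := by positivity
        have : 0 ≤ β ^ 2 := by positivity
        linarith) ht
  have hn := norm_nonneg (n 0)
  have hd := norm_nonneg (d 0)
  have p1 : 0 ≤ γ / μ := by positivity
  have p3 : 0 ≤ (γ ^ 2 + β ^ 2) / γ / μ := by positivity
  have hE := Real.exp_pos (-(c * t))
  constructor
  · refine h1.trans ?_
    rw [mul_left_comm (8 * _)]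
    refine mul_le_mul_of_nonneg_left ?_ hE.le
    have : γ * ‖d 0‖ / (μ * k ^ 2) = γ / μ * (‖d 0‖ / k ^ 2) := by field_simp
    rw [this]
    have hd' : 0 ≤ ‖d 0‖ / k ^ 2 := by positivity
    nlinarith [mul_nonneg p1 hn, mul_nonneg p3 hn, mul_nonneg p3 hd']
  · refine h2.trans ?_
    rw [mul_left_comm (8 * _)]
    refine mul_le_mul_of_nonneg_left ?_ hE.le
    have h5 : (μ * k ^ 2 * ‖d 0‖ + (γ ^ 2 * k ^ 2 + β ^ 2) / γ * ‖n 0‖) / (μ * k ^ 2) ≤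
        ‖d 0‖ + (γ ^ 2 + β ^ 2) / γ / μ * ‖n 0‖ := by
      have h6 : (γ ^ 2 * k ^ 2 + β ^ 2) / γ ≤ (γ ^ 2 + β ^ 2) / γ * k ^ 2 := by
        rw [div_mul_eq_mul_div]
        gcongr
        nlinarith [sq_nonneg β]
      rw [div_le_iff₀ (by positivity)]
      have h7 := mul_le_mul_of_nonneg_right h6 hn
      have h8 : (‖d 0‖ + (γ ^ 2 + β ^ 2) / γ / μ * ‖n 0‖) * (μ * k ^ 2) =
          μ * k ^ 2 * ‖d 0‖ + (γ ^ 2 + β ^ 2) / γ * k ^ 2 * ‖n 0‖ := by field_simp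
      linarith
    nlinarith [mul_nonneg p1 hn, mul_nonneg p1 hd, mul_nonneg p3 hd]

/-! ### The transverse part: factorization into a real mode and an oscillator -/

/-- The electromagnetic part `x' = -μ k² x - β y`, `y' = β x + k z`, `z' = -k y` at the frequency
`k`. -/
structure IsElectromagneticFlow (β μ k : ℝ) (x y z : ℝ → ℂ) : Prop where
  deriv_x : ∀ t, HasDerivAt x (-(μ * k ^ 2 * x t) - β * y t) t
  deriv_y : ∀ t, HasDerivAt y (β * x t + k * z t) t
  deriv_z : ∀ t, HasDerivAt z (-(k * y t)) t

/-- Splitting off the mode `e^{-νt}` from a solution of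
`(d/dt + ν) (d²/dt² + T d/dt + D) f = 0`. -/
theorem norm_le_of_mode_splitting {f g s : ℝ → ℂ} {ν T D P ρ K : ℝ} (hν : 0 < ν) (hT : 0 < T)
    (hD : 0 < D) (hP : 0 < P) (hPe : P = ν ^ 2 - T * ν + D)
    (hρ : 3 * ρ * (D + T ^ 2) ≤ T * D) (hK : 0 < K) (hKD : K ^ 2 ≤ D + T ^ 2)
    (hf : ∀ t, HasDerivAt f (g t) t) (hg : ∀ t, HasDerivAt g (-(T * g t) - D * f t + s t) t)
    (hs : ∀ t, HasDerivAt s (-(ν * s t)) t) {t : ℝ} (ht : 0 ≤ t) :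
    ‖f t‖ ≤ Real.exp (-(ν * t)) * (‖s 0‖ / P) +
      Real.exp (-(ρ * t)) * (8 * (‖f 0 - s 0 / P‖ + ‖g 0 + ν * s 0 / P‖ / K)) := by
  have hPc : (P : ℂ) ≠ 0 := by exact_mod_cast hP.ne'
  -- `P` is the value of `λ² + Tλ + D` at `λ = -ν`, so `s/P` is a particular solution and the
  -- difference is a free oscillator.
  have h1 := norm_le_of_damped_oscillator (f := fun t => f t - s t / P)
    (g := fun t => g t + ν * s t / P) hT hD hρ hK hKD
    (fun t => ((hf t).sub ((hs t).div_const (P : ℂ))).congr_deriv (by ring))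
    (fun t => ((hg t).add (((hs t).const_mul (ν : ℂ)).div_const (P : ℂ))).congr_deriv (by
      have : (P : ℂ) = ν ^ 2 - T * ν + D := by rw [hPe]; push_cast; ring
      field_simp
      rw [this]
      ring)) ht
  have h2 := norm_le_of_deriv_eq_neg_mul_add (h := fun _ => 0) (c := 0) (K := 0) hν
    (by linarith) (fun t => (hs t).congr_deriv (by simp)) (fun t _ => by simp) ht
  have h3 : ‖s t / P‖ ≤ Real.exp (-(ν * t)) * (‖s 0‖ / P) := by
    rw [norm_div, Complex.norm_real, Real.norm_of_nonneg hP.le, ← mul_div_assoc]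
    gcongr
    simpa using h2
  have h4 := norm_add_le (f t - s t / P) (s t / P)
  rw [sub_add_cancel] at h4
  linarith

/-- The characteristic polynomial of the electromagnetic system has a real root in `(-a, 0)`. -/
theorem exists_characteristic_root {a β k : ℝ} (ha : 0 < a) (hβ : 0 < β) (hk : 0 < k) :
    ∃ ν : ℝ, 0 < ν ∧ ν < a ∧ (a - ν) * (ν ^ 2 + k ^ 2) = ν * β ^ 2 := by
  have hc : ContinuousOn (fun ν : ℝ => ν * β ^ 2 - (a - ν) * (ν ^ 2 + k ^ 2)) (Set.Icc 0 a) := by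
    fun_prop
  have h0 : (0 : ℝ) ∈ Set.Ioo ((0 : ℝ) * β ^ 2 - (a - 0) * (0 ^ 2 + k ^ 2))
      (a * β ^ 2 - (a - a) * (a ^ 2 + k ^ 2)) := by
    constructor
    · have : 0 < a * k ^ 2 := by positivity
      linarith
    · have : 0 < a * β ^ 2 := by positivity
      linarith
  obtain ⟨ν, hν, h⟩ := intermediate_value_Ioo ha.le hc h0
  simp only at h
  exact ⟨ν, hν.1, hν.2, by linarith⟩

/-- The data of the factorization `(λ + ν) (λ² + T λ + D)` of the characteristic polynomial. -/
structure IsModeFactorization (β μ k ν T D P : ℝ) : Prop where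
  ν_pos : 0 < ν
  T_pos : 0 < T
  add_eq : ν + T = μ * k ^ 2
  mul_eq : T * (ν ^ 2 + k ^ 2) = ν * β ^ 2
  D_eq : D = k ^ 2 + β ^ 2 - ν * T
  P_eq : P = ν ^ 2 - T * ν + D

/-- With `T = μk² - ν` the equation for the root is `mul_eq`. Comparing coefficients of `(λ + ν)(λ²
+ Tλ + D)` with `(λ + μk²)(λ² + k²) + β²λ` gives `D`, and then `mul_eq` yields the constant term `νD
= μk⁴`. -/
theorem exists_isModeFactorization {β μ k : ℝ} (hβ : 0 < β) (hμ : 0 < μ) (hk : 0 < k) :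
    ∃ ν T D P, IsModeFactorization β μ k ν T D P := by
  obtain ⟨ν, h1, h2, h3⟩ := exists_characteristic_root (a := μ * k ^ 2) (by positivity) hβ hk
  exact ⟨ν, μ * k ^ 2 - ν, _, _, h1, by linarith, by ring, h3, rfl, rfl⟩

section modes

variable {β μ k ν T D P ρ K : ℝ} {x y z : ℝ → ℂ}

theorem IsModeFactorization.le_D (h : IsModeFactorization β μ k ν T D P) :
    k ^ 2 ≤ D := by
  have h1 : ν * T ≤ β ^ 2 := by
    have h2 : T * ν ^ 2 ≤ ν * β ^ 2 := by
      have := mul_nonneg h.T_pos.le (sq_nonneg k)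
      linarith [h.mul_eq]
    have h3 : ν * (ν * T) ≤ ν * β ^ 2 := by linarith
    exact le_of_mul_le_mul_left h3 h.ν_pos
  rw [h.D_eq]; linarith

/-- Here `s` is the initial value of `x'' + T x' + D x`, rewritten through the system as a
combination of `x, y, z`. Its row of coefficients is a left eigenvector for `-ν`, so the combination
decays exactly like `e^{-νt}`. The same scheme with other rows serves `y` and `z`. -/
theorem IsElectromagneticFlow.norm_x_le (hX : IsElectromagneticFlow β μ k x y z)
    (h : IsModeFactorization β μ k ν T D P) (hk : 0 < k) (hP : 0 < P)
    (hρ : 3 * ρ * (D + T ^ 2) ≤ T * D) (hK : 0 < K) (hKD : K ^ 2 ≤ D + T ^ 2) {t : ℝ}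
    (ht : 0 ≤ t) {s : ℂ} (hs : s = (k ^ 2 + ν ^ 2) * x 0 + ν * β * y 0 - β * k * z 0) :
    ‖x t‖ ≤ Real.exp (-(ν * t)) * (‖s‖ / P) + Real.exp (-(ρ * t)) *
      (8 * (‖x 0 - s / P‖ + ‖-(μ * k ^ 2 * x 0) - β * y 0 + ν * s / P‖ / K)) := by
  subst hs
  have e1 : (ν + T : ℂ) = μ * k ^ 2 := by exact_mod_cast h.add_eq
  have e2 : (T * (ν ^ 2 + k ^ 2) : ℂ) = ν * β ^ 2 := by exact_mod_cast h.mul_eq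
  have e3 : (D : ℂ) = k ^ 2 + β ^ 2 - ν * T := by rw [h.D_eq]; push_cast; ring
  refine norm_le_of_mode_splitting
    (s := fun t => (k ^ 2 + ν ^ 2) * x t + ν * β * y t - β * k * z t) h.ν_pos h.T_pos
    ((pow_pos hk 2).trans_le h.le_D) hP h.P_eq hρ hK hKD hX.deriv_x (fun t => ?_)
    (fun t => ?_) ht
  · refine ((((hX.deriv_x t).const_mul (μ * k ^ 2 : ℂ)).neg).sub
      ((hX.deriv_y t).const_mul (β : ℂ))).congr_deriv ?_
    rw [e3, ← e1]
    ring
  · refine ((((hX.deriv_x t).const_mul (k ^ 2 + ν ^ 2 : ℂ)).add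
      ((hX.deriv_y t).const_mul (ν * β : ℂ))).sub
      ((hX.deriv_z t).const_mul (β * k : ℂ))).congr_deriv ?_
    rw [← e1]
    linear_combination -(x t) * e2

theorem IsElectromagneticFlow.norm_y_le (hX : IsElectromagneticFlow β μ k x y z)
    (h : IsModeFactorization β μ k ν T D P) (hk : 0 < k) (hP : 0 < P)
    (hρ : 3 * ρ * (D + T ^ 2) ≤ T * D) (hK : 0 < K) (hKD : K ^ 2 ≤ D + T ^ 2) {t : ℝ}
    (ht : 0 ≤ t) {s : ℂ} (hs : s = -(ν * β * x 0) - ν * T * y 0 + k * T * z 0) :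
    ‖y t‖ ≤ Real.exp (-(ν * t)) * (‖s‖ / P) + Real.exp (-(ρ * t)) *
      (8 * (‖y 0 - s / P‖ + ‖β * x 0 + k * z 0 + ν * s / P‖ / K)) := by
  subst hs
  have e1 : (ν + T : ℂ) = μ * k ^ 2 := by exact_mod_cast h.add_eq
  have e2 : (T * (ν ^ 2 + k ^ 2) : ℂ) = ν * β ^ 2 := by exact_mod_cast h.mul_eq
  have e3 : (D : ℂ) = k ^ 2 + β ^ 2 - ν * T := by rw [h.D_eq]; push_cast; ring
  refine norm_le_of_mode_splitting
    (s := fun t => -(ν * β * x t) - ν * T * y t + k * T * z t) h.ν_pos h.T_pos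
    ((pow_pos hk 2).trans_le h.le_D) hP h.P_eq hρ hK hKD hX.deriv_y (fun t => ?_)
    (fun t => ?_) ht
  · refine (((hX.deriv_x t).const_mul (β : ℂ)).add
      ((hX.deriv_z t).const_mul (k : ℂ))).congr_deriv ?_
    rw [e3, ← e1]
    ring
  · refine (((((hX.deriv_x t).const_mul (ν * β : ℂ)).neg).sub
      ((hX.deriv_y t).const_mul (ν * T : ℂ))).add
      ((hX.deriv_z t).const_mul (k * T : ℂ))).congr_deriv ?_
    rw [← e1]
    linear_combination -(y t) * e2

theorem IsElectromagneticFlow.norm_z_le (hX : IsElectromagneticFlow β μ k x y z)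
    (h : IsModeFactorization β μ k ν T D P) (hk : 0 < k) (hP : 0 < P)
    (hρ : 3 * ρ * (D + T ^ 2) ≤ T * D) (hK : 0 < K) (hKD : K ^ 2 ≤ D + T ^ 2) {t : ℝ}
    (ht : 0 ≤ t) {s : ℂ} (hs : s = -(k * β * x 0) - k * T * y 0 + (D - k ^ 2) * z 0) :
    ‖z t‖ ≤ Real.exp (-(ν * t)) * (‖s‖ / P) + Real.exp (-(ρ * t)) *
      (8 * (‖z 0 - s / P‖ + ‖-(k * y 0) + ν * s / P‖ / K)) := by
  subst hs
  have e1 : (ν + T : ℂ) = μ * k ^ 2 := by exact_mod_cast h.add_eq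
  have e2 : (T * (ν ^ 2 + k ^ 2) : ℂ) = ν * β ^ 2 := by exact_mod_cast h.mul_eq
  have e3 : (D : ℂ) = k ^ 2 + β ^ 2 - ν * T := by rw [h.D_eq]; push_cast; ring
  refine norm_le_of_mode_splitting
    (s := fun t => -(k * β * x t) - k * T * y t + (D - k ^ 2) * z t) h.ν_pos h.T_pos
    ((pow_pos hk 2).trans_le h.le_D) hP h.P_eq hρ hK hKD hX.deriv_z (fun t => ?_)
    (fun t => ?_) ht
  · refine (((hX.deriv_y t).const_mul (k : ℂ)).neg).congr_deriv ?_
    ring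
  · refine (((((hX.deriv_x t).const_mul (k * β : ℂ)).neg).sub
      ((hX.deriv_y t).const_mul (k * T : ℂ))).add
      ((hX.deriv_z t).const_mul (D - k ^ 2 : ℂ))).congr_deriv ?_
    rw [e3, ← e1]
    linear_combination -(z t) * e2

end modes

/-! ### The transverse part at intermediate frequencies -/

/-- Exponential decay at frequencies that stay away from `0` and `∞`. -/
theorem exists_middle_frequency_bound_real {β μ : ℝ} (hβ : 0 < β) (hμ : 0 < μ) {r R : ℝ}
    (hr : 0 < r) (hR : 0 < R) :
    ∃ c : ℝ, 0 < c ∧ ∀ (k : ℝ) (x y z : ℝ → ℝ), r ≤ k → k ≤ R →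
      (∀ t, HasDerivAt x (-(μ * k ^ 2 * x t) - β * y t) t) →
      (∀ t, HasDerivAt y (β * x t + k * z t) t) → (∀ t, HasDerivAt z (-(k * y t)) t) →
      ∀ t, 0 ≤ t → x t ^ 2 + y t ^ 2 + z t ^ 2 ≤
        3 * (Real.exp (-(2 * c * t)) * (x 0 ^ 2 + y 0 ^ 2 + z 0 ^ 2)) := by
  -- The energy dissipates only `x`. Adding `ε(xy - κyz)` produces `-εβy²` and `-εκkz²`. The choice
  -- of `κ` keeps the bad term `κky²` below half of `βy²`; `A` collects the resulting coefficient of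
  -- `x²`; `ε` is small enough for `μr²x²` to absorb `εAx²` and for the cross terms to stay below
  -- half of the energy.
  set κ := β / (2 * R) with hκ
  have hκ0 : 0 < κ := by positivity
  have hκR : κ * R = β / 2 := by rw [hκ]; field_simp
  set A := (μ * R ^ 2) ^ 2 / β + β + (R + κ * β) ^ 2 / (2 * κ * r) with hA
  have hA0 : 0 < A := by positivity
  set ε := min (μ * r ^ 2 / (2 * A)) (min (1 / 4) (1 / (4 * κ))) with hε
  have hε0 : 0 < ε := by positivity
  have hε1 : ε * A ≤ μ * r ^ 2 / 2 := by
    have := min_le_left (μ * r ^ 2 / (2 * A)) (min (1 / 4) (1 / (4 * κ)))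
    rw [← hε, le_div_iff₀ (by positivity)] at this
    linarith
  have hε2 : ε ≤ 1 / 4 := (min_le_right _ _).trans (min_le_left _ _)
  have hε3 : ε * κ ≤ 1 / 4 := by
    have h1 : ε ≤ 1 / (4 * κ) := (min_le_right _ _).trans (min_le_right _ _)
    rw [le_div_iff₀ (by positivity)] at h1
    linarith
  set c := min (μ * r ^ 2 / 2) (min (ε * β / 4) (ε * κ * r / 2)) with hc
  have hc0 : 0 < c := by positivity
  have hc1 : c ≤ μ * r ^ 2 / 2 := min_le_left _ _
  have hc2 : c ≤ ε * β / 4 := (min_le_right _ _).trans (min_le_left _ _)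
  have hc3 : c ≤ ε * κ * r / 2 := (min_le_right _ _).trans (min_le_right _ _)
  refine ⟨c / 2, by positivity, fun k x y z hrk hkR hx hy hz t ht => ?_⟩
  have hk : 0 < k := hr.trans_le hrk
  have hequiv : ∀ x y z : ℝ, |ε * (x * y) - ε * κ * (y * z)| ≤ (x ^ 2 + y ^ 2 + z ^ 2) / 4 := by
    intro x y z
    have h1 : |ε * (x * y)| ≤ 1 / 4 * ((x ^ 2 + y ^ 2) / 2) := by
      rw [abs_mul, abs_of_pos hε0]
      gcongr
      rw [abs_le]
      constructor <;> nlinarith [sq_nonneg (x + y), sq_nonneg (x - y)]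
    have h2 : |ε * κ * (y * z)| ≤ 1 / 4 * ((y ^ 2 + z ^ 2) / 2) := by
      rw [abs_mul, abs_of_pos (mul_pos hε0 hκ0)]
      gcongr
      rw [abs_le]
      constructor <;> nlinarith [sq_nonneg (y + z), sq_nonneg (y - z)]
    have h3 := abs_sub (ε * (x * y)) (ε * κ * (y * z))
    nlinarith [sq_nonneg x, sq_nonneg z]
  have hder : ∀ t, HasDerivAt
      (fun t => (x t ^ 2 + y t ^ 2 + z t ^ 2) / 2 + (ε * (x t * y t) - ε * κ * (y t * z t)))
      (-(μ * k ^ 2 * x t ^ 2) + ε * (-(μ * k ^ 2 * x t * y t) - β * y t ^ 2 + β * x t ^ 2 +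
        k * x t * z t) - ε * κ * (β * x t * z t + k * z t ^ 2 - k * y t ^ 2)) t := by
    intro t
    refine ((((((hx t).pow 2).add ((hy t).pow 2)).add ((hz t).pow 2)).div_const 2).add
      ((((hx t).mul (hy t)).const_mul ε).sub
        (((hy t).mul (hz t)).const_mul (ε * κ)))).congr_deriv ?_
    simp only [Nat.cast_ofNat]
    ring
  have hdec := le_exp_mul_of_deriv_le (c := c) hder (fun t _ => by
    have h0 := (abs_le.1 (hequiv (x t) (y t) (z t))).2
    set x := x t
    set y := y t
    set z := z t
    have h1 : μ * r ^ 2 * x ^ 2 ≤ μ * k ^ 2 * x ^ 2 := by gcongr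
    have h2 : -(μ * k ^ 2 * x * y) ≤ (μ * R ^ 2) ^ 2 / β * x ^ 2 + β / 4 * y ^ 2 := by
      have h3 : (μ * k ^ 2) ^ 2 / β * x ^ 2 ≤ (μ * R ^ 2) ^ 2 / β * x ^ 2 := by gcongr
      have h4 : 0 ≤ (2 * (μ * k ^ 2) * x + β * y) ^ 2 / (4 * β) := by positivity
      have h5 : (2 * (μ * k ^ 2) * x + β * y) ^ 2 / (4 * β) = (μ * k ^ 2) ^ 2 / β * x ^ 2 +
        μ * k ^ 2 * x * y + β / 4 * y ^ 2 := by field_simp; ring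
      linarith
    have h6 : (k - κ * β) * (x * z) ≤ (R + κ * β) ^ 2 / (2 * κ * r) * x ^ 2 +
        κ * r / 2 * z ^ 2 := by
      have h7 : (k - κ * β) ^ 2 ≤ (R + κ * β) ^ 2 := by
        have : 0 < κ * β := by positivity
        apply sq_le_sq'
        · linarith
        · linarith
      have h8 : (k - κ * β) ^ 2 / (2 * κ * r) * x ^ 2 ≤ (R + κ * β) ^ 2 / (2 * κ * r) * x ^ 2 := by
        gcongr
      have h9 : 0 ≤ ((k - κ * β) * x - κ * r * z) ^ 2 / (2 * κ * r) := by positivity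
      have h10 : ((k - κ * β) * x - κ * r * z) ^ 2 / (2 * κ * r) =
        (k - κ * β) ^ 2 / (2 * κ * r) * x ^ 2 - (k - κ * β) * (x * z) + κ * r / 2 * z ^ 2 := by
        field_simp; ring
      linarith
    have h11 : κ * k * y ^ 2 ≤ β / 2 * y ^ 2 := by
      rw [← hκR]; gcongr
    have h12 : κ * r * z ^ 2 ≤ κ * k * z ^ 2 := by gcongr
    have h13 : -(μ * k ^ 2 * x * y) - β * y ^ 2 + β * x ^ 2 + k * x * z -
        κ * (β * x * z + k * z ^ 2 - k * y ^ 2) ≤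
        A * x ^ 2 - β / 4 * y ^ 2 - κ * r / 2 * z ^ 2 := by
      rw [hA]; linarith
    have h14 := mul_le_mul_of_nonneg_left h13 hε0.le
    have h15 := mul_le_mul_of_nonneg_right hε1 (sq_nonneg x)
    have h16 := mul_le_mul_of_nonneg_right hc1 (sq_nonneg x)
    have h17 := mul_le_mul_of_nonneg_right hc2 (sq_nonneg y)
    have h18 := mul_le_mul_of_nonneg_right hc3 (sq_nonneg z)
    have h19 := mul_le_mul_of_nonneg_left h0 hc0.le
    have h20 := mul_nonneg hc0.le (sq_nonneg x)
    have h21 := mul_nonneg hc0.le (sq_nonneg y)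
    have h22 := mul_nonneg hc0.le (sq_nonneg z)
    linarith) ht
  have h1 := (abs_le.1 (hequiv (x t) (y t) (z t))).1
  have h2 := (abs_le.1 (hequiv (x 0) (y 0) (z 0))).2
  have h3 := mul_le_mul_of_nonneg_left h2 (Real.exp_pos (-(c * t))).le
  rw [show 2 * (c / 2) * t = c * t by ring]
  linarith

theorem IsElectromagneticFlow.exists_middle_frequency_bound {β μ : ℝ} (hβ : 0 < β) (hμ : 0 < μ)
    {r R : ℝ} (hr : 0 < r) (hR : 0 < R) :
    ∃ c : ℝ, 0 < c ∧ ∀ (k : ℝ) (x y z : ℝ → ℂ), IsElectromagneticFlow β μ k x y z →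
      r ≤ k → k ≤ R → ∀ t, 0 ≤ t → ∀ w ∈ ({x t, y t, z t} : Set ℂ),
        ‖w‖ ≤ 2 * (Real.exp (-(c * t)) * (‖x 0‖ + ‖y 0‖ + ‖z 0‖)) := by
  obtain ⟨c, hc, h⟩ := exists_middle_frequency_bound_real hβ hμ hr hR
  refine ⟨c, hc, fun k x y z hX h1 h2 t ht w hw => ?_⟩
  have hre := h k (fun t => (x t).re) (fun t => (y t).re) (fun t => (z t).re) h1 h2
    (fun t => (hasDerivAt_re (hX.deriv_x t)).congr_deriv (by simp [← Complex.ofReal_pow]))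
    (fun t => (hasDerivAt_re (hX.deriv_y t)).congr_deriv (by simp))
    (fun t => (hasDerivAt_re (hX.deriv_z t)).congr_deriv (by simp)) t ht
  have him := h k (fun t => (x t).im) (fun t => (y t).im) (fun t => (z t).im) h1 h2
    (fun t => (hasDerivAt_im (hX.deriv_x t)).congr_deriv (by simp [← Complex.ofReal_pow]))
    (fun t => (hasDerivAt_im (hX.deriv_y t)).congr_deriv (by simp))
    (fun t => (hasDerivAt_im (hX.deriv_z t)).congr_deriv (by simp)) t ht
  have hsq : ∀ w : ℂ, ‖w‖ ^ 2 = w.re ^ 2 + w.im ^ 2 := fun w => by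
    rw [Complex.sq_norm, Complex.normSq_apply]; ring
  have hx := hsq (x 0)
  have hy := hsq (y 0)
  have hz := hsq (z 0)
  have hw2 : ‖w‖ ^ 2 ≤ 3 * (Real.exp (-(2 * c * t)) * (‖x 0‖ ^ 2 + ‖y 0‖ ^ 2 + ‖z 0‖ ^ 2)) := by
    rw [hx, hy, hz, hsq w]
    have := sq_nonneg (x t).re
    have := sq_nonneg (x t).im
    have := sq_nonneg (y t).re
    have := sq_nonneg (y t).im
    have := sq_nonneg (z t).re
    have := sq_nonneg (z t).im
    simp only [Set.mem_insert_iff, Set.mem_singleton_iff] at hw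
    rcases hw with rfl | rfl | rfl <;> linarith
  have hfin := abs_le_of_sq_le_mul_exp (x := ‖w‖) (c := c) (t := t)
    (M := 2 * (‖x 0‖ + ‖y 0‖ + ‖z 0‖)) (by positivity) (by
      refine hw2.trans ?_
      rw [mul_left_comm]
      gcongr
      have := norm_nonneg (x 0)
      have := norm_nonneg (y 0)
      have := norm_nonneg (z 0)
      have : 0 ≤ ‖x 0‖ * ‖y 0‖ := by positivity
      have : 0 ≤ ‖x 0‖ * ‖z 0‖ := by positivity
      have : 0 ≤ ‖y 0‖ * ‖z 0‖ := by positivity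
      nlinarith)
  rw [abs_of_nonneg (norm_nonneg w)] at hfin
  linarith

/-! ### The transverse part at small frequencies -/

theorem norm_real_smul_le {a b : ℝ} (w : ℂ) (h : |a| ≤ b) : ‖(a : ℂ) * w‖ ≤ b * ‖w‖ := by
  rw [norm_mul, Complex.norm_real, Real.norm_eq_abs]
  exact mul_le_mul_of_nonneg_right h (norm_nonneg w)

theorem norm_add_three_le {a b c : ℂ} {A B C : ℝ} (ha : ‖a‖ ≤ A) (hb : ‖b‖ ≤ B) (hc : ‖c‖ ≤ C) :
    ‖a + b + c‖ ≤ A + B + C :=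
  (norm_add_le _ _).trans (add_le_add ((norm_add_le _ _).trans (add_le_add ha hb)) hc)

/-- Asymptotics of the factorization for small frequencies. -/
theorem IsModeFactorization.exists_low_frequency_bound {β μ : ℝ} (hβ : 0 < β) (hμ : 0 < μ) :
    ∃ r M c : ℝ, 0 < r ∧ r ≤ 1 ∧ 1 ≤ M ∧ 0 < c ∧ β ≤ M ∧ μ ≤ M ∧ ∀ k ν T D P,
      IsModeFactorization β μ k ν T D P → 0 < k → k ≤ r →
      c * k ^ 4 ≤ ν ∧ ν ≤ M * k ^ 4 ∧ T ≤ M * k ^ 2 ∧ k ^ 2 + ν ^ 2 ≤ M * k ^ 2 ∧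
      1 ≤ M * P ∧ 0 < P ∧ |ν ^ 2 - T * ν + k ^ 2| ≤ M * k ^ 2 ∧
      3 * (c * k ^ 2) * (D + T ^ 2) ≤ T * D ∧ (1 / M) ^ 2 ≤ D + T ^ 2 := by
  set S := 1 + μ ^ 2 + β ^ 2 with hS
  have hS0 : 0 < S := by positivity
  have hS1 : 1 ≤ S := by have := sq_nonneg μ; have := sq_nonneg β; linarith
  set M := 1 + β + μ + μ * (1 + μ ^ 2) / β ^ 2 + (1 + 2 * μ ^ 2) + 2 / β ^ 2 with hM
  have p1 : 0 ≤ μ * (1 + μ ^ 2) / β ^ 2 := by positivity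
  have p2 : 0 ≤ 2 / β ^ 2 := by positivity
  have p3 := sq_nonneg μ
  have hM1 : 1 ≤ M := by linarith
  -- For `k ≤ r` one has `μk² ≤ β/2`, hence `νT ≤ β²/4`. This keeps `D` and `P = ν² + k² + β² - 2νT`
  -- above `β²/2`, so that `-ν` stays away from the roots of the quadratic factor.
  set r := min 1 (β / (2 * μ)) with hr
  have hrβ : μ * r ≤ β / 2 := by
    have := min_le_right 1 (β / (2 * μ))
    rw [← hr, le_div_iff₀ (by positivity)] at this
    linarith
  set c := min (μ / S) (μ * β ^ 2 * (β ^ 2 / 2) / (3 * S * S)) with hc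
  have hc1 : c * S ≤ μ := by
    have := min_le_left (μ / S) (μ * β ^ 2 * (β ^ 2 / 2) / (3 * S * S))
    rwa [← hc, le_div_iff₀ (by positivity)] at this
  have hc2 : 3 * c * S * S ≤ μ * β ^ 2 * (β ^ 2 / 2) := by
    have := min_le_right (μ / S) (μ * β ^ 2 * (β ^ 2 / 2) / (3 * S * S))
    rw [← hc, le_div_iff₀ (by positivity)] at this
    linarith
  have hc0 : 0 < c := by positivity
  refine ⟨r, M, c, by positivity, min_le_left _ _, hM1, hc0, by linarith, by linarith,
    fun k ν T D P h hk hkr => ?_⟩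
  have hk1 : k ≤ 1 := hkr.trans (min_le_left _ _)
  have hk2 : k ^ 2 ≤ 1 := pow_le_one₀ hk.le hk1
  have hk0 : 0 < k ^ 2 := by positivity
  have hν := h.ν_pos
  have hT := h.T_pos
  have hadd := h.add_eq
  have hmul := h.mul_eq
  have hνa : ν ≤ μ * k ^ 2 := by linarith
  have hTa : T ≤ μ * k ^ 2 := by linarith
  have hν2 : ν ^ 2 ≤ μ ^ 2 * k ^ 2 := by
    calc ν ^ 2 ≤ (μ * k ^ 2) ^ 2 := by gcongr
      _ = μ ^ 2 * k ^ 2 * k ^ 2 := by ring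
      _ ≤ μ ^ 2 * k ^ 2 * 1 := by gcongr
      _ = _ := by ring
  have hN : ν ^ 2 + k ^ 2 ≤ (1 + μ ^ 2) * k ^ 2 := by linarith
  have hNS : ν ^ 2 + k ^ 2 + β ^ 2 ≤ S := by
    have : (1 + μ ^ 2) * k ^ 2 ≤ (1 + μ ^ 2) * 1 := by gcongr
    linarith
  have hνT : ν * T ≤ β ^ 2 / 4 := by
    have h1 : μ * k ^ 2 ≤ β / 2 := by
      calc μ * k ^ 2 = μ * k * k := by ring
        _ ≤ μ * r * 1 := by gcongr
        _ ≤ _ := by linarith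
    calc ν * T ≤ (β / 2) * (β / 2) := by
          apply mul_le_mul (by linarith) (by linarith) hT.le (by positivity)
      _ = _ := by ring
  have hνT0 : 0 < ν * T := by positivity
  have hDlow : β ^ 2 / 2 ≤ D := by rw [h.D_eq]; linarith
  have hPlow : β ^ 2 / 2 ≤ P := by
    rw [h.P_eq, h.D_eq]; have := sq_nonneg ν; linarith
  have hD0 : 0 < D := lt_of_lt_of_le (by positivity) hDlow
  have hP0 : 0 < P := lt_of_lt_of_le (by positivity) hPlow
  -- These two forms of the root equation carry the asymptotics: `ν² + k² + β²` lies between `β²`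
  -- and `S`, and `ν² + k²` is comparable to `k²`, so `ν ~ k⁴` and `T ~ k²`.
  have hroot : ν * (ν ^ 2 + k ^ 2 + β ^ 2) = μ * k ^ 2 * (ν ^ 2 + k ^ 2) := by
    rw [← hadd]; linarith
  have hrootT : T * (ν ^ 2 + k ^ 2 + β ^ 2) = μ * k ^ 2 * β ^ 2 := by
    rw [← hadd]; linarith
  have hTlow : μ * k ^ 2 * β ^ 2 ≤ T * S := by
    rw [← hrootT]; gcongr
  refine ⟨?_, ?_, ?_, ?_, ?_, hP0, ?_, ?_, ?_⟩
  · have h1 : μ * k ^ 2 * k ^ 2 ≤ ν * S := by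
      calc μ * k ^ 2 * k ^ 2 ≤ μ * k ^ 2 * (ν ^ 2 + k ^ 2) := by
            gcongr; have := sq_nonneg ν; linarith
        _ = ν * (ν ^ 2 + k ^ 2 + β ^ 2) := hroot.symm
        _ ≤ _ := by gcongr
    have h2 : c * k ^ 4 * S ≤ ν * S := by
      calc c * k ^ 4 * S = c * S * k ^ 4 := by ring
        _ ≤ μ * k ^ 4 := by gcongr
        _ = μ * k ^ 2 * k ^ 2 := by ring
        _ ≤ _ := h1
    exact le_of_mul_le_mul_right h2 hS0
  · have h1 : ν * β ^ 2 ≤ μ * (1 + μ ^ 2) / β ^ 2 * k ^ 4 * β ^ 2 := by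
      calc ν * β ^ 2 ≤ ν * (ν ^ 2 + k ^ 2 + β ^ 2) := by
            gcongr; have := sq_nonneg ν; linarith
        _ = μ * k ^ 2 * (ν ^ 2 + k ^ 2) := hroot
        _ ≤ μ * k ^ 2 * ((1 + μ ^ 2) * k ^ 2) := by gcongr
        _ = _ := by field_simp
    have h2 := le_of_mul_le_mul_right h1 (by positivity)
    refine h2.trans ?_
    gcongr
    linarith
  · refine hTa.trans ?_
    gcongr
    linarith
  · calc k ^ 2 + ν ^ 2 ≤ (1 + μ ^ 2) * k ^ 2 := by linarith
      _ ≤ _ := by gcongr; linarith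
  · calc (1 : ℝ) = 2 / β ^ 2 * (β ^ 2 / 2) := by field_simp
      _ ≤ M * P := by
        apply mul_le_mul (by linarith) hPlow (by positivity) (by linarith)
  · have h1 : T * ν ≤ μ ^ 2 * k ^ 2 := by
      calc T * ν ≤ μ * k ^ 2 * (μ * k ^ 2) := by gcongr
        _ = μ ^ 2 * k ^ 2 * k ^ 2 := by ring
        _ ≤ μ ^ 2 * k ^ 2 * 1 := by gcongr
        _ = _ := by ring
    have h2 : (1 + 2 * μ ^ 2) * k ^ 2 ≤ M * k ^ 2 := by gcongr; linarith
    have h3 := sq_nonneg ν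
    have h4 : 0 ≤ μ ^ 2 * k ^ 2 := by positivity
    rw [abs_le]
    constructor <;> linarith
  · have h1 : D + T ^ 2 ≤ S := by
      have h2 : T ^ 2 ≤ μ ^ 2 := by
        have : T ≤ μ := hTa.trans (mul_le_of_le_one_right hμ.le hk2)
        gcongr
      rw [h.D_eq]; linarith
    have h3 : 3 * (c * k ^ 2) * (D + T ^ 2) * S ≤ T * D * S := by
      calc 3 * (c * k ^ 2) * (D + T ^ 2) * S ≤ 3 * (c * k ^ 2) * S * S := by gcongr
        _ = 3 * c * S * S * k ^ 2 := by ring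
        _ ≤ μ * β ^ 2 * (β ^ 2 / 2) * k ^ 2 := by gcongr
        _ = μ * k ^ 2 * β ^ 2 * (β ^ 2 / 2) := by ring
        _ ≤ T * S * D := by gcongr
        _ = _ := by ring
    exact le_of_mul_le_mul_right h3 hS0
  · have h1 : 1 / M ≤ β ^ 2 / 2 := by
      rw [div_le_iff₀ (by linarith)]
      calc (1 : ℝ) = β ^ 2 / 2 * (2 / β ^ 2) := by field_simp
        _ ≤ _ := by gcongr; linarith
    have h2 : (1 / M) ≤ 1 := by rw [div_le_iff₀ (by linarith)]; linarith
    have h3 : 0 ≤ 1 / M := by positivity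
    calc (1 / M) ^ 2 ≤ 1 / M := by nlinarith
      _ ≤ D := h1.trans hDlow
      _ ≤ _ := by have := sq_nonneg T; linarith

/-- The rapidly decaying part of the low frequency bound. -/
theorem mode_sum_le {ν ρ c₁ c₂ t A B s f g K M : ℝ} (ht : 0 ≤ t) (hν : c₁ ≤ ν) (hρ : c₂ ≤ ρ)
    (hs : s ≤ M * A) (hA : 0 ≤ A) (hf : f ≤ M * B) (hg : g ≤ M * B) (hB : 0 ≤ B) (hM : 1 ≤ M)
    (hK : 1 / M ≤ K) :
    Real.exp (-(ν * t)) * s + Real.exp (-(ρ * t)) * (8 * (f + g / K)) ≤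
      16 * M ^ 2 * (Real.exp (-(c₂ * t)) * B + Real.exp (-(c₁ * t)) * A) := by
  have hM0 : 0 < M := by linarith
  have h1 : Real.exp (-(ν * t)) * s ≤ Real.exp (-(c₁ * t)) * (16 * M ^ 2 * A) := by
    have h2 : s ≤ 16 * M ^ 2 * A := by
      refine hs.trans ?_
      gcongr
      nlinarith
    calc Real.exp (-(ν * t)) * s ≤ Real.exp (-(ν * t)) * (16 * M ^ 2 * A) := by gcongr
      _ ≤ _ := by gcongr
  have h3 : 8 * (f + g / K) ≤ 16 * M ^ 2 * B := by
    have hK0 : 0 < K := lt_of_lt_of_le (by positivity) hK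
    have h4 : g / K ≤ M ^ 2 * B := by
      rw [div_le_iff₀ hK0]
      have h5 : M ^ 2 * B * (1 / M) ≤ M ^ 2 * B * K := by gcongr
      have h6 : M ^ 2 * B * (1 / M) = M * B := by field_simp
      linarith
    have h7 : M * B ≤ M ^ 2 * B := by
      gcongr; nlinarith
    linarith
  have h8 : Real.exp (-(ρ * t)) * (8 * (f + g / K)) ≤
      Real.exp (-(c₂ * t)) * (16 * M ^ 2 * B) := by
    calc Real.exp (-(ρ * t)) * (8 * (f + g / K)) ≤ Real.exp (-(ρ * t)) * (16 * M ^ 2 * B) := by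
          gcongr
      _ ≤ _ := by gcongr
  linarith

/-- Since `ν = O(k⁴)`, `T = O(k²)` and `P` is bounded below, every entry of the row defining `s` has
a definite power of `k`. These powers are the weights of the slow term `e^{-ck⁴t}`; the rest decays
at the rate `ck²` of the quadratic factor. -/
theorem IsElectromagneticFlow.exists_very_low_frequency_bound {β μ : ℝ} (hβ : 0 < β)
    (hμ : 0 < μ) :
    ∃ r c C : ℝ, 0 < r ∧ r ≤ 1 ∧ 0 < c ∧ 0 < C ∧ ∀ (k : ℝ) (x y z : ℝ → ℂ),
      IsElectromagneticFlow β μ k x y z → 0 < k → k ≤ r → ∀ t, 0 ≤ t →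
        ‖x t‖ ≤ C * (Real.exp (-(c * k ^ 2 * t)) * (‖x 0‖ + ‖y 0‖ + k * ‖z 0‖) +
          Real.exp (-(c * k ^ 4 * t)) * (k ^ 2 * ‖x 0‖ + k ^ 4 * ‖y 0‖ + k * ‖z 0‖)) ∧
        ‖y t‖ ≤ C * (Real.exp (-(c * k ^ 2 * t)) * (‖x 0‖ + ‖y 0‖ + k * ‖z 0‖) +
          Real.exp (-(c * k ^ 4 * t)) * (k ^ 4 * ‖x 0‖ + k ^ 6 * ‖y 0‖ + k ^ 3 * ‖z 0‖)) ∧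
        ‖z t‖ ≤ C * (Real.exp (-(c * k ^ 2 * t)) * (k * (‖x 0‖ + ‖y 0‖ + k * ‖z 0‖)) +
          Real.exp (-(c * k ^ 4 * t)) * (k * ‖x 0‖ + k ^ 3 * ‖y 0‖ + ‖z 0‖)) := by
  obtain ⟨r, M, c, hr, hr1, hM, hc, hβM, hμM, hmode⟩ :=
    IsModeFactorization.exists_low_frequency_bound hβ hμ
  refine ⟨r, c, 16 * (3 * M ^ 4) ^ 2, hr, hr1, hc, by positivity,
    fun k x y z hX hk hkr t ht => ?_⟩
  obtain ⟨ν, T, D, P, h⟩ := exists_isModeFactorization hβ hμ hk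
  obtain ⟨hν, hνM, hTM, hNM, hPM, hP, hPD, hρ, hKD⟩ := hmode k ν T D P h hk hkr
  have hM0 : 0 < M := by linarith
  have hk1 : k ≤ 1 := hkr.trans hr1
  have hK : 0 < 1 / M := by positivity
  have hνp := h.ν_pos
  have hTp := h.T_pos
  have hM2 : M ≤ M ^ 2 := by nlinarith
  have hM3 : M ^ 2 ≤ M ^ 3 := pow_le_pow_right₀ hM (by norm_num)
  have hM4 : M ^ 3 ≤ M ^ 4 := pow_le_pow_right₀ hM (by norm_num)
  set a := ‖x 0‖ with ha
  set b := ‖y 0‖ with hb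
  set d := ‖z 0‖ with hd
  have ha0 : 0 ≤ a := norm_nonneg _
  have hb0 : 0 ≤ b := norm_nonneg _
  have hd0 : 0 ≤ d := norm_nonneg _
  have hpw : ∀ m n : ℕ, m ≤ n → k ^ n ≤ k ^ m := fun m n hmn => pow_le_pow_of_le_one hk.le hk1 hmn
  have hk2 : k ^ 2 ≤ 1 := pow_le_one₀ hk.le hk1
  have hdiv : ∀ (s : ℂ) (X : ℝ), ‖s‖ ≤ M ^ 2 * X → 0 ≤ X → ‖s / P‖ ≤ M ^ 3 * X := by
    intro s X hs hX
    rw [norm_div, Complex.norm_real, Real.norm_of_nonneg hP.le, div_le_iff₀ hP]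
    calc ‖s‖ ≤ M ^ 2 * X * 1 := by linarith
      _ ≤ M ^ 2 * X * (M * P) := by gcongr
      _ = _ := by ring
  have hνk : ∀ (s : ℂ) (X : ℝ), ‖s / P‖ ≤ X → ‖ν * s / P‖ ≤ M * k ^ 4 * X := by
    intro s X hs
    rw [mul_div_assoc]
    refine (norm_real_smul_le _ (b := M * k ^ 4) ?_).trans (by gcongr)
    rwa [abs_of_pos hνp]
  have hfin : ∀ (s : ℂ) (A : ℝ), ‖s / P‖ ≤ M ^ 3 * A → 0 ≤ A → ‖s‖ / P ≤ 3 * M ^ 4 * A := by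
    intro s A hs hA
    rw [norm_div, Complex.norm_real, Real.norm_of_nonneg hP.le] at hs
    refine hs.trans ?_
    gcongr
    linarith
  have hμk : μ * k ^ 2 ≤ M := by
    calc μ * k ^ 2 ≤ M * 1 := by gcongr
      _ = M := mul_one M
  refine ⟨?_, ?_, ?_⟩
  · set s : ℂ := (k ^ 2 + ν ^ 2) * x 0 + ν * β * y 0 - β * k * z 0 with hs
    have hs1 : ‖s‖ ≤ M ^ 2 * (k ^ 2 * a + k ^ 4 * b + k * d) := by
      have e : s = ((k ^ 2 + ν ^ 2 : ℝ) : ℂ) * x 0 + ((ν * β : ℝ) : ℂ) * y 0 +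
        ((-(β * k) : ℝ) : ℂ) * z 0 := by rw [hs]; push_cast; ring
      rw [e]
      refine (norm_add_three_le (norm_real_smul_le _ (b := M ^ 2 * k ^ 2) ?_)
        (norm_real_smul_le _ (b := M ^ 2 * k ^ 4) ?_)
        (norm_real_smul_le _ (b := M ^ 2 * k) ?_)).trans (le_of_eq (by ring))
      · rw [abs_of_pos (by positivity)]
        exact hNM.trans (by gcongr)
      · rw [abs_of_pos (by positivity)]
        calc ν * β ≤ (M * k ^ 4) * M := by gcongr
          _ = _ := by ring
      · rw [abs_neg, abs_of_pos (by positivity)]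
        gcongr
        linarith
    have hA : 0 ≤ k ^ 2 * a + k ^ 4 * b + k * d := by positivity
    have hs2 := hdiv s _ hs1 hA
    have hAB : k ^ 2 * a + k ^ 4 * b + k * d ≤ a + b + k * d := by
      have h1 : k ^ 2 * a ≤ 1 * a := by gcongr
      have h2 : k ^ 4 * b ≤ 1 * b := by gcongr; exact pow_le_one₀ hk.le hk1
      linarith
    have hB : 0 ≤ a + b + k * d := by positivity
    refine (hX.norm_x_le h hk hP hρ hK hKD ht hs).trans ?_
    refine mode_sum_le ht hν le_rfl (hfin s _ hs2 hA) hA ?_ ?_ hB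
      (by linarith) (one_div_le_one_div_of_le hM0 (by linarith))
    · refine (norm_sub_le _ _).trans ?_
      have h1 : M ^ 3 * (k ^ 2 * a + k ^ 4 * b + k * d) ≤ M ^ 3 * (a + b + k * d) := by gcongr
      have h2 : M ^ 3 * (a + b + k * d) ≤ M ^ 4 * (a + b + k * d) := by gcongr
      have h3 : 1 * (a + b + k * d) ≤ M ^ 4 * (a + b + k * d) := by gcongr; linarith
      have h4 : 0 ≤ k * d := by positivity
      linarith
    · have h1 := hνk s _ hs2
      have h2 : M * k ^ 4 * (M ^ 3 * (k ^ 2 * a + k ^ 4 * b + k * d)) ≤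
          M * 1 * (M ^ 3 * (a + b + k * d)) := by
        gcongr; exact pow_le_one₀ hk.le hk1
      have e : -(μ * k ^ 2 * x 0) - β * y 0 + ν * s / P = ((-(μ * k ^ 2) : ℝ) : ℂ) * x 0 +
        ((-β : ℝ) : ℂ) * y 0 + ν * s / P := by push_cast; ring
      rw [e]
      refine (norm_add_three_le (norm_real_smul_le _ (b := M) ?_)
        (norm_real_smul_le _ (b := M) ?_) h1).trans ?_
      · rwa [abs_neg, abs_of_pos (by positivity)]
      · rwa [abs_neg, abs_of_pos (by positivity)]
      · have h3 : M * (a + b + k * d) ≤ M ^ 4 * (a + b + k * d) := by gcongr; linarith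
        have h4 : 0 ≤ M * (k * d) := by positivity
        have h5 : 0 ≤ M ^ 4 * (a + b + k * d) := by positivity
        linarith
  · set s : ℂ := -(ν * β * x 0) - ν * T * y 0 + k * T * z 0 with hs
    have hs1 : ‖s‖ ≤ M ^ 2 * (k ^ 4 * a + k ^ 6 * b + k ^ 3 * d) := by
      have e : s = ((-(ν * β) : ℝ) : ℂ) * x 0 + ((-(ν * T) : ℝ) : ℂ) * y 0 +
        ((k * T : ℝ) : ℂ) * z 0 := by rw [hs]; push_cast; ring
      rw [e]
      refine (norm_add_three_le (norm_real_smul_le _ (b := M ^ 2 * k ^ 4) ?_)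
        (norm_real_smul_le _ (b := M ^ 2 * k ^ 6) ?_)
        (norm_real_smul_le _ (b := M ^ 2 * k ^ 3) ?_)).trans (le_of_eq (by ring))
      · rw [abs_neg, abs_of_pos (by positivity)]
        calc ν * β ≤ (M * k ^ 4) * M := by gcongr
          _ = _ := by ring
      · rw [abs_neg, abs_of_pos (by positivity)]
        calc ν * T ≤ (M * k ^ 4) * (M * k ^ 2) := by gcongr
          _ = _ := by ring
      · rw [abs_of_pos (by positivity)]
        calc k * T ≤ k * (M * k ^ 2) := by gcongr
          _ = M * k ^ 3 := by ring
          _ ≤ _ := by gcongr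
    have hA : 0 ≤ k ^ 4 * a + k ^ 6 * b + k ^ 3 * d := by positivity
    have hs2 := hdiv s _ hs1 hA
    have hAB : k ^ 4 * a + k ^ 6 * b + k ^ 3 * d ≤ a + b + k * d := by
      have h1 : k ^ 4 * a ≤ 1 * a := by gcongr; exact pow_le_one₀ hk.le hk1
      have h2 : k ^ 6 * b ≤ 1 * b := by gcongr; exact pow_le_one₀ hk.le hk1
      have h3 : k ^ 3 * d ≤ k ^ 1 * d := by gcongr ?_ * d; exact hpw 1 3 (by norm_num)
      linarith
    have hB : 0 ≤ a + b + k * d := by positivity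
    refine (hX.norm_y_le h hk hP hρ hK hKD ht hs).trans ?_
    refine mode_sum_le ht hν le_rfl (hfin s _ hs2 hA) hA ?_ ?_ hB
      (by linarith) (one_div_le_one_div_of_le hM0 (by linarith))
    · refine (norm_sub_le _ _).trans ?_
      have h1 : M ^ 3 * (k ^ 4 * a + k ^ 6 * b + k ^ 3 * d) ≤ M ^ 3 * (a + b + k * d) := by gcongr
      have h2 : M ^ 3 * (a + b + k * d) ≤ M ^ 4 * (a + b + k * d) := by gcongr
      have h3 : 1 * (a + b + k * d) ≤ M ^ 4 * (a + b + k * d) := by gcongr; linarith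
      have h4 : 0 ≤ k * d := by positivity
      linarith
    · have h1 := hνk s _ hs2
      have h2 : M * k ^ 4 * (M ^ 3 * (k ^ 4 * a + k ^ 6 * b + k ^ 3 * d)) ≤
          M * 1 * (M ^ 3 * (a + b + k * d)) := by
        gcongr; exact pow_le_one₀ hk.le hk1
      refine (norm_add_three_le (norm_real_smul_le _ (b := M) ?_)
        (norm_real_smul_le _ (b := k) ?_) h1).trans ?_
      · rwa [abs_of_pos (by positivity)]
      · rw [abs_of_pos (by positivity)]
      · have h3 : M * (a + b + k * d) ≤ M ^ 4 * (a + b + k * d) := by gcongr; linarith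
        have h4 : 1 * (k * d) ≤ M * (k * d) := by gcongr
        have h5 : 0 ≤ M ^ 4 * (a + b + k * d) := by positivity
        have h6 : 0 ≤ M * b := by positivity
        linarith
  · set s : ℂ := -(k * β * x 0) - k * T * y 0 + (D - k ^ 2) * z 0 with hs
    have hDk : |D - k ^ 2| ≤ M ^ 2 := by
      have h1 := h.le_D
      have h2 := h.D_eq
      have h3 : 0 < ν * T := by positivity
      rw [abs_of_nonneg (by linarith)]
      calc D - k ^ 2 ≤ β ^ 2 := by linarith
        _ ≤ _ := by gcongr
    have hb1 : |(-(k * β) : ℝ)| ≤ M ^ 2 * k := by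
      rw [abs_neg, abs_of_pos (by positivity)]
      calc k * β ≤ k * M ^ 2 := by gcongr; linarith
        _ = _ := by ring
    have hb2 : |(-(k * T) : ℝ)| ≤ M ^ 2 * k ^ 3 := by
      rw [abs_neg, abs_of_pos (by positivity)]
      calc k * T ≤ k * (M * k ^ 2) := by gcongr
        _ = M * k ^ 3 := by ring
        _ ≤ _ := by gcongr
    have hs1 : ‖s‖ ≤ M ^ 2 * (k * a + k ^ 3 * b + d) := by
      have e : s = ((-(k * β) : ℝ) : ℂ) * x 0 + ((-(k * T) : ℝ) : ℂ) * y 0 +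
        ((D - k ^ 2 : ℝ) : ℂ) * z 0 := by rw [hs]; push_cast; ring
      rw [e]
      exact (norm_add_three_le (norm_real_smul_le _ hb1)
        (norm_real_smul_le _ hb2) (norm_real_smul_le _ hDk)).trans (le_of_eq (by ring))
    have hA : 0 ≤ k * a + k ^ 3 * b + d := by positivity
    have hs2 := hdiv s _ hs1 hA
    have hB : 0 ≤ k * (a + b + k * d) := by positivity
    have hAB : k ^ 4 * (k * a + k ^ 3 * b + d) ≤ k * (a + b + k * d) := by
      have h1 : k ^ 5 * a ≤ k ^ 1 * a := by gcongr ?_ * a; exact hpw 1 5 (by norm_num)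
      have h2 : k ^ 7 * b ≤ k ^ 1 * b := by gcongr ?_ * b; exact hpw 1 7 (by norm_num)
      have h3 : k ^ 4 * d ≤ k ^ 2 * d := by gcongr ?_ * d; exact hpw 2 4 (by norm_num)
      linarith
    refine (hX.norm_z_le h hk hP hρ hK hKD ht hs).trans ?_
    refine mode_sum_le ht hν le_rfl (hfin s _ hs2 hA) hA ?_ ?_ hB
      (by linarith) (one_div_le_one_div_of_le hM0 (by linarith))
    · have hPc : (P : ℂ) ≠ 0 := by exact_mod_cast hP.ne'
      -- A cancellation: the coefficient of `z 0` becomes `(P - (D - k²))/P = (ν² - Tν + k²)/P =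
      -- O(k²)`. Almost all of `z 0` lies on the slow mode, and only `k² ‖z 0‖` enters the
      -- `e^{-ck²t}` part.
      have e : z 0 - s / P = (((k * β : ℝ) : ℂ) * x 0 + ((k * T : ℝ) : ℂ) * y 0 +
        ((ν ^ 2 - T * ν + k ^ 2 : ℝ) : ℂ) * z 0) / P := by
        rw [eq_div_iff hPc, sub_mul, div_mul_cancel₀ _ hPc, hs, h.P_eq]; push_cast; ring
      rw [e]
      have h1 : M ^ 3 * (k * (a + b + k * d)) ≤ 3 * M ^ 4 * (k * (a + b + k * d)) := by
        gcongr; linarith [pow_pos hM0 4]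
      refine (hdiv _ (k * (a + b + k * d)) ?_ hB).trans h1
      rw [abs_neg] at hb1 hb2
      refine (norm_add_three_le (norm_real_smul_le _ hb1) (norm_real_smul_le _ hb2)
        (norm_real_smul_le _ hPD)).trans ?_
      have h2 : M ^ 2 * k ^ 3 * b ≤ M ^ 2 * k ^ 1 * b := by
        gcongr ?_ * ?_ * b; exact hpw 1 3 (by norm_num)
      have h3 : M * k ^ 2 * d ≤ M ^ 2 * k ^ 2 * d := by gcongr
      linarith
    · have h1 := hνk s _ hs2
      have h2 : M * k ^ 4 * (M ^ 3 * (k * a + k ^ 3 * b + d)) ≤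
          M ^ 4 * (k * (a + b + k * d)) := by
        calc M * k ^ 4 * (M ^ 3 * (k * a + k ^ 3 * b + d)) =
            M ^ 4 * (k ^ 4 * (k * a + k ^ 3 * b + d)) := by ring
          _ ≤ _ := by gcongr
      refine (norm_add_le _ _).trans ?_
      have h3 : ‖-((k : ℂ) * y 0)‖ ≤ k * b := by
        rw [norm_neg]; exact norm_real_smul_le _ (abs_of_pos hk).le
      have h4 : 1 * (k * (a + b + k * d)) ≤ M ^ 4 * (k * (a + b + k * d)) := by gcongr; linarith
      have h5 : 0 ≤ k * a := by positivity
      have h6 : 0 ≤ k * (k * d) := by positivity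
      linarith

/-! ### The transverse part at large frequencies -/

/-- Asymptotics of the factorization for large frequencies. -/
theorem IsModeFactorization.exists_high_frequency_bound {β μ : ℝ} (hβ : 0 < β) (hμ : 0 < μ) :
    ∃ R M c : ℝ, 1 ≤ R ∧ 1 ≤ M ∧ 0 < c ∧ β ≤ M ∧ ∀ k ν T D P,
      IsModeFactorization β μ k ν T D P → R ≤ k →
      c / k ^ 2 ≤ ν ∧ k ^ 2 ≤ M * ν ∧ ν ^ 2 ≤ M * P ∧ 1 ≤ M * P ∧ 0 < P ∧ ν * T ≤ M ∧ k * T ≤ M ∧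
      |P - ν ^ 2| ≤ M * k ^ 2 ∧ |D - k ^ 2| ≤ M ∧
      3 * (c / k ^ 2) * (D + T ^ 2) ≤ T * D ∧ k ^ 2 ≤ D + T ^ 2 := by
  set c₀ := μ / (1 + β ^ 2) with hc₀
  have hc₀0 : 0 < c₀ := by positivity
  have hc₀1 : c₀ * (1 + β ^ 2) = μ := div_mul_cancel₀ _ (by positivity)
  set cT := β ^ 2 / (μ + 1 / c₀) with hcT
  have hcT0 : 0 < cT := by positivity
  set M := 2 + β + 1 / c₀ + 2 * β ^ 2 with hM
  have p1 : 0 < 1 / c₀ := by positivity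
  have p2 := sq_nonneg β
  have hM1 : 1 ≤ M := by linarith
  set c := min c₀ (cT / (3 * (1 + M ^ 2))) with hc
  have hc0 : 0 < c := by positivity
  have hc1 : c ≤ c₀ := min_le_left _ _
  have hc2 : 3 * c * (1 + M ^ 2) ≤ cT := by
    have := min_le_right c₀ (cT / (3 * (1 + M ^ 2)))
    rw [← hc, le_div_iff₀ (by positivity)] at this
    linarith
  -- The threshold gives `k² ≥ 2β²`. Together with `νT ≤ β²` it makes `P = ν² + k² + β² - 2νT` at
  -- least `(ν² + k²)/2`.
  refine ⟨1 + 2 * β ^ 2, M, c, by linarith, hM1, hc0, by linarith, fun k ν T D P h hkR => ?_⟩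
  have hk1 : 1 ≤ k := by linarith
  have hk : 0 < k := by linarith
  have hk2 : k ≤ k ^ 2 := by nlinarith
  have hν := h.ν_pos
  have hT := h.T_pos
  have hadd := h.add_eq
  have hmul := h.mul_eq
  have hνa : ν ≤ μ * k ^ 2 := by linarith
  have hroot : ν * (ν ^ 2 + k ^ 2 + β ^ 2) = μ * k ^ 2 * (ν ^ 2 + k ^ 2) := by
    rw [← hadd]; linarith
  have hN1 : 1 ≤ ν ^ 2 + k ^ 2 := by have := sq_nonneg ν; linarith
  have hN : 2 * β ^ 2 ≤ ν ^ 2 + k ^ 2 := by have := sq_nonneg ν; linarith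
  -- As `ν² + k² ≥ 1`, the denominator `ν² + k² + β²` in the root equation is at most `(1 + β²)(ν² +
  -- k²)`, which gives `ν ≥ μk²/(1 + β²)`.
  have hνlow : c₀ * k ^ 2 ≤ ν := by
    have h1 : c₀ * k ^ 2 * (ν ^ 2 + k ^ 2 + β ^ 2) ≤ ν * (ν ^ 2 + k ^ 2 + β ^ 2) := by
      rw [hroot]
      calc c₀ * k ^ 2 * (ν ^ 2 + k ^ 2 + β ^ 2) ≤
          c₀ * k ^ 2 * ((1 + β ^ 2) * (ν ^ 2 + k ^ 2)) := by
            gcongr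
            have := mul_le_mul_of_nonneg_left hN1 p2
            linarith
        _ = c₀ * (1 + β ^ 2) * k ^ 2 * (ν ^ 2 + k ^ 2) := by ring
        _ = _ := by rw [hc₀1]
    exact le_of_mul_le_mul_right h1 (by positivity)
  have hTν : T * ν ≤ β ^ 2 := by
    have h2 : T * ν ^ 2 ≤ ν * β ^ 2 := by
      have := mul_nonneg hT.le (sq_nonneg k)
      linarith
    have h3 : ν * (T * ν) ≤ ν * β ^ 2 := by linarith
    exact le_of_mul_le_mul_left h3 hν
  have hkT : k * T ≤ β ^ 2 := by
    have h1 : 2 * (ν * k) ≤ ν ^ 2 + k ^ 2 := by nlinarith [sq_nonneg (ν - k)]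
    have h2 : T * (2 * (ν * k)) ≤ ν * β ^ 2 := by
      rw [← hmul]; gcongr
    have h3 : 0 ≤ k * T * ν := by positivity
    have h4 : ν * (k * T) ≤ ν * β ^ 2 := by linarith
    exact le_of_mul_le_mul_left h4 hν
  have hDlow : k ^ 2 ≤ D := h.le_D
  have hD0 : 0 < D := lt_of_lt_of_le (by positivity) hDlow
  have hνT0 : 0 < ν * T := by positivity
  have hPN : (ν ^ 2 + k ^ 2) / 2 ≤ P := by
    rw [h.P_eq, h.D_eq]; linarith
  have hkk : k ^ 2 ≤ 1 / c₀ * ν := by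
    calc k ^ 2 = 1 / c₀ * (c₀ * k ^ 2) := by field_simp
      _ ≤ _ := by gcongr
  have hP0 : 0 < P := lt_of_lt_of_le (by positivity) hPN
  have hPM : 2 * P ≤ M * P := by gcongr; linarith
  refine ⟨?_, ?_, ?_, ?_, hP0, by linarith, by linarith, ?_, ?_, ?_, ?_⟩
  · calc c / k ^ 2 ≤ c := div_le_self hc0.le (by linarith)
      _ ≤ c₀ * 1 := by linarith
      _ ≤ c₀ * k ^ 2 := by gcongr; linarith
      _ ≤ ν := hνlow
  · refine hkk.trans ?_
    gcongr
    linarith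
  · have := sq_nonneg k
    linarith
  · linarith
  · rw [h.P_eq, h.D_eq]
    have h1 : (1 + 2 * β ^ 2) * k ^ 2 ≤ M * k ^ 2 := by gcongr; linarith
    have h2 : β ^ 2 * 1 ≤ β ^ 2 * k ^ 2 := by gcongr; linarith
    rw [abs_le]
    constructor <;> linarith
  · rw [h.D_eq, abs_le]
    constructor <;> linarith
  · have h1 : cT ≤ T * k ^ 2 := by
      rw [hcT, div_le_iff₀ (by positivity)]
      have h2 : ν ^ 2 + k ^ 2 ≤ ν * ((μ + 1 / c₀) * k ^ 2) := by
        have h3 : ν * ν ≤ ν * (μ * k ^ 2) := by gcongr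
        have h4 : 1 / c₀ * ν * 1 ≤ 1 / c₀ * ν * k ^ 2 := by gcongr; linarith
        linarith
      have h5 : ν * β ^ 2 ≤ ν * (T * k ^ 2 * (μ + 1 / c₀)) := by
        rw [← hmul]
        calc T * (ν ^ 2 + k ^ 2) ≤ T * (ν * ((μ + 1 / c₀) * k ^ 2)) := by gcongr
          _ = _ := by ring
      exact le_of_mul_le_mul_left h5 hν
    have hTM : T ≤ M := by
      have : 1 * T ≤ k * T := by gcongr
      linarith
    have h6 : D + T ^ 2 ≤ (1 + M ^ 2) * D := by
      have h7 : T ^ 2 ≤ M ^ 2 := by gcongr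
      have h8 : M ^ 2 * 1 ≤ M ^ 2 * D := by gcongr; linarith
      linarith
    calc 3 * (c / k ^ 2) * (D + T ^ 2) ≤ 3 * (c / k ^ 2) * ((1 + M ^ 2) * D) := by gcongr
      _ = 3 * c * (1 + M ^ 2) / k ^ 2 * D := by ring
      _ ≤ T * k ^ 2 / k ^ 2 * D := by
        gcongr ?_ / _ * _
        exact hc2.trans h1
      _ = _ := by field_simp
  · have := sq_nonneg T
    linarith

/-- Now `-ν ~ -k²` is the fast root and the quadratic factor is slow, with `T ~ k⁻²`. Velocities are
measured on the scale `K = k`. The weight `k⁻²` on `x 0` uses that `νk²` and `k⁴` are `O(P)`. -/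
theorem IsElectromagneticFlow.exists_very_high_frequency_bound {β μ : ℝ} (hβ : 0 < β)
    (hμ : 0 < μ) :
    ∃ R c C : ℝ, 1 ≤ R ∧ 0 < c ∧ 0 < C ∧ ∀ (k : ℝ) (x y z : ℝ → ℂ),
      IsElectromagneticFlow β μ k x y z → R ≤ k → ∀ t, 0 ≤ t →
        ‖y t‖ ≤ C * (Real.exp (-(c / k ^ 2 * t)) * (‖x 0‖ / k ^ 2 + ‖y 0‖ + ‖z 0‖)) ∧
        ‖z t‖ ≤ C * (Real.exp (-(c / k ^ 2 * t)) * (‖x 0‖ / k ^ 2 + ‖y 0‖ + ‖z 0‖)) := by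
  obtain ⟨R, M, c, hR, hM, hc, hβM, hmode⟩ :=
    IsModeFactorization.exists_high_frequency_bound hβ hμ
  refine ⟨R, c, 16 * (3 * M ^ 5) ^ 2 * 2, hR, hc, by positivity,
    fun k x y z hX hkR t ht => ?_⟩
  have hk1 : 1 ≤ k := hR.trans hkR
  have hk : 0 < k := by linarith
  obtain ⟨ν, T, D, P, h⟩ := exists_isModeFactorization hβ hμ hk
  obtain ⟨hν, hkν, hνP, hPM, hP, hνT, hkT, hPν, hDk, hρ, hKD⟩ := hmode k ν T D P h hkR
  have hM0 : 0 < M := by linarith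
  have hνp := h.ν_pos
  have hTp := h.T_pos
  have hpow : ∀ m n : ℕ, m ≤ n → M ^ m ≤ M ^ n := fun m n hmn => pow_le_pow_right₀ hM hmn
  set a := ‖x 0‖ with ha
  set b := ‖y 0‖ with hb
  set d := ‖z 0‖ with hd
  have ha0 : 0 ≤ a := norm_nonneg _
  have hb0 : 0 ≤ b := norm_nonneg _
  have hd0 : 0 ≤ d := norm_nonneg _
  set A := a / k ^ 2 + b + d with hA
  have ha' : 0 ≤ a / k ^ 2 := by positivity
  have hA0 : 0 ≤ A := by positivity
  have hνk2 : ν * k ^ 2 ≤ M ^ 2 * P := by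
    calc ν * k ^ 2 ≤ ν * (M * ν) := by gcongr
      _ = M * ν ^ 2 := by ring
      _ ≤ M * (M * P) := by gcongr
      _ = _ := by ring
  have hk4 : k ^ 4 ≤ M ^ 3 * P := by
    calc k ^ 4 = k ^ 2 * k ^ 2 := by ring
      _ ≤ M * ν * k ^ 2 := by gcongr
      _ = M * (ν * k ^ 2) := by ring
      _ ≤ M * (M ^ 2 * P) := by gcongr
      _ = _ := by ring
  have hcoef : ∀ (e L : ℝ) (w : ℂ), |e| ≤ L * P → ‖((e / P : ℝ) : ℂ) * w‖ ≤ L * ‖w‖ := by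
    intro e L w he
    refine norm_real_smul_le w ?_
    rwa [abs_div, abs_of_pos hP, div_le_iff₀ hP]
  have hcoefk : ∀ (e L : ℝ), |e| * k ^ 2 ≤ L * P → ‖((e / P : ℝ) : ℂ) * x 0‖ ≤ L * (a / k ^ 2) := by
    intro e L he
    have h1 : |e| ≤ L / k ^ 2 * P := by
      rw [div_mul_eq_mul_div, le_div_iff₀ (by positivity)]; exact he
    exact (hcoef e _ _ h1).trans (le_of_eq (by ring))
  have hgk : ∀ (g : ℂ) (L : ℝ), ‖g‖ ≤ k * L → ‖g‖ / k ≤ 1 * L := by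
    intro g L hg
    rw [div_le_iff₀ hk]; linarith
  have hsum : ∀ (s g f : ℂ), ‖s‖ / P ≤ 3 * M ^ 5 * A → ‖f‖ ≤ 3 * M ^ 5 * A →
      ‖g‖ / k ≤ 3 * M ^ 5 * A →
      Real.exp (-(ν * t)) * (‖s‖ / P) + Real.exp (-(c / k ^ 2 * t)) * (8 * (‖f‖ + ‖g‖ / k)) ≤
        16 * (3 * M ^ 5) ^ 2 * 2 * (Real.exp (-(c / k ^ 2 * t)) * A) := by
    intro s g f h1 h2 h3
    have h4 : 1 ≤ 3 * M ^ 5 := by linarith [one_le_pow₀ hM (n := 5)]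
    have h5 := mode_sum_le (K := 1) (M := 3 * M ^ 5) ht hν (le_refl (c / k ^ 2)) h1 hA0 h2 h3 hA0
      h4 (by rw [div_le_iff₀ (by linarith)]; linarith)
    rw [div_one] at h5
    linarith
  have hM5 : 1 ≤ M ^ 5 := one_le_pow₀ hM
  have h15 := hpow 1 5 (by norm_num)
  have h25 := hpow 2 5 (by norm_num)
  have h35 := hpow 3 5 (by norm_num)
  have h45 := hpow 4 5 (by norm_num)
  rw [pow_one] at h15
  have hPc : (P : ℂ) ≠ 0 := by exact_mod_cast hP.ne'
  have hνP' : ν * 1 ≤ M ^ 2 * P := by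
    refine le_trans ?_ hνk2; gcongr; exact one_le_pow₀ hk1
  have hscale : ∀ L, L ≤ M ^ 5 → 0 ≤ L → L * A ≤ M ^ 5 * A := fun L hL _ => by gcongr
  have hfin3 : ∀ {L : ℝ} {u v w : ℂ}, L ≤ M ^ 5 → ‖u‖ ≤ L * (a / k ^ 2) → ‖v‖ ≤ L * b →
      ‖w‖ ≤ L * d → ‖u + v + w‖ ≤ M ^ 5 * A := by
    intro L u v w hL hu hv hw
    refine (norm_add_three_le hu hv hw).trans ?_
    calc L * (a / k ^ 2) + L * b + L * d = L * A := by rw [hA]; ring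
      _ ≤ _ := by gcongr
  have hyA : b ≤ M ^ 5 * A := by
    calc b ≤ 1 * A := by linarith
      _ ≤ _ := by gcongr
  have hzA : d ≤ M ^ 5 * A := by
    calc d ≤ 1 * A := by linarith
      _ ≤ _ := by gcongr
  have hMA : 0 ≤ M ^ 5 * A := by positivity
  have hνTP : ν * T ≤ M ^ 2 * P := by
    calc ν * T ≤ M * 1 := by linarith
      _ ≤ M * (M * P) := by gcongr
      _ = _ := by ring
  have hkTP : k * T ≤ M ^ 2 * P := by
    calc k * T ≤ M * 1 := by linarith
      _ ≤ M * (M * P) := by gcongr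
      _ = _ := by ring
  have hkk : k ≤ k ^ 2 := by nlinarith
  constructor
  · set s : ℂ := -(ν * β * x 0) - ν * T * y 0 + k * T * z 0 with hs
    have hs1 : ‖s / P‖ ≤ M ^ 5 * A := by
      have e : s / P = ((-(ν * β) / P : ℝ) : ℂ) * x 0 + ((-(ν * T) / P : ℝ) : ℂ) * y 0 +
        ((k * T / P : ℝ) : ℂ) * z 0 := by rw [hs]; push_cast; field_simp; ring
      rw [e]
      refine hfin3 h35 (hcoefk _ _ ?_) (hcoef _ _ _ ?_) (hcoef _ _ _ ?_)
      · rw [abs_neg, abs_of_pos (by positivity)]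
        calc ν * β * k ^ 2 = β * (ν * k ^ 2) := by ring
          _ ≤ M * (M ^ 2 * P) := by gcongr
          _ = _ := by ring
      · rw [abs_neg, abs_of_pos (by positivity)]
        refine hνTP.trans ?_
        gcongr
        norm_num
      · rw [abs_of_pos (by positivity)]
        refine hkTP.trans ?_
        gcongr
        norm_num
    have hs2 : ‖s‖ / P ≤ M ^ 5 * A := by
      rwa [norm_div, Complex.norm_real, Real.norm_of_nonneg hP.le] at hs1
    refine (hX.norm_y_le h hk hP hρ hk hKD ht hs).trans (hsum _ _ _ (by linarith) ?_ ?_)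
    · refine (norm_sub_le _ _).trans ?_
      linarith
    · refine (hgk _ (3 * M ^ 5 * A) ?_).trans (by linarith)
      -- The term `β x 0` alone has no gain in `k`. Combined with the matching part of `νs/P` its
      -- coefficient becomes `β(P - ν²)/P`, where `P - ν² = O(k²)` while `P` is at least of order
      -- `k⁴`.
      have e : β * x 0 + k * z 0 + ν * s / P = ((β * (P - ν ^ 2) / P : ℝ) : ℂ) * x 0 +
        (((-(ν * (ν * T)) / P : ℝ) : ℂ) * y 0 + (((k * (ν * T)) / P : ℝ) : ℂ) * z 0) + k * z 0 := by
        rw [hs]; push_cast; field_simp; ring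
      rw [e]
      have g1 : ‖((β * (P - ν ^ 2) / P : ℝ) : ℂ) * x 0‖ ≤ k * (M ^ 5 * (a / k ^ 2)) := by
        refine (hcoefk _ (M ^ 5) ?_).trans (le_mul_of_one_le_left (by positivity) hk1)
        rw [abs_mul, abs_of_pos hβ]
        calc β * |P - ν ^ 2| * k ^ 2 ≤ M * (M * k ^ 2) * k ^ 2 := by gcongr
          _ = M ^ 2 * k ^ 4 := by ring
          _ ≤ M ^ 2 * (M ^ 3 * P) := by gcongr
          _ = _ := by ring
      have g2 : ‖((-(ν * (ν * T)) / P : ℝ) : ℂ) * y 0‖ ≤ k * (M ^ 5 * b) := by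
        refine (hcoef _ (M ^ 5) _ ?_).trans (le_mul_of_one_le_left (by positivity) hk1)
        rw [abs_neg, abs_of_pos (by positivity)]
        calc ν * (ν * T) ≤ (M ^ 2 * P) * M := by
              apply mul_le_mul (by linarith) hνT (by positivity) (by positivity)
          _ = M ^ 3 * P := by ring
          _ ≤ _ := by gcongr
      have g3 : ‖(((k * (ν * T)) / P : ℝ) : ℂ) * z 0‖ ≤ k * (M ^ 5 * d) := by
        refine (hcoef _ (k * M ^ 5) _ ?_).trans (le_of_eq (by ring))
        rw [abs_of_pos (by positivity)]
        calc k * (ν * T) ≤ k * (M ^ 2 * P) := by gcongr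
          _ ≤ k * (M ^ 5 * P) := by gcongr
          _ = _ := by ring
      have g4 : ‖(k : ℂ) * z 0‖ ≤ k * d := norm_real_smul_le _ (abs_of_pos hk).le
      have g5 := norm_add_three_le g1 ((norm_add_le _ _).trans (add_le_add g2 g3)) g4
      refine g5.trans ?_
      have g6 : k * d ≤ k * (M ^ 5 * A) := by gcongr
      have g7 : k * (M ^ 5 * A) = k * (M ^ 5 * (a / k ^ 2)) + k * (M ^ 5 * b) +
        k * (M ^ 5 * d) := by rw [hA]; ring
      have g8 : 0 ≤ k * (M ^ 5 * A) := by positivity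
      linarith
  · set s : ℂ := -(k * β * x 0) - k * T * y 0 + (D - k ^ 2) * z 0 with hs
    have q1 : |-(k * β)| * k ^ 2 ≤ M ^ 4 * P := by
      rw [abs_neg, abs_of_pos (by positivity)]
      calc k * β * k ^ 2 ≤ k ^ 2 * M * k ^ 2 := by gcongr
        _ = M * k ^ 4 := by ring
        _ ≤ M * (M ^ 3 * P) := by gcongr
        _ = _ := by ring
    have hs1 : ‖s / P‖ ≤ M ^ 5 * A := by
      have e : s / P = ((-(k * β) / P : ℝ) : ℂ) * x 0 + ((-(k * T) / P : ℝ) : ℂ) * y 0 +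
        (((D - k ^ 2) / P : ℝ) : ℂ) * z 0 := by rw [hs]; push_cast; field_simp; ring
      rw [e]
      refine hfin3 h45 (hcoefk _ _ q1) (hcoef _ _ _ ?_) (hcoef _ _ _ ?_)
      · rw [abs_neg, abs_of_pos (by positivity)]
        refine hkTP.trans ?_
        gcongr
        norm_num
      · calc |D - k ^ 2| ≤ M * 1 := by linarith
          _ ≤ M * (M * P) := by gcongr
          _ = M ^ 2 * P := by ring
          _ ≤ _ := by gcongr; norm_num
    have hs2 : ‖s‖ / P ≤ M ^ 5 * A := by
      rwa [norm_div, Complex.norm_real, Real.norm_of_nonneg hP.le] at hs1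
    refine (hX.norm_z_le h hk hP hρ hk hKD ht hs).trans (hsum _ _ _ (by linarith) ?_ ?_)
    · refine (norm_sub_le _ _).trans ?_
      linarith
    · refine (hgk _ (3 * M ^ 5 * A) ?_).trans (by linarith)
      have e : -(k * y 0) + ν * s / P = ((k * (-(ν * β)) / P : ℝ) : ℂ) * x 0 +
        (((-(k * (ν * T)) / P : ℝ) : ℂ) * y 0 + ((ν * (D - k ^ 2) / P : ℝ) : ℂ) * z 0) +
        ((-k : ℝ) : ℂ) * y 0 := by
        rw [hs]; push_cast; field_simp; ring
      rw [e]
      have g1 : ‖((k * (-(ν * β)) / P : ℝ) : ℂ) * x 0‖ ≤ k * (M ^ 5 * (a / k ^ 2)) := by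
        refine (hcoefk _ (k * M ^ 5) ?_).trans (le_of_eq (by ring))
        rw [mul_neg, abs_neg, abs_of_pos (by positivity)]
        calc k * (ν * β) * k ^ 2 = k * (β * (ν * k ^ 2)) := by ring
          _ ≤ k * (M * (M ^ 2 * P)) := by gcongr
          _ = k * M ^ 3 * P := by ring
          _ ≤ k * M ^ 5 * P := by gcongr
      have g2 : ‖((-(k * (ν * T)) / P : ℝ) : ℂ) * y 0‖ ≤ k * (M ^ 5 * b) := by
        refine (hcoef _ (k * M ^ 5) _ ?_).trans (le_of_eq (by ring))
        rw [abs_neg, abs_of_pos (by positivity)]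
        calc k * (ν * T) ≤ k * (M ^ 2 * P) := by gcongr
          _ ≤ k * (M ^ 5 * P) := by gcongr
          _ = _ := by ring
      have g3 : ‖((ν * (D - k ^ 2) / P : ℝ) : ℂ) * z 0‖ ≤ k * (M ^ 5 * d) := by
        refine (hcoef _ (M ^ 5) _ ?_).trans (le_mul_of_one_le_left (by positivity) hk1)
        rw [abs_mul, abs_of_pos hνp]
        calc ν * |D - k ^ 2| ≤ (M ^ 2 * P) * M := by
              apply mul_le_mul (by linarith) hDk (by positivity) (by positivity)
          _ = M ^ 3 * P := by ring
          _ ≤ _ := by gcongr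
      have g4 : ‖((-k : ℝ) : ℂ) * y 0‖ ≤ k * b :=
        norm_real_smul_le _ (by rw [abs_neg, abs_of_pos hk])
      have g5 := norm_add_three_le g1 ((norm_add_le _ _).trans (add_le_add g2 g3)) g4
      refine g5.trans ?_
      have g6 : k * b ≤ k * (M ^ 5 * A) := by gcongr
      have g7 : k * (M ^ 5 * A) = k * (M ^ 5 * (a / k ^ 2)) + k * (M ^ 5 * b) +
        k * (M ^ 5 * d) := by rw [hA]; ring
      have g8 : 0 ≤ k * (M ^ 5 * A) := by positivity
      linarith

/-! ### The transverse part on the full ranges `k ≤ 1` and `k ≥ 1` -/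

theorem exp_neg_mul_le {c c' t : ℝ} (h : c ≤ c') (ht : 0 ≤ t) :
    Real.exp (-(c' * t)) ≤ Real.exp (-(c * t)) := by
  gcongr

/-- On `r ≤ k ≤ 1` the uniform decay `e^{-c₂t}` is stronger than needed, and the powers of `k` in
the `e^{-ck²t}` term are bounded below by `r²`, so that term alone absorbs the estimate. -/
theorem IsElectromagneticFlow.exists_low_frequency_bound {β μ : ℝ} (hβ : 0 < β) (hμ : 0 < μ) :
    ∃ c C : ℝ, 0 < c ∧ 0 < C ∧ ∀ (k : ℝ) (x y z : ℝ → ℂ),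
      IsElectromagneticFlow β μ k x y z → 0 < k → k ≤ 1 → ∀ t, 0 ≤ t →
        ‖x t‖ ≤ C * (Real.exp (-(c * k ^ 2 * t)) * (‖x 0‖ + ‖y 0‖ + k * ‖z 0‖) +
          Real.exp (-(c * k ^ 4 * t)) * (k ^ 2 * ‖x 0‖ + k ^ 4 * ‖y 0‖ + k * ‖z 0‖)) ∧
        ‖y t‖ ≤ C * (Real.exp (-(c * k ^ 2 * t)) * (‖x 0‖ + ‖y 0‖ + k * ‖z 0‖) +
          Real.exp (-(c * k ^ 4 * t)) * (k ^ 4 * ‖x 0‖ + k ^ 6 * ‖y 0‖ + k ^ 3 * ‖z 0‖)) ∧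
        ‖z t‖ ≤ C * (Real.exp (-(c * k ^ 2 * t)) * (k * (‖x 0‖ + ‖y 0‖ + k * ‖z 0‖)) +
          Real.exp (-(c * k ^ 4 * t)) * (k * ‖x 0‖ + k ^ 3 * ‖y 0‖ + ‖z 0‖)) := by
  obtain ⟨r, c₁, C₁, hr, hr1, hc₁, hC₁, h₁⟩ := exists_very_low_frequency_bound hβ hμ
  obtain ⟨c₂, hc₂, h₂⟩ := exists_middle_frequency_bound hβ hμ hr one_pos
  set c := min c₁ c₂ with hc
  have hcc₁ : c ≤ c₁ := min_le_left _ _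
  have hcc₂ : c ≤ c₂ := min_le_right _ _
  have hc0 : 0 < c := by positivity
  refine ⟨c, C₁ + 2 / r ^ 2, hc0, by positivity, fun k x y z hX hk hk1 t ht => ?_⟩
  have hk2 : k ^ 2 ≤ 1 := pow_le_one₀ hk.le hk1
  set a := ‖x 0‖ with ha
  set b := ‖y 0‖ with hb
  set d := ‖z 0‖ with hd
  have ha0 : 0 ≤ a := norm_nonneg _
  have hb0 : 0 ≤ b := norm_nonneg _
  have hd0 : 0 ≤ d := norm_nonneg _
  have hr2 : 0 < r ^ 2 := by positivity
  rcases le_total k r with hkr | hkr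
  · have key : ∀ w A B : ℝ, 0 ≤ A → 0 ≤ B → w ≤ C₁ * (Real.exp (-(c₁ * k ^ 2 * t)) * A +
        Real.exp (-(c₁ * k ^ 4 * t)) * B) → w ≤ (C₁ + 2 / r ^ 2) * (Real.exp (-(c * k ^ 2 * t)) * A +
        Real.exp (-(c * k ^ 4 * t)) * B) := by
      intro w A B hA hB hw
      refine hw.trans ?_
      gcongr
      have : 0 < 2 / r ^ 2 := by positivity
      linarith
    obtain ⟨h1, h2, h3⟩ := h₁ k x y z hX hk hkr t ht
    exact ⟨key _ _ _ (by positivity) (by positivity) h1,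
      key _ _ _ (by positivity) (by positivity) h2, key _ _ _ (by positivity) (by positivity) h3⟩
  · have key : ∀ w A B : ℝ, 0 ≤ A → 0 ≤ B → r ^ 2 * (a + b + d) ≤ A →
        w ≤ 2 * (Real.exp (-(c₂ * t)) * (a + b + d)) →
        w ≤ (C₁ + 2 / r ^ 2) * (Real.exp (-(c * k ^ 2 * t)) * A +
        Real.exp (-(c * k ^ 4 * t)) * B) := by
      intro w A B hA hB hAB hw
      have h1 : Real.exp (-(c₂ * t)) ≤ Real.exp (-(c * k ^ 2 * t)) := by
        refine exp_neg_mul_le ?_ ht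
        calc c * k ^ 2 ≤ c * 1 := by gcongr
          _ ≤ c₂ := by linarith
      have h2 : a + b + d ≤ 1 / r ^ 2 * A := by
        rw [one_div_mul_eq_div, le_div_iff₀ hr2]; linarith
      calc w ≤ 2 * (Real.exp (-(c * k ^ 2 * t)) * (1 / r ^ 2 * A)) := hw.trans (by gcongr)
        _ = (0 + 2 / r ^ 2) * (Real.exp (-(c * k ^ 2 * t)) * A + 0) := by ring
        _ ≤ _ := by gcongr; positivity
    have hrk : r ^ 2 ≤ r := by nlinarith
    have hr3 : r ^ 2 ≤ k ^ 2 := by gcongr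
    have e1 : r ^ 2 * (a + b + d) ≤ a + b + k * d := by
      have g1 : r ^ 2 * a ≤ 1 * a := by gcongr; linarith
      have g2 : r ^ 2 * b ≤ 1 * b := by gcongr; linarith
      have g3 : r ^ 2 * d ≤ k * d := by gcongr; linarith
      linarith
    have e2 : r ^ 2 * (a + b + d) ≤ k * (a + b + k * d) := by
      have g1 : r ^ 2 * a ≤ k * a := by gcongr; linarith
      have g2 : r ^ 2 * b ≤ k * b := by gcongr; linarith
      have g3 : r ^ 2 * d ≤ k ^ 2 * d := by gcongr
      linarith
    have hm := h₂ k x y z hX hkr hk1 t ht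
    exact ⟨key _ _ _ (by positivity) (by positivity) e1 (hm _ (by simp)),
      key _ _ _ (by positivity) (by positivity) e1 (hm _ (by simp)),
      key _ _ _ (by positivity) (by positivity) e2 (hm _ (by simp))⟩

/-- `y` and `z` come from the very high and the intermediate range. `x` is then regarded as a scalar
equation with damping `μk²` forced by `βy`: the damping contributes the factor `k⁻²`, and the
initial value decays exponentially with no loss. -/
theorem IsElectromagneticFlow.exists_high_frequency_bound {β μ : ℝ} (hβ : 0 < β) (hμ : 0 < μ) :
    ∃ c C : ℝ, 0 < c ∧ 0 < C ∧ ∀ (k : ℝ) (x y z : ℝ → ℂ),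
      IsElectromagneticFlow β μ k x y z → 1 ≤ k → ∀ t, 0 ≤ t →
        ‖x t‖ ≤ C * (Real.exp (-(c * t)) * ‖x 0‖ +
          Real.exp (-(c / k ^ 2 * t)) * ((‖x 0‖ / k ^ 2 + ‖y 0‖ + ‖z 0‖) / k ^ 2)) ∧
        ‖y t‖ ≤ C * (Real.exp (-(c / k ^ 2 * t)) * (‖x 0‖ / k ^ 2 + ‖y 0‖ + ‖z 0‖)) ∧
        ‖z t‖ ≤ C * (Real.exp (-(c / k ^ 2 * t)) * (‖x 0‖ / k ^ 2 + ‖y 0‖ + ‖z 0‖)) := by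
  obtain ⟨R, c₁, C₁, hR, hc₁, hC₁, h₁⟩ := exists_very_high_frequency_bound hβ hμ
  obtain ⟨c₂, hc₂, h₂⟩ := exists_middle_frequency_bound hβ hμ (r := 1) one_pos
    (lt_of_lt_of_le one_pos hR)
  set c := min (min c₁ c₂) (μ / 2) with hc
  have hcc₁ : c ≤ c₁ := (min_le_left _ _).trans (min_le_left _ _)
  have hcc₂ : c ≤ c₂ := (min_le_left _ _).trans (min_le_right _ _)
  have hcμ : c ≤ μ / 2 := min_le_right _ _
  have hc0 : 0 < c := by positivity
  set C₂ := C₁ + 2 * R ^ 2 with hC₂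
  have hC₂0 : 0 < C₂ := by positivity
  refine ⟨c, 1 + C₂ + 4 * (β * C₂) / μ, hc0, by positivity, fun k x y z hX hk1 => ?_⟩
  have hk : 0 < k := by linarith
  have hk2 : 1 ≤ k ^ 2 := one_le_pow₀ hk1
  set a := ‖x 0‖ with ha
  set b := ‖y 0‖ with hb
  set d := ‖z 0‖ with hd
  have ha0 : 0 ≤ a := norm_nonneg _
  have hb0 : 0 ≤ b := norm_nonneg _
  have hd0 : 0 ≤ d := norm_nonneg _
  set A := a / k ^ 2 + b + d with hA
  have hA0 : 0 ≤ A := by positivity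
  have hck : c / k ^ 2 ≤ c := div_le_self hc0.le hk2
  have hyz : ∀ t, 0 ≤ t → ‖y t‖ ≤ C₂ * (Real.exp (-(c / k ^ 2 * t)) * A) ∧
      ‖z t‖ ≤ C₂ * (Real.exp (-(c / k ^ 2 * t)) * A) := by
    intro t ht
    rcases le_total R k with hkR | hkR
    · have h3 : C₁ * (Real.exp (-(c₁ / k ^ 2 * t)) * A) ≤
          C₂ * (Real.exp (-(c / k ^ 2 * t)) * A) := by
        gcongr
        have : 0 ≤ R ^ 2 := by positivity
        linarith
      obtain ⟨h1, h2⟩ := h₁ k x y z hX hkR t ht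
      exact ⟨h1.trans h3, h2.trans h3⟩
    · have h3 : 2 * (Real.exp (-(c₂ * t)) * (a + b + d)) ≤
          C₂ * (Real.exp (-(c / k ^ 2 * t)) * A) := by
        have h4 : a + b + d ≤ R ^ 2 * A := by
          have hR2 : 1 ≤ R ^ 2 := one_le_pow₀ hR
          have h5 : k ^ 2 ≤ R ^ 2 := by gcongr
          have h6 : a ≤ R ^ 2 * (a / k ^ 2) := by
            calc a = k ^ 2 * (a / k ^ 2) := by field_simp
              _ ≤ _ := by gcongr
          have h7 : 1 * b ≤ R ^ 2 * b := by gcongr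
          have h8 : 1 * d ≤ R ^ 2 * d := by gcongr
          rw [hA]; linarith
        have h9 : Real.exp (-(c₂ * t)) ≤ Real.exp (-(c / k ^ 2 * t)) :=
          exp_neg_mul_le (by linarith) ht
        calc 2 * (Real.exp (-(c₂ * t)) * (a + b + d)) ≤
            2 * (Real.exp (-(c / k ^ 2 * t)) * (R ^ 2 * A)) := by gcongr
          _ = (0 + 2 * R ^ 2) * (Real.exp (-(c / k ^ 2 * t)) * A) := by ring
          _ ≤ _ := by rw [hC₂]; gcongr
      have hm := h₂ k x y z hX hk1 hkR t ht
      exact ⟨(hm _ (by simp)).trans h3, (hm _ (by simp)).trans h3⟩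
  intro t ht
  have hq : 0 ≤ 4 * (β * C₂) / μ := by positivity
  have hup : C₂ * (Real.exp (-(c / k ^ 2 * t)) * A) ≤
      (1 + C₂ + 4 * (β * C₂) / μ) * (Real.exp (-(c / k ^ 2 * t)) * A) := by
    gcongr
    linarith
  refine ⟨?_, (hyz t ht).1.trans hup, (hyz t ht).2.trans hup⟩
  have hl : μ ≤ μ * k ^ 2 := le_mul_of_one_le_right hμ.le hk2
  have hx := norm_le_of_deriv_eq_neg_mul_add (h := fun t => -(β * y t)) (l := μ * k ^ 2)
    (c := c / k ^ 2) (K := β * C₂ * A) (by positivity) (by linarith)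
    (fun t => (hX.deriv_x t).congr_deriv (by push_cast; ring)) (fun t ht => by
      rw [norm_neg]
      refine (norm_real_smul_le _ (abs_of_pos hβ).le).trans ?_
      calc β * ‖y t‖ ≤ β * (C₂ * (Real.exp (-(c / k ^ 2 * t)) * A)) := by
            gcongr; exact (hyz t ht).1
        _ = _ := by ring) ht
  have h1 : Real.exp (-(μ * k ^ 2 * t)) ≤ Real.exp (-(c * t)) := exp_neg_mul_le (by linarith) ht
  have h2 : 4 * (β * C₂ * A) / (μ * k ^ 2) = 4 * (β * C₂) / μ * (A / k ^ 2) := by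
    field_simp
  calc ‖x t‖ ≤ Real.exp (-(c * t)) * a +
        Real.exp (-(c / k ^ 2 * t)) * (4 * (β * C₂) / μ * (A / k ^ 2)) := by
        rw [← h2]
        exact hx.trans (by gcongr)
    _ = 1 * (Real.exp (-(c * t)) * a) +
        4 * (β * C₂) / μ * (Real.exp (-(c / k ^ 2 * t)) * (A / k ^ 2)) := by ring
    _ ≤ (1 + C₂ + 4 * (β * C₂) / μ) * (Real.exp (-(c * t)) * a) +
        (1 + C₂ + 4 * (β * C₂) / μ) * (Real.exp (-(c / k ^ 2 * t)) * (A / k ^ 2)) := by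
        gcongr <;> linarith
    _ = _ := by ring

/-! ### The full system at one frequency: Helmholtz decomposition -/

/-- The symbol `i v × w` of the curl. -/
noncomputable def icross (v : Fin 3 → ℝ) (w : Fin 3 → ℂ) : Fin 3 → ℂ :=
  ![Complex.I * (v 1 * w 2 - v 2 * w 1), Complex.I * (v 2 * w 0 - v 0 * w 2),
    Complex.I * (v 0 * w 1 - v 1 * w 0)]

/-- The symbol `i v · w` of the divergence. -/
noncomputable def idot (v : Fin 3 → ℝ) (w : Fin 3 → ℂ) : ℂ := ∑ i, Complex.I * v i * w i

section symbols

variable {v : Fin 3 → ℝ} {k : ℝ}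

theorem norm_idot_le (hv : ∀ i, |v i| ≤ k) (w : Fin 3 → ℂ) : ‖idot v w‖ ≤ k * ∑ i, ‖w i‖ := by
  rw [idot, Finset.mul_sum]
  refine (norm_sum_le _ _).trans (Finset.sum_le_sum fun i _ => ?_)
  rw [norm_mul, norm_mul, Complex.norm_I, one_mul, Complex.norm_real, Real.norm_eq_abs]
  exact mul_le_mul_of_nonneg_right (hv i) (norm_nonneg _)

theorem norm_icross_le (hv : ∀ i, |v i| ≤ k) (w : Fin 3 → ℂ) (i : Fin 3) :
    ‖icross v w i‖ ≤ k * ∑ i, ‖w i‖ := by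
  have h : ∀ i j : Fin 3, ∀ a b : Fin 3, ‖Complex.I * (v i * w a - v j * w b)‖ ≤
      k * ‖w a‖ + k * ‖w b‖ := by
    intro i j a b
    rw [norm_mul, Complex.norm_I, one_mul]
    exact (norm_sub_le _ _).trans
      (add_le_add (norm_real_smul_le _ (hv i)) (norm_real_smul_le _ (hv j)))
  have hk : 0 ≤ k := (abs_nonneg _).trans (hv 0)
  rw [Fin.sum_univ_three]
  have h0 := mul_nonneg hk (norm_nonneg (w 0))
  have h1 := mul_nonneg hk (norm_nonneg (w 1))
  have h2 := mul_nonneg hk (norm_nonneg (w 2))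
  fin_cases i
  · exact (h 1 2 2 1).trans (by linarith)
  · exact (h 2 0 0 2).trans (by linarith)
  · exact (h 0 1 1 0).trans (by linarith)

/-- The symbol form of `curl curl = -Δ + ∇ div`. It both closes the transverse system and recovers a
vector from its curl and divergence. -/
theorem icross_icross (hk : ∑ i, v i ^ 2 = k ^ 2) (w : Fin 3 → ℂ) (i : Fin 3) :
    icross v (icross v w) i = k ^ 2 * w i + Complex.I * v i * idot v w := by
  have h : (k : ℂ) ^ 2 = v 0 ^ 2 + v 1 ^ 2 + v 2 ^ 2 := by
    rw [Fin.sum_univ_three] at hk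
    exact_mod_cast hk.symm
  rw [h, idot, Fin.sum_univ_three]
  fin_cases i <;> simp [icross] <;> ring_nf <;> simp <;> ring

theorem idot_icross (w : Fin 3 → ℂ) : idot v (icross v w) = 0 := by
  rw [idot, Fin.sum_univ_three]
  simp [icross]
  ring

theorem abs_le_of_sum_sq (hk0 : 0 ≤ k) (hk : ∑ i, v i ^ 2 = k ^ 2) (i : Fin 3) : |v i| ≤ k := by
  refine abs_le_of_sq_le_sq ?_ hk0
  rw [← hk]
  exact Finset.single_le_sum (f := fun i => v i ^ 2) (fun i _ => sq_nonneg _) (Finset.mem_univ i)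

theorem HasDerivAt.idot {w : ℝ → Fin 3 → ℂ} {w' : Fin 3 → ℂ} {t : ℝ}
    (h : ∀ i, HasDerivAt (fun t => w t i) (w' i) t) :
    HasDerivAt (fun t => idot v (w t)) (idot v w') t :=
  HasDerivAt.fun_sum fun i _ => (h i).const_mul _

theorem HasDerivAt.icross {w : ℝ → Fin 3 → ℂ} {w' : Fin 3 → ℂ} {t : ℝ}
    (h : ∀ i, HasDerivAt (fun t => w t i) (w' i) t) (i : Fin 3) :
    HasDerivAt (fun t => icross v (w t) i) (icross v w' i) t := by
  have h1 : ∀ a b c d : Fin 3, HasDerivAt (fun t => Complex.I * (v a * w t b - v c * w t d))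
      (Complex.I * (v a * w' b - v c * w' d)) t := fun a b c d =>
    (((h b).const_mul _).sub ((h d).const_mul _)).const_mul _
  fin_cases i
  · exact h1 1 2 2 1
  · exact h1 2 0 0 2
  · exact h1 0 1 1 0

end symbols

/-- The Navier-Stokes-Maxwell system at the frequency `v`, with the density eliminated by means of
the Gauss law. -/
structure IsFrequencyFlow (γ β μ : ℝ) (v : Fin 3 → ℝ) (k : ℝ) (u E B : ℝ → Fin 3 → ℂ) : Prop where
  sum_sq : ∑ i, v i ^ 2 = k ^ 2
  deriv_u : ∀ t i, HasDerivAt (fun t => u t i)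
    (γ * (γ / β) * (Complex.I * v i * idot v (E t)) - β * E t i - μ * k ^ 2 * u t i) t
  deriv_E : ∀ t i, HasDerivAt (fun t => E t i) (icross v (B t) i + β * u t i) t
  deriv_B : ∀ t i, HasDerivAt (fun t => B t i) (-icross v (E t) i) t
  idot_B : idot v (B 0) = 0

namespace IsFrequencyFlow

variable {γ β μ : ℝ} {v : Fin 3 → ℝ} {k : ℝ} {u E B : ℝ → Fin 3 → ℂ}

/-- Taking the divergence removes the magnetic field from the equation for `E`, and the Gauss law
identifies the density with `-(γ/β) div E`. -/
theorem isCompressibleFlow (hβ : 0 < β) (hγ : 0 < γ) (h : IsFrequencyFlow γ β μ v k u E B) :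
    IsCompressibleFlow γ β μ k (fun t => -(γ / β * idot v (E t))) (fun t => idot v (u t)) := by
  have hβ' : (β : ℂ) ≠ 0 := by exact_mod_cast hβ.ne'
  have hγ' : (γ : ℂ) ≠ 0 := by exact_mod_cast hγ.ne'
  have hk : (k : ℂ) ^ 2 = v 0 ^ 2 + v 1 ^ 2 + v 2 ^ 2 := by
    have := h.sum_sq
    rw [Fin.sum_univ_three] at this
    exact_mod_cast this.symm
  constructor
  · intro t
    refine (((HasDerivAt.idot (h.deriv_E t)).const_mul _).neg).congr_deriv ?_
    have h1 : idot v (fun i => icross v (B t) i + β * u t i) =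
        idot v (icross v (B t)) + β * idot v (u t) := by
      simp only [idot, Fin.sum_univ_three]; ring
    rw [h1, idot_icross]
    field_simp
    ring
  · intro t
    refine (HasDerivAt.idot (h.deriv_u t)).congr_deriv ?_
    have h1 : idot v (fun i => γ * (γ / β) * (Complex.I * v i * idot v (E t)) - β * E t i -
        μ * k ^ 2 * u t i) = -(γ * (γ / β) * k ^ 2 * idot v (E t)) - β * idot v (E t) -
        μ * k ^ 2 * idot v (u t) := by
      rw [hk]
      generalize hX : idot v (E t) = X
      have hX' := hX
      simp only [idot, Fin.sum_univ_three] at hX' ⊢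
      linear_combination (-β) * hX' + (γ * (γ / β) * X * (v 0 ^ 2 + v 1 ^ 2 + v 2 ^ 2)) *
        Complex.I_sq
    rw [h1]
    field_simp
    ring

theorem idot_B_eq_zero (h : IsFrequencyFlow γ β μ v k u E B) (t : ℝ) : idot v (B t) = 0 := by
  have h1 : ∀ t, HasDerivAt (fun t => idot v (B t)) 0 t := fun t => by
    refine (HasDerivAt.idot (h.deriv_B t)).congr_deriv ?_
    have : idot v (fun i => -icross v (E t) i) = -idot v (icross v (E t)) := by
      simp only [idot, Fin.sum_univ_three]; ring
    rw [this, idot_icross, neg_zero]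
  have h2 := is_const_of_deriv_eq_zero (fun t => (h1 t).differentiableAt)
    (fun t => (h1 t).deriv) t 0
  rw [h2, h.idot_B]

/-- The curl annihilates the gradient term. Since `div B = 0` is preserved, `curl curl B = k² B`,
and the choice `z = kB` closes the system in each component separately. -/
theorem isElectromagneticFlow (h : IsFrequencyFlow γ β μ v k u E B) (i : Fin 3) :
    IsElectromagneticFlow β μ k (fun t => icross v (u t) i) (fun t => icross v (E t) i)
      (fun t => k * B t i) := by
  refine ⟨fun t => ?_, fun t => ?_, fun t => ?_⟩
  · refine (HasDerivAt.icross (h.deriv_u t) i).congr_deriv ?_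
    generalize idot v (E t) = X
    fin_cases i <;> simp [icross] <;> ring
  · refine (HasDerivAt.icross (h.deriv_E t) i).congr_deriv ?_
    have h1 := icross_icross h.sum_sq (B t) i
    rw [h.idot_B_eq_zero] at h1
    have h2 : icross v (fun i => icross v (B t) i + β * u t i) i =
        icross v (icross v (B t)) i + β * icross v (u t) i := by
      fin_cases i <;> simp [icross] <;> ring
    rw [h2, h1]
    ring
  · refine ((h.deriv_B t i).const_mul (k : ℂ)).congr_deriv ?_
    ring

/-- From `k² w = curl curl w - ∇ div w`, where the outer operation costs one factor `k`. -/
theorem mul_norm_le (hk : 0 < k) (hv : ∑ i, v i ^ 2 = k ^ 2) (w : Fin 3 → ℂ) (i : Fin 3) :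
    k * ‖w i‖ ≤ ∑ j, ‖icross v w j‖ + ‖idot v w‖ := by
  have hvk := abs_le_of_sum_sq hk.le hv
  have h1 : (k ^ 2 : ℂ) * w i = icross v (icross v w) i - Complex.I * v i * idot v w := by
    rw [icross_icross hv]; ring
  have h2 : k ^ 2 * ‖w i‖ ≤ k * ∑ j, ‖icross v w j‖ + k * ‖idot v w‖ := by
    have h3 : ‖(k ^ 2 : ℂ) * w i‖ = k ^ 2 * ‖w i‖ := by
      rw [norm_mul, norm_pow, Complex.norm_real, Real.norm_of_nonneg hk.le]
    rw [← h3, h1]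
    refine (norm_sub_le _ _).trans (add_le_add (norm_icross_le hvk _ i) ?_)
    rw [norm_mul, norm_mul, Complex.norm_I, one_mul, Complex.norm_real, Real.norm_eq_abs]
    exact mul_le_mul_of_nonneg_right (hvk i) (norm_nonneg _)
  have h4 : k * (k * ‖w i‖) ≤ k * (∑ j, ‖icross v w j‖ + ‖idot v w‖) := by linarith
  exact le_of_mul_le_mul_left h4 hk

end IsFrequencyFlow

/-- The data of both subsystems are at most `k` times the original data, up to constants. Recovering
the fields costs one division by `k`, which cancels that factor exactly. -/
theorem IsFrequencyFlow.exists_low_frequency_bound {γ β μ : ℝ} (hγ : 0 < γ) (hβ : 0 < β)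
    (hμ : 0 < μ) :
    ∃ c C : ℝ, 0 < c ∧ 0 < C ∧ ∀ (v : Fin 3 → ℝ) (k : ℝ) (u E B : ℝ → Fin 3 → ℂ) (a b d : ℝ),
      IsFrequencyFlow γ β μ v k u E B → 0 < k → k ≤ 1 →
      ∑ i, ‖u 0 i‖ = a → ∑ i, ‖E 0 i‖ = b → ∑ i, ‖B 0 i‖ = d → ∀ t, 0 ≤ t → ∀ i,
        ‖u t i‖ ≤ C * (Real.exp (-(c * k ^ 2 * t)) * (a + b + k * d) +
          Real.exp (-(c * k ^ 4 * t)) * (k ^ 2 * a + k ^ 4 * b + k * d)) ∧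
        ‖E t i‖ ≤ C * (Real.exp (-(c * k ^ 2 * t)) * (a + b + k * d) +
          Real.exp (-(c * k ^ 4 * t)) * (k ^ 4 * a + k ^ 6 * b + k ^ 3 * d)) ∧
        ‖B t i‖ ≤ C * (Real.exp (-(c * k ^ 2 * t)) * (k * (a + b + k * d)) +
          Real.exp (-(c * k ^ 4 * t)) * (k * a + k ^ 3 * b + d)) := by
  obtain ⟨c₁, C₁, hc₁, hC₁, h₁⟩ := IsElectromagneticFlow.exists_low_frequency_bound hβ hμ
  obtain ⟨c₂, C₂, hc₂, hC₂, h₂⟩ := IsCompressibleFlow.exists_low_frequency_bound hγ hβ hμ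
  set c := min c₁ c₂ with hc
  have hcc₁ : c ≤ c₁ := min_le_left _ _
  have hcc₂ : c ≤ c₂ := min_le_right _ _
  have hc0 : 0 < c := by positivity
  set K := C₂ * (1 + γ / β) * (1 + β / γ) with hK
  have hK0 : 0 < K := by positivity
  refine ⟨c, 3 * C₁ + K, hc0, by positivity,
    fun v k u E B a b d hX hk hk1 ha hb hd t ht => ?_⟩
  have hvk := abs_le_of_sum_sq hk.le hX.sum_sq
  have ha0 : 0 ≤ a := ha ▸ Finset.sum_nonneg fun i _ => norm_nonneg _
  have hb0 : 0 ≤ b := hb ▸ Finset.sum_nonneg fun i _ => norm_nonneg _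
  have hd0 : 0 ≤ d := hd ▸ Finset.sum_nonneg fun i _ => norm_nonneg _
  have hx0 : ∀ i, ‖icross v (u 0) i‖ ≤ k * a := fun i => ha ▸ norm_icross_le hvk _ i
  have hy0 : ∀ i, ‖icross v (E 0) i‖ ≤ k * b := fun i => hb ▸ norm_icross_le hvk _ i
  have hz0 : ∀ i, ‖(k : ℂ) * B 0 i‖ ≤ k * d := fun i => by
    refine (norm_real_smul_le _ (abs_of_pos hk).le).trans ?_
    gcongr
    rw [← hd]
    exact Finset.single_le_sum (f := fun i => ‖B 0 i‖) (fun i _ => norm_nonneg _)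
      (Finset.mem_univ i)
  have hn0 : ‖-((γ : ℂ) / β * idot v (E 0))‖ ≤ γ / β * (k * b) := by
    rw [norm_neg, ← Complex.ofReal_div]
    refine (norm_real_smul_le _ (abs_of_pos (by positivity)).le).trans ?_
    gcongr
    exact hb ▸ norm_idot_le hvk _
  have hd0' : ‖idot v (u 0)‖ ≤ k * a := ha ▸ norm_idot_le hvk _
  have he2 : ∀ c', c ≤ c' → Real.exp (-(c' * k ^ 2 * t)) ≤ Real.exp (-(c * k ^ 2 * t)) :=
    fun c' h => by gcongr
  have he4 : Real.exp (-(c₁ * k ^ 4 * t)) ≤ Real.exp (-(c * k ^ 4 * t)) := by gcongr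
  have hcomp := h₂ k _ _ (hX.isCompressibleFlow hβ hγ) hk hk1 t ht
  have hem := fun i => h₁ k _ _ _ (hX.isElectromagneticFlow i) hk hk1 t ht
  set e2 := Real.exp (-(c * k ^ 2 * t)) with he2def
  set e4 := Real.exp (-(c * k ^ 4 * t)) with he4def
  have he20 : 0 < e2 := Real.exp_pos _
  have he40 : 0 < e4 := Real.exp_pos _
  have hnd : C₂ * (Real.exp (-(c₂ * k ^ 2 * t)) * (‖-((γ : ℂ) / β * idot v (E 0))‖ +
      ‖idot v (u 0)‖)) ≤ k * (C₂ * (1 + γ / β) * (e2 * (a + b + k * d))) := by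
    have h3 : 0 ≤ γ / β * a := by positivity
    have h4 : 0 ≤ (1 + γ / β) * (k * d) := by positivity
    calc C₂ * (Real.exp (-(c₂ * k ^ 2 * t)) * (‖-((γ : ℂ) / β * idot v (E 0))‖ +
        ‖idot v (u 0)‖)) ≤ C₂ * (e2 * (γ / β * (k * b) + k * a)) := by
          gcongr
          exact he2 _ hcc₂
      _ = C₂ * (e2 * (k * (γ / β * b + a))) := by ring
      _ ≤ C₂ * (e2 * (k * ((1 + γ / β) * (a + b + k * d)))) := by
          gcongr
          linarith
      _ = _ := by ring
  have hKn : C₂ * (1 + γ / β) ≤ K := by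
    rw [hK]
    refine le_mul_of_one_le_right (by positivity) ?_
    have : 0 < β / γ := by positivity
    linarith
  have hfin : ∀ w F S : ℝ, 0 ≤ F → 0 ≤ S →
      k * w ≤ 3 * (C₁ * (k * (F + S))) + k * (K * F) → w ≤ (3 * C₁ + K) * (F + S) := by
    intro w F S hF hS h
    have h5 : k * w ≤ k * ((3 * C₁ + K) * (F + S)) := by
      have : 0 ≤ k * (K * S) := by positivity
      linarith
    exact le_of_mul_le_mul_left h5 hk
  have hxs : ∀ i, ‖icross v (u t) i‖ ≤ C₁ * (k * (e2 * (a + b + k * d) +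
      e4 * (k ^ 2 * a + k ^ 4 * b + k * d))) := fun i => by
    refine (hem i).1.trans ?_
    calc _ ≤ C₁ * (e2 * (k * a + k * b + k * (k * d)) +
          e4 * (k ^ 2 * (k * a) + k ^ 4 * (k * b) + k * (k * d))) := by
          gcongr
          exacts [he2 _ hcc₁, hx0 i, hy0 i, hz0 i, hx0 i, hy0 i, hz0 i]
      _ = _ := by ring
  have hys : ∀ i, ‖icross v (E t) i‖ ≤ C₁ * (k * (e2 * (a + b + k * d) +
      e4 * (k ^ 4 * a + k ^ 6 * b + k ^ 3 * d))) := fun i => by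
    refine (hem i).2.1.trans ?_
    calc _ ≤ C₁ * (e2 * (k * a + k * b + k * (k * d)) +
          e4 * (k ^ 4 * (k * a) + k ^ 6 * (k * b) + k ^ 3 * (k * d))) := by
          gcongr
          exacts [he2 _ hcc₁, hx0 i, hy0 i, hz0 i, hx0 i, hy0 i, hz0 i]
      _ = _ := by ring
  intro i
  refine ⟨hfin _ _ _ (by positivity) (by positivity) ?_,
    hfin _ _ _ (by positivity) (by positivity) ?_,
    hfin _ _ _ (by positivity) (by positivity) ?_⟩
  · have h6 := IsFrequencyFlow.mul_norm_le hk hX.sum_sq (u t) i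
    have h7 := hcomp.2.trans hnd
    have h8 : k * (C₂ * (1 + γ / β) * (e2 * (a + b + k * d))) ≤
      k * (K * (e2 * (a + b + k * d))) := by gcongr
    rw [Fin.sum_univ_three] at h6
    linarith [hxs 0, hxs 1, hxs 2]
  · have h6 := IsFrequencyFlow.mul_norm_le hk hX.sum_sq (E t) i
    have h7 := hcomp.1.trans hnd
    rw [norm_neg, ← Complex.ofReal_div, norm_mul, Complex.norm_real,
      Real.norm_of_nonneg (by positivity)] at h7
    have h8 : ‖idot v (E t)‖ ≤ k * (K * (e2 * (a + b + k * d))) := by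
      calc ‖idot v (E t)‖ = β / γ * (γ / β * ‖idot v (E t)‖) := by field_simp
        _ ≤ β / γ * (k * (C₂ * (1 + γ / β) * (e2 * (a + b + k * d)))) := by gcongr
        _ ≤ (1 + β / γ) * (k * (C₂ * (1 + γ / β) * (e2 * (a + b + k * d)))) := by
            gcongr; linarith
        _ = _ := by rw [hK]; ring
    rw [Fin.sum_univ_three] at h6
    linarith [hys 0, hys 1, hys 2]
  · have h6 := (hem i).2.2
    rw [norm_mul, Complex.norm_real, Real.norm_of_nonneg hk.le] at h6
    have h7 : C₁ * (Real.exp (-(c₁ * k ^ 2 * t)) * (k * (‖icross v (u 0) i‖ +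
        ‖icross v (E 0) i‖ + k * ‖(k : ℂ) * B 0 i‖)) + Real.exp (-(c₁ * k ^ 4 * t)) *
        (k * ‖icross v (u 0) i‖ + k ^ 3 * ‖icross v (E 0) i‖ + ‖(k : ℂ) * B 0 i‖)) ≤
        C₁ * (e2 * (k * (k * a + k * b + k * (k * d))) +
          e4 * (k * (k * a) + k ^ 3 * (k * b) + k * d)) := by
      gcongr
      exacts [he2 _ hcc₁, hx0 i, hy0 i, hz0 i, hx0 i, hy0 i, hz0 i]
    have h8 : 0 ≤ C₁ * (k * (e2 * (k * (a + b + k * d)) + e4 * (k * a + k ^ 3 * b + d))) := by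
      positivity
    have h9 : 0 ≤ k * (K * (e2 * (k * (a + b + k * d)))) := by positivity
    linarith

/-- The number `m` is the size of the initial density. Keeping it separate from `b` lets the
exponentially decaying part of `u` see `m/k`, a bound by one derivative less of `n₀`. In the bound
for `E` it is estimated by `kb` through the Gauss law. -/
theorem IsFrequencyFlow.exists_high_frequency_bound {γ β μ : ℝ} (hγ : 0 < γ) (hβ : 0 < β)
    (hμ : 0 < μ) :
    ∃ c C : ℝ, 0 < c ∧ 0 < C ∧ ∀ (v : Fin 3 → ℝ) (k : ℝ) (u E B : ℝ → Fin 3 → ℂ) (a b d m : ℝ),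
      IsFrequencyFlow γ β μ v k u E B → 1 ≤ k →
      ∑ i, ‖u 0 i‖ = a → ∑ i, ‖E 0 i‖ = b → ∑ i, ‖B 0 i‖ = d →
      ‖(γ / β : ℂ) * idot v (E 0)‖ = m → ∀ t, 0 ≤ t → ∀ i,
        ‖u t i‖ ≤ C * (Real.exp (-(c * t)) * (a + m / k) +
          Real.exp (-(c / k ^ 2 * t)) * (a / k ^ 4 + b / k ^ 2 + d / k ^ 2)) ∧
        ‖E t i‖ ≤ C * (Real.exp (-(c / k ^ 2 * t)) * (a / k ^ 2 + b + d)) ∧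
        ‖B t i‖ ≤ C * (Real.exp (-(c / k ^ 2 * t)) * (a / k ^ 2 + b + d)) := by
  obtain ⟨c₁, C₁, hc₁, hC₁, h₁⟩ := IsElectromagneticFlow.exists_high_frequency_bound hβ hμ
  obtain ⟨c₂, C₂, hc₂, hC₂, h₂⟩ := IsCompressibleFlow.exists_high_frequency_bound hγ hβ hμ
  set c := min c₁ c₂ with hc
  have hcc₁ : c ≤ c₁ := min_le_left _ _
  have hcc₂ : c ≤ c₂ := min_le_right _ _
  have hc0 : 0 < c := by positivity
  set K := C₂ * (1 + γ / β) * (1 + β / γ) with hK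
  have hK0 : 0 < K := by positivity
  refine ⟨c, 3 * C₁ + K, hc0, by positivity,
    fun v k u E B a b d m hX hk1 ha hb hd hm t ht => ?_⟩
  have hk : 0 < k := by linarith
  have hk2 : 1 ≤ k ^ 2 := one_le_pow₀ hk1
  have hvk := abs_le_of_sum_sq hk.le hX.sum_sq
  have ha0 : 0 ≤ a := ha ▸ Finset.sum_nonneg fun i _ => norm_nonneg _
  have hb0 : 0 ≤ b := hb ▸ Finset.sum_nonneg fun i _ => norm_nonneg _
  have hd0 : 0 ≤ d := hd ▸ Finset.sum_nonneg fun i _ => norm_nonneg _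
  have hm0 : 0 ≤ m := hm ▸ norm_nonneg _
  have hx0 : ∀ i, ‖icross v (u 0) i‖ ≤ k * a := fun i => ha ▸ norm_icross_le hvk _ i
  have hy0 : ∀ i, ‖icross v (E 0) i‖ ≤ k * b := fun i => hb ▸ norm_icross_le hvk _ i
  have hz0 : ∀ i, ‖(k : ℂ) * B 0 i‖ ≤ k * d := fun i => by
    refine (norm_real_smul_le _ (abs_of_pos hk).le).trans ?_
    gcongr
    rw [← hd]
    exact Finset.single_le_sum (f := fun i => ‖B 0 i‖) (fun i _ => norm_nonneg _)
      (Finset.mem_univ i)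
  have hmb : m ≤ γ / β * (k * b) := by
    rw [← hm, ← Complex.ofReal_div]
    refine (norm_real_smul_le _ (abs_of_pos (by positivity)).le).trans ?_
    gcongr
    exact hb ▸ norm_idot_le hvk _
  have hd0' : ‖idot v (u 0)‖ ≤ k * a := ha ▸ norm_idot_le hvk _
  have hem := fun i => h₁ k _ _ _ (hX.isElectromagneticFlow i) hk1 t ht
  have hcomp := h₂ k _ _ (hX.isCompressibleFlow hβ hγ) hk1 t ht
  simp only [norm_neg] at hcomp hem
  rw [hm] at hcomp
  set e1 := Real.exp (-(c * t)) with he1def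
  set e2 := Real.exp (-(c / k ^ 2 * t)) with he2def
  have he10 : 0 < e1 := Real.exp_pos _
  have he20 : 0 < e2 := Real.exp_pos _
  have g1 : ∀ c', c ≤ c' → Real.exp (-(c' * t)) ≤ e1 := fun c' h => exp_neg_mul_le h ht
  have g2 : Real.exp (-(c₁ / k ^ 2 * t)) ≤ e2 := exp_neg_mul_le (by gcongr) ht
  have g12 : e1 ≤ e2 := exp_neg_mul_le (div_le_self hc0.le hk2) ht
  have hγβ : 0 < γ / β := by positivity
  have hβγ : 0 < β / γ := by positivity
  have hKn : C₂ * (1 + γ / β) ≤ K := by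
    rw [hK]
    exact le_mul_of_one_le_right (by positivity) (by linarith)
  have hC₂K : C₂ ≤ K := le_trans (le_mul_of_one_le_right hC₂.le (by linarith)) hKn
  have hA : ∀ i, ‖icross v (u 0) i‖ / k ^ 2 + ‖icross v (E 0) i‖ + ‖(k : ℂ) * B 0 i‖ ≤
      k * (a / k ^ 2 + b + d) := fun i => by
    calc _ ≤ k * a / k ^ 2 + k * b + k * d := by
          gcongr
          exacts [hx0 i, hy0 i, hz0 i]
      _ = _ := by ring
  have hA0 : 0 ≤ a / k ^ 2 + b + d := by positivity
  have hyzs : ∀ i (w : ℝ), w ≤ C₁ * (Real.exp (-(c₁ / k ^ 2 * t)) * (‖icross v (u 0) i‖ / k ^ 2 +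
      ‖icross v (E 0) i‖ + ‖(k : ℂ) * B 0 i‖)) → w ≤ C₁ * (k * (e2 * (a / k ^ 2 + b + d))) := by
    intro i w hw
    refine hw.trans ?_
    calc _ ≤ C₁ * (e2 * (k * (a / k ^ 2 + b + d))) := by
          gcongr
          exact hA i
      _ = _ := by ring
  have hxs : ∀ i, ‖icross v (u t) i‖ ≤ C₁ * (k * (e1 * a +
      e2 * (a / k ^ 4 + b / k ^ 2 + d / k ^ 2))) := fun i => by
    refine (hem i).1.trans ?_
    calc _ ≤ C₁ * (e1 * (k * a) + e2 * (k * (a / k ^ 2 + b + d) / k ^ 2)) := by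
          gcongr
          exacts [g1 _ hcc₁, hx0 i, hA i]
      _ = _ := by field_simp
  intro i
  refine ⟨?_, ?_, ?_⟩
  · have h6 := IsFrequencyFlow.mul_norm_le hk hX.sum_sq (u t) i
    have h7 : ‖idot v (u t)‖ ≤ k * (K * (e1 * (a + m / k))) := by
      refine hcomp.2.trans ?_
      calc _ ≤ K * (e1 * (m + k * a)) := by gcongr; exact g1 _ hcc₂
        _ = _ := by field_simp; ring
    rw [Fin.sum_univ_three] at h6
    have h8 : 0 ≤ C₁ * (k * (e1 * (m / k))) := by positivity
    have h9 : 0 ≤ k * (K * (e2 * (a / k ^ 4 + b / k ^ 2 + d / k ^ 2))) := by positivity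
    have h10 : k * ‖u t i‖ ≤ k * ((3 * C₁ + K) * (e1 * (a + m / k) +
        e2 * (a / k ^ 4 + b / k ^ 2 + d / k ^ 2))) := by
      linarith [hxs 0, hxs 1, hxs 2]
    exact le_of_mul_le_mul_left h10 hk
  · have h6 := IsFrequencyFlow.mul_norm_le hk hX.sum_sq (E t) i
    have h7 := hcomp.1
    rw [← Complex.ofReal_div, norm_mul, Complex.norm_real,
      Real.norm_of_nonneg (by positivity)] at h7
    have h8 : m + ‖idot v (u 0)‖ / k ^ 2 ≤ (1 + γ / β) * (k * (a / k ^ 2 + b + d)) := by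
      have q1 : ‖idot v (u 0)‖ / k ^ 2 ≤ k * a / k ^ 2 := by gcongr
      have q2 : 0 ≤ k * b := by positivity
      have q3 : 0 ≤ (1 + γ / β) * (k * d) := by positivity
      have q4 : 0 ≤ γ / β * (k * a / k ^ 2) := by positivity
      have q5 : k * a / k ^ 2 = k * (a / k ^ 2) := by ring
      rw [q5] at q1 q4
      linarith
    have h9 : ‖idot v (E t)‖ ≤ k * (K * (e2 * (a / k ^ 2 + b + d))) := by
      calc ‖idot v (E t)‖ = β / γ * (γ / β * ‖idot v (E t)‖) := by field_simp
        _ ≤ β / γ * (C₂ * (e2 * ((1 + γ / β) * (k * (a / k ^ 2 + b + d))))) := by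
            refine mul_le_mul_of_nonneg_left (h7.trans ?_) hβγ.le
            gcongr
            exact (g1 _ hcc₂).trans g12
        _ ≤ (1 + β / γ) * (C₂ * (e2 * ((1 + γ / β) * (k * (a / k ^ 2 + b + d))))) := by
            gcongr; linarith
        _ = _ := by rw [hK]; ring
    have h10 : k * ‖E t i‖ ≤ k * ((3 * C₁ + K) * (e2 * (a / k ^ 2 + b + d))) := by
      rw [Fin.sum_univ_three] at h6
      linarith [hyzs 0 _ (hem 0).2.1, hyzs 1 _ (hem 1).2.1, hyzs 2 _ (hem 2).2.1]
    exact le_of_mul_le_mul_left h10 hk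
  · have h6 := hyzs i _ (hem i).2.2
    rw [norm_mul, Complex.norm_real, Real.norm_of_nonneg hk.le] at h6
    have h8 : 0 ≤ C₁ * (k * (e2 * (a / k ^ 2 + b + d))) := by positivity
    have h9 : 0 ≤ k * (K * (e2 * (a / k ^ 2 + b + d))) := by positivity
    have h10 : k * ‖B t i‖ ≤ k * ((3 * C₁ + K) * (e2 * (a / k ^ 2 + b + d))) := by linarith
    exact le_of_mul_le_mul_left h10 hk

/-! ### The linear system on the Fourier side -/

/-- The angular frequency `2 π ξ`. -/
noncomputable def angFreq (ξ : R3) (i : Fin 3) : ℝ := 2 * Real.pi * ξ i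

theorem sum_angFreq_sq (ξ : R3) : ∑ i, angFreq ξ i ^ 2 = (2 * Real.pi * ‖ξ‖) ^ 2 := by
  simp only [angFreq, mul_pow, ← Finset.mul_sum, EuclideanSpace.norm_sq_eq, Real.norm_eq_abs,
    sq_abs]

/-- The symbol of `∂_i`. -/
noncomputable def pdSymbol (i : Fin 3) (ξ : R3) : ℂ := Complex.I * angFreq ξ i

/-- The symbol of `-Δ`. -/
noncomputable def lapSymbol (ξ : R3) : ℂ := ((2 * Real.pi * ‖ξ‖) ^ 2 : ℝ)

theorem pdSymbol_hasTemperateGrowth (i : Fin 3) : (pdSymbol i).HasTemperateGrowth := by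
  have h : (fun ξ : R3 => inner ℝ ξ (basisVec i)).HasTemperateGrowth := by fun_prop
  have h2 : (fun ξ : R3 => Complex.ofRealCLM (inner ℝ ξ (basisVec i))).HasTemperateGrowth := by
    fun_prop
  have : pdSymbol i = fun ξ : R3 => (Complex.I * (2 * Real.pi)) *
      Complex.ofRealCLM (inner ℝ ξ (basisVec i)) := by
    ext ξ
    simp [pdSymbol, angFreq, basisVec, EuclideanSpace.inner_single_right]
    ring
  rw [this]
  exact (Function.HasTemperateGrowth.const _).mul h2

theorem lapSymbol_eq : lapSymbol = -∑ i, pdSymbol i * pdSymbol i := by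
  ext ξ
  rw [lapSymbol, ← sum_angFreq_sq]
  simp only [Pi.neg_apply, Pi.add_apply, Pi.mul_apply, pdSymbol, Fin.sum_univ_three]
  push_cast
  linear_combination ((angFreq ξ 0 : ℂ) ^ 2 + (angFreq ξ 1 : ℂ) ^ 2 + (angFreq ξ 2 : ℂ) ^ 2) *
    Complex.I_sq

theorem lapSymbol_hasTemperateGrowth : lapSymbol.HasTemperateGrowth := by
  rw [lapSymbol_eq, Fin.sum_univ_three]
  have h := pdSymbol_hasTemperateGrowth
  exact ((((h 0).mul (h 0)).add ((h 1).mul (h 1))).add ((h 2).mul (h 2))).neg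

/-- Multiplication of a tempered distribution by a symbol. -/
noncomputable abbrev mulT (f : R3 → ℂ) (T : TDist) : TDist :=
  TemperedDistribution.smulLeftCLM ℂ f T

theorem mulT_neg {f : R3 → ℂ} (hf : f.HasTemperateGrowth) (T : TDist) :
    mulT (-f) T = -mulT f T := by
  rw [mulT, TemperedDistribution.smulLeftCLM_neg hf]; rfl

theorem mulT_zero (T : TDist) : mulT 0 T = 0 := by
  have h := TemperedDistribution.smulLeftCLM_const (0 : ℂ) T
  exact h.trans (zero_smul ℂ T)

theorem mulT_const (c : ℂ) (T : TDist) : mulT (fun _ => c) T = c • T :=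
  TemperedDistribution.smulLeftCLM_const c T

theorem mulT_sub {f g : R3 → ℂ} (hf : f.HasTemperateGrowth) (hg : g.HasTemperateGrowth)
    (T : TDist) : mulT (f - g) T = mulT f T - mulT g T := by
  rw [mulT, TemperedDistribution.smulLeftCLM_sub hf hg]; rfl

theorem mulT_add {f g : R3 → ℂ} (hf : f.HasTemperateGrowth) (hg : g.HasTemperateGrowth)
    (T : TDist) : mulT (f + g) T = mulT f T + mulT g T := by
  rw [mulT, TemperedDistribution.smulLeftCLM_add hf hg]; rfl

theorem mulT_smul {f : R3 → ℂ} (hf : f.HasTemperateGrowth) (c : ℂ) (T : TDist) :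
    mulT (c • f) T = c • mulT f T := by
  rw [mulT, TemperedDistribution.smulLeftCLM_smul hf]; rfl

theorem mulT_mulT {f g : R3 → ℂ} (hf : f.HasTemperateGrowth) (hg : g.HasTemperateGrowth)
    (T : TDist) : mulT f (mulT g T) = mulT (g * f) T :=
  TemperedDistribution.smulLeftCLM_smulLeftCLM_apply hg hf T

theorem fourier_pd (i : Fin 3) (T : TDist) : 𝓕 (pd i T) = mulT (pdSymbol i) (𝓕 T) := by
  have h : (fun ξ : R3 => inner ℝ ξ (basisVec i)).HasTemperateGrowth := by fun_prop
  have h2 : (fun ξ : R3 => ((inner ℝ ξ (basisVec i) : ℝ) : ℂ)).HasTemperateGrowth := by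
    have : (fun ξ : R3 => Complex.ofRealCLM (inner ℝ ξ (basisVec i))).HasTemperateGrowth := by
      fun_prop
    exact this
  have : pdSymbol i = (2 * Real.pi * Complex.I) • fun ξ : R3 =>
      ((inner ℝ ξ (basisVec i) : ℝ) : ℂ) := by
    ext ξ
    simp [pdSymbol, angFreq, basisVec, EuclideanSpace.inner_single_right]
    ring
  rw [this, mulT_smul h2, pd, TemperedDistribution.fourier_lineDerivOp_eq]

theorem fourier_sum_pd (V : Fin 3 → TDist) :
    𝓕 (divergence V) = ∑ i, mulT (pdSymbol i) (𝓕 (V i)) := by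
  rw [divergence, ← FourierTransform.fourierCLM_apply (R := ℂ), map_sum]
  simp only [FourierTransform.fourierCLM_apply, fourier_pd]

theorem fourier_laplacian (T : TDist) : 𝓕 (Δ T) = -mulT lapSymbol (𝓕 T) := by
  have h := pdSymbol_hasTemperateGrowth
  have h1 : Δ T = divergence fun i => pd i T := by
    rw [TemperedDistribution.laplacian_eq_sum (EuclideanSpace.basisFun (Fin 3) ℝ), divergence]
    simp only [EuclideanSpace.basisFun_apply, pd, basisVec]
  rw [h1, fourier_sum_pd]
  simp only [fourier_pd]
  rw [lapSymbol_eq, Fin.sum_univ_three, Fin.sum_univ_three,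
    mulT_neg ((((h 0).mul (h 0)).add ((h 1).mul (h 1))).add ((h 2).mul (h 2))),
    mulT_add (((h 0).mul (h 0)).add ((h 1).mul (h 1))) ((h 2).mul (h 2)),
    mulT_add ((h 0).mul (h 0)) ((h 1).mul (h 1)), neg_neg]
  simp only [mulT_mulT (h _) (h _)]

theorem fourier_smul_real (c : ℝ) (T : TDist) : 𝓕 (c • T) = (c : ℂ) • 𝓕 T := by
  have : c • T = (c : ℂ) • T := by ext φ; simp
  rw [this, FourierTransform.fourier_smul]

theorem fourier_neg_tdist (T : TDist) : 𝓕 (-T) = -𝓕 T := by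
  ext φ; simp [TemperedDistribution.fourier_apply]

theorem fourier_sub_tdist (T S : TDist) : 𝓕 (T - S) = 𝓕 T - 𝓕 S := by
  ext φ; simp [TemperedDistribution.fourier_apply]

/-- The symbol of the curl. -/
noncomputable def curlSymbol : Fin 3 → Fin 3 → R3 → ℂ :=
  ![![0, -pdSymbol 2, pdSymbol 1], ![pdSymbol 2, 0, -pdSymbol 0], ![-pdSymbol 1, pdSymbol 0, 0]]

theorem curlSymbol_hasTemperateGrowth (i j : Fin 3) : (curlSymbol i j).HasTemperateGrowth := by
  have h := pdSymbol_hasTemperateGrowth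
  have h0 : (0 : R3 → ℂ).HasTemperateGrowth := Function.HasTemperateGrowth.const 0
  fin_cases i <;> fin_cases j
  exacts [h0, (h 2).neg, h 1, h 2, h0, (h 0).neg, (h 1).neg, h 0, h0]

theorem fourier_curl (V : Fin 3 → TDist) (i : Fin 3) :
    𝓕 (curl V i) = ∑ j, mulT (curlSymbol i j) (𝓕 (V j)) := by
  have h := pdSymbol_hasTemperateGrowth
  rw [Fin.sum_univ_three]
  fin_cases i <;>
  simp [curl, curlSymbol, fourier_sub_tdist, fourier_pd, mulT_zero, mulT_neg (h _)] <;> abel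

theorem sum_curlSymbol_mul (ξ : R3) (w : Fin 3 → ℂ) (i : Fin 3) :
    ∑ j, curlSymbol i j ξ * w j = icross (angFreq ξ) w i := by
  rw [Fin.sum_univ_three]
  fin_cases i <;> simp [curlSymbol, icross, pdSymbol] <;> ring

/-- A diagonal block of symbols. -/
noncomputable def diagSymbol (f : R3 → ℂ) (i j : Fin 3) : R3 → ℂ := if i = j then f else 0

theorem diagSymbol_hasTemperateGrowth {f : R3 → ℂ} (hf : f.HasTemperateGrowth) (i j : Fin 3) :
    (diagSymbol f i j).HasTemperateGrowth := by
  rw [diagSymbol]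
  split_ifs
  · exact hf
  · exact Function.HasTemperateGrowth.const 0

theorem sum_mulT_diagSymbol (f : R3 → ℂ) (V : Fin 3 → TDist) (i : Fin 3) :
    ∑ j, mulT (diagSymbol f i j) (V j) = mulT f (V i) := by
  rw [Finset.sum_eq_single i]
  · rw [diagSymbol, if_pos rfl]
  · intro j _ hj
    rw [diagSymbol, if_neg hj.symm, mulT_zero]
  · simp

theorem sum_diagSymbol_mul (f : R3 → ℂ) (ξ : R3) (w : Fin 3 → ℂ) (i : Fin 3) :
    ∑ j, diagSymbol f i j ξ * w j = f ξ * w i := by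
  rw [Finset.sum_eq_single i]
  · rw [diagSymbol, if_pos rfl]
  · intro j _ hj
    rw [diagSymbol, if_neg hj.symm, Pi.zero_apply, zero_mul]
  · simp

/-- The symbol of `[u, E, B] ↦ [(γ²/β) ∇ div E - β E + μ Δ u, curl B + β u, -curl E]`. -/
noncomputable def nsmSymbol (γ β μ : ℝ) (x y : Fin 3 × Fin 3) : R3 → ℂ :=
  (![![diagSymbol (((-μ : ℝ) : ℂ) • lapSymbol), fun i j => ((γ * (γ / β) : ℝ) : ℂ) •
      (pdSymbol j * pdSymbol i) - diagSymbol (fun _ => (β : ℂ)) i j, 0],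
    ![diagSymbol fun _ => (β : ℂ), 0, curlSymbol],
    ![0, fun i j => -curlSymbol i j, 0]] : Fin 3 → Fin 3 → Fin 3 → Fin 3 → R3 → ℂ) x.1 y.1 x.2 y.2

theorem nsmSymbol_hasTemperateGrowth (γ β μ : ℝ) (x y : Fin 3 × Fin 3) :
    (nsmSymbol γ β μ x y).HasTemperateGrowth := by
  have h := pdSymbol_hasTemperateGrowth
  have h0 : (0 : R3 → ℂ).HasTemperateGrowth := Function.HasTemperateGrowth.const 0
  obtain ⟨b, i⟩ := x
  obtain ⟨c, j⟩ := y
  have hc : (fun _ : R3 => (β : ℂ)).HasTemperateGrowth := Function.HasTemperateGrowth.const _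
  have hs : ∀ (a : ℂ) {f : R3 → ℂ}, f.HasTemperateGrowth → (a • f).HasTemperateGrowth :=
    fun a f hf => (Function.HasTemperateGrowth.const a).mul hf
  fin_cases b <;> fin_cases c
  exacts [diagSymbol_hasTemperateGrowth (hs _ lapSymbol_hasTemperateGrowth) i j,
    (hs _ ((h j).mul (h i))).sub (diagSymbol_hasTemperateGrowth hc i j), h0,
    diagSymbol_hasTemperateGrowth hc i j, h0, curlSymbol_hasTemperateGrowth i j, h0,
    (curlSymbol_hasTemperateGrowth i j).neg, h0]

theorem neg_smul_tdist (c : ℂ) (T : TDist) : (-c) • T = -(c • T) := neg_smul c T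

theorem mulT_map_add (f : R3 → ℂ) (S T : TDist) : mulT f (S + T) = mulT f S + mulT f T :=
  map_add (TemperedDistribution.smulLeftCLM ℂ f) S T

theorem mulT_map_sub (f : R3 → ℂ) (S T : TDist) : mulT f (S - T) = mulT f S - mulT f T :=
  map_sub (TemperedDistribution.smulLeftCLM ℂ f) S T

theorem mulT_map_neg (f : R3 → ℂ) (T : TDist) : mulT f (-T) = -mulT f T :=
  map_neg (TemperedDistribution.smulLeftCLM ℂ f) T

theorem mulT_map_smul (f : R3 → ℂ) (c : ℂ) (T : TDist) : mulT f (c • T) = c • mulT f T :=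
  map_smul (TemperedDistribution.smulLeftCLM ℂ f) c T

theorem mulT_map_sum (f : R3 → ℂ) (V : Fin 3 → TDist) :
    mulT f (∑ i, V i) = ∑ i, mulT f (V i) :=
  map_sum (TemperedDistribution.smulLeftCLM ℂ f) V Finset.univ

theorem smul_sum_tdist (c : ℂ) (V : Fin 3 → TDist) : ∑ i, c • V i = c • ∑ i, V i :=
  Finset.smul_sum.symm

theorem sum_mulT_nsmSymbol (γ β μ : ℝ) (U E B : Fin 3 → TDist) (i : Fin 3) :
    ∑ y : Fin 3 × Fin 3, mulT (nsmSymbol γ β μ (0, i) y) (![U, E, B] y.1 y.2) =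
      -((μ : ℂ) • mulT lapSymbol (U i)) + (((γ * (γ / β) : ℝ) : ℂ) •
        mulT (pdSymbol i) (∑ j, mulT (pdSymbol j) (E j)) - (β : ℂ) • E i) ∧
    ∑ y : Fin 3 × Fin 3, mulT (nsmSymbol γ β μ (1, i) y) (![U, E, B] y.1 y.2) =
      (β : ℂ) • U i + ∑ j, mulT (curlSymbol i j) (B j) ∧
    ∑ y : Fin 3 × Fin 3, mulT (nsmSymbol γ β μ (2, i) y) (![U, E, B] y.1 y.2) =
      -∑ j, mulT (curlSymbol i j) (E j) := by
  have h := pdSymbol_hasTemperateGrowth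
  refine ⟨?_, ?_, ?_⟩
  · rw [Fintype.sum_prod_type, Fin.sum_univ_three]
    have h1 : ∑ j, mulT (nsmSymbol γ β μ (0, i) (0, j)) (U j) = -((μ : ℂ) • mulT lapSymbol (U i)) := by
      refine (sum_mulT_diagSymbol _ U i).trans ?_
      rw [mulT_smul lapSymbol_hasTemperateGrowth, Complex.ofReal_neg, neg_smul_tdist]
    have h2 : ∑ j, mulT (nsmSymbol γ β μ (0, i) (1, j)) (E j) = ((γ * (γ / β) : ℝ) : ℂ) •
        mulT (pdSymbol i) (∑ j, mulT (pdSymbol j) (E j)) - (β : ℂ) • E i := by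
      have hc : (fun _ : R3 => (β : ℂ)).HasTemperateGrowth := Function.HasTemperateGrowth.const _
      rw [← mulT_const β (E i), ← sum_mulT_diagSymbol (fun _ => (β : ℂ)) E i, mulT_map_sum,
        ← smul_sum_tdist, ← Finset.sum_sub_distrib]
      refine Finset.sum_congr rfl fun j _ => ?_
      rw [mulT_mulT (h i) (h j), ← mulT_smul ((h j).mul (h i))]
      exact mulT_sub ((Function.HasTemperateGrowth.const _).mul ((h j).mul (h i)))
        (diagSymbol_hasTemperateGrowth hc i j) (E j)
    have h3 : ∑ j, mulT (nsmSymbol γ β μ (0, i) (2, j)) (B j) = 0 :=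
      Finset.sum_eq_zero fun j _ => mulT_zero _
    exact (congrArg₂ (· + ·) (congrArg₂ (· + ·) h1 h2) h3).trans (add_zero _)
  · rw [Fintype.sum_prod_type, Fin.sum_univ_three]
    have h1 : ∑ j, mulT (nsmSymbol γ β μ (1, i) (0, j)) (U j) = (β : ℂ) • U i :=
      (sum_mulT_diagSymbol _ U i).trans (mulT_const _ _)
    have h2 : ∑ j, mulT (nsmSymbol γ β μ (1, i) (1, j)) (E j) = 0 :=
      Finset.sum_eq_zero fun j _ => mulT_zero _
    exact (congrArg₂ (· + ·) (congrArg₂ (· + ·) h1 h2) rfl).trans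
      (congrArg₂ (· + ·) (add_zero _) rfl)
  · rw [Fintype.sum_prod_type, Fin.sum_univ_three]
    have h1 : ∑ j, mulT (nsmSymbol γ β μ (2, i) (0, j)) (U j) = 0 :=
      Finset.sum_eq_zero fun j _ => mulT_zero _
    have h2 : ∑ j, mulT (nsmSymbol γ β μ (2, i) (1, j)) (E j) =
        -∑ j, mulT (curlSymbol i j) (E j) := by
      rw [← Finset.sum_neg_distrib]
      exact Finset.sum_congr rfl fun j _ => mulT_neg (curlSymbol_hasTemperateGrowth i j) _
    have h3 : ∑ j, mulT (nsmSymbol γ β μ (2, i) (2, j)) (B j) = 0 :=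
      Finset.sum_eq_zero fun j _ => mulT_zero _
    exact (congrArg₂ (· + ·) (congrArg₂ (· + ·) h1 h2) h3).trans ((add_zero _).trans (zero_add _))

theorem sum_nsmSymbol_mul (γ β μ : ℝ) (ξ : R3) (w : Fin 3 × Fin 3 → ℂ) (i : Fin 3) :
    ∑ y : Fin 3 × Fin 3, nsmSymbol γ β μ (0, i) y ξ * w y =
      γ * (γ / β) * (Complex.I * angFreq ξ i * idot (angFreq ξ) fun j => w (1, j)) -
        β * w (1, i) - μ * (2 * Real.pi * ‖ξ‖ : ℝ) ^ 2 * w (0, i) ∧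
    ∑ y : Fin 3 × Fin 3, nsmSymbol γ β μ (1, i) y ξ * w y =
      icross (angFreq ξ) (fun j => w (2, j)) i + β * w (0, i) ∧
    ∑ y : Fin 3 × Fin 3, nsmSymbol γ β μ (2, i) y ξ * w y =
      -icross (angFreq ξ) (fun j => w (1, j)) i := by
  refine ⟨?_, ?_, ?_⟩
  · rw [Fintype.sum_prod_type, Fin.sum_univ_three]
    have h1 : ∑ j, nsmSymbol γ β μ (0, i) (0, j) ξ * w (0, j) =
        -(μ * (2 * Real.pi * ‖ξ‖ : ℝ) ^ 2 * w (0, i)) := by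
      refine (sum_diagSymbol_mul _ ξ (fun j => w (0, j)) i).trans ?_
      simp only [Pi.smul_apply, lapSymbol, smul_eq_mul]
      push_cast
      ring
    have h2 : ∑ j, nsmSymbol γ β μ (0, i) (1, j) ξ * w (1, j) =
        γ * (γ / β) * (Complex.I * angFreq ξ i * idot (angFreq ξ) fun j => w (1, j)) -
        β * w (1, i) := by
      rw [← sum_diagSymbol_mul (fun _ => (β : ℂ)) ξ (fun j => w (1, j)) i, idot, Finset.mul_sum,
        Finset.mul_sum, ← Finset.sum_sub_distrib]
      refine Finset.sum_congr rfl fun j _ => ?_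
      have : nsmSymbol γ β μ (0, i) (1, j) ξ = ((γ * (γ / β) : ℝ) : ℂ) *
        (pdSymbol j ξ * pdSymbol i ξ) - diagSymbol (fun _ => (β : ℂ)) i j ξ := rfl
      rw [this, pdSymbol, pdSymbol]
      push_cast
      ring
    have h3 : ∑ j, nsmSymbol γ β μ (0, i) (2, j) ξ * w (2, j) = 0 :=
      Finset.sum_eq_zero fun j _ => zero_mul _
    rw [h1, h2, h3]
    ring
  · rw [Fintype.sum_prod_type, Fin.sum_univ_three]
    have h1 : ∑ j, nsmSymbol γ β μ (1, i) (0, j) ξ * w (0, j) = β * w (0, i) :=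
      sum_diagSymbol_mul _ ξ (fun j => w (0, j)) i
    have h2 : ∑ j, nsmSymbol γ β μ (1, i) (1, j) ξ * w (1, j) = 0 :=
      Finset.sum_eq_zero fun j _ => zero_mul _
    have h3 : ∑ j, nsmSymbol γ β μ (1, i) (2, j) ξ * w (2, j) =
        icross (angFreq ξ) (fun j => w (2, j)) i := sum_curlSymbol_mul ξ (fun j => w (2, j)) i
    rw [h1, h2, h3]
    ring
  · rw [Fintype.sum_prod_type, Fin.sum_univ_three]
    have h1 : ∑ j, nsmSymbol γ β μ (2, i) (0, j) ξ * w (0, j) = 0 :=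
      Finset.sum_eq_zero fun j _ => zero_mul _
    have h2 : ∑ j, nsmSymbol γ β μ (2, i) (1, j) ξ * w (1, j) =
        -icross (angFreq ξ) (fun j => w (1, j)) i := by
      rw [← sum_curlSymbol_mul ξ (fun j => w (1, j)) i, ← Finset.sum_neg_distrib]
      exact Finset.sum_congr rfl fun j _ => neg_mul _ _
    have h3 : ∑ j, nsmSymbol γ β μ (2, i) (2, j) ξ * w (2, j) = 0 :=
      Finset.sum_eq_zero fun j _ => zero_mul _
    rw [h1, h2, h3]
    ring

theorem HasTimeDeriv.fourier {T : ℝ → TDist} {T' : TDist} {t : ℝ} (h : HasTimeDeriv T T' t)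
    (φ : 𝓢(R3, ℂ)) : HasDerivAt (fun τ => 𝓕 (T τ) φ) (𝓕 T' φ) t := h (𝓕 φ)

namespace IsLinearSolution

variable {γ β μ : ℝ} {n : ℝ → TDist} {u E B : ℝ → Fin 3 → TDist} {n₀ : TDist}
  {u₀ E₀ B₀ : Fin 3 → TDist}

theorem fourier_density (h : IsLinearSolution γ β μ n u E B n₀ u₀ E₀ B₀) (hγ : 0 < γ)
    (hβ : 0 < β) {t : ℝ} (ht : 0 ≤ t) :
    𝓕 (n t) = -(((γ / β : ℝ) : ℂ) • ∑ j, mulT (pdSymbol j) (𝓕 (E t j))) := by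
  rw [← fourier_sum_pd, h.div_E t ht, fourier_neg_tdist, fourier_smul_real, smul_neg, neg_neg,
    smul_smul, ← Complex.ofReal_mul]
  have : γ / β * (β / γ) = 1 := by field_simp
  rw [this, Complex.ofReal_one, one_smul]

/-- The Gauss law holds for all `t ≥ 0`, so `γ∇n` may be replaced by `-(γ²/β)∇ div E`. The nine
components of `u, E, B` then evolve by themselves. -/
theorem isSymbolFlow (h : IsLinearSolution γ β μ n u E B n₀ u₀ E₀ B₀) (hγ : 0 < γ)
    (hβ : 0 < β) :
    IsSymbolFlow (nsmSymbol γ β μ) (fun t x => 𝓕 (![u t, E t, B t] x.1 x.2)) := by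
  constructor
  · intro t ht x φ
    have hsum : ∑ y : Fin 3 × Fin 3, 𝓕 (![u t, E t, B t] y.1 y.2)
        (SchwartzMap.smulLeftCLM ℂ (nsmSymbol γ β μ x y) φ) =
        (∑ y : Fin 3 × Fin 3, mulT (nsmSymbol γ β μ x y) (![fun j => 𝓕 (u t j),
          fun j => 𝓕 (E t j), fun j => 𝓕 (B t j)] y.1 y.2)) φ := by
      rw [sum_apply]
      refine Finset.sum_congr rfl fun y _ => ?_
      rw [mulT, TemperedDistribution.smulLeftCLM_apply_apply]
      obtain ⟨c, j⟩ := y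
      fin_cases c <;> rfl
    rw [hsum]
    obtain ⟨b, i⟩ := x
    obtain ⟨h1, h2, h3⟩ := sum_mulT_nsmSymbol γ β μ (fun j => 𝓕 (u t j)) (fun j => 𝓕 (E t j))
      (fun j => 𝓕 (B t j)) i
    fin_cases b
    · refine ((h.eq_u t ht i).fourier φ).congr_deriv ?_
      refine congrArg (fun T : TDist => T φ) (Eq.trans ?_ h1.symm)
      rw [FourierTransform.fourier_add, fourier_sub_tdist, fourier_neg_tdist, fourier_smul_real,
        fourier_smul_real, fourier_smul_real, fourier_laplacian, fourier_pd,
        h.fourier_density hγ hβ ht.le, mulT_map_neg, mulT_map_smul, Complex.ofReal_mul]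
      ext φ
      simp
      ring
    · refine ((h.eq_E t ht i).fourier φ).congr_deriv ?_
      refine congrArg (fun T : TDist => T φ) (Eq.trans ?_ h2.symm)
      rw [FourierTransform.fourier_add, fourier_smul_real, fourier_curl, add_comm]
    · refine ((h.eq_B t ht i).fourier φ).congr_deriv ?_
      refine congrArg (fun T : TDist => T φ) (Eq.trans ?_ h3.symm)
      rw [fourier_neg_tdist, fourier_curl]
  · rintro ⟨b, i⟩ φ
    fin_cases b
    · exact (h.init_u i).2 (𝓕 φ)
    · exact (h.init_E i).2 (𝓕 φ)
    · exact (h.init_B i).2 (𝓕 φ)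

end IsLinearSolution

/-! ### The closed system for the density and the divergence of the velocity -/

/-- The symbol of `[n, div u] ↦ [-γ div u, -γ Δ n + (β²/γ) n + μ Δ div u]`. -/
noncomputable def densitySymbol (γ β μ : ℝ) : Fin 2 → Fin 2 → R3 → ℂ :=
  ![![0, fun _ => ((-γ : ℝ) : ℂ)], ![(γ : ℂ) • lapSymbol + fun _ => ((β ^ 2 / γ : ℝ) : ℂ),
    ((-μ : ℝ) : ℂ) • lapSymbol]]

theorem densitySymbol_hasTemperateGrowth (γ β μ : ℝ) (i j : Fin 2) :
    (densitySymbol γ β μ i j).HasTemperateGrowth := by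
  have hs : ∀ a : ℂ, (a • lapSymbol).HasTemperateGrowth :=
    fun a => (Function.HasTemperateGrowth.const a).mul lapSymbol_hasTemperateGrowth
  fin_cases i <;> fin_cases j
  exacts [Function.HasTemperateGrowth.const 0, Function.HasTemperateGrowth.const _,
    (hs _).add (Function.HasTemperateGrowth.const _), hs _]

namespace IsLinearSolution

variable {γ β μ : ℝ} {n : ℝ → TDist} {u E B : ℝ → Fin 3 → TDist} {n₀ : TDist}
  {u₀ E₀ B₀ : Fin 3 → TDist}

theorem hasTimeDeriv_divergence {V : ℝ → Fin 3 → TDist} {V' : Fin 3 → TDist} {t : ℝ}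
    (h : ∀ i, HasTimeDeriv (fun t => V t i) (V' i) t) :
    HasTimeDeriv (fun t => divergence (V t)) (divergence V') t := by
  intro φ
  have h1 : ∀ W : Fin 3 → TDist, divergence W φ = ∑ i, W i (-∂_{basisVec i} φ) := by
    intro W
    rw [divergence, sum_apply]
    exact Finset.sum_congr rfl fun i _ => TemperedDistribution.lineDerivOp_apply_apply _ _ _
  simp only [h1]
  exact HasDerivAt.fun_sum fun i _ => h i _

/-- The divergence of the momentum equation, with `div E = -(β/γ)n`, involves only `n` and `div u`.
Because `B` does not occur, the density can be estimated without any control of `B₀`. -/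
theorem isSymbolFlow_density (h : IsLinearSolution γ β μ n u E B n₀ u₀ E₀ B₀) :
    IsSymbolFlow (densitySymbol γ β μ) (fun t => ![𝓕 (n t), 𝓕 (divergence (u t))]) := by
  have hc : ∀ c : ℂ, (fun _ : R3 => c).HasTemperateGrowth := fun c =>
    Function.HasTemperateGrowth.const c
  have hl := lapSymbol_hasTemperateGrowth
  have hp := pdSymbol_hasTemperateGrowth
  constructor
  · intro t ht i φ
    fin_cases i
    · refine ((h.eq_n t ht).fourier φ).congr_deriv ?_
      have h1 : 𝓕 (-(γ • divergence (u t))) = mulT 0 (𝓕 (n t)) +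
          mulT (fun _ => ((-γ : ℝ) : ℂ)) (𝓕 (divergence (u t))) := by
        rw [mulT_zero, mulT_const, fourier_neg_tdist, fourier_smul_real, zero_add,
          Complex.ofReal_neg, neg_smul_tdist]
      rw [h1, Fin.sum_univ_two]
      rfl
    · refine ((hasTimeDeriv_divergence (h.eq_u t ht)).fourier φ).congr_deriv ?_
      have h1 : 𝓕 (divergence fun i => -(γ • pd i (n t)) - β • E t i + μ • Δ (u t i)) =
          mulT ((γ : ℂ) • lapSymbol + fun _ => ((β ^ 2 / γ : ℝ) : ℂ)) (𝓕 (n t)) +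
          mulT (((-μ : ℝ) : ℂ) • lapSymbol) (𝓕 (divergence (u t))) := by
        have h2 : ∑ i, mulT (pdSymbol i) (𝓕 (E t i)) = -(((β / γ : ℝ) : ℂ) • 𝓕 (n t)) := by
          rw [← fourier_sum_pd, h.div_E t ht.le, fourier_neg_tdist, fourier_smul_real]
        have h3 : ∑ i, mulT (pdSymbol i) (mulT (pdSymbol i) (𝓕 (n t))) =
            -mulT lapSymbol (𝓕 (n t)) := by
          rw [← fourier_laplacian,
            TemperedDistribution.laplacian_eq_sum (EuclideanSpace.basisFun (Fin 3) ℝ)]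
          have h4 : ∑ i, ∂_{(EuclideanSpace.basisFun (Fin 3) ℝ) i}
              (∂_{(EuclideanSpace.basisFun (Fin 3) ℝ) i} (n t)) =
              divergence fun i => pd i (n t) := by
            simp only [EuclideanSpace.basisFun_apply, divergence, pd, basisVec]
          rw [h4, fourier_sum_pd]
          simp only [fourier_pd]
        have h5 : ∑ i, mulT (pdSymbol i) (mulT lapSymbol (𝓕 (u t i))) =
            mulT lapSymbol (𝓕 (divergence (u t))) := by
          rw [fourier_sum_pd, mulT_map_sum]
          refine Finset.sum_congr rfl fun i _ => ?_
          rw [mulT_mulT (hp i) hl, mulT_mulT hl (hp i), mul_comm]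
        rw [fourier_sum_pd]
        have h6 : ∀ i, mulT (pdSymbol i) (𝓕 (-(γ • pd i (n t)) - β • E t i + μ • Δ (u t i))) =
            -((γ : ℂ) • mulT (pdSymbol i) (mulT (pdSymbol i) (𝓕 (n t)))) -
            (β : ℂ) • mulT (pdSymbol i) (𝓕 (E t i)) -
            (μ : ℂ) • mulT (pdSymbol i) (mulT lapSymbol (𝓕 (u t i))) := by
          intro i
          rw [FourierTransform.fourier_add, fourier_sub_tdist, fourier_neg_tdist,
            fourier_smul_real, fourier_smul_real, fourier_smul_real, fourier_laplacian,
            fourier_pd, mulT_map_add, mulT_map_sub, mulT_map_neg, mulT_map_smul, mulT_map_smul,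
            mulT_map_smul, mulT_map_neg]
          ext φ
          simp
          ring
        simp only [h6]
        rw [Finset.sum_sub_distrib, Finset.sum_sub_distrib, Finset.sum_neg_distrib,
          smul_sum_tdist, smul_sum_tdist, smul_sum_tdist, h2, h3, h5]
        have h7 : mulT ((γ : ℂ) • lapSymbol + fun _ => ((β ^ 2 / γ : ℝ) : ℂ)) (𝓕 (n t)) =
            (γ : ℂ) • mulT lapSymbol (𝓕 (n t)) + ((β ^ 2 / γ : ℝ) : ℂ) • 𝓕 (n t) := by
          rw [← mulT_smul hl, ← mulT_const (β ^ 2 / γ : ℝ) (𝓕 (n t))]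
          exact mulT_add ((hc _).mul hl) (hc _) _
        rw [h7, mulT_smul hl]
        ext φ
        simp
        ring
      rw [h1, Fin.sum_univ_two]
      rfl
  · intro i φ
    fin_cases i
    · exact h.init_n.2 (𝓕 φ)
    · have h1 : ∀ t, 𝓕 (divergence (u t)) φ = ∑ i, u t i (-∂_{basisVec i} (𝓕 φ)) := by
        intro t
        rw [TemperedDistribution.fourier_apply, divergence, sum_apply]
        exact Finset.sum_congr rfl fun i _ => TemperedDistribution.lineDerivOp_apply_apply _ _ _
      have h2 : ContinuousWithinAt (fun t => ∑ i, u t i (-∂_{basisVec i} (𝓕 φ))) (Set.Ici 0) 0 :=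
        tendsto_finsetSum _ fun i _ => (h.init_u i).2 _
      simpa [h1] using h2

end IsLinearSolution

/-! ### The matrix exponential as a function of frequency -/

section symbolSolution

variable {ι : Type*} [Fintype ι]

/-- The solution of the ordinary differential equation with the matrix `a ξ` and the initial value
`g ξ`. -/
noncomputable def symbolSolution (a : ι → ι → R3 → ℂ) (g : ι → R3 → ℂ) (t : ℝ) (ξ : R3) (i : ι) : ℂ :=
  NormedSpace.exp ((t : ℂ) • symbolMap a ξ) (fun j => g j ξ) i

variable {a : ι → ι → R3 → ℂ} {g : ι → R3 → ℂ}

theorem symbolSolution_zero (ξ : R3) (i : ι) : symbolSolution a g 0 ξ i = g i ξ := by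
  rw [symbolSolution, Complex.ofReal_zero, zero_smul ℂ (symbolMap a ξ), NormedSpace.exp_zero]
  rfl

theorem hasDerivAt_symbolSolution (ξ : R3) (i : ι) (t : ℝ) :
    HasDerivAt (fun t => symbolSolution a g t ξ i) (∑ j, a i j ξ * symbolSolution a g t ξ j) t := by
  have h1 : HasDerivAt (fun t : ℝ => NormedSpace.exp ((t : ℂ) • symbolMap a ξ))
      (symbolMap a ξ * NormedSpace.exp ((t : ℂ) • symbolMap a ξ)) t := by
    have h0 : HasDerivAt (fun t : ℝ => (t : ℂ)) 1 t := (hasDerivAt_id t).ofReal_comp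
    exact ((hasDerivAt_exp_smul_const' (𝕂 := ℂ) (symbolMap a ξ) (t : ℂ)).scomp t h0).congr_deriv
      (one_smul ℂ _)
  have h2 : HasDerivAt (fun t : ℝ => NormedSpace.exp ((t : ℂ) • symbolMap a ξ) fun j => g j ξ)
      ((symbolMap a ξ * NormedSpace.exp ((t : ℂ) • symbolMap a ξ)) fun j => g j ξ) t :=
    ((ContinuousLinearMap.apply ℂ (ι → ℂ) fun j => g j ξ).restrictScalars ℝ).hasFDerivAt.comp_hasDerivAt
      t h1
  refine ((hasDerivAt_pi.1 h2) i).congr_deriv ?_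
  rw [mul_apply_eq_comp, symbolMap_apply]
  rfl

theorem aestronglyMeasurable_symbolSolution (ha : ∀ i j, Continuous (a i j))
    (hg : ∀ i, AEStronglyMeasurable (g i)) (t : ℝ) (i : ι) :
    AEStronglyMeasurable (fun ξ => symbolSolution a g t ξ i) := by
  have h1 : Continuous fun ξ => symbolMap a ξ := by
    refine continuous_clm_apply.2 fun v => continuous_pi fun i => ?_
    simp only [symbolMap_apply]
    exact continuous_finsetSum _ fun j _ => (ha i j).mul continuous_const
  have h2 : Continuous fun ξ => NormedSpace.exp ((t : ℂ) • symbolMap a ξ) := by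
    let _ : NormedAlgebra ℚ ((ι → ℂ) →L[ℂ] (ι → ℂ)) := NormedAlgebra.restrictScalars ℚ ℂ _
    have h0 : Continuous fun ξ => (t : ℂ) • symbolMap a ξ := h1.const_smul (t : ℂ)
    exact NormedSpace.exp_continuous.comp h0
  have h3 : AEStronglyMeasurable (fun ξ => fun j => g j ξ) (volume : Measure R3) :=
    (aemeasurable_pi_iff.2 fun i => (hg i).aemeasurable).aestronglyMeasurable
  have h4 : Continuous fun p : ((ι → ℂ) →L[ℂ] (ι → ℂ)) × (ι → ℂ) => p.1 p.2 i :=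
    (continuous_apply i).comp (continuous_fst.clm_apply continuous_snd)
  exact h4.comp_aestronglyMeasurable (h2.aestronglyMeasurable.prodMk h3)

end symbolSolution

theorem locallyIntegrable_continuous_mul {f g : R3 → ℂ} (hf : Continuous f)
    (hg : LocallyIntegrable g) : LocallyIntegrable fun ξ => f ξ * g ξ := by
  rw [locallyIntegrable_iff] at hg ⊢
  exact fun K hK => (hg K hK).continuousOn_mul hf.continuousOn hK

theorem represents_sum_mulT {r : ℝ≥0∞} (hr : 1 ≤ r) {f g : Fin 3 → R3 → ℂ} {T : Fin 3 → TDist}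
    (hf : ∀ i, (f i).HasTemperateGrowth) (hg : ∀ i, MemLp (g i) r)
    (hT : ∀ i, Represents (T i) (g i)) :
    Represents (∑ i, mulT (f i) (T i)) (fun ξ => ∑ i, f i ξ * g i ξ) := by
  intro φ
  have h1 : ∀ i ξ, (SchwartzMap.smulLeftCLM ℂ (f i) φ) ξ * g i ξ = φ ξ * (f i ξ * g i ξ) := by
    intro i ξ
    rw [SchwartzMap.smulLeftCLM_apply_apply (hf i), smul_eq_mul]
    ring
  rw [sum_apply]
  simp only [Finset.mul_sum]
  rw [integral_finsetSum]
  · refine Finset.sum_congr rfl fun i _ => ?_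
    rw [mulT, TemperedDistribution.smulLeftCLM_apply_apply, hT i]
    simp only [h1]
  · intro i _
    have := SchwartzMap.integrable_mul_memLp hr (hg i) (SchwartzMap.smulLeftCLM ℂ (f i) φ)
    simpa only [h1] using this

theorem Represents.smul {T : TDist} {g : R3 → ℂ} (h : Represents T g) (c : ℂ) :
    Represents (c • T) (fun ξ => c * g ξ) := by
  intro φ
  have h1 : ∀ ξ, φ ξ * (c * g ξ) = c * (φ ξ * g ξ) := fun ξ => by ring
  simp only [h1]
  rw [integral_const_mul, ← h φ]
  rfl

/-! ### Pointwise bounds for the Fourier transform of a solution -/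

namespace IsLinearSolution

variable {γ β μ : ℝ} {n : ℝ → TDist} {u E B : ℝ → Fin 3 → TDist} {n₀ : TDist}
  {u₀ E₀ B₀ : Fin 3 → TDist}

theorem represents_density (h : IsLinearSolution γ β μ n u E B n₀ u₀ E₀ B₀) (hγ : 0 < γ)
    (hβ : 0 < β) {r : ℝ≥0∞} (hr : 1 ≤ r) {g : Fin 3 → R3 → ℂ} (hg : ∀ i, MemLp (g i) r)
    (hE : ∀ i, Represents (𝓕 (E₀ i)) (g i)) :
    Represents (𝓕 n₀) (fun ξ => -(γ / β * idot (angFreq ξ) fun i => g i ξ)) := by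
  have h1 := h.fourier_density hγ hβ le_rfl
  have hE0 : ∀ i, E 0 i = E₀ i := fun i => (h.init_E i).1
  simp only [hE0, h.init_n.1] at h1
  have h2 := (represents_sum_mulT hr pdSymbol_hasTemperateGrowth hg hE).smul
    (-((γ / β : ℝ) : ℂ))
  rw [h1, ← neg_smul_tdist]
  convert h2 using 2 with ξ
  simp only [idot, pdSymbol]
  push_cast
  ring

/-- At each frequency the solution formula is a compressible flow, so the oscillator bounds apply.
Representation is claimed against compactly supported tests only: that the function is in an `L^r`
space follows later from the bounds themselves. -/
theorem exists_density_bound (hγ : 0 < γ) (hβ : 0 < β) (hμ : 0 < μ) :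
    ∃ c C : ℝ, 0 < c ∧ 0 < C ∧ ∀ (n : ℝ → TDist) (u E B : ℝ → Fin 3 → TDist)
      (n₀ : TDist) (u₀ E₀ B₀ : Fin 3 → TDist) (r : ℝ≥0∞) (gu gE : Fin 3 → R3 → ℂ),
      IsLinearSolution γ β μ n u E B n₀ u₀ E₀ B₀ → 1 ≤ r →
      (∀ i, MemLp (gu i) r) → (∀ i, MemLp (gE i) r) →
      (∀ i, Represents (𝓕 (u₀ i)) (gu i)) → (∀ i, Represents (𝓕 (E₀ i)) (gE i)) →
      ∀ t, 0 ≤ t → ∃ h : R3 → ℂ, AEStronglyMeasurable h ∧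
        (∀ φ : 𝓢(R3, ℂ), HasCompactSupport φ → 𝓕 (n t) φ = ∫ ξ, φ ξ * h ξ) ∧
        ∀ (ξ : R3) (k : ℝ), k = 2 * Real.pi * ‖ξ‖ →
          (0 < k → k ≤ 1 → ‖h ξ‖ ≤ C * (Real.exp (-(c * k ^ 2 * t)) *
            (k * (∑ i, ‖gu i ξ‖ + ∑ i, ‖gE i ξ‖)))) ∧
          (1 ≤ k → ‖h ξ‖ ≤ C * (Real.exp (-(c * t)) *
            (‖-(γ / β * idot (angFreq ξ) fun i => gE i ξ)‖ + (∑ i, ‖gu i ξ‖) / k))) := by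
  obtain ⟨c₁, C₁, hc₁, hC₁, h₁⟩ := IsCompressibleFlow.exists_low_frequency_bound hγ hβ hμ
  obtain ⟨c₂, C₂, hc₂, hC₂, h₂⟩ := IsCompressibleFlow.exists_high_frequency_bound hγ hβ hμ
  have hγβ : 0 < γ / β := by positivity
  refine ⟨min c₁ c₂, C₁ * (1 + γ / β) + C₂, by positivity, by positivity,
    fun n u E B n₀ u₀ E₀ B₀ r gu gE hS hr hgu hgE hu hE t ht => ?_⟩
  set g : Fin 2 → R3 → ℂ := ![fun ξ => -(γ / β * idot (angFreq ξ) fun i => gE i ξ),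
    fun ξ => idot (angFreq ξ) fun i => gu i ξ] with hg
  have hcp : ∀ i, Continuous (pdSymbol i) := fun i => (pdSymbol_hasTemperateGrowth i).1.continuous
  have hloc : ∀ G : Fin 3 → R3 → ℂ, (∀ i, MemLp (G i) r) →
      LocallyIntegrable fun ξ => idot (angFreq ξ) fun i => G i ξ := by
    intro G hG
    simp only [idot, Fin.sum_univ_three]
    have h1 : ∀ i, LocallyIntegrable fun ξ => pdSymbol i ξ * G i ξ := fun i =>
      locallyIntegrable_continuous_mul (hcp i) ((hG i).locallyIntegrable hr)
    exact ((h1 0).add (h1 1)).add (h1 2)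
  have hgloc : ∀ i, LocallyIntegrable (g i) := by
    intro i
    fin_cases i
    · exact (locallyIntegrable_continuous_mul (f := fun _ => (γ / β : ℂ)) continuous_const
        (hloc gE hgE)).neg
    · exact hloc gu hgu
  have hrep : ∀ i, Represents (![𝓕 (n 0), 𝓕 (divergence (u 0))] i) (g i) := by
    intro i
    fin_cases i
    · have := hS.represents_density hγ hβ hr hgE hE
      rw [← hS.init_n.1] at this
      exact this
    · have hu0 : ∀ i, u 0 i = u₀ i := fun i => (hS.init_u i).1
      have h3 := represents_sum_mulT hr pdSymbol_hasTemperateGrowth hgu hu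
      have h4 := fourier_sum_pd (u 0)
      simp only [hu0] at h4
      rw [← h4] at h3
      exact h3
  have hflow := hS.isSymbolFlow_density
  have htemp := densitySymbol_hasTemperateGrowth γ β μ
  refine ⟨fun ξ => symbolSolution (densitySymbol γ β μ) g t ξ 0,
    aestronglyMeasurable_symbolSolution (fun i j => (htemp i j).1.continuous)
      (fun i => (hgloc i).aestronglyMeasurable) t 0,
    fun φ hφ => hflow.apply_eq_integral_exp htemp hgloc hrep ht 0 hφ, fun ξ k hk => ?_⟩
  have hsq : ∑ i, angFreq ξ i ^ 2 = k ^ 2 := by rw [hk, sum_angFreq_sq]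
  have hcf : IsCompressibleFlow γ β μ k
      (fun t => symbolSolution (densitySymbol γ β μ) g t ξ 0)
      (fun t => symbolSolution (densitySymbol γ β μ) g t ξ 1) := by
    have hγ' : (γ : ℂ) ≠ 0 := by exact_mod_cast hγ.ne'
    constructor
    · intro t
      refine (hasDerivAt_symbolSolution ξ 0 t).congr_deriv ?_
      rw [Fin.sum_univ_two]
      simp [densitySymbol]
    · intro t
      refine (hasDerivAt_symbolSolution ξ 1 t).congr_deriv ?_
      rw [Fin.sum_univ_two]
      have h3 : densitySymbol γ β μ 1 0 ξ = γ * k ^ 2 + β ^ 2 / γ := by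
        simp [densitySymbol, lapSymbol, hk]
      have h4 : densitySymbol γ β μ 1 1 ξ = -(μ * k ^ 2) := by
        simp [densitySymbol, lapSymbol, hk]
      rw [h3, h4]
      field_simp
      ring
  have hbd : 0 ≤ k → ∀ G : Fin 3 → R3 → ℂ, ‖idot (angFreq ξ) fun i => G i ξ‖ ≤ k * ∑ i, ‖G i ξ‖ :=
    fun hk0 G => norm_idot_le (abs_le_of_sum_sq hk0 hsq) _
  have hsu : 0 ≤ ∑ i, ‖gu i ξ‖ := Finset.sum_nonneg fun i _ => norm_nonneg _
  have hsE : 0 ≤ ∑ i, ‖gE i ξ‖ := Finset.sum_nonneg fun i _ => norm_nonneg _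
  have hd0 : symbolSolution (densitySymbol γ β μ) g 0 ξ 1 = idot (angFreq ξ) fun i => gu i ξ :=
    symbolSolution_zero ξ 1
  have hn0 : symbolSolution (densitySymbol γ β μ) g 0 ξ 0 =
      -(γ / β * idot (angFreq ξ) fun i => gE i ξ) := symbolSolution_zero ξ 0
  constructor
  · intro hk0 hk1
    have h3 := (h₁ k _ _ hcf hk0 hk1 t ht).1
    rw [hd0, hn0] at h3
    refine h3.trans ?_
    have h4 : ‖-((γ : ℂ) / β * idot (angFreq ξ) fun i => gE i ξ)‖ ≤
        γ / β * (k * ∑ i, ‖gE i ξ‖) := by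
      rw [norm_neg, ← Complex.ofReal_div]
      refine (norm_real_smul_le _ (abs_of_pos hγβ).le).trans ?_
      gcongr
      exact hbd hk0.le gE
    have h5 : Real.exp (-(c₁ * k ^ 2 * t)) ≤ Real.exp (-(min c₁ c₂ * k ^ 2 * t)) := by
      gcongr
      exact min_le_left _ _
    calc _ ≤ C₁ * (Real.exp (-(min c₁ c₂ * k ^ 2 * t)) *
          (γ / β * (k * ∑ i, ‖gE i ξ‖) + k * ∑ i, ‖gu i ξ‖)) := by
          gcongr
          exact hbd hk0.le gu
      _ ≤ C₁ * (Real.exp (-(min c₁ c₂ * k ^ 2 * t)) *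
          ((1 + γ / β) * (k * (∑ i, ‖gu i ξ‖ + ∑ i, ‖gE i ξ‖)))) := by
          gcongr
          have h6 : 0 ≤ k * ∑ i, ‖gE i ξ‖ := by positivity
          have h7 : 0 ≤ γ / β * (k * ∑ i, ‖gu i ξ‖) := by positivity
          linarith
      _ = C₁ * (1 + γ / β) * (Real.exp (-(min c₁ c₂ * k ^ 2 * t)) *
          (k * (∑ i, ‖gu i ξ‖ + ∑ i, ‖gE i ξ‖))) := by ring
      _ ≤ _ := by gcongr; linarith
  · intro hk1
    have hk0 : 0 < k := by linarith
    have h3 := (h₂ k _ _ hcf hk1 t ht).1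
    rw [hd0, hn0] at h3
    refine h3.trans ?_
    have h5 : Real.exp (-(c₂ * t)) ≤ Real.exp (-(min c₁ c₂ * t)) :=
      exp_neg_mul_le (min_le_right _ _) ht
    have h6 : ‖idot (angFreq ξ) fun i => gu i ξ‖ / k ^ 2 ≤ (∑ i, ‖gu i ξ‖) / k := by
      rw [div_le_div_iff₀ (by positivity) hk0]
      have := mul_le_mul_of_nonneg_right (hbd hk0.le gu) hk0.le
      linarith
    gcongr
    have : 0 ≤ C₁ * (1 + γ / β) := by positivity
    linarith

/-- The solution formula gives a frequency flow wherever `iv·B₀` vanishes on the Fourier side. The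
equation `div B₀ = 0` provides this almost everywhere, hence the quantifier in the bounds. -/
theorem exists_system_bound (hγ : 0 < γ) (hβ : 0 < β) (hμ : 0 < μ) :
    ∃ c C : ℝ, 0 < c ∧ 0 < C ∧ ∀ (n : ℝ → TDist) (u E B : ℝ → Fin 3 → TDist)
      (n₀ : TDist) (u₀ E₀ B₀ : Fin 3 → TDist) (r : ℝ≥0∞) (gu gE gB : Fin 3 → R3 → ℂ),
      IsLinearSolution γ β μ n u E B n₀ u₀ E₀ B₀ → 1 ≤ r →
      (∀ i, MemLp (gu i) r) → (∀ i, MemLp (gE i) r) → (∀ i, MemLp (gB i) r) →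
      (∀ i, Represents (𝓕 (u₀ i)) (gu i)) → (∀ i, Represents (𝓕 (E₀ i)) (gE i)) →
      (∀ i, Represents (𝓕 (B₀ i)) (gB i)) →
      ∀ t, 0 ≤ t → ∃ hu hE hB : Fin 3 → R3 → ℂ,
        (∀ i, AEStronglyMeasurable (hu i) ∧ AEStronglyMeasurable (hE i) ∧
          AEStronglyMeasurable (hB i)) ∧
        (∀ i, ∀ φ : 𝓢(R3, ℂ), HasCompactSupport φ → 𝓕 (u t i) φ = ∫ ξ, φ ξ * hu i ξ) ∧
        (∀ i, ∀ φ : 𝓢(R3, ℂ), HasCompactSupport φ → 𝓕 (E t i) φ = ∫ ξ, φ ξ * hE i ξ) ∧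
        (∀ i, ∀ φ : 𝓢(R3, ℂ), HasCompactSupport φ → 𝓕 (B t i) φ = ∫ ξ, φ ξ * hB i ξ) ∧
        ∀ᵐ ξ : R3, ∀ (k a b d m : ℝ), k = 2 * Real.pi * ‖ξ‖ → ∑ i, ‖gu i ξ‖ = a →
          ∑ i, ‖gE i ξ‖ = b → ∑ i, ‖gB i ξ‖ = d →
          ‖-(γ / β * idot (angFreq ξ) fun i => gE i ξ)‖ = m →
          (0 < k → k ≤ 1 → ∀ i,
            ‖hu i ξ‖ ≤ C * (Real.exp (-(c * k ^ 2 * t)) * (a + b + k * d) +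
              Real.exp (-(c * k ^ 4 * t)) * (k ^ 2 * a + k ^ 4 * b + k * d)) ∧
            ‖hE i ξ‖ ≤ C * (Real.exp (-(c * k ^ 2 * t)) * (a + b + k * d) +
              Real.exp (-(c * k ^ 4 * t)) * (k ^ 4 * a + k ^ 6 * b + k ^ 3 * d)) ∧
            ‖hB i ξ‖ ≤ C * (Real.exp (-(c * k ^ 2 * t)) * (k * (a + b + k * d)) +
              Real.exp (-(c * k ^ 4 * t)) * (k * a + k ^ 3 * b + d))) ∧
          (1 ≤ k → ∀ i,
            ‖hu i ξ‖ ≤ C * (Real.exp (-(c * t)) * (a + m / k) +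
              Real.exp (-(c / k ^ 2 * t)) * (a / k ^ 4 + b / k ^ 2 + d / k ^ 2)) ∧
            ‖hE i ξ‖ ≤ C * (Real.exp (-(c / k ^ 2 * t)) * (a / k ^ 2 + b + d)) ∧
            ‖hB i ξ‖ ≤ C * (Real.exp (-(c / k ^ 2 * t)) * (a / k ^ 2 + b + d))) := by
  obtain ⟨c₁, C₁, hc₁, hC₁, h₁⟩ := IsFrequencyFlow.exists_low_frequency_bound hγ hβ hμ
  obtain ⟨c₂, C₂, hc₂, hC₂, h₂⟩ := IsFrequencyFlow.exists_high_frequency_bound hγ hβ hμ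
  refine ⟨min c₁ c₂, C₁ + C₂, by positivity, by positivity,
    fun n u E B n₀ u₀ E₀ B₀ r gu gE gB hS hr hgu hgE hgB hu hE hB t ht => ?_⟩
  set g : Fin 3 × Fin 3 → R3 → ℂ := fun x => ![gu, gE, gB] x.1 x.2 with hg
  have hgloc : ∀ x, LocallyIntegrable (g x) := by
    rintro ⟨b, i⟩
    fin_cases b
    exacts [(hgu i).locallyIntegrable hr, (hgE i).locallyIntegrable hr,
      (hgB i).locallyIntegrable hr]
  have hrep : ∀ x : Fin 3 × Fin 3, Represents (𝓕 (![u 0, E 0, B 0] x.1 x.2)) (g x) := by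
    rintro ⟨b, i⟩
    fin_cases b
    · have := hu i
      rw [← (hS.init_u i).1] at this
      exact this
    · have := hE i
      rw [← (hS.init_E i).1] at this
      exact this
    · have := hB i
      rw [← (hS.init_B i).1] at this
      exact this
  have hflow := hS.isSymbolFlow hγ hβ
  have htemp := nsmSymbol_hasTemperateGrowth γ β μ
  have hmeas := fun x => aestronglyMeasurable_symbolSolution
    (fun i j => (htemp i j).1.continuous) (fun i => (hgloc i).aestronglyMeasurable) t x
  have hint := fun x => fun φ hφ => hflow.apply_eq_integral_exp htemp hgloc hrep ht x (φ := φ) hφ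
  have hdiv : ∀ᵐ ξ : R3, idot (angFreq ξ) (fun i => gB i ξ) = 0 := by
    have h3 := represents_sum_mulT hr pdSymbol_hasTemperateGrowth hgB hB
    have h4 := fourier_sum_pd (B 0)
    have hB0 : ∀ i, B 0 i = B₀ i := fun i => (hS.init_B i).1
    rw [hS.div_B 0 le_rfl] at h4
    simp only [hB0] at h4
    rw [← h4] at h3
    refine ae_eq_of_forall_integral_schwartz_eq ?_ (locallyIntegrable_const 0) fun φ _ => ?_
    · simp only [idot, Fin.sum_univ_three]
      have h1 : ∀ i, LocallyIntegrable fun ξ => pdSymbol i ξ * gB i ξ := fun i =>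
        locallyIntegrable_continuous_mul (pdSymbol_hasTemperateGrowth i).1.continuous
          ((hgB i).locallyIntegrable hr)
      exact ((h1 0).add (h1 1)).add (h1 2)
    · have h5 := h3 φ
      simp only [mul_zero, integral_zero]
      rw [TemperedDistribution.fourier_apply] at h5
      exact h5.symm
  refine ⟨fun i ξ => symbolSolution (nsmSymbol γ β μ) g t ξ (0, i),
    fun i ξ => symbolSolution (nsmSymbol γ β μ) g t ξ (1, i),
    fun i ξ => symbolSolution (nsmSymbol γ β μ) g t ξ (2, i),
    fun i => ⟨hmeas (0, i), hmeas (1, i), hmeas (2, i)⟩, fun i => hint (0, i), fun i => hint (1, i),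
    fun i => hint (2, i), ?_⟩
  filter_upwards [hdiv] with ξ hξ k a b d m hk ha hb hd hm
  have hX : IsFrequencyFlow γ β μ (angFreq ξ) k
      (fun t i => symbolSolution (nsmSymbol γ β μ) g t ξ (0, i))
      (fun t i => symbolSolution (nsmSymbol γ β μ) g t ξ (1, i))
      (fun t i => symbolSolution (nsmSymbol γ β μ) g t ξ (2, i)) := by
    constructor
    · rw [hk, sum_angFreq_sq]
    · intro t i
      refine (hasDerivAt_symbolSolution ξ (0, i) t).congr_deriv ?_
      rw [hk]
      exact (sum_nsmSymbol_mul γ β μ ξ _ i).1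
    · intro t i
      exact (hasDerivAt_symbolSolution ξ (1, i) t).congr_deriv (sum_nsmSymbol_mul γ β μ ξ _ i).2.1
    · intro t i
      exact (hasDerivAt_symbolSolution ξ (2, i) t).congr_deriv (sum_nsmSymbol_mul γ β μ ξ _ i).2.2
    · simp only [symbolSolution_zero]
      exact hξ
  have hau : ∑ i, ‖symbolSolution (nsmSymbol γ β μ) g 0 ξ (0, i)‖ = a := by
    simp only [symbolSolution_zero]; exact ha
  have hbE : ∑ i, ‖symbolSolution (nsmSymbol γ β μ) g 0 ξ (1, i)‖ = b := by
    simp only [symbolSolution_zero]; exact hb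
  have hdB : ∑ i, ‖symbolSolution (nsmSymbol γ β μ) g 0 ξ (2, i)‖ = d := by
    simp only [symbolSolution_zero]; exact hd
  have hmE : ‖(γ / β : ℂ) * idot (angFreq ξ)
      fun i => symbolSolution (nsmSymbol γ β μ) g 0 ξ (1, i)‖ = m := by
    simp only [symbolSolution_zero]; rw [norm_neg] at hm; exact hm
  have ha0 : 0 ≤ a := ha ▸ Finset.sum_nonneg fun i _ => norm_nonneg _
  have hb0 : 0 ≤ b := hb ▸ Finset.sum_nonneg fun i _ => norm_nonneg _
  have hd0 : 0 ≤ d := hd ▸ Finset.sum_nonneg fun i _ => norm_nonneg _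
  have hm0 : 0 ≤ m := hm ▸ norm_nonneg _
  have hc1 : min c₁ c₂ ≤ c₁ := min_le_left _ _
  have hc2 : min c₁ c₂ ≤ c₂ := min_le_right _ _
  set c := min c₁ c₂ with hc
  constructor
  · intro hk0 hk1 i
    obtain ⟨q1, q2, q3⟩ := h₁ (angFreq ξ) k _ _ _ a b d hX hk0 hk1 hau hbE hdB t ht i
    have key : ∀ w P Q : ℝ, 0 ≤ P → 0 ≤ Q → w ≤ C₁ * (Real.exp (-(c₁ * k ^ 2 * t)) * P +
        Real.exp (-(c₁ * k ^ 4 * t)) * Q) → w ≤ (C₁ + C₂) * (Real.exp (-(c * k ^ 2 * t)) * P +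
        Real.exp (-(c * k ^ 4 * t)) * Q) := by
      intro w P Q hP hQ hw
      refine hw.trans ?_
      gcongr
      linarith
    exact ⟨key _ _ _ (by positivity) (by positivity) q1,
      key _ _ _ (by positivity) (by positivity) q2, key _ _ _ (by positivity) (by positivity) q3⟩
  · intro hk1 i
    have hk0 : 0 < k := by linarith
    obtain ⟨q1, q2, q3⟩ := h₂ (angFreq ξ) k _ _ _ a b d m hX hk1 hau hbE hdB hmE t ht i
    have g1 : Real.exp (-(c₂ * t)) ≤ Real.exp (-(c * t)) := exp_neg_mul_le hc2 ht
    have g2 : Real.exp (-(c₂ / k ^ 2 * t)) ≤ Real.exp (-(c / k ^ 2 * t)) :=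
      exp_neg_mul_le (by gcongr) ht
    refine ⟨q1.trans ?_, q2.trans ?_, q3.trans ?_⟩ <;>
    · gcongr
      linarith

end IsLinearSolution

/-! ### Norms of the low and high frequency kernels -/

/-- The length `|2πξ|` of the angular frequency. -/
noncomputable def waveNumber (ξ : R3) : ℝ := 2 * Real.pi * ‖ξ‖

theorem waveNumber_nonneg (ξ : R3) : 0 ≤ waveNumber ξ := by unfold waveNumber; positivity

theorem measurable_waveNumber : Measurable waveNumber := by unfold waveNumber; fun_prop

theorem norm_le_waveNumber (ξ : R3) : ‖ξ‖ ≤ waveNumber ξ := by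
  unfold waveNumber
  nlinarith [Real.pi_gt_three, norm_nonneg ξ]

theorem waveNumber_smul {a : ℝ} (ha : 0 ≤ a) (ξ : R3) : waveNumber (a • ξ) = a * waveNumber ξ := by
  rw [waveNumber, waveNumber, norm_smul, Real.norm_of_nonneg ha]
  ring

/-- A function that decays like `|ξ|^{-b}` belongs to `L^r` if `b > 3 / r`. -/
theorem memLp_of_waveNumber_decay {r : ℝ≥0∞} (hr : 1 ≤ r) {b C : ℝ} (hb : 0 ≤ b)
    (hbr : r = ∞ ∨ 3 * (r⁻¹).toReal < b) {f : R3 → ℝ} (hf : AEStronglyMeasurable f)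
    (h : ∀ ξ, ‖f ξ‖ ≤ C * max 1 (waveNumber ξ) ^ (-b)) : MemLp f r := by
  have hC : 0 ≤ C := by
    have h0 := (norm_nonneg _).trans (h 0)
    rwa [waveNumber, norm_zero, mul_zero, max_eq_left zero_le_one, Real.one_rpow, mul_one] at h0
  have hmeas : AEStronglyMeasurable (fun ξ : R3 => (1 + ‖ξ‖) ^ (-b)) :=
    Measurable.aestronglyMeasurable (by fun_prop)
  have hG : MemLp (fun ξ : R3 => (1 + ‖ξ‖) ^ (-b)) r := by
    by_cases hrt : r = ∞
    · rw [hrt]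
      refine memLp_top_of_bound hmeas 1 (Filter.Eventually.of_forall fun ξ => ?_)
      rw [Real.norm_of_nonneg (by positivity)]
      exact Real.rpow_le_one_of_one_le_of_nonpos (by linarith [norm_nonneg ξ]) (by linarith)
    · have hbr' := hbr.resolve_left hrt
      have hr0 : r ≠ 0 := (zero_lt_one.trans_le hr).ne'
      have hrpos : 0 < r.toReal := ENNReal.toReal_pos hr0 hrt
      rw [← integrable_norm_rpow_iff hmeas hr0 hrt]
      rw [ENNReal.toReal_inv, ← div_eq_mul_inv, div_lt_iff₀ hrpos] at hbr'
      have h3 : (Module.finrank ℝ R3 : ℝ) < b * r.toReal := by simpa using hbr'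
      refine (integrable_one_add_norm (E := R3) (μ := volume) h3).congr
        (Filter.Eventually.of_forall fun ξ => ?_)
      simp only
      rw [Real.norm_of_nonneg (by positivity), ← Real.rpow_mul (by positivity), neg_mul]
  refine hG.of_le_mul hf (c := C * 2 ^ b) (Filter.Eventually.of_forall fun ξ => (h ξ).trans ?_)
  rw [Real.norm_of_nonneg (by positivity), mul_assoc]
  refine mul_le_mul_of_nonneg_left ?_ hC
  have h1 : 1 + ‖ξ‖ ≤ 2 * max 1 (waveNumber ξ) := by
    linarith [le_max_left 1 (waveNumber ξ), le_max_right 1 (waveNumber ξ), norm_le_waveNumber ξ]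
  have h2 : (2 * max 1 (waveNumber ξ)) ^ (-b) ≤ (1 + ‖ξ‖) ^ (-b) :=
    Real.rpow_le_rpow_of_nonpos (by positivity) h1 (by linarith)
  rw [Real.mul_rpow (by norm_num) (by positivity), Real.rpow_neg (by norm_num)] at h2
  have h3 : (0 : ℝ) < 2 ^ b := by positivity
  calc max 1 (waveNumber ξ) ^ (-b) = 2 ^ b * ((2 ^ b)⁻¹ * max 1 (waveNumber ξ) ^ (-b)) := by
        field_simp
    _ ≤ _ := by gcongr

theorem three_mul_inv_toReal_le {r : ℝ≥0∞} (hr : 1 ≤ r) : 3 * (r⁻¹).toReal ≤ 3 := by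
  have : (r⁻¹).toReal ≤ 1 := by
    refine ENNReal.toReal_le_of_le_ofReal zero_le_one ?_
    rw [ENNReal.ofReal_one]
    exact ENNReal.inv_le_one.2 hr
  linarith

theorem memLp_waveNumber_pow_mul_exp {r : ℝ≥0∞} (hr : 1 ≤ r) (a : ℕ) {m : ℕ} (hm : m ≠ 0) {c : ℝ}
    (hc : 0 < c) : MemLp (fun ξ => waveNumber ξ ^ a * Real.exp (-(c * waveNumber ξ ^ m))) r := by
  have hk := measurable_waveNumber
  -- The exponent `4` exceeds `3/r` for every `r ≥ 1`. The constant comes from `y^N/N! ≤ e^y` with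
  -- `N = a + 4` and `y = ck`.
  refine memLp_of_waveNumber_decay hr (b := 4) (C := 1 + (a + 4).factorial / c ^ (a + 4)) (by norm_num)
    (Or.inr (by linarith [three_mul_inv_toReal_le hr])) (Measurable.aestronglyMeasurable (by fun_prop))
    fun ξ => ?_
  have h0 := waveNumber_nonneg ξ
  set k := waveNumber ξ
  rw [Real.norm_of_nonneg (by positivity)]
  have h4 : (4 : ℝ) = ((4 : ℕ) : ℝ) := by norm_num
  rw [Real.rpow_neg (by positivity), h4, Real.rpow_natCast]
  rcases le_total k 1 with h1 | h1
  · rw [max_eq_left h1, one_pow, inv_one, mul_one]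
    have h2 : k ^ a * Real.exp (-(c * k ^ m)) ≤ 1 * 1 := by
      gcongr
      · exact pow_le_one₀ h0 h1
      · exact Real.exp_le_one_iff.2 (by have : 0 ≤ c * k ^ m := by positivity
                                        linarith)
    have : (0 : ℝ) ≤ (a + 4).factorial / c ^ (a + 4) := by positivity
    linarith
  · have hk0 : 0 < k := by linarith
    rw [max_eq_right h1]
    have h2 : k ≤ k ^ m := le_self_pow₀ h1 hm
    have h3 := Real.pow_div_factorial_le_exp (x := c * k) (by positivity) (a + 4)
    rw [div_le_iff₀ (by positivity), mul_pow] at h3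
    have h5 : Real.exp (-(c * k ^ m)) ≤ Real.exp (-(c * k)) := by
      apply Real.exp_le_exp.2
      have := mul_le_mul_of_nonneg_left h2 hc.le
      linarith
    have h6 : k ^ a * k ^ 4 * Real.exp (-(c * k)) ≤ (a + 4).factorial / c ^ (a + 4) := by
      rw [le_div_iff₀ (by positivity), Real.exp_neg, ← pow_add]
      have := Real.exp_pos (c * k)
      field_simp
      linarith
    have hk4 : 0 < k ^ 4 := by positivity
    rw [← div_eq_mul_inv, le_div_iff₀ hk4]
    calc k ^ a * Real.exp (-(c * k ^ m)) * k ^ 4 = k ^ a * k ^ 4 * Real.exp (-(c * k ^ m)) := by ring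
      _ ≤ k ^ a * k ^ 4 * Real.exp (-(c * k)) := by gcongr
      _ ≤ _ := by linarith

theorem eLpNorm_comp_smul {f : R3 → ℝ} (hf : AEStronglyMeasurable f) (r : ℝ≥0∞) {a : ℝ}
    (ha : 0 < a) : eLpNorm (fun ξ => f (a • ξ)) r volume =
      ENNReal.ofReal (a ^ (-(3 * (r⁻¹).toReal))) * eLpNorm f r volume := by
  have h1 : Measure.map (fun ξ : R3 => a • ξ) volume = ENNReal.ofReal ((a ^ 3)⁻¹) • volume := by
    rw [Measure.map_addHaar_smul volume ha.ne']
    simp only [finrank_euclideanSpace, Fintype.card_fin]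
    rw [abs_of_pos (by positivity)]
  have h2 : ENNReal.ofReal ((a ^ 3)⁻¹) ≠ 0 := by
    rw [Ne, ENNReal.ofReal_eq_zero, not_le]; positivity
  have h3 : AEStronglyMeasurable f (Measure.map (fun ξ : R3 => a • ξ) volume) := by
    rw [h1]; exact hf.smul_measure _
  have h4 := eLpNorm_map_measure (p := r) h3 (by fun_prop)
  rw [h1, eLpNorm_smul_measure_of_ne_zero h2] at h4
  change eLpNorm (f ∘ fun ξ => a • ξ) r volume = _
  rw [← h4, smul_eq_mul, one_div, ENNReal.ofReal_rpow_of_pos (by positivity)]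
  congr 2
  rw [Real.rpow_neg ha.le, Real.rpow_mul ha.le, Real.inv_rpow (by positivity)]
  norm_cast

open Classical in
/-- The multiplier `|2πξ|^a e^{-c|2πξ|^m t}`, cut off to low frequencies. -/
noncomputable def lowKernel (a m : ℕ) (c t : ℝ) (ξ : R3) : ℝ :=
  if waveNumber ξ ≤ 1 then waveNumber ξ ^ a * Real.exp (-(c * waveNumber ξ ^ m * t)) else 0

open Classical in
/-- The multiplier `|2πξ|^l`, cut off to high frequencies. -/
noncomputable def highKernel (l : ℝ) (ξ : R3) : ℝ :=
  if 1 ≤ waveNumber ξ then waveNumber ξ ^ l else 0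

theorem lowKernel_nonneg (a m : ℕ) (c t : ℝ) (ξ : R3) : 0 ≤ lowKernel a m c t ξ := by
  have := waveNumber_nonneg ξ
  unfold lowKernel; split_ifs <;> positivity

theorem highKernel_nonneg (l : ℝ) (ξ : R3) : 0 ≤ highKernel l ξ := by
  have := waveNumber_nonneg ξ
  unfold highKernel; split_ifs <;> positivity

theorem measurable_lowKernel (a m : ℕ) (c t : ℝ) : Measurable (lowKernel a m c t) := by
  have hk := measurable_waveNumber
  exact Measurable.ite (measurableSet_le hk measurable_const) (by fun_prop) measurable_const

theorem measurable_highKernel (l : ℝ) : Measurable (highKernel l) := by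
  have hk := measurable_waveNumber
  exact Measurable.ite (measurableSet_le measurable_const hk) (by fun_prop) measurable_const

theorem memLp_highKernel {r : ℝ≥0∞} (hr : 1 ≤ r) {b : ℝ} (hb : 0 ≤ b)
    (hbr : r = ∞ ∨ 3 * (r⁻¹).toReal < b) : MemLp (highKernel (-b)) r := by
  refine memLp_of_waveNumber_decay hr (C := 1) hb hbr (measurable_highKernel _).aestronglyMeasurable
    fun ξ => ?_
  rw [Real.norm_of_nonneg (highKernel_nonneg _ _), one_mul, highKernel]
  split_ifs with h
  · rw [max_eq_right h]
  · positivity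

/-- Below `k = 1` the factor `e^{-ck^m t}` is at most `e^c e^{-ck^m(1+t)}`, which is a dilate by
`(1+t)^{1/m}` of a fixed function. Dilation gives the exponent `(a + 3/r)/m` from the weight `k^a`
and the volume, uniformly down to `t = 0`. -/
theorem exists_eLpNorm_lowKernel_le {r : ℝ≥0∞} (hr : 1 ≤ r) (a : ℕ) {m : ℕ} (hm : m ≠ 0) {c : ℝ}
    (hc : 0 < c) : ∃ C : ℝ, 0 < C ∧ ∀ t, 0 ≤ t → eLpNorm (lowKernel a m c t) r volume ≤
      ENNReal.ofReal C * polyDecay ((a + 3 * (r⁻¹).toReal) / m) t := by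
  have hG := memLp_waveNumber_pow_mul_exp hr a hm hc
  set G : R3 → ℝ := fun ξ => waveNumber ξ ^ a * Real.exp (-(c * waveNumber ξ ^ m)) with hGdef
  set N := eLpNorm G r volume with hN
  have hNt : N ≠ ∞ := hG.2.ne
  refine ⟨Real.exp c * (N.toReal + 1), by positivity, fun t ht => ?_⟩
  have ht1 : (0 : ℝ) < 1 + t := by linarith
  have hm0 : (m : ℝ) ≠ 0 := Nat.cast_ne_zero.2 hm
  set y : ℝ := (1 + t) ^ ((1 : ℝ) / m) with hy
  have hy0 : 0 < y := by positivity
  have hym : y ^ m = 1 + t := by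
    rw [hy, ← Real.rpow_natCast, ← Real.rpow_mul ht1.le, one_div_mul_cancel hm0, Real.rpow_one]
  have hpt : ∀ ξ, ‖lowKernel a m c t ξ‖ ≤ Real.exp c * (y ^ a)⁻¹ * ‖G (y • ξ)‖ := by
    intro ξ
    have h0 := waveNumber_nonneg ξ
    rw [Real.norm_of_nonneg (lowKernel_nonneg _ _ _ _ _), lowKernel]
    split_ifs with h1
    · rw [hGdef]
      simp only [waveNumber_smul hy0.le]
      rw [Real.norm_of_nonneg (by positivity), mul_pow, mul_pow, hym]
      calc waveNumber ξ ^ a * Real.exp (-(c * waveNumber ξ ^ m * t))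
          ≤ waveNumber ξ ^ a *
            (Real.exp c * Real.exp (-(c * ((1 + t) * waveNumber ξ ^ m)))) := by
            rw [← Real.exp_add]
            gcongr
            have : waveNumber ξ ^ m ≤ 1 := pow_le_one₀ h0 h1
            nlinarith
        _ = _ := by field_simp
    · positivity
  have h1 := eLpNorm_le_mul_eLpNorm_of_ae_le_mul (p := r) (μ := volume)
    (Filter.Eventually.of_forall hpt)
  rw [eLpNorm_comp_smul hG.1 r hy0, ← hN] at h1
  refine h1.trans ?_
  have hd : (y ^ a)⁻¹ * y ^ (-(3 * (r⁻¹).toReal)) =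
      (1 + t) ^ (-((a + 3 * (r⁻¹).toReal) / m)) := by
    rw [← Real.rpow_natCast, ← Real.rpow_neg hy0.le, ← Real.rpow_add hy0, hy,
      ← Real.rpow_mul ht1.le]
    congr 1
    field_simp
    ring
  have hNle : N ≤ ENNReal.ofReal (N.toReal + 1) := by
    rw [← ENNReal.ofReal_toReal hNt]
    refine ENNReal.ofReal_le_ofReal ?_
    rw [ENNReal.toReal_ofReal ENNReal.toReal_nonneg]
    linarith
  rw [polyDecay, ← hd, ← mul_assoc, ← ENNReal.ofReal_mul (by positivity)]
  refine (mul_le_mul_right hNle _).trans ?_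
  rw [← ENNReal.ofReal_mul (by positivity), ← ENNReal.ofReal_mul (by positivity)]
  apply ENNReal.ofReal_le_ofReal
  apply le_of_eq; ring

/-- The mechanism of regularity loss. With `y = t/k²` one has `1 + t ≤ k²(1 + y)`, and `e^{-cy}`
beats any power of `1 + y`, so decay of order `ℓ/2` costs the factor `k^ℓ`. -/
theorem exp_neg_div_sq_mul_le {c l : ℝ} (hc : 0 < c) (hl : 0 ≤ l) : ∃ D : ℝ, 0 < D ∧ ∀ k t : ℝ,
    1 ≤ k → 0 ≤ t → Real.exp (-(c / k ^ 2 * t)) ≤ D * (1 + t) ^ (-(l / 2)) * k ^ l := by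
  obtain ⟨N, hN⟩ := exists_nat_ge (l / 2)
  refine ⟨Real.exp c * (N.factorial / c ^ N), by positivity, fun k t hk ht => ?_⟩
  have hk0 : 0 < k := by linarith
  set y := t / k ^ 2 with hy
  have hy0 : 0 ≤ y := by positivity
  have h1 : 1 + t ≤ k ^ 2 * (1 + y) := by
    have h2 : k ^ 2 * y = t := by rw [hy]; field_simp
    rw [mul_add, h2]
    nlinarith
  have h2 : (1 + t) ^ (l / 2) ≤ k ^ l * (1 + y) ^ N := by
    calc (1 + t) ^ (l / 2) ≤ (k ^ 2 * (1 + y)) ^ (l / 2) :=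
          Real.rpow_le_rpow (by linarith) h1 (by linarith)
      _ = k ^ l * (1 + y) ^ (l / 2) := by
          rw [Real.mul_rpow (by positivity) (by positivity), ← Real.rpow_natCast k 2,
            ← Real.rpow_mul hk0.le]
          congr 2
          push_cast; ring
      _ ≤ k ^ l * (1 + y) ^ (N : ℝ) := by
          gcongr
          linarith
      _ = _ := by rw [Real.rpow_natCast]
  have h3 := Real.pow_div_factorial_le_exp (x := c * (1 + y)) (by positivity) N
  rw [div_le_iff₀ (by positivity), mul_pow] at h3
  have h4 : c / k ^ 2 * t = c * y := by rw [hy]; ring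
  rw [h4, Real.rpow_neg (by linarith)]
  have h5 : (0 : ℝ) < (1 + t) ^ (l / 2) := by positivity
  have h6 : Real.exp (c * (1 + y)) = Real.exp c * Real.exp (c * y) := by
    rw [← Real.exp_add]; ring_nf
  rw [h6] at h3
  rw [Real.exp_neg]
  have h7 := Real.exp_pos (c * y)
  have h8 : 0 < c ^ N := by positivity
  have h9 : (1 + y) ^ N ≤ Real.exp c * (N.factorial / c ^ N) * Real.exp (c * y) := by
    calc (1 + y) ^ N = c ^ N * (1 + y) ^ N / c ^ N := by field_simp
      _ ≤ Real.exp c * Real.exp (c * y) * N.factorial / c ^ N :=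
        div_le_div_of_nonneg_right h3 h8.le
      _ = _ := by ring
  have h10 : (1 + t) ^ (l / 2) ≤
      k ^ l * (Real.exp c * (N.factorial / c ^ N) * Real.exp (c * y)) :=
    h2.trans (by gcongr)
  rw [inv_le_iff_one_le_mul₀ h7]
  calc (1 : ℝ) = (1 + t) ^ (l / 2) * ((1 + t) ^ (l / 2))⁻¹ := by field_simp
    _ ≤ k ^ l * (Real.exp c * (N.factorial / c ^ N) * Real.exp (c * y)) *
        ((1 + t) ^ (l / 2))⁻¹ := by gcongr
    _ = _ := by ring

/-! ### From pointwise multipliers to norms -/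

/-- The kernel exponent is `1/r = 1/p - 1/q`, which is exactly what Hölder needs between `L^{p'}`
and `L^{q'}`. The value `r = ∞` at `p = q = 2` is the case where a merely bounded kernel is enough.
-/
theorem exists_holder_exponents {p q q' : ℝ≥0∞} (hp1 : 1 ≤ p) (hp2 : p ≤ 2) (hq : 2 ≤ q)
    (hqq : q'⁻¹ + q⁻¹ = 1) : ∃ p' r : ℝ≥0∞, 1 ≤ p' ∧ p⁻¹ + p'⁻¹ = 1 ∧ 1 ≤ r ∧
      ENNReal.HolderTriple r p' q' ∧ 3 * (r⁻¹).toReal = gap p q ∧ (p = 2 → q = 2 → r = ∞) := by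
  have h1 : p⁻¹ ≤ 1 := ENNReal.inv_le_one.2 hp1
  have hqp : q⁻¹ ≤ p⁻¹ := ENNReal.inv_le_inv.2 (hp2.trans hq)
  have hpt : p⁻¹ ≠ ∞ := (h1.trans_lt ENNReal.one_lt_top).ne
  have hqt : q⁻¹ ≠ ∞ := (hqp.trans_lt hpt.lt_top).ne
  refine ⟨(1 - p⁻¹)⁻¹, (p⁻¹ - q⁻¹)⁻¹, ?_, ?_, ?_, ⟨?_⟩, ?_, ?_⟩
  · exact ENNReal.one_le_inv.2 tsub_le_self
  · rw [inv_inv]; exact add_tsub_cancel_of_le h1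
  · exact ENNReal.one_le_inv.2 (tsub_le_self.trans h1)
  · rw [inv_inv, inv_inv]
    have h2 : p⁻¹ - q⁻¹ + (1 - p⁻¹) + q⁻¹ = q'⁻¹ + q⁻¹ := by
      rw [hqq, add_right_comm, tsub_add_cancel_of_le hqp, add_tsub_cancel_of_le h1]
    exact (ENNReal.add_left_inj hqt).1 h2
  · rw [inv_inv, ENNReal.toReal_sub_of_le hqp hpt, gap]
  · rintro rfl rfl
    simp

/-- The function `f` is measurable and its `L^q` norm is at most `C X`. -/
structure FreqBound (q : ℝ≥0∞) (C : ℝ) (X : ℝ≥0∞) (f : R3 → ℝ) : Prop where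
  pos : 0 < C
  aestronglyMeasurable : AEStronglyMeasurable f
  eLpNorm_le : eLpNorm f q volume ≤ ENNReal.ofReal C * X

namespace FreqBound

variable {q X Y : ℝ≥0∞} {C D : ℝ} {f g : R3 → ℝ}

theorem mono (h : FreqBound q C X f) (hX : X ≤ Y) : FreqBound q C Y f :=
  ⟨h.pos, h.aestronglyMeasurable, h.eLpNorm_le.trans (by gcongr)⟩

theorem add (hf : FreqBound q C X f) (hg : FreqBound q D X g) (hq : 1 ≤ q) :
    FreqBound q (C + D) X (fun ξ => f ξ + g ξ) := by
  refine ⟨add_pos hf.pos hg.pos, hf.aestronglyMeasurable.add hg.aestronglyMeasurable,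
    (eLpNorm_add_le hf.aestronglyMeasurable hg.aestronglyMeasurable hq).trans ?_⟩
  rw [ENNReal.ofReal_add hf.pos.le hg.pos.le, add_mul]
  exact add_le_add hf.eLpNorm_le hg.eLpNorm_le

theorem smul {a : ℝ} (ha : 0 ≤ a) (h : FreqBound q C X f) :
    FreqBound q C (ENNReal.ofReal a * X) (fun ξ => a * f ξ) := by
  refine ⟨h.pos, h.aestronglyMeasurable.const_mul a,
    (eLpNorm_const_smul_le (c := a) (f := f)).trans ?_⟩
  rw [mul_left_comm, Real.enorm_of_nonneg ha]
  gcongr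
  exact h.eLpNorm_le

theorem const_mul {a : ℝ} (ha : 0 < a) (h : FreqBound q C X f) :
    FreqBound q (a * C) X (fun ξ => a * f ξ) := by
  refine ⟨mul_pos ha h.pos, h.aestronglyMeasurable.const_mul a,
    (h.smul ha.le).eLpNorm_le.trans (le_of_eq ?_)⟩
  rw [ENNReal.ofReal_mul ha.le]
  ring

theorem mul_sum {K : R3 → ℝ} {f : Fin 3 → R3 → ℝ}
    (h : ∀ i, FreqBound q C X (fun ξ => K ξ * f i ξ)) (hq : 1 ≤ q) :
    FreqBound q (C + C + C) X (fun ξ => K ξ * ∑ i, f i ξ) := by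
  have := ((h 0).add (h 1) hq).add (h 2) hq
  convert this using 2 with ξ
  rw [Fin.sum_univ_three]
  ring

end FreqBound

/-- The transform of the data has already been chosen by means of `p`. Uniqueness lets the
Hausdorff-Young bound for another exponent, such as `s`, apply to that same function. -/
theorem exists_fourier_eLpNorm_le {p p' : ℝ≥0∞} (h1 : 1 ≤ p) (h2 : p ≤ 2) (hp' : 1 ≤ p')
    (hpp : p⁻¹ + p'⁻¹ = 1) : ∃ C : ℝ, 0 < C ∧ ∀ (T : TDist) (g : R3 → ℂ), LocallyIntegrable g →
      Represents (𝓕 T) g → distLpNorm p T ≠ ∞ →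
        MemLp g p' ∧ eLpNorm g p' volume ≤ ENNReal.ofReal C * distLpNorm p T := by
  obtain ⟨C, hC, h⟩ := exists_fourier_represents h1 h2 hpp
  refine ⟨C + 1, by positivity, fun T g hg hT hfin => ?_⟩
  obtain ⟨g', hg', hT', hb⟩ := h T hfin
  have hae : g =ᵐ[volume] g' := ae_eq_of_forall_integral_schwartz_eq hg
    (hg'.locallyIntegrable hp') fun φ _ => by rw [← hT, ← hT']
  refine ⟨(memLp_congr_ae hae).2 hg', ?_⟩
  rw [eLpNorm_congr_ae hae]
  refine hb.trans ?_
  gcongr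
  linarith

theorem eLpNorm_kernel_mul_norm_le {r p' q' : ℝ≥0∞} [ENNReal.HolderTriple r p' q'] {K : R3 → ℝ}
    {g : R3 → ℂ} (hK : AEStronglyMeasurable K) (hg : AEStronglyMeasurable g) :
    eLpNorm (fun ξ => K ξ * ‖g ξ‖) q' volume ≤ eLpNorm K r volume * eLpNorm g p' volume := by
  have := eLpNorm_le_eLpNorm_mul_eLpNorm_of_nnnorm (p := r) (q := p') (r := q') hK hg
    (fun x y => x * ‖y‖) 1 (Filter.Eventually.of_forall fun ξ => by simp)
  simpa using this

theorem polyDecay_ne_zero (a : ℝ) {t : ℝ} (ht : 0 ≤ t) : polyDecay a t ≠ 0 := by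
  rw [polyDecay, Ne, ENNReal.ofReal_eq_zero, not_le]
  positivity

section terms

variable {p q q' : ℝ≥0∞}

/-- Hölder with the kernel in `L^r` and Hausdorff-Young for the datum. If the datum has infinite
norm the bound is trivial, because the decay factor is never zero. -/
theorem exists_freqBound_low_scalar (hp1 : 1 ≤ p) (hp2 : p ≤ 2) (hq : 2 ≤ q)
    (hqq : q'⁻¹ + q⁻¹ = 1) (a : ℕ) {m : ℕ} (hm : m ≠ 0) {c : ℝ} (hc : 0 < c) :
    ∃ C : ℝ, 0 < C ∧ ∀ (T : TDist) (g : R3 → ℂ), LocallyIntegrable g → Represents (𝓕 T) g →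
      ∀ t, 0 ≤ t → FreqBound q' C (polyDecay ((a + gap p q) / m) t * distLpNorm p T)
        (fun ξ => lowKernel a m c t ξ * ‖g ξ‖) := by
  obtain ⟨p', r, hp', hpp, hr, _, hgap, -⟩ := exists_holder_exponents hp1 hp2 hq hqq
  obtain ⟨C₁, hC₁, h₁⟩ := exists_fourier_eLpNorm_le hp1 hp2 hp' hpp
  obtain ⟨C₂, hC₂, h₂⟩ := exists_eLpNorm_lowKernel_le hr a hm hc
  refine ⟨C₂ * C₁, by positivity, fun T g hg hT t ht => ?_⟩
  have hK := (measurable_lowKernel a m c t).aestronglyMeasurable (μ := volume)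
  refine ⟨by positivity, hK.mul hg.aestronglyMeasurable.norm, ?_⟩
  by_cases hfin : distLpNorm p T = ∞
  · rw [hfin, ENNReal.mul_top (polyDecay_ne_zero _ ht), ENNReal.mul_top]
    · exact le_top
    · rw [Ne, ENNReal.ofReal_eq_zero, not_le]; positivity
  · obtain ⟨-, hb⟩ := h₁ T g hg hT hfin
    have h3 := h₂ t ht
    rw [hgap] at h3
    refine (eLpNorm_kernel_mul_norm_le (r := r) (p' := p') hK hg.aestronglyMeasurable).trans
      ((mul_le_mul' h3 hb).trans (le_of_eq ?_))
    rw [ENNReal.ofReal_mul hC₂.le]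
    ring

theorem exists_freqBound_low (hp1 : 1 ≤ p) (hp2 : p ≤ 2) (hq : 2 ≤ q) (hq' : 1 ≤ q')
    (hqq : q'⁻¹ + q⁻¹ = 1) (a : ℕ) {m : ℕ} (hm : m ≠ 0) {c : ℝ} (hc : 0 < c) :
    ∃ C : ℝ, 0 < C ∧ ∀ (V : Fin 3 → TDist) (g : Fin 3 → R3 → ℂ), (∀ i, LocallyIntegrable (g i)) →
      (∀ i, Represents (𝓕 (V i)) (g i)) →
      ∀ t, 0 ≤ t → FreqBound q' C (polyDecay ((a + gap p q) / m) t * vecLpNorm p V)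
        (fun ξ => lowKernel a m c t ξ * ∑ i, ‖g i ξ‖) := by
  obtain ⟨C, hC, h⟩ := exists_freqBound_low_scalar hp1 hp2 hq hqq a hm hc
  refine ⟨C + C + C, by positivity, fun V g hg hV t ht => FreqBound.mul_sum (fun i => ?_) hq'⟩
  refine (h (V i) (g i) (hg i) (hV i) t ht).mono ?_
  gcongr
  exact Finset.single_le_sum (f := fun i => distLpNorm p (V i)) (fun _ _ => zero_le)
    (Finset.mem_univ i)

theorem gap_nonneg {s : ℝ≥0∞} (hs1 : 1 ≤ s) (hs2 : s ≤ 2) (hq : 2 ≤ q) : 0 ≤ gap s q := by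
  have h1 : s⁻¹ ≤ 1 := ENNReal.inv_le_one.2 hs1
  have h2 : q⁻¹ ≤ s⁻¹ := ENNReal.inv_le_inv.2 (hs2.trans hq)
  have := ENNReal.toReal_mono (h1.trans_lt ENNReal.one_lt_top).ne h2
  unfold gap
  linarith

/-- The kernel `k^{-(m-l)}` on `k ≥ 1` lies in `L^r` when `m - l > 3/r`. The strict inequality
explains the added `1` in the index; for `s = q = 2` boundedness suffices and equality `m = l` is
allowed. -/
theorem regIndex_spec {s : ℝ≥0∞} (l : ℝ) :
    (s = 2 ∧ q = 2 ∧ (0 : ℝ) ≤ regIndex l s q - l) ∨ gap s q < regIndex l s q - l := by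
  unfold regIndex
  split_ifs with h1 h2
  · right; push_cast; linarith
  · obtain ⟨rfl, rfl, z, rfl⟩ := h2
    refine Or.inl ⟨rfl, rfl, ?_⟩
    have hz : (0 : ℝ) ≤ z := by
      have : gap 2 2 = 0 := by simp [gap]
      rw [this] at h1
      linarith
    lift z to ℕ using (by exact_mod_cast hz)
    simp
  · right
    push_cast
    linarith [Nat.lt_floor_add_one (l + gap s q)]

theorem fourier_iterated_pd (m : ℕ) (α : Fin m → Fin 3) (T : TDist) :
    (fun ξ => ∏ i, pdSymbol (α i) ξ).HasTemperateGrowth ∧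
    𝓕 (∂^{fun i => basisVec (α i)} T) = mulT (fun ξ => ∏ i, pdSymbol (α i) ξ) (𝓕 T) := by
  induction m with
  | zero =>
    constructor
    · simp only [Finset.univ_eq_empty, Finset.prod_empty]
      fun_prop
    · simp only [Finset.univ_eq_empty, Finset.prod_empty]
      rw [mulT_const, one_smul]
      rfl
  | succ m ih =>
    obtain ⟨h1, h2⟩ := ih (fun i => α i.succ)
    have h3 : (fun ξ => ∏ i, pdSymbol (α i) ξ) =
        (fun ξ => ∏ i : Fin m, pdSymbol (α i.succ) ξ) * pdSymbol (α 0) := by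
      ext ξ
      rw [Fin.prod_univ_succ, mul_comm]
      rfl
    constructor
    · rw [h3]
      exact h1.mul (pdSymbol_hasTemperateGrowth _)
    · rw [h3, ← mulT_mulT (pdSymbol_hasTemperateGrowth _) h1, ← h2, ← fourier_pd]
      rfl

theorem norm_pdSymbol (i : Fin 3) (ξ : R3) : ‖pdSymbol i ξ‖ = |angFreq ξ i| := by
  rw [pdSymbol, norm_mul, Complex.norm_I, one_mul, Complex.norm_real, Real.norm_eq_abs]

theorem norm_pdSymbol_le (i : Fin 3) (ξ : R3) : ‖pdSymbol i ξ‖ ≤ waveNumber ξ := by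
  rw [norm_pdSymbol]
  refine abs_le_of_sq_le_sq ?_ (waveNumber_nonneg ξ)
  rw [waveNumber, ← sum_angFreq_sq]
  exact Finset.single_le_sum (f := fun i => angFreq ξ i ^ 2) (fun _ _ => sq_nonneg _)
    (Finset.mem_univ i)

/-- The largest coordinate is at least one third of the length, so pure derivatives of order `m`
already control `k^m`. -/
theorem waveNumber_pow_le (m : ℕ) (ξ : R3) :
    waveNumber ξ ^ m ≤ 3 ^ m * ∑ i, ‖pdSymbol i ξ ^ m‖ := by
  obtain ⟨i, -, hi⟩ := Finset.exists_max_image Finset.univ (fun i => ‖pdSymbol i ξ‖)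
    Finset.univ_nonempty
  have h1 : waveNumber ξ ≤ 3 * ‖pdSymbol i ξ‖ := by
    refine le_of_sq_le_sq ?_ (by positivity)
    rw [waveNumber, ← sum_angFreq_sq]
    have h2 : ∀ j, angFreq ξ j ^ 2 ≤ ‖pdSymbol i ξ‖ ^ 2 := fun j => by
      rw [← sq_abs, ← norm_pdSymbol]
      have := hi j (Finset.mem_univ j)
      gcongr
    rw [Fin.sum_univ_three]
    nlinarith [h2 0, h2 1, h2 2, sq_nonneg ‖pdSymbol i ξ‖]
  calc waveNumber ξ ^ m ≤ (3 * ‖pdSymbol i ξ‖) ^ m := pow_le_pow_left₀ (waveNumber_nonneg ξ) h1 m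
    _ = 3 ^ m * ‖pdSymbol i ξ ^ m‖ := by rw [mul_pow, norm_pow]
    _ ≤ _ := by
      gcongr
      exact Finset.single_le_sum (f := fun i => ‖pdSymbol i ξ ^ m‖) (fun _ _ => norm_nonneg _)
        (Finset.mem_univ i)

/-- Write `k^l = k^{-(m-l)} k^m`. The first factor is in `L^r` by the choice of `m`; the second is
absorbed by the transforms of the pure derivatives `∂_i^m T`, which are estimated in `L^s`. -/
theorem exists_freqBound_high_scalar {s : ℝ≥0∞} (hs1 : 1 ≤ s) (hs2 : s ≤ 2) (hq : 2 ≤ q)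
    (hq' : 1 ≤ q') (hqq : q'⁻¹ + q⁻¹ = 1) (l : ℝ) :
    ∃ C : ℝ, 0 < C ∧ ∀ (T : TDist) (g : R3 → ℂ), LocallyIntegrable g → Represents (𝓕 T) g →
      FreqBound q' C (gradNorm (regIndex l s q) s T) (fun ξ => highKernel l ξ * ‖g ξ‖) := by
  obtain ⟨s', r, hs', hss, hr, _, hgap, hrt⟩ := exists_holder_exponents hs1 hs2 hq hqq
  obtain ⟨C₁, hC₁, h₁⟩ := exists_fourier_eLpNorm_le hs1 hs2 hs' hss
  have hspec := regIndex_spec (s := s) (q := q) l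
  set m := regIndex l s q
  have hb : 0 ≤ (m : ℝ) - l ∧ (r = ∞ ∨ 3 * (r⁻¹).toReal < (m : ℝ) - l) := by
    rcases hspec with ⟨h1, h2, h3⟩ | h
    · exact ⟨h3, Or.inl (hrt h1 h2)⟩
    · exact ⟨(gap_nonneg hs1 hs2 hq).trans h.le, Or.inr (hgap ▸ h)⟩
  have hK := memLp_highKernel hr hb.1 hb.2
  set K := highKernel (-((m : ℝ) - l)) with hKdef
  set N := (eLpNorm K r volume).toReal with hN
  have hN0 : 0 ≤ N := ENNReal.toReal_nonneg
  have hKN : eLpNorm K r volume ≤ ENNReal.ofReal (N + 1) := by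
    rw [← ENNReal.ofReal_toReal hK.2.ne]
    exact ENNReal.ofReal_le_ofReal (by linarith)
  set D := (N + 1) * C₁ with hD
  have hD0 : 0 < D := by positivity
  refine ⟨3 ^ m * (D + D + D), by positivity, fun T g hg hT => ?_⟩
  have hmeas : AEStronglyMeasurable (fun ξ => highKernel l ξ * ‖g ξ‖) :=
    (measurable_highKernel l).aestronglyMeasurable.mul hg.aestronglyMeasurable.norm
  refine ⟨by positivity, hmeas, ?_⟩
  by_cases hfin : gradNorm m s T = ∞
  · rw [hfin, ENNReal.mul_top]
    · exact le_top
    · rw [Ne, ENNReal.ofReal_eq_zero, not_le]; positivity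
  have hterm : ∀ i, FreqBound q' D (gradNorm m s T) (fun ξ => K ξ * ‖pdSymbol i ξ ^ m * g ξ‖) := by
    intro i
    have hle : distLpNorm s (∂^{fun _ : Fin m => basisVec i} T) ≤ gradNorm m s T :=
      Finset.single_le_sum (f := fun α : Fin m → Fin 3 =>
        distLpNorm s (∂^{fun j => basisVec (α j)} T)) (fun _ _ => zero_le)
        (Finset.mem_univ fun _ => i)
    obtain ⟨hgr, hF⟩ := fourier_iterated_pd m (fun _ => i) T
    simp only [Finset.prod_const, Finset.card_univ, Fintype.card_fin] at hgr hF
    have hli : LocallyIntegrable (fun ξ => pdSymbol i ξ ^ m * g ξ) :=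
      locallyIntegrable_continuous_mul hgr.1.continuous hg
    have hrep : Represents (𝓕 (∂^{fun _ : Fin m => basisVec i} T))
        (fun ξ => pdSymbol i ξ ^ m * g ξ) := by
      intro φ
      rw [hF, mulT, TemperedDistribution.smulLeftCLM_apply_apply, hT]
      congr 1 with ξ
      rw [SchwartzMap.smulLeftCLM_apply_apply hgr, smul_eq_mul]
      ring
    obtain ⟨-, hbd⟩ := h₁ _ _ hli hrep (ne_top_of_le_ne_top hfin hle)
    refine ⟨hD0, hK.1.mul hli.aestronglyMeasurable.norm, ?_⟩
    refine (eLpNorm_kernel_mul_norm_le (r := r) (p' := s') hK.1 hli.aestronglyMeasurable).trans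
      ((mul_le_mul' hKN (hbd.trans (mul_le_mul_right hle _))).trans (le_of_eq ?_))
    rw [hD, ENNReal.ofReal_mul (by positivity)]
    ring
  have hsum := (FreqBound.mul_sum hterm hq').const_mul (a := 3 ^ m) (by positivity)
  refine le_trans (eLpNorm_mono_real fun ξ => ?_) hsum.eLpNorm_le
  rw [Real.norm_of_nonneg (mul_nonneg (highKernel_nonneg _ _) (norm_nonneg _)), hKdef, highKernel,
    highKernel]
  split_ifs with h1
  · have hk : 0 < waveNumber ξ := by linarith
    have h2 : waveNumber ξ ^ l = waveNumber ξ ^ (-((m : ℝ) - l)) * waveNumber ξ ^ m := by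
      rw [← Real.rpow_natCast, ← Real.rpow_add hk]
      congr 1
      ring
    rw [h2]
    simp only [norm_mul]
    rw [← Finset.sum_mul]
    have h3 := waveNumber_pow_le m ξ
    calc waveNumber ξ ^ (-((m : ℝ) - l)) * waveNumber ξ ^ m * ‖g ξ‖
        ≤ waveNumber ξ ^ (-((m : ℝ) - l)) * (3 ^ m * ∑ i, ‖pdSymbol i ξ ^ m‖) * ‖g ξ‖ := by gcongr
      _ = _ := by ring
  · simp

theorem exists_freqBound_high {s : ℝ≥0∞} (hs1 : 1 ≤ s) (hs2 : s ≤ 2) (hq : 2 ≤ q)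
    (hq' : 1 ≤ q') (hqq : q'⁻¹ + q⁻¹ = 1) (l : ℝ) :
    ∃ C : ℝ, 0 < C ∧ ∀ (V : Fin 3 → TDist) (g : Fin 3 → R3 → ℂ), (∀ i, LocallyIntegrable (g i)) →
      (∀ i, Represents (𝓕 (V i)) (g i)) →
      FreqBound q' C (vgradNorm (regIndex l s q) s V)
        (fun ξ => highKernel l ξ * ∑ i, ‖g i ξ‖) := by
  obtain ⟨C, hC, h⟩ := exists_freqBound_high_scalar hs1 hs2 hq hq' hqq l
  refine ⟨C + C + C, by positivity, fun V g hg hV => FreqBound.mul_sum (fun i => ?_) hq'⟩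
  refine (h (V i) (g i) (hg i) (hV i)).mono ?_
  exact Finset.single_le_sum (f := fun i => gradNorm (regIndex l s q) s (V i)) (fun _ _ => zero_le)
    (Finset.mem_univ i)

/-- The symbol of each `∂^α` of order `j` is at most `k^j`, so the dominating function puts the
transform of `∂^α T` in `L^{q'}`. Only then is it represented against all Schwartz functions, and
the inverse Hausdorff-Young bound applies. The constant counts the `3^j` derivatives. -/
theorem exists_gradNorm_le (hq : 2 ≤ q) (hq' : 1 ≤ q') (hqq : q'⁻¹ + q⁻¹ = 1) (j : ℕ) :
    ∃ C : ℝ, 0 < C ∧ ∀ (T : TDist) (h : R3 → ℂ) (f : R3 → ℝ) (X : ℝ≥0∞) (D : ℝ),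
      AEStronglyMeasurable h →
      (∀ φ : 𝓢(R3, ℂ), HasCompactSupport φ → 𝓕 T φ = ∫ ξ, φ ξ * h ξ) →
      (∀ᵐ ξ, waveNumber ξ ^ j * ‖h ξ‖ ≤ f ξ) → FreqBound q' D X f →
      gradNorm j q T ≤ ENNReal.ofReal (C * D) * X := by
  have hq2 : q' ≤ 2 := by
    have h1 : q⁻¹ ≤ 2⁻¹ := ENNReal.inv_le_inv.2 hq
    have h2 : (2 : ℝ≥0∞)⁻¹ ≤ q'⁻¹ := by
      by_contra! hcon
      have := ENNReal.add_lt_add_of_lt_of_le (by simp; positivity) hcon h1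
      rw [hqq, ENNReal.inv_two_add_inv_two] at this
      exact lt_irrefl _ this
    exact ENNReal.inv_le_inv.1 h2
  obtain ⟨C, hC, hY⟩ := distLpNorm_le_of_fourier_represents hq' hq2 hqq
  refine ⟨3 ^ j * (C + 1), by positivity, fun T h f X D hh hT hle hf => ?_⟩
  have hD := hf.pos
  by_cases hX : X = ∞
  · rw [hX, ENNReal.mul_top]
    · exact le_top
    · rw [Ne, ENNReal.ofReal_eq_zero, not_le]; positivity
  have hft : eLpNorm f q' volume < ∞ :=
    hf.eLpNorm_le.trans_lt (ENNReal.mul_lt_top ENNReal.ofReal_lt_top (lt_top_iff_ne_top.2 hX))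
  have hterm : ∀ α : Fin j → Fin 3, distLpNorm q (∂^{fun i => basisVec (α i)} T) ≤
      ENNReal.ofReal ((C + 1) * D) * X := by
    intro α
    obtain ⟨hgr, hF⟩ := fourier_iterated_pd j α T
    have hSle : ∀ ξ, ‖∏ i, pdSymbol (α i) ξ‖ ≤ waveNumber ξ ^ j := fun ξ => by
      rw [norm_prod]
      refine (Finset.prod_le_prod (fun _ _ => norm_nonneg _)
        fun i _ => norm_pdSymbol_le (α i) ξ).trans (le_of_eq ?_)
      simp
    have hae : ∀ᵐ ξ, ‖(∏ i, pdSymbol (α i) ξ) * h ξ‖ ≤ f ξ := by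
      filter_upwards [hle] with ξ hξ
      rw [norm_mul]
      exact (mul_le_mul_of_nonneg_right (hSle ξ) (norm_nonneg _)).trans hξ
    have hnorm := eLpNorm_mono_ae_real (p := q') hae
    have hmem : MemLp (fun ξ => (∏ i, pdSymbol (α i) ξ) * h ξ) q' :=
      ⟨hgr.1.continuous.aestronglyMeasurable.mul hh, hnorm.trans_lt hft⟩
    have hrep : Represents (𝓕 (∂^{fun i => basisVec (α i)} T))
        (fun ξ => (∏ i, pdSymbol (α i) ξ) * h ξ) := by
      refine represents_of_hasCompactSupport hq' hmem fun φ hφ => ?_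
      have h1 : ∀ ξ, SchwartzMap.smulLeftCLM ℂ (fun ξ => ∏ i, pdSymbol (α i) ξ) φ ξ =
          (∏ i, pdSymbol (α i) ξ) * φ ξ := fun ξ => by
        rw [SchwartzMap.smulLeftCLM_apply_apply hgr, smul_eq_mul]
      have h2 : HasCompactSupport
          (SchwartzMap.smulLeftCLM ℂ (fun ξ => ∏ i, pdSymbol (α i) ξ) φ) := by
        have : ⇑(SchwartzMap.smulLeftCLM ℂ (fun ξ => ∏ i, pdSymbol (α i) ξ) φ) =
            (fun ξ => ∏ i, pdSymbol (α i) ξ) * φ := funext h1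
        rw [this]
        exact hφ.mul_left
      rw [hF, mulT, TemperedDistribution.smulLeftCLM_apply_apply, hT _ h2]
      congr 1 with ξ
      rw [h1]
      ring
    refine (hY _ _ hmem hrep).trans ?_
    calc ENNReal.ofReal C * _ ≤ ENNReal.ofReal (C + 1) * (ENNReal.ofReal D * X) := by
          gcongr
          · linarith
          · exact hnorm.trans hf.eLpNorm_le
      _ = _ := by rw [ENNReal.ofReal_mul (by positivity), mul_assoc]
  refine (Finset.sum_le_sum fun α _ => hterm α).trans (le_of_eq ?_)
  rw [Finset.sum_const, Finset.card_univ, Fintype.card_fun, Fintype.card_fin, Fintype.card_fin,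
    nsmul_eq_mul, mul_assoc (3 ^ j : ℝ), ENNReal.ofReal_mul (p := (3 : ℝ) ^ j) (by positivity),
    ENNReal.ofReal_pow (by norm_num), ← mul_assoc]
  norm_num

end terms

section terms

variable {p q q' : ℝ≥0∞}

theorem exists_freqBound_heat (hp1 : 1 ≤ p) (hp2 : p ≤ 2) (hq : 2 ≤ q) (hq' : 1 ≤ q')
    (hqq : q'⁻¹ + q⁻¹ = 1) {c : ℝ} (hc : 0 < c) (a : ℕ) :
    ∃ C : ℝ, 0 < C ∧ ∀ (V : Fin 3 → TDist) (g : Fin 3 → R3 → ℂ), (∀ i, LocallyIntegrable (g i)) →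
      (∀ i, Represents (𝓕 (V i)) (g i)) →
      ∀ t, 0 ≤ t → FreqBound q' C (polyDecay (rateIndex a p q) t * vecLpNorm p V)
        (fun ξ => lowKernel a 2 c t ξ * ∑ i, ‖g i ξ‖) := by
  have h := exists_freqBound_low hp1 hp2 hq hq' hqq a (two_ne_zero) hc
  have e : ((a : ℝ) + gap p q) / (2 : ℕ) = rateIndex a p q := by rw [rateIndex]; push_cast; ring
  rwa [e] at h

theorem exists_freqBound_biharmonic (hp1 : 1 ≤ p) (hp2 : p ≤ 2) (hq : 2 ≤ q) (hq' : 1 ≤ q')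
    (hqq : q'⁻¹ + q⁻¹ = 1) {c : ℝ} (hc : 0 < c) (a : ℕ) :
    ∃ C : ℝ, 0 < C ∧ ∀ (V : Fin 3 → TDist) (g : Fin 3 → R3 → ℂ), (∀ i, LocallyIntegrable (g i)) →
      (∀ i, Represents (𝓕 (V i)) (g i)) →
      ∀ t, 0 ≤ t → FreqBound q' C (polyDecay (rateIndex a p q / 2) t * vecLpNorm p V)
        (fun ξ => lowKernel a 4 c t ξ * ∑ i, ‖g i ξ‖) := by
  have h := exists_freqBound_low hp1 hp2 hq hq' hqq a (four_ne_zero) hc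
  have e : ((a : ℝ) + gap p q) / (4 : ℕ) = rateIndex a p q / 2 := by
    rw [rateIndex]; push_cast; ring
  rwa [e] at h

end terms

theorem exists_fourier_represents_vec {p p' : ℝ≥0∞} (h1 : 1 ≤ p) (h2 : p ≤ 2)
    (hpp : p⁻¹ + p'⁻¹ = 1) {V : Fin 3 → TDist} (hV : vecLpNorm p V ≠ ∞) :
    ∃ g : Fin 3 → R3 → ℂ, (∀ i, MemLp (g i) p') ∧ ∀ i, Represents (𝓕 (V i)) (g i) := by
  obtain ⟨C, -, h⟩ := exists_fourier_represents h1 h2 hpp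
  have h3 : ∀ i, distLpNorm p (V i) ≠ ∞ := fun i => (ENNReal.sum_ne_top.1 hV) i (Finset.mem_univ i)
  choose g hg hT _ using fun i => h (V i) (h3 i)
  exact ⟨g, hg, hT⟩

theorem locallyIntegrable_density_symbol (c : ℂ) {r : ℝ≥0∞} (hr : 1 ≤ r) {g : Fin 3 → R3 → ℂ}
    (hg : ∀ i, MemLp (g i) r) :
    LocallyIntegrable fun ξ => -(c * idot (angFreq ξ) fun i => g i ξ) := by
  have h1 : ∀ i, LocallyIntegrable fun ξ => (-c * pdSymbol i ξ) * g i ξ := fun i =>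
    locallyIntegrable_continuous_mul
      (continuous_const.mul (pdSymbol_hasTemperateGrowth i).1.continuous)
      ((hg i).locallyIntegrable hr)
  refine (((h1 0).add (h1 1)).add (h1 2)).congr (Filter.Eventually.of_forall fun ξ => ?_)
  simp only [idot, pdSymbol, Fin.sum_univ_three, Pi.add_apply]
  ring

/-! ### Splitting the frequency bounds into kernels -/

section pointwise

variable {C c c' D l k a b d m t x : ℝ} {j : ℕ} {ξ : R3}

theorem rpow_natCast_sub (hk : 0 < k) (j i : ℕ) : k ^ ((j : ℝ) - i) = k ^ j / k ^ i := by
  rw [Real.rpow_sub hk, Real.rpow_natCast, Real.rpow_natCast]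

/-- Bounds for `k ≤ 1` become low kernels, bounds for `k > 1` become high kernels, and kernels of
the other range only add nonnegative terms. The free rate `c' ≤ c` lets all estimates share one
exponential rate later. -/
theorem density_pointwise (hξ : ξ ≠ 0) (ha : 0 ≤ a) (hb : 0 ≤ b) (hm : 0 ≤ m) (hC : 0 < C)
    (hcc : c' ≤ c) (ht : 0 ≤ t) (hk : k = waveNumber ξ)
    (hlow : 0 < k → k ≤ 1 → x ≤ C * (Real.exp (-(c * k ^ 2 * t)) * (k * (a + b))))
    (hhigh : 1 ≤ k → x ≤ C * (Real.exp (-(c * t)) * (m + a / k))) :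
    waveNumber ξ ^ j * x ≤ C * (lowKernel (j + 1) 2 c t ξ * b + lowKernel (j + 1) 2 c t ξ * a
      + Real.exp (-(c' * t)) * (highKernel (j : ℝ) ξ * m)
      + Real.exp (-(c' * t)) * (highKernel ((j : ℝ) - 1) ξ * a)) := by
  have hk0 : 0 < k := by
    rw [hk, waveNumber]; have := norm_pos_iff.2 hξ; positivity
  have hH := fun l => highKernel_nonneg l ξ
  have hL := fun a m t => lowKernel_nonneg a m c t ξ
  rw [← hk]
  rcases le_or_gt k 1 with h1 | h1
  · have hL1 : lowKernel (j + 1) 2 c t ξ = k ^ (j + 1) * Real.exp (-(c * k ^ 2 * t)) := by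
      rw [lowKernel, if_pos (hk ▸ h1), hk]
    have h2 := mul_le_mul_of_nonneg_left (hlow hk0 h1) (pow_nonneg hk0.le j)
    have h3 : 0 ≤ Real.exp (-(c' * t)) * (highKernel (j : ℝ) ξ * m) :=
      mul_nonneg (Real.exp_nonneg _) (mul_nonneg (hH _) hm)
    have h4 : 0 ≤ Real.exp (-(c' * t)) * (highKernel ((j : ℝ) - 1) ξ * a) :=
      mul_nonneg (Real.exp_nonneg _) (mul_nonneg (hH _) ha)
    refine h2.trans ?_
    rw [mul_left_comm]
    refine mul_le_mul_of_nonneg_left ?_ hC.le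
    rw [hL1]
    calc k ^ j * (Real.exp (-(c * k ^ 2 * t)) * (k * (a + b)))
        = k ^ (j + 1) * Real.exp (-(c * k ^ 2 * t)) * b
          + k ^ (j + 1) * Real.exp (-(c * k ^ 2 * t)) * a := by ring
      _ ≤ _ := by linarith
  · have hHl : ∀ l, highKernel l ξ = k ^ l := fun l => by
      rw [highKernel, if_pos (hk ▸ h1.le), hk]
    have h2 := mul_le_mul_of_nonneg_left (hhigh h1.le) (pow_nonneg hk0.le j)
    refine h2.trans ?_
    rw [mul_left_comm]
    refine mul_le_mul_of_nonneg_left ?_ hC.le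
    have h3 := mul_nonneg (hL (j + 1) 2 t) hb
    have h4 := mul_nonneg (hL (j + 1) 2 t) ha
    have h5 := rpow_natCast_sub hk0 j 1
    rw [Nat.cast_one, pow_one] at h5
    rw [hHl, hHl, h5, Real.rpow_natCast]
    have h6 := exp_neg_mul_le hcc ht
    calc k ^ j * (Real.exp (-(c * t)) * (m + a / k))
        ≤ k ^ j * (Real.exp (-(c' * t)) * (m + a / k)) := by gcongr
      _ = Real.exp (-(c' * t)) * (k ^ j * m) + Real.exp (-(c' * t)) * (k ^ j / k * a) := by ring
      _ ≤ _ := by linarith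

/-- Above `k = 1` the factor `e^{-ct/k²}` is exchanged through `hDk` for `D(1+t)^{-l/2} k^l`. Its
inverse powers of `k` become the shifts `-4` and `-2` in the orders of regularity, while the term
`m/k` gives the order `j - 1` for the density. -/
theorem velocity_pointwise (hξ : ξ ≠ 0) (ha : 0 ≤ a) (hb : 0 ≤ b) (hd : 0 ≤ d) (hm : 0 ≤ m)
    (hC : 0 < C) (hD : 0 < D) (hcc : c' ≤ c) (ht : 0 ≤ t) (hk : k = waveNumber ξ)
    (hDk : ∀ k t : ℝ, 1 ≤ k → 0 ≤ t →
      Real.exp (-(c / k ^ 2 * t)) ≤ D * (1 + t) ^ (-(l / 2)) * k ^ l)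
    (hlow : 0 < k → k ≤ 1 → x ≤ C * (Real.exp (-(c * k ^ 2 * t)) * (a + b + k * d) +
      Real.exp (-(c * k ^ 4 * t)) * (k ^ 2 * a + k ^ 4 * b + k * d)))
    (hhigh : 1 ≤ k → x ≤ C * (Real.exp (-(c * t)) * (a + m / k) +
      Real.exp (-(c / k ^ 2 * t)) * (a / k ^ 4 + b / k ^ 2 + d / k ^ 2))) :
    waveNumber ξ ^ j * x ≤ C * (lowKernel j 2 c t ξ * a
      + lowKernel j 2 c t ξ * b
      + lowKernel (j + 1) 2 c t ξ * d
      + lowKernel (j + 2) 4 c t ξ * a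
      + lowKernel (j + 4) 4 c t ξ * b
      + lowKernel (j + 1) 4 c t ξ * d
      + Real.exp (-(c' * t)) * (highKernel (j : ℝ) ξ * a)
      + Real.exp (-(c' * t)) * (highKernel ((j : ℝ) - 1) ξ * m)
      + D * ((1 + t) ^ (-(l / 2)) * (highKernel ((j : ℝ) - 4 + l) ξ * a))
      + D * ((1 + t) ^ (-(l / 2)) * (highKernel ((j : ℝ) - 2 + l) ξ * b))
      + D * ((1 + t) ^ (-(l / 2)) * (highKernel ((j : ℝ) - 2 + l) ξ * d))) := by
  have hk0 : 0 < k := by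
    rw [hk, waveNumber]; have := norm_pos_iff.2 hξ; positivity
  have hP : (0 : ℝ) ≤ (1 + t) ^ (-(l / 2)) := by positivity
  have hE : ∀ {l y : ℝ}, 0 ≤ y → 0 ≤ Real.exp (-(c' * t)) * (highKernel l ξ * y) := fun hy =>
    mul_nonneg (Real.exp_nonneg _) (mul_nonneg (highKernel_nonneg _ _) hy)
  have hH : ∀ {l' y : ℝ}, 0 ≤ y → 0 ≤ D * ((1 + t) ^ (-(l / 2)) * (highKernel l' ξ * y)) :=
    fun hy => mul_nonneg hD.le (mul_nonneg hP (mul_nonneg (highKernel_nonneg _ _) hy))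
  have hL : ∀ {a m y}, 0 ≤ y → 0 ≤ lowKernel a m c t ξ * y := fun hy =>
    mul_nonneg (lowKernel_nonneg _ _ _ _ _) hy
  rw [← hk]
  rcases le_or_gt k 1 with h1 | h1
  · have hL1 : ∀ a m, lowKernel a m c t ξ = k ^ a * Real.exp (-(c * k ^ m * t)) := fun a m => by
      rw [lowKernel, if_pos (hk ▸ h1), hk]
    refine (mul_le_mul_of_nonneg_left (hlow hk0 h1) (pow_nonneg hk0.le j)).trans ?_
    rw [mul_left_comm]
    refine mul_le_mul_of_nonneg_left ?_ hC.le
    refine le_trans (le_of_eq ?_) (le_add_of_le_of_nonneg (le_add_of_le_of_nonneg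
      (le_add_of_le_of_nonneg (le_add_of_le_of_nonneg
      (le_add_of_le_of_nonneg (le_refl (lowKernel j 2 c t ξ * a
      + lowKernel j 2 c t ξ * b
      + lowKernel (j + 1) 2 c t ξ * d
      + lowKernel (j + 2) 4 c t ξ * a
      + lowKernel (j + 4) 4 c t ξ * b
      + lowKernel (j + 1) 4 c t ξ * d)) (hE ha)) (hE hm)) (hH ha)) (hH hb)) (hH hd))
    simp only [hL1]
    ring
  · have hHl : ∀ l, highKernel l ξ = k ^ l := fun l => by
      rw [highKernel, if_pos (hk ▸ h1.le), hk]
    refine (mul_le_mul_of_nonneg_left (hhigh h1.le) (pow_nonneg hk0.le j)).trans ?_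
    rw [mul_left_comm]
    refine mul_le_mul_of_nonneg_left ?_ hC.le
    have h6 := hDk k t h1.le ht
    have h2 := rpow_natCast_sub hk0 j 2
    push_cast at h2
    have h3 := rpow_natCast_sub hk0 j 4
    have h4 := rpow_natCast_sub hk0 j 1
    push_cast at h3 h4
    have h5 := exp_neg_mul_le hcc ht
    calc _ ≤ Real.exp (-(c' * t)) * (highKernel (j : ℝ) ξ * a)
          + Real.exp (-(c' * t)) * (highKernel ((j : ℝ) - 1) ξ * m)
          + D * ((1 + t) ^ (-(l / 2)) * (highKernel ((j : ℝ) - 4 + l) ξ * a))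
          + D * ((1 + t) ^ (-(l / 2)) * (highKernel ((j : ℝ) - 2 + l) ξ * b))
          + D * ((1 + t) ^ (-(l / 2)) * (highKernel ((j : ℝ) - 2 + l) ξ * d)) := ?_
      _ ≤ _ := ?_
    · rw [hHl, hHl, hHl, hHl, Real.rpow_add hk0, Real.rpow_add hk0, h2, h3, h4, Real.rpow_natCast]
      calc k ^ j * (Real.exp (-(c * t)) * (a + m / k) +
            Real.exp (-(c / k ^ 2 * t)) * (a / k ^ 4 + b / k ^ 2 + d / k ^ 2))
          ≤ k ^ j * (Real.exp (-(c' * t)) * (a + m / k) +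
            (D * (1 + t) ^ (-(l / 2)) * k ^ l) * (a / k ^ 4 + b / k ^ 2 + d / k ^ 2)) := by gcongr
        _ = _ := by ring
    · linarith [hL (a := j) (m := 2) ha, hL (a := j) (m := 2) hb, hL (a := (j + 1)) (m := 2) hd,
      hL (a := (j + 2)) (m := 4) ha, hL (a := (j + 4)) (m := 4) hb, hL (a := (j + 1)) (m := 4) hd]

theorem electric_pointwise (hξ : ξ ≠ 0) (ha : 0 ≤ a) (hb : 0 ≤ b) (hd : 0 ≤ d)
    (hC : 0 < C) (hD : 0 < D) (ht : 0 ≤ t) (hk : k = waveNumber ξ)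
    (hDk : ∀ k t : ℝ, 1 ≤ k → 0 ≤ t →
      Real.exp (-(c / k ^ 2 * t)) ≤ D * (1 + t) ^ (-(l / 2)) * k ^ l)
    (hlow : 0 < k → k ≤ 1 → x ≤ C * (Real.exp (-(c * k ^ 2 * t)) * (a + b + k * d) +
      Real.exp (-(c * k ^ 4 * t)) * (k ^ 4 * a + k ^ 6 * b + k ^ 3 * d)))
    (hhigh : 1 ≤ k → x ≤ C * (Real.exp (-(c / k ^ 2 * t)) * (a / k ^ 2 + b + d))) :
    waveNumber ξ ^ j * x ≤ C * (lowKernel j 2 c t ξ * a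
      + lowKernel j 2 c t ξ * b
      + lowKernel (j + 1) 2 c t ξ * d
      + lowKernel (j + 4) 4 c t ξ * a
      + lowKernel (j + 6) 4 c t ξ * b
      + lowKernel (j + 3) 4 c t ξ * d
      + D * ((1 + t) ^ (-(l / 2)) * (highKernel ((j : ℝ) - 2 + l) ξ * a))
      + D * ((1 + t) ^ (-(l / 2)) * (highKernel ((j : ℝ) + l) ξ * b))
      + D * ((1 + t) ^ (-(l / 2)) * (highKernel ((j : ℝ) + l) ξ * d))) := by
  have hk0 : 0 < k := by
    rw [hk, waveNumber]; have := norm_pos_iff.2 hξ; positivity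
  have hP : (0 : ℝ) ≤ (1 + t) ^ (-(l / 2)) := by positivity
  have hH : ∀ {l' y : ℝ}, 0 ≤ y → 0 ≤ D * ((1 + t) ^ (-(l / 2)) * (highKernel l' ξ * y)) :=
    fun hy => mul_nonneg hD.le (mul_nonneg hP (mul_nonneg (highKernel_nonneg _ _) hy))
  have hL : ∀ {a m y}, 0 ≤ y → 0 ≤ lowKernel a m c t ξ * y := fun hy =>
    mul_nonneg (lowKernel_nonneg _ _ _ _ _) hy
  rw [← hk]
  rcases le_or_gt k 1 with h1 | h1
  · have hL1 : ∀ a m, lowKernel a m c t ξ = k ^ a * Real.exp (-(c * k ^ m * t)) := fun a m => by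
      rw [lowKernel, if_pos (hk ▸ h1), hk]
    refine (mul_le_mul_of_nonneg_left (hlow hk0 h1) (pow_nonneg hk0.le j)).trans ?_
    rw [mul_left_comm]
    refine mul_le_mul_of_nonneg_left ?_ hC.le
    refine le_trans (le_of_eq ?_) (le_add_of_le_of_nonneg (le_add_of_le_of_nonneg
      (le_add_of_le_of_nonneg (le_refl (lowKernel j 2 c t ξ * a
      + lowKernel j 2 c t ξ * b
      + lowKernel (j + 1) 2 c t ξ * d
      + lowKernel (j + 4) 4 c t ξ * a
      + lowKernel (j + 6) 4 c t ξ * b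
      + lowKernel (j + 3) 4 c t ξ * d)) (hH ha)) (hH hb)) (hH hd))
    simp only [hL1]
    ring
  · have hHl : ∀ l, highKernel l ξ = k ^ l := fun l => by
      rw [highKernel, if_pos (hk ▸ h1.le), hk]
    refine (mul_le_mul_of_nonneg_left (hhigh h1.le) (pow_nonneg hk0.le j)).trans ?_
    rw [mul_left_comm]
    refine mul_le_mul_of_nonneg_left ?_ hC.le
    have h6 := hDk k t h1.le ht
    have h2 := rpow_natCast_sub hk0 j 2
    push_cast at h2
    calc _ ≤ D * ((1 + t) ^ (-(l / 2)) * (highKernel ((j : ℝ) - 2 + l) ξ * a))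
          + D * ((1 + t) ^ (-(l / 2)) * (highKernel ((j : ℝ) + l) ξ * b))
          + D * ((1 + t) ^ (-(l / 2)) * (highKernel ((j : ℝ) + l) ξ * d)) := ?_
      _ ≤ _ := ?_
    · rw [hHl, hHl, Real.rpow_add hk0, Real.rpow_add hk0, h2, Real.rpow_natCast]
      calc k ^ j * (Real.exp (-(c / k ^ 2 * t)) * (a / k ^ 2 + b + d))
          ≤ k ^ j * ((D * (1 + t) ^ (-(l / 2)) * k ^ l) * (a / k ^ 2 + b + d)) := by gcongr
        _ = _ := by ring
    · linarith [hL (a := j) (m := 2) ha, hL (a := j) (m := 2) hb, hL (a := (j + 1)) (m := 2) hd,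
      hL (a := (j + 4)) (m := 4) ha, hL (a := (j + 6)) (m := 4) hb, hL (a := (j + 3)) (m := 4) hd]

theorem magnetic_pointwise (hξ : ξ ≠ 0) (ha : 0 ≤ a) (hb : 0 ≤ b) (hd : 0 ≤ d)
    (hC : 0 < C) (hD : 0 < D) (ht : 0 ≤ t) (hk : k = waveNumber ξ)
    (hDk : ∀ k t : ℝ, 1 ≤ k → 0 ≤ t →
      Real.exp (-(c / k ^ 2 * t)) ≤ D * (1 + t) ^ (-(l / 2)) * k ^ l)
    (hlow : 0 < k → k ≤ 1 → x ≤ C * (Real.exp (-(c * k ^ 2 * t)) * (k * (a + b + k * d)) +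
      Real.exp (-(c * k ^ 4 * t)) * (k * a + k ^ 3 * b + d)))
    (hhigh : 1 ≤ k → x ≤ C * (Real.exp (-(c / k ^ 2 * t)) * (a / k ^ 2 + b + d))) :
    waveNumber ξ ^ j * x ≤ C * (lowKernel (j + 1) 2 c t ξ * a
      + lowKernel (j + 1) 2 c t ξ * b
      + lowKernel (j + 2) 2 c t ξ * d
      + lowKernel (j + 1) 4 c t ξ * a
      + lowKernel (j + 3) 4 c t ξ * b
      + lowKernel j 4 c t ξ * d
      + D * ((1 + t) ^ (-(l / 2)) * (highKernel ((j : ℝ) - 2 + l) ξ * a))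
      + D * ((1 + t) ^ (-(l / 2)) * (highKernel ((j : ℝ) + l) ξ * b))
      + D * ((1 + t) ^ (-(l / 2)) * (highKernel ((j : ℝ) + l) ξ * d))) := by
  have hk0 : 0 < k := by
    rw [hk, waveNumber]; have := norm_pos_iff.2 hξ; positivity
  have hP : (0 : ℝ) ≤ (1 + t) ^ (-(l / 2)) := by positivity
  have hH : ∀ {l' y : ℝ}, 0 ≤ y → 0 ≤ D * ((1 + t) ^ (-(l / 2)) * (highKernel l' ξ * y)) :=
    fun hy => mul_nonneg hD.le (mul_nonneg hP (mul_nonneg (highKernel_nonneg _ _) hy))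
  have hL : ∀ {a m y}, 0 ≤ y → 0 ≤ lowKernel a m c t ξ * y := fun hy =>
    mul_nonneg (lowKernel_nonneg _ _ _ _ _) hy
  rw [← hk]
  rcases le_or_gt k 1 with h1 | h1
  · have hL1 : ∀ a m, lowKernel a m c t ξ = k ^ a * Real.exp (-(c * k ^ m * t)) := fun a m => by
      rw [lowKernel, if_pos (hk ▸ h1), hk]
    refine (mul_le_mul_of_nonneg_left (hlow hk0 h1) (pow_nonneg hk0.le j)).trans ?_
    rw [mul_left_comm]
    refine mul_le_mul_of_nonneg_left ?_ hC.le
    refine le_trans (le_of_eq ?_) (le_add_of_le_of_nonneg (le_add_of_le_of_nonneg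
      (le_add_of_le_of_nonneg (le_refl (lowKernel (j + 1) 2 c t ξ * a
      + lowKernel (j + 1) 2 c t ξ * b
      + lowKernel (j + 2) 2 c t ξ * d
      + lowKernel (j + 1) 4 c t ξ * a
      + lowKernel (j + 3) 4 c t ξ * b
      + lowKernel j 4 c t ξ * d)) (hH ha)) (hH hb)) (hH hd))
    simp only [hL1]
    ring
  · have hHl : ∀ l, highKernel l ξ = k ^ l := fun l => by
      rw [highKernel, if_pos (hk ▸ h1.le), hk]
    refine (mul_le_mul_of_nonneg_left (hhigh h1.le) (pow_nonneg hk0.le j)).trans ?_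
    rw [mul_left_comm]
    refine mul_le_mul_of_nonneg_left ?_ hC.le
    have h6 := hDk k t h1.le ht
    have h2 := rpow_natCast_sub hk0 j 2
    push_cast at h2
    calc _ ≤ D * ((1 + t) ^ (-(l / 2)) * (highKernel ((j : ℝ) - 2 + l) ξ * a))
          + D * ((1 + t) ^ (-(l / 2)) * (highKernel ((j : ℝ) + l) ξ * b))
          + D * ((1 + t) ^ (-(l / 2)) * (highKernel ((j : ℝ) + l) ξ * d)) := ?_
      _ ≤ _ := ?_
    · rw [hHl, hHl, Real.rpow_add hk0, Real.rpow_add hk0, h2, Real.rpow_natCast]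
      calc k ^ j * (Real.exp (-(c / k ^ 2 * t)) * (a / k ^ 2 + b + d))
          ≤ k ^ j * ((D * (1 + t) ^ (-(l / 2)) * k ^ l) * (a / k ^ 2 + b + d)) := by gcongr
        _ = _ := by ring
    · linarith [hL (a := (j + 1)) (m := 2) ha, hL (a := (j + 1)) (m := 2) hb, hL (a := (j +
      2)) (m := 2) hd, hL (a := (j + 1)) (m := 4) ha, hL (a := (j + 3)) (m := 4) hb,
      hL (a := j) (m := 4) hd]

end pointwise

/-! ### Assembling the decay estimates -/

theorem ae_ne_zero : ∀ᵐ ξ : R3, ξ ≠ 0 := by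
  rw [ae_iff]
  simp

theorem polyDecay_mul_eq_top {a t : ℝ} (ht : 0 ≤ t) {X : ℝ≥0∞} (hX : X = ∞) :
    polyDecay a t * X = ∞ := by
  rw [hX, ENNReal.mul_top (polyDecay_ne_zero a ht)]

theorem le_ofReal_mul_top {C : ℝ} (hC : 0 < C) {X Y : ℝ≥0∞} (hX : X = ∞) :
    Y ≤ ENNReal.ofReal C * X := by
  rw [hX, ENNReal.mul_top]
  · exact le_top
  · rw [Ne, ENNReal.ofReal_eq_zero, not_le]; exact hC

theorem ennreal_le_add_left (X Y : ℝ≥0∞) : X ≤ Y + X := le_add_self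

theorem ennreal_le_add_of_le {X Y Z : ℝ≥0∞} (h : X ≤ Y) : X ≤ Y + Z := le_add_right h

theorem sum_fin_three_le {C : ℝ} {X : ℝ≥0∞} {f : Fin 3 → ℝ≥0∞}
    (h : ∀ i, f i ≤ ENNReal.ofReal C * X) : ∑ i, f i ≤ ENNReal.ofReal (3 * C) * X := by
  refine (Finset.sum_le_sum fun i _ => h i).trans (le_of_eq ?_)
  rw [Finset.sum_const, Finset.card_univ, Fintype.card_fin, nsmul_eq_mul,
    ENNReal.ofReal_mul (by norm_num), mul_assoc]
  norm_num

theorem exists_conjugate_exponent {q : ℝ≥0∞} (hq : 2 ≤ q) :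
    ∃ q' : ℝ≥0∞, 1 ≤ q' ∧ q'⁻¹ + q⁻¹ = 1 := by
  have h1 : q⁻¹ ≤ 1 := ENNReal.inv_le_one.2 (one_le_two.trans hq)
  refine ⟨(1 - q⁻¹)⁻¹, ENNReal.one_le_inv.2 tsub_le_self, ?_⟩
  rw [inv_inv, tsub_add_cancel_of_le h1]

namespace IsLinearSolution

variable {γ β μ : ℝ}

/-- The decay of the density. -/
theorem exists_density_decay (hγ : 0 < γ) (hβ : 0 < β) (hμ : 0 < μ) : ∃ c : ℝ, 0 < c ∧
    ∀ c' : ℝ, c' ≤ c → ∀ (p s q : ℝ≥0∞), 1 ≤ p → p ≤ 2 → 1 ≤ s → s ≤ 2 → 2 ≤ q → ∀ (j : ℕ),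
    ∃ C : ℝ, 0 < C ∧ ∀ (n : ℝ → TDist) (u E B : ℝ → Fin 3 → TDist)
      (n₀ : TDist) (u₀ E₀ B₀ : Fin 3 → TDist),
      IsLinearSolution γ β μ n u E B n₀ u₀ E₀ B₀ → ∀ t : ℝ, 0 ≤ t →
        gradNorm j q (n t) ≤ ENNReal.ofReal C *
          (polyDecay (rateIndex (j + 1) p q) t * vecLpNorm p E₀
            + polyDecay (rateIndex (j + 1) p q) t * vecLpNorm p u₀
            + expDecay c' t * gradNorm (regIndex (j : ℝ) s q) s n₀
            + expDecay c' t * vgradNorm (regIndex ((j : ℝ) - 1) s q) s u₀) := by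
  obtain ⟨c, C₀, hc, hC₀, hbound⟩ := exists_density_bound hγ hβ hμ
  refine ⟨c, hc, fun c' hcc p s q hp1 hp2 hs1 hs2 hq j => ?_⟩
  obtain ⟨q', hq', hqq⟩ := exists_conjugate_exponent hq
  obtain ⟨p', -, hp', hpp, -⟩ := exists_holder_exponents hp1 hp2 hq hqq
  obtain ⟨C₁, hC₁, h₁⟩ := exists_freqBound_heat hp1 hp2 hq hq' hqq hc (j + 1)
  obtain ⟨C₂, hC₂, h₂⟩ := exists_freqBound_high_scalar hs1 hs2 hq hq' hqq (j : ℝ)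
  obtain ⟨C₃, hC₃, h₃⟩ := exists_freqBound_high hs1 hs2 hq hq' hqq ((j : ℝ) - 1)
  obtain ⟨C₄, hC₄, h₄⟩ := exists_gradNorm_le hq hq' hqq j
  refine ⟨C₄ * (C₀ * (C₁ + C₁ + C₂ + C₃)), by positivity,
    fun n u E B n₀ u₀ E₀ B₀ hS t ht => ?_⟩
  -- With an infinite `L^p` norm on the right there is nothing to prove. Otherwise the transforms of
  -- the data are functions, as the frequency analysis requires.
  by_cases hE : vecLpNorm p E₀ = ∞
  · refine le_ofReal_mul_top (by positivity) ?_
    simp [polyDecay_mul_eq_top ht hE]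
  by_cases hu : vecLpNorm p u₀ = ∞
  · refine le_ofReal_mul_top (by positivity) ?_
    simp [polyDecay_mul_eq_top ht hu]
  obtain ⟨gu, hgu, hgu'⟩ := exists_fourier_represents_vec hp1 hp2 hpp hu
  obtain ⟨gE, hgE, hgE'⟩ := exists_fourier_represents_vec hp1 hp2 hpp hE
  have lu := fun i => (hgu i).locallyIntegrable hp'
  have lE := fun i => (hgE i).locallyIntegrable hp'
  obtain ⟨h, hmeas, hrep, hle⟩ := hbound n u E B n₀ u₀ E₀ B₀ p' gu gE hS hp' hgu hgE hgu' hgE' t ht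
  have hn := hS.represents_density hγ hβ hp' hgE hgE'
  have ln := locallyIntegrable_density_symbol (γ / β : ℂ) hp' hgE
  have hk (ξ : R3) (hξ : ξ ≠ 0) := density_pointwise (j := j) hξ
    (Finset.sum_nonneg fun i _ => norm_nonneg (gu i ξ))
    (Finset.sum_nonneg fun i _ => norm_nonneg (gE i ξ)) (norm_nonneg _) hC₀ hcc ht rfl
    (hle ξ _ rfl).1 (hle ξ _ rfl).2
  refine h₄ (n t) h _ _ _ hmeas hrep (ae_ne_zero.mono hk) ?_
  refine (((((h₁ E₀ gE lE hgE' t ht).mono ?_).add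
    ((h₁ u₀ gu lu hgu' t ht).mono ?_) hq').add
    (((h₂ _ _ ln hn).smul (Real.exp_nonneg _)).mono ?_) hq').add
    (((h₃ u₀ gu lu hgu').smul (Real.exp_nonneg _)).mono ?_) hq').const_mul hC₀
  · exact le_add_right (le_add_right (le_add_right le_rfl))
  · exact le_add_right (le_add_right le_add_self)
  · exact le_add_right le_add_self
  · exact le_add_self


/-- The decay of the velocity and of the electromagnetic field. -/
theorem exists_system_decay (hγ : 0 < γ) (hβ : 0 < β) (hμ : 0 < μ) : ∃ c : ℝ, 0 < c ∧
    ∀ c' : ℝ, c' ≤ c → ∀ (p s q : ℝ≥0∞), 1 ≤ p → p ≤ 2 → 1 ≤ s → s ≤ 2 → 2 ≤ q →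
    ∀ (l : ℝ), 0 ≤ l → ∀ (j : ℕ),
    ∃ C : ℝ, 0 < C ∧ ∀ (n : ℝ → TDist) (u E B : ℝ → Fin 3 → TDist)
      (n₀ : TDist) (u₀ E₀ B₀ : Fin 3 → TDist),
      IsLinearSolution γ β μ n u E B n₀ u₀ E₀ B₀ → ∀ t : ℝ, 0 ≤ t →
        vgradNorm j q (u t) ≤ ENNReal.ofReal C *
          (polyDecay (rateIndex (j + 1) p q) t * (distLpNorm p n₀ + vecLpNorm p B₀)
            + polyDecay (rateIndex j p q) t * (vecLpNorm p u₀ + vecLpNorm p E₀)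
            + polyDecay (rateIndex (j + 2) p q / 2) t * vecLpNorm p u₀
            + polyDecay (rateIndex (j + 4) p q / 2) t * vecLpNorm p E₀
            + polyDecay (rateIndex (j + 1) p q / 2) t * vecLpNorm p B₀
            + expDecay c' t *
                (gradNorm (regIndex ((j : ℝ) - 1) s q) s n₀
                  + vgradNorm (regIndex (j : ℝ) s q) s u₀
                  + vgradNorm (regIndex ((j : ℝ) - 2) s q) s E₀
                  + vgradNorm (regIndex ((j : ℝ) - 3) s q) s B₀)
            + polyDecay (l / 2) t *
                (vgradNorm (regIndex ((j : ℝ) - 4 + l) s q) s u₀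
                  + (vgradNorm (regIndex ((j : ℝ) - 2 + l) s q) s E₀
                    + vgradNorm (regIndex ((j : ℝ) - 2 + l) s q) s B₀))) ∧
        vgradNorm j q (E t) ≤ ENNReal.ofReal C *
          (polyDecay (rateIndex j p q) t * (vecLpNorm p u₀ + vecLpNorm p E₀)
            + polyDecay (rateIndex (j + 1) p q) t * vecLpNorm p B₀
            + polyDecay (rateIndex (j + 4) p q / 2) t * vecLpNorm p u₀
            + polyDecay (rateIndex (j + 6) p q / 2) t * vecLpNorm p E₀
            + polyDecay (rateIndex (j + 3) p q / 2) t * vecLpNorm p B₀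
            + expDecay c' t *
                (vgradNorm (regIndex ((j : ℝ) - 2) s q) s u₀
                  + vgradNorm (regIndex (j : ℝ) s q) s E₀
                  + vgradNorm (regIndex ((j : ℝ) - 5) s q) s B₀)
            + polyDecay (l / 2) t *
                (vgradNorm (regIndex ((j : ℝ) - 2 + l) s q) s u₀
                  + (vgradNorm (regIndex ((j : ℝ) + l) s q) s E₀
                    + vgradNorm (regIndex ((j : ℝ) + l) s q) s B₀))) ∧
        vgradNorm j q (B t) ≤ ENNReal.ofReal C *
          (polyDecay (rateIndex (j + 1) p q) t * (vecLpNorm p u₀ + vecLpNorm p E₀)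
            + polyDecay (rateIndex (j + 2) p q) t * vecLpNorm p B₀
            + polyDecay (rateIndex (j + 1) p q / 2) t * vecLpNorm p u₀
            + polyDecay (rateIndex (j + 3) p q / 2) t * vecLpNorm p E₀
            + polyDecay (rateIndex j p q / 2) t * vecLpNorm p B₀
            + expDecay c' t *
                (vgradNorm (regIndex ((j : ℝ) - 3) s q) s u₀
                  + vgradNorm (regIndex ((j : ℝ) - 5) s q) s E₀
                  + vgradNorm (regIndex ((j : ℝ) - 6) s q) s B₀)
            + polyDecay (l / 2) t *
                (vgradNorm (regIndex ((j : ℝ) - 2 + l) s q) s u₀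
                  + (vgradNorm (regIndex ((j : ℝ) + l) s q) s E₀
                    + vgradNorm (regIndex ((j : ℝ) + l) s q) s B₀))) := by
  obtain ⟨c, C₀, hc, hC₀, hbound⟩ := exists_system_bound hγ hβ hμ
  refine ⟨c, hc, fun c' hcc p s q hp1 hp2 hs1 hs2 hq l hl j => ?_⟩
  obtain ⟨q', hq', hqq⟩ := exists_conjugate_exponent hq
  obtain ⟨p', -, hp', hpp, -⟩ := exists_holder_exponents hp1 hp2 hq hqq
  obtain ⟨D, hD, hDk⟩ := exp_neg_div_sq_mul_le (c := c) hc hl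
  choose H hH heat using exists_freqBound_heat hp1 hp2 hq hq' hqq hc
  choose K hK biharm using exists_freqBound_biharmonic hp1 hp2 hq hq' hqq hc
  obtain ⟨N, hN, highn⟩ := exists_freqBound_high_scalar hs1 hs2 hq hq' hqq ((j : ℝ) - 1)
  choose R hR high using exists_freqBound_high (q := q) hs1 hs2 hq hq' hqq
  obtain ⟨G, hG, grad⟩ := exists_gradNorm_le hq hq' hqq j
  set CU := C₀ * (H j + H j + H (j + 1) + K (j + 2) + K (j + 4) + K (j + 1) + R (j : ℝ) + N +
    D * R ((j : ℝ) - 4 + l) + D * R ((j : ℝ) - 2 + l) + D * R ((j : ℝ) - 2 + l)) with hCU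
  set CE := C₀ * (H j + H j + H (j + 1) + K (j + 4) + K (j + 6) + K (j + 3) +
    D * R ((j : ℝ) - 2 + l) + D * R ((j : ℝ) + l) + D * R ((j : ℝ) + l)) with hCE
  set CB := C₀ * (H (j + 1) + H (j + 1) + H (j + 2) + K (j + 1) + K (j + 3) + K j +
    D * R ((j : ℝ) - 2 + l) + D * R ((j : ℝ) + l) + D * R ((j : ℝ) + l)) with hCB
  have hCU0 : 0 < CU := by rw [hCU]; apply_rules [mul_pos, add_pos]
  have hCE0 : 0 < CE := by rw [hCE]; apply_rules [mul_pos, add_pos]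
  have hCB0 : 0 < CB := by rw [hCB]; apply_rules [mul_pos, add_pos]
  refine ⟨3 * (G * (CU + CE + CB)), by positivity, fun n u E B n₀ u₀ E₀ B₀ hS t ht => ?_⟩
  have hP : (0 : ℝ) ≤ (1 + t) ^ (-(l / 2)) := by positivity
  have htop : ∀ X : ℝ≥0∞, X = ∞ → ∀ Y, Y ≤ ENNReal.ofReal (3 * (G * (CU + CE + CB))) * X :=
    fun X hX Y => le_ofReal_mul_top (by positivity) hX
  by_cases hu : vecLpNorm p u₀ = ∞
  · refine ⟨htop _ ?_ _, htop _ ?_ _, htop _ ?_ _⟩ <;> simp [polyDecay_mul_eq_top ht hu]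
  by_cases hE : vecLpNorm p E₀ = ∞
  · refine ⟨htop _ ?_ _, htop _ ?_ _, htop _ ?_ _⟩ <;> simp [polyDecay_mul_eq_top ht hE]
  by_cases hB : vecLpNorm p B₀ = ∞
  · refine ⟨htop _ ?_ _, htop _ ?_ _, htop _ ?_ _⟩ <;> simp [polyDecay_mul_eq_top ht hB]
  obtain ⟨gu, hgu, ru⟩ := exists_fourier_represents_vec hp1 hp2 hpp hu
  obtain ⟨gE, hgE, rE⟩ := exists_fourier_represents_vec hp1 hp2 hpp hE
  obtain ⟨gB, hgB, rB⟩ := exists_fourier_represents_vec hp1 hp2 hpp hB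
  have lu := fun i => (hgu i).locallyIntegrable hp'
  have lE := fun i => (hgE i).locallyIntegrable hp'
  have lB := fun i => (hgB i).locallyIntegrable hp'
  have rn := hS.represents_density hγ hβ hp' hgE rE
  have ln := locallyIntegrable_density_symbol (γ / β : ℂ) hp' hgE
  obtain ⟨hu, hE, hB, hmeas, hrepu, hrepE, hrepB, hle⟩ :=
    hbound n u E B n₀ u₀ E₀ B₀ p' gu gE gB hS hp' hgu hgE hgB ru rE rB t ht
  -- On a fixed set of full measure the bound holds at every point, so the pointwise splitting can
  -- be applied there and its right-hand side taken as the dominating function.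
  obtain ⟨S, hSmem, hSle⟩ := (hle.and ae_ne_zero).exists_mem
  have hnn : ∀ (g : Fin 3 → R3 → ℂ) (ξ : R3), 0 ≤ ∑ i, ‖g i ξ‖ := fun g ξ =>
    Finset.sum_nonneg fun i _ => norm_nonneg (g i ξ)
  have hmono : ∀ {C X : ℝ} {Y Z : ℝ≥0∞}, X ≤ C → Y ≤ ENNReal.ofReal (G * X) * Z →
      Y ≤ ENNReal.ofReal (G * C) * Z := fun hXC hY => hY.trans (by gcongr)
  refine ⟨sum_fin_three_le fun i => hmono (X := CU) (by linarith) ?_,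
    sum_fin_three_le fun i => hmono (X := CE) (by linarith) ?_,
    sum_fin_three_le fun i => hmono (X := CB) (by linarith) ?_⟩
  · have hk (ξ : R3) (hξ : ξ ∈ S) := velocity_pointwise (j := j) (hSle ξ hξ).2
      (hnn gu ξ) (hnn gE ξ) (hnn gB ξ) (norm_nonneg _) hC₀ hD hcc ht rfl hDk
      (fun hk hk1 => (((hSle ξ hξ).1 _ _ _ _ _ rfl rfl rfl rfl rfl).1 hk hk1 i).1)
      (fun hk => (((hSle ξ hξ).1 _ _ _ _ _ rfl rfl rfl rfl rfl).2 hk i).1)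
    refine grad _ (hu i) _ _ CU (hmeas i).1 (hrepu i)
      (Filter.eventually_of_mem hSmem hk) ?_
    refine ((((((((((((heat j u₀ gu lu ru t ht).mono ?_).add
      ((heat j E₀ gE lE rE t ht).mono ?_) hq').add
      ((heat (j + 1) B₀ gB lB rB t ht).mono ?_) hq').add
      ((biharm (j + 2) u₀ gu lu ru t ht).mono ?_) hq').add
      ((biharm (j + 4) E₀ gE lE rE t ht).mono ?_) hq').add
      ((biharm (j + 1) B₀ gB lB rB t ht).mono ?_) hq').add
      (((high (j : ℝ) u₀ gu lu ru).smul (Real.exp_nonneg _)).mono ?_) hq').add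
      (((highn n₀ _ ln rn).smul (Real.exp_nonneg _)).mono ?_) hq').add
      ((((high ((j : ℝ) - 4 + l) u₀ gu lu ru).smul hP).const_mul hD).mono ?_) hq').add
      ((((high ((j : ℝ) - 2 + l) E₀ gE lE rE).smul hP).const_mul hD).mono ?_) hq').add
      ((((high ((j : ℝ) - 2 + l) B₀ gB lB rB).smul hP).const_mul hD).mono ?_) hq').const_mul hC₀
    -- Each summand is one of the terms on the right. Terms without a counterpart, such as the `L^p`
    -- norm of `n₀` or the exponential terms in `E₀` and `B₀`, are only nonnegative additions.
    all_goals
      simp only [mul_add, ← add_assoc, polyDecay, expDecay]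
      repeat first
        | with_reducible exact ennreal_le_add_left _ _
        | with_reducible exact le_rfl
        | refine ennreal_le_add_of_le ?_
  · have hk (ξ : R3) (hξ : ξ ∈ S) := electric_pointwise (j := j) (hSle ξ hξ).2
      (hnn gu ξ) (hnn gE ξ) (hnn gB ξ) hC₀ hD ht rfl hDk
      (fun hk hk1 => (((hSle ξ hξ).1 _ _ _ _ _ rfl rfl rfl rfl rfl).1 hk hk1 i).2.1)
      (fun hk => (((hSle ξ hξ).1 _ _ _ _ _ rfl rfl rfl rfl rfl).2 hk i).2.1)
    refine grad _ (hE i) _ _ CE (hmeas i).2.1 (hrepE i)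
      (Filter.eventually_of_mem hSmem hk) ?_
    refine ((((((((((heat j u₀ gu lu ru t ht).mono ?_).add
      ((heat j E₀ gE lE rE t ht).mono ?_) hq').add
      ((heat (j + 1) B₀ gB lB rB t ht).mono ?_) hq').add
      ((biharm (j + 4) u₀ gu lu ru t ht).mono ?_) hq').add
      ((biharm (j + 6) E₀ gE lE rE t ht).mono ?_) hq').add
      ((biharm (j + 3) B₀ gB lB rB t ht).mono ?_) hq').add
      ((((high ((j : ℝ) - 2 + l) u₀ gu lu ru).smul hP).const_mul hD).mono ?_) hq').add
      ((((high ((j : ℝ) + l) E₀ gE lE rE).smul hP).const_mul hD).mono ?_) hq').add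
      ((((high ((j : ℝ) + l) B₀ gB lB rB).smul hP).const_mul hD).mono ?_) hq').const_mul hC₀
    all_goals
      simp only [mul_add, ← add_assoc, polyDecay, expDecay]
      repeat first
        | with_reducible exact ennreal_le_add_left _ _
        | with_reducible exact le_rfl
        | refine ennreal_le_add_of_le ?_
  · have hk (ξ : R3) (hξ : ξ ∈ S) := magnetic_pointwise (j := j) (hSle ξ hξ).2
      (hnn gu ξ) (hnn gE ξ) (hnn gB ξ) hC₀ hD ht rfl hDk
      (fun hk hk1 => (((hSle ξ hξ).1 _ _ _ _ _ rfl rfl rfl rfl rfl).1 hk hk1 i).2.2)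
      (fun hk => (((hSle ξ hξ).1 _ _ _ _ _ rfl rfl rfl rfl rfl).2 hk i).2.2)
    refine grad _ (hB i) _ _ CB (hmeas i).2.2 (hrepB i)
      (Filter.eventually_of_mem hSmem hk) ?_
    refine ((((((((((heat (j + 1) u₀ gu lu ru t ht).mono ?_).add
      ((heat (j + 1) E₀ gE lE rE t ht).mono ?_) hq').add
      ((heat (j + 2) B₀ gB lB rB t ht).mono ?_) hq').add
      ((biharm (j + 1) u₀ gu lu ru t ht).mono ?_) hq').add
      ((biharm (j + 3) E₀ gE lE rE t ht).mono ?_) hq').add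
      ((biharm j B₀ gB lB rB t ht).mono ?_) hq').add
      ((((high ((j : ℝ) - 2 + l) u₀ gu lu ru).smul hP).const_mul hD).mono ?_) hq').add
      ((((high ((j : ℝ) + l) E₀ gE lE rE).smul hP).const_mul hD).mono ?_) hq').add
      ((((high ((j : ℝ) + l) B₀ gB lB rB).smul hP).const_mul hD).mono ?_) hq').const_mul hC₀
    all_goals
      simp only [mul_add, ← add_assoc, polyDecay, expDecay]
      repeat first
        | with_reducible exact ennreal_le_add_left _ _
        | with_reducible exact le_rfl
        | refine ennreal_le_add_of_le ?_

end IsLinearSolution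

theorem theorem5p2 (γ β μ : ℝ) (hγ : 0 < γ) (hβ : 0 < β) (hμ : 0 < μ) :
    ∃ c : ℝ, 0 < c ∧
    ∀ (p s q : ℝ≥0∞), 1 ≤ p → p ≤ 2 → 1 ≤ s → s ≤ 2 → 2 ≤ q →
    ∀ (l : ℝ), 0 ≤ l → ∀ (j : ℕ),
    ∃ C : ℝ, 0 < C ∧
    ∀ (n : ℝ → TDist) (u E B : ℝ → Fin 3 → TDist)
      (n₀ : TDist) (u₀ E₀ B₀ : Fin 3 → TDist),
      IsLinearSolution γ β μ n u E B n₀ u₀ E₀ B₀ →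
      ∀ t : ℝ, 0 ≤ t →
        gradNorm j q (n t) ≤ ENNReal.ofReal C *
          (polyDecay (rateIndex (j + 1) p q) t * vecLpNorm p E₀
            + polyDecay (rateIndex (j + 1) p q) t * vecLpNorm p u₀
            + expDecay c t * gradNorm (regIndex (j : ℝ) s q) s n₀
            + expDecay c t * vgradNorm (regIndex ((j : ℝ) - 1) s q) s u₀) ∧
        vgradNorm j q (u t) ≤ ENNReal.ofReal C *
          (polyDecay (rateIndex (j + 1) p q) t * (distLpNorm p n₀ + vecLpNorm p B₀)
            + polyDecay (rateIndex j p q) t * (vecLpNorm p u₀ + vecLpNorm p E₀)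
            + polyDecay (rateIndex (j + 2) p q / 2) t * vecLpNorm p u₀
            + polyDecay (rateIndex (j + 4) p q / 2) t * vecLpNorm p E₀
            + polyDecay (rateIndex (j + 1) p q / 2) t * vecLpNorm p B₀
            + expDecay c t *
                (gradNorm (regIndex ((j : ℝ) - 1) s q) s n₀
                  + vgradNorm (regIndex (j : ℝ) s q) s u₀
                  + vgradNorm (regIndex ((j : ℝ) - 2) s q) s E₀
                  + vgradNorm (regIndex ((j : ℝ) - 3) s q) s B₀)
            + polyDecay (l / 2) t *
                (vgradNorm (regIndex ((j : ℝ) - 4 + l) s q) s u₀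
                  + (vgradNorm (regIndex ((j : ℝ) - 2 + l) s q) s E₀
                    + vgradNorm (regIndex ((j : ℝ) - 2 + l) s q) s B₀))) ∧
        vgradNorm j q (E t) ≤ ENNReal.ofReal C *
          (polyDecay (rateIndex j p q) t * (vecLpNorm p u₀ + vecLpNorm p E₀)
            + polyDecay (rateIndex (j + 1) p q) t * vecLpNorm p B₀
            + polyDecay (rateIndex (j + 4) p q / 2) t * vecLpNorm p u₀
            + polyDecay (rateIndex (j + 6) p q / 2) t * vecLpNorm p E₀
            + polyDecay (rateIndex (j + 3) p q / 2) t * vecLpNorm p B₀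
            + expDecay c t *
                (vgradNorm (regIndex ((j : ℝ) - 2) s q) s u₀
                  + vgradNorm (regIndex (j : ℝ) s q) s E₀
                  + vgradNorm (regIndex ((j : ℝ) - 5) s q) s B₀)
            + polyDecay (l / 2) t *
                (vgradNorm (regIndex ((j : ℝ) - 2 + l) s q) s u₀
                  + (vgradNorm (regIndex ((j : ℝ) + l) s q) s E₀
                    + vgradNorm (regIndex ((j : ℝ) + l) s q) s B₀))) ∧
        vgradNorm j q (B t) ≤ ENNReal.ofReal C *
          (polyDecay (rateIndex (j + 1) p q) t * (vecLpNorm p u₀ + vecLpNorm p E₀)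
            + polyDecay (rateIndex (j + 2) p q) t * vecLpNorm p B₀
            + polyDecay (rateIndex (j + 1) p q / 2) t * vecLpNorm p u₀
            + polyDecay (rateIndex (j + 3) p q / 2) t * vecLpNorm p E₀
            + polyDecay (rateIndex j p q / 2) t * vecLpNorm p B₀
            + expDecay c t *
                (vgradNorm (regIndex ((j : ℝ) - 3) s q) s u₀
                  + vgradNorm (regIndex ((j : ℝ) - 5) s q) s E₀
                  + vgradNorm (regIndex ((j : ℝ) - 6) s q) s B₀)
            + polyDecay (l / 2) t *
                (vgradNorm (regIndex ((j : ℝ) - 2 + l) s q) s u₀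
                  + (vgradNorm (regIndex ((j : ℝ) + l) s q) s E₀
                    + vgradNorm (regIndex ((j : ℝ) + l) s q) s B₀))) := by
  obtain ⟨c₁, hc₁, h₁⟩ := IsLinearSolution.exists_density_decay hγ hβ hμ
  obtain ⟨c₂, hc₂, h₂⟩ := IsLinearSolution.exists_system_decay hγ hβ hμ
  -- The density and the system estimates come with different rates. Both hold for every smaller
  -- rate, so the minimum serves all four inequalities.
  refine ⟨min c₁ c₂, lt_min hc₁ hc₂, fun p s q hp1 hp2 hs1 hs2 hq l hl j => ?_⟩
  obtain ⟨C₁, hC₁, h₁⟩ := h₁ _ (min_le_left c₁ c₂) p s q hp1 hp2 hs1 hs2 hq j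
  obtain ⟨C₂, hC₂, h₂⟩ := h₂ _ (min_le_right c₁ c₂) p s q hp1 hp2 hs1 hs2 hq l hl j
  refine ⟨C₁ + C₂, by positivity, fun n u E B n₀ u₀ E₀ B₀ hS t ht => ?_⟩
  obtain ⟨hu, hE, hB⟩ := h₂ n u E B n₀ u₀ E₀ B₀ hS t ht
  have hmono : ∀ {C : ℝ} {Y Z : ℝ≥0∞}, C ≤ C₁ + C₂ → Y ≤ ENNReal.ofReal C * Z →
      Y ≤ ENNReal.ofReal (C₁ + C₂) * Z := fun hC hY => hY.trans (by gcongr)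
  exact ⟨hmono (by linarith) (h₁ n u E B n₀ u₀ E₀ B₀ hS t ht), hmono (by linarith) hu,
    hmono (by linarith) hE, hmono (by linarith) hB⟩
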